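/- Let $(M,\Omega)$ be a $C^\infty$-smooth symplectic manifold of dimension $2n$ with a Hamiltonian $(S^1)^\varkappa$-action generated by $C^\infty$-smooth functions $J_1,\dots,J_\varkappa$ (the $\ell$-th infinitesimal generator is the Hamiltonian vector field $X_{J_\ell}$, $\mathrm dJ_\ell=\Omega(\cdot,X_{J_\ell})$), and let $m_0\in M$ be fixed under this action. Let $\Gamma$ be a finite Abelian group acting on an open neighbourhood $N'$ of $m_0$ by smooth symplectomorphisms $\rho(\psi)$, $\psi\in\Gamma$, that preserve $J_1,\dots,J_\varkappa$ and fix $m_0$. Then there exist a $\Gamma\times(S^1)^\varkappa$-invariant open neighbourhood $U\subset N'$ of $m_0$, smooth local coordinates $x_1,y_1,\dots,x_n,y_n$ on $U$ vanishing at $m_0$, constants $c_\ell\in\mathbb R$, integers $0\le k_e\le n$ and $p_{j\ell}\in\mathbb Z$, and rational numbers $q_{\psi,j}$ with $q_{\psi,j}\in\frac12\mathbb Z$ for $j>k_e$, such that the following holds. (a) On $U$, with $z_j=x_j+iy_j$, $$\Omega=\sum_{j=1}^n \mathrm dx_j\wedge \mathrm dy_j,\qquad J_\ell=c_\ell+\sum_{j=1}^{k_e}p_{j\ell}\frac{x_j^2+y_j^2}2\quad(1\le\ell\le\varkappa),\qquad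 \rho(\psi):(z_1,\dots,z_n)\mapsto(e^{2\pi iq_{\psi,1}}z_1,\dots,e^{2\pi iq_{\psi,n}}z_n)\quad(\psi\in\Gamma).$$ If $M$, $\Omega$, the $J_\ell$ and $\rho$ are real-analytic, the coordinates can be chosen real-analytic. (b) For every integer $k\ge4$ and every neighbourhood $U'$ of $m_0$ with compact closure $\overline{U'}\subset U$ there exist a compact set $K\subset U$ and constants $\varepsilon_0>0$, $C$ such that the following holds for all $0<\varepsilon\le\varepsilon_0$. Let $\tilde N'\subset\tilde M$ be open subsets of $M$ with $U\subset\tilde N'$ (for example $\tilde N'=\tilde M$). Let $\tilde\Omega$ be a smooth symplectic structure on $\tilde M$, let the smooth functions $\tilde J_1,\dots,\tilde J_\varkappa$ generate a Hamiltonian $(S^1)^\varkappa$-action on $(\tilde M,\tilde\Omega)$, and let $\tilde\rho$ be an action of $\Gamma$ on $\tilde N'$ by smooth symplectomorphisms preserving $\tilde J_1,\dots,\tilde J_\varkappa$. Suppose that on $K$, in the coordinates $(x,y)$, $\tilde J_\ell$ is $\varepsilon$-close to $J_\ell$ in the $C^k$-norm, $\tilde\Omega$ is $\varepsilon$-close to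 $\Omega$ in the $C^{k+n-2}$-norm, and $\tilde\rho(\psi)$ maps $K$ into $U$ and is $\varepsilon$-close to $\rho(\psi)$ in the $C^{k-1}$-norm, for all $\ell$ and $\psi$. Then there exist a point $\tilde m_0\in U'$ fixed under the perturbed $\Gamma\times(S^1)^\varkappa$-action, an open neighbourhood $\tilde U$ with $U'\subset\tilde U\subset U$ invariant under that action, and smooth local coordinates $\tilde x_1,\tilde y_1,\dots,\tilde x_n,\tilde y_n$ on $\tilde U$ vanishing at $\tilde m_0$ in which $\tilde\Omega$, $\tilde J_\ell$, $\tilde\rho(\psi)$ have the form in (a) with the same $k_e$, $p_{j\ell}$, $q_{\psi,j}$ and with some constants $\tilde c_\ell$, $|\tilde c_\ell-c_\ell|\le C\varepsilon$; moreover $(\tilde x,\tilde y)$ is $C\varepsilon$-close to $(x,y)$ in the $C^{k-4}$-norm on $\tilde U$. If both systems are real-analytic, $(x,y)$ and $(\tilde x,\tilde y)$ can be chosen real-analytic. Moreover, let a family of such systems $(\Omega_b,J_b,\rho_b)$ on $\tilde M$, $\tilde N'$ (fixed, as above) depend smoothly (resp. analytically, in the analytic case) on a parameter $b$ in an open neighbourhood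 of $0$ in $\mathbb R^d$, with $(\Omega_0,J_0,\rho_0)=(\Omega,J,\rho)$ on $U$. Then for every $U'$ as above and all $b$ close enough to $0$ there are a fixed point $m_b\in U'$, an invariant open set $U_b$, $U'\subset U_b\subset U$, and coordinates on $U_b$ vanishing at $m_b$ in which the $b$-th system has the form in (a) with the same $k_e,p_{j\ell},q_{\psi,j}$ and some constants $c_{b,\ell}$; the set of pairs $(b,m)$ with $m\in U_b$ is open, the coordinates depend smoothly (resp. analytically) on $(b,m)$ there, and for $b=0$ they are the restrictions of $(x,y)$. -/

import Mathlib

open Set Topology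
open scoped Manifold ContDiff

noncomputable section

namespace TorusNormalForm

/-- The model space `ℝ²ⁿ`; the coordinate with index `(j, 0)` is `x_j`, the one with index `(j, 1)`
is `y_j`. -/
abbrev R2n (n : ℕ) : Type := EuclideanSpace ℝ (Fin n × Fin 2)

/-- The complex coordinate `z_j = x_j + i y_j`. -/
def zc {n : ℕ} (w : R2n n) (j : Fin n) : ℂ := ⟨w (j, 0), w (j, 1)⟩

/-- The torus `(S¹)^κ`. -/
abbrev Torus (κ : ℕ) : Type := Fin κ → Circle

section Manifold

variable {n : ℕ} {M : Type*} [TopologicalSpace M] [ChartedSpace (R2n n) M]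

/-- A (not necessarily continuous) field of alternating bilinear forms on the tangent spaces. -/
abbrev TwoForm (n : ℕ) (M : Type*) [TopologicalSpace M] [ChartedSpace (R2n n) M] : Type _ :=
  ∀ m : M, TangentSpace 𝓘(ℝ, R2n n) m [⋀^Fin 2]→L[ℝ] ℝ

/-- The expression of a 2-form in a coordinate system `e`: its pullback under `e⁻¹`, a 2-form on the
open subset `e.target` of `ℝ²ⁿ`. -/
def formInChart (e : OpenPartialHomeomorph M (R2n n)) (Ω : TwoForm n M) (w : R2n n) :
    R2n n [⋀^Fin 2]→L[ℝ] ℝ :=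
  (Ω (e.symm w)).compContinuousLinearMap
    (mfderiv 𝓘(ℝ, R2n n) 𝓘(ℝ, R2n n) e.symm w : R2n n →L[ℝ] TangentSpace 𝓘(ℝ, R2n n) (e.symm w))

/-- `Ω` is a symplectic structure of class `C^s` on the open set `N`: a closed nondegenerate
2-form of class `C^s`. -/
structure IsSymplecticOn (s : WithTop ℕ∞) (Ω : TwoForm n M) (N : Set M) : Prop where
  contDiffOn : ∀ e ∈ atlas (R2n n) M,
    ContDiffOn ℝ s (formInChart e Ω) (e.target ∩ e.symm ⁻¹' N)
  closed : ∀ e ∈ atlas (R2n n) M, ∀ w ∈ e.target ∩ e.symm ⁻¹' N,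
    extDeriv (formInChart e Ω) w = 0
  nondegenerate : ∀ m ∈ N, ∀ v : TangentSpace 𝓘(ℝ, R2n n) m, v ≠ 0 →
    ∃ w : TangentSpace 𝓘(ℝ, R2n n) m, Ω m ![v, w] ≠ 0

/-- `θ` is a Hamiltonian action of `(S¹)^κ` on the open set `N` generated by `J_1, …, J_κ`: it is an
action of class `C^s` whose `ℓ`-th infinitesimal generator is the Hamiltonian vector field `X` of
`J_ℓ`, i.e. `dJ_ℓ = Ω(·, X)`.  Smoothness in the torus variable is expressed through the covering
`ℝ^κ → (S¹)^κ`. -/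
structure IsHamiltonianTorusAction {κ : ℕ} (s : WithTop ℕ∞) (Ω : TwoForm n M)
    (J : Fin κ → M → ℝ) (θ : Torus κ → M → M) (N : Set M) : Prop where
  contMDiffOn_J : ∀ l, ContMDiffOn 𝓘(ℝ, R2n n) 𝓘(ℝ, ℝ) s (J l) N
  mapsTo : ∀ t, MapsTo (θ t) N N
  one : ∀ m ∈ N, θ 1 m = m
  mul : ∀ t t', ∀ m ∈ N, θ (t * t') m = θ t (θ t' m)
  contMDiffOn : ContMDiffOn (𝓘(ℝ, Fin κ → ℝ).prod 𝓘(ℝ, R2n n)) 𝓘(ℝ, R2n n) s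
    (fun τm : (Fin κ → ℝ) × M => θ (fun l => Circle.exp (τm.1 l)) τm.2) (univ ×ˢ N)
  generates : ∀ l, ∀ m ∈ N, ∃ X : TangentSpace 𝓘(ℝ, R2n n) m,
    X = mfderiv 𝓘(ℝ, ℝ) 𝓘(ℝ, R2n n) (fun t : ℝ => θ (Pi.mulSingle l (Circle.exp t)) m) 0 (1 : ℝ) ∧
    ∀ v : TangentSpace 𝓘(ℝ, R2n n) m,
      mfderiv 𝓘(ℝ, R2n n) 𝓘(ℝ, ℝ) (J l) m v = Ω m ![v, X]

/-- `ρ` is an action of the group `Γ` on the open set `N` by symplectomorphisms of class `C^s`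
that preserve `J_1, …, J_κ`. -/
structure IsSymplecticAction {κ : ℕ} {Γ : Type*} [Group Γ] (s : WithTop ℕ∞) (Ω : TwoForm n M)
    (J : Fin κ → M → ℝ) (ρ : Γ → M → M) (N : Set M) : Prop where
  mapsTo : ∀ ψ, MapsTo (ρ ψ) N N
  one : ∀ m ∈ N, ρ 1 m = m
  mul : ∀ ψ ψ', ∀ m ∈ N, ρ (ψ * ψ') m = ρ ψ (ρ ψ' m)
  contMDiffOn : ∀ ψ, ContMDiffOn 𝓘(ℝ, R2n n) 𝓘(ℝ, R2n n) s (ρ ψ) N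
  symplectic : ∀ ψ, ∀ m ∈ N,
    (Ω (ρ ψ m)).compContinuousLinearMap (mfderiv 𝓘(ℝ, R2n n) 𝓘(ℝ, R2n n) (ρ ψ) m) = Ω m
  preserves_J : ∀ ψ l, ∀ m ∈ N, J l (ρ ψ m) = J l m

/-- A system of class `C^s`: a symplectic structure `Ω` and a Hamiltonian `(S¹)^κ`-action `θ`
generated by `J_1, …, J_κ` on the open set `N`, and an action `ρ` of `Γ` by `J`-preserving
symplectomorphisms on the open subset `N'` of `N`. -/
structure IsSystem {κ : ℕ} {Γ : Type*} [Group Γ] (s : WithTop ℕ∞) (Ω : TwoForm n M)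
    (J : Fin κ → M → ℝ) (θ : Torus κ → M → M) (N : Set M) (ρ : Γ → M → M) (N' : Set M) :
    Prop where
  isOpen : IsOpen N
  isOpen' : IsOpen N'
  subset : N' ⊆ N
  symplectic : IsSymplecticOn s Ω N
  torus : IsHamiltonianTorusAction s Ω J θ N
  finite : IsSymplecticAction s Ω J ρ N'

/-- `φ` is a system of local coordinates `x_1, y_1, …, x_n, y_n` of class `C^s`, defined on the
`Γ × (S¹)^κ`-invariant neighbourhood `φ.source` of the fixed point `m₀` and centred at `m₀`, in which
`Ω = ∑ dx_j ∧ dy_j`, `J_ℓ = c_ℓ + ∑_{j ≤ kₑ} p_{jℓ} (x_j² + y_j²) / 2`, and `ρ(ψ)` is the rotation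
`z_j ↦ exp(2πi q_{ψ,j}) z_j`. -/
structure IsNormalForm {κ : ℕ} {Γ : Type*} (s : WithTop ℕ∞) (Ω : TwoForm n M)
    (J : Fin κ → M → ℝ) (θ : Torus κ → M → M) (ρ : Γ → M → M)
    (kₑ : ℕ) (p : Fin n → Fin κ → ℤ) (q : Γ → Fin n → ℚ) (c : Fin κ → ℝ)
    (φ : OpenPartialHomeomorph M (R2n n)) (m₀ : M) : Prop where
  smooth : φ ∈ IsManifold.maximalAtlas 𝓘(ℝ, R2n n) s M
  mem_source : m₀ ∈ φ.source
  centred : φ m₀ = 0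
  torus_fixed : ∀ t, θ t m₀ = m₀
  finite_fixed : ∀ ψ, ρ ψ m₀ = m₀
  torus_invariant : ∀ t, MapsTo (θ t) φ.source φ.source
  finite_invariant : ∀ ψ, MapsTo (ρ ψ) φ.source φ.source
  form_eq : ∀ w ∈ φ.target, ∀ u v : R2n n,
    formInChart φ Ω w ![u, v] = ∑ j, (u (j, 0) * v (j, 1) - u (j, 1) * v (j, 0))
  J_eq : ∀ l, ∀ m ∈ φ.source,
    J l m = c l + ∑ j with j.val < kₑ, (p j l : ℝ) * ((φ m (j, 0) ^ 2 + φ m (j, 1) ^ 2) / 2)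
  finite_eq : ∀ ψ j, ∀ m ∈ φ.source,
    zc (φ (ρ ψ m)) j = Complex.exp (2 * Real.pi * Complex.I * (q ψ j : ℂ)) * zc (φ m) j

/-- `‖f - g‖_{C^k} ≤ ε` on the set `S`, for functions of class `C^k` near each point of `S`. -/
def CkCloseOn {E F : Type*} [NormedAddCommGroup E] [NormedSpace ℝ E] [NormedAddCommGroup F]
    [NormedSpace ℝ F] (k : ℕ) (S : Set E) (f g : E → F) (ε : ℝ) : Prop :=
  ∀ i ≤ k, ∀ w ∈ S, ‖iteratedFDeriv ℝ i (fun w' => f w' - g w') w‖ ≤ ε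

/-- On the subset `K` of the domain of the coordinates `φ`, and measured in these coordinates,
the functions `J'` are `ε`-close to `J` in the `C^k`-norm, the form `Ω'` is `ε`-close to `Ω` in the
`C^(k+n-2)`-norm, and the maps `ρ'(ψ)` are `ε`-close to `ρ(ψ)` in the `C^(k-1)`-norm. -/
structure IsClosePerturbation {κ : ℕ} {Γ : Type*} (φ : OpenPartialHomeomorph M (R2n n))
    (K : Set M) (k : ℕ) (ε : ℝ) (Ω Ω' : TwoForm n M) (J J' : Fin κ → M → ℝ) (ρ ρ' : Γ → M → M) :
    Prop where
  J_close : ∀ l, CkCloseOn k (φ '' K) (J' l ∘ φ.symm) (J l ∘ φ.symm) ε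
  form_close : CkCloseOn (k + n - 2) (φ '' K) (formInChart φ Ω') (formInChart φ Ω) ε
  mapsTo : ∀ ψ, MapsTo (ρ' ψ) K φ.source
  finite_close : ∀ ψ, CkCloseOn (k - 1) (φ '' K) (φ ∘ ρ' ψ ∘ φ.symm) (φ ∘ ρ ψ ∘ φ.symm) ε

/-- A family of systems (with the parameter `b` in the open subset `B` of `ℝ^d`) on `N`, with
actions of `Γ` on `N'`, that depends on the parameter in a `C^s` way. -/
structure IsSystemFamily {κ d : ℕ} {Γ : Type*} [Group Γ] (s : WithTop ℕ∞)
    (B : Set (EuclideanSpace ℝ (Fin d))) (Ω : EuclideanSpace ℝ (Fin d) → TwoForm n M)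
    (J : EuclideanSpace ℝ (Fin d) → Fin κ → M → ℝ)
    (θ : EuclideanSpace ℝ (Fin d) → Torus κ → M → M) (N : Set M)
    (ρ : EuclideanSpace ℝ (Fin d) → Γ → M → M) (N' : Set M) : Prop where
  isOpen : IsOpen B
  system : ∀ b ∈ B, IsSystem s (Ω b) (J b) (θ b) N (ρ b) N'
  form_contDiffOn : ∀ e ∈ atlas (R2n n) M,
    ContDiffOn ℝ s (fun bw : EuclideanSpace ℝ (Fin d) × R2n n => formInChart e (Ω bw.1) bw.2)
      (B ×ˢ (e.target ∩ e.symm ⁻¹' N))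
  J_contMDiffOn : ∀ l,
    ContMDiffOn (𝓘(ℝ, EuclideanSpace ℝ (Fin d)).prod 𝓘(ℝ, R2n n)) 𝓘(ℝ, ℝ) s
      (fun bm : EuclideanSpace ℝ (Fin d) × M => J bm.1 l bm.2) (B ×ˢ N)
  finite_contMDiffOn : ∀ ψ,
    ContMDiffOn (𝓘(ℝ, EuclideanSpace ℝ (Fin d)).prod 𝓘(ℝ, R2n n)) 𝓘(ℝ, R2n n) s
      (fun bm : EuclideanSpace ℝ (Fin d) × M => ρ bm.1 ψ bm.2) (B ×ˢ N')

/-- Persistence of the normal form under small perturbations. -/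
def PersistsUnderPerturbations {κ : ℕ} {Γ : Type*} [Group Γ] (r : WithTop ℕ∞) (Ω : TwoForm n M)
    (J : Fin κ → M → ℝ) (ρ : Γ → M → M)
    (kₑ : ℕ) (p : Fin n → Fin κ → ℤ) (q : Γ → Fin n → ℚ) (c : Fin κ → ℝ)
    (φ : OpenPartialHomeomorph M (R2n n)) (m₀ : M) : Prop :=
  ∀ k : ℕ, 4 ≤ k → ∀ U' ∈ 𝓝 m₀, IsCompact (closure U') → closure U' ⊆ φ.source →
    ∃ K : Set M, IsCompact K ∧ K ⊆ φ.source ∧ ∃ ε₀ > (0 : ℝ), ∃ C : ℝ,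
      ∀ ε : ℝ, 0 < ε → ε ≤ ε₀ → ∀ s : WithTop ℕ∞, (s = ∞ ∨ s = ω) → s ≤ r →
      ∀ (Ω' : TwoForm n M) (J' : Fin κ → M → ℝ) (θ' : Torus κ → M → M) (N : Set M)
        (ρ' : Γ → M → M) (N' : Set M),
        IsSystem s Ω' J' θ' N ρ' N' → φ.source ⊆ N' →
        IsClosePerturbation φ K k ε Ω Ω' J J' ρ ρ' →
        ∃ (m₀' : M) (φ' : OpenPartialHomeomorph M (R2n n)) (c' : Fin κ → ℝ),
          m₀' ∈ U' ∧ U' ⊆ φ'.source ∧ φ'.source ⊆ φ.source ∧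
          IsNormalForm s Ω' J' θ' ρ' kₑ p q c' φ' m₀' ∧
          CkCloseOn (k - 4) (φ '' φ'.source) (φ' ∘ φ.symm) id (C * ε) ∧
          ∀ l, |c' l - c l| ≤ C * ε

/-- Persistence of the normal form in families: for a family of systems that contains the given
system (near `m₀`) as its member with parameter `0`, the coordinates extend to a family of
normalizing coordinates of the same class. -/
def PersistsInFamilies {κ : ℕ} {Γ : Type*} [Group Γ] (r : WithTop ℕ∞) (Ω : TwoForm n M)
    (J : Fin κ → M → ℝ) (ρ : Γ → M → M)
    (kₑ : ℕ) (p : Fin n → Fin κ → ℤ) (q : Γ → Fin n → ℚ)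
    (φ : OpenPartialHomeomorph M (R2n n)) (m₀ : M) : Prop :=
  ∀ U' ∈ 𝓝 m₀, IsCompact (closure U') → closure U' ⊆ φ.source →
    ∀ s : WithTop ℕ∞, (s = ∞ ∨ s = ω) → s ≤ r →
    ∀ (d : ℕ) (B : Set (EuclideanSpace ℝ (Fin d)))
      (Ω' : EuclideanSpace ℝ (Fin d) → TwoForm n M)
      (J' : EuclideanSpace ℝ (Fin d) → Fin κ → M → ℝ)
      (θ' : EuclideanSpace ℝ (Fin d) → Torus κ → M → M) (N : Set M)
      (ρ' : EuclideanSpace ℝ (Fin d) → Γ → M → M) (N' : Set M),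
      IsSystemFamily s B Ω' J' θ' N ρ' N' → 0 ∈ B → φ.source ⊆ N' →
      (∀ m ∈ φ.source, Ω' 0 m = Ω m ∧ (∀ l, J' 0 l m = J l m) ∧ ∀ ψ, ρ' 0 ψ m = ρ ψ m) →
      ∃ (B' : Set (EuclideanSpace ℝ (Fin d))) (m₀' : EuclideanSpace ℝ (Fin d) → M)
        (φ' : EuclideanSpace ℝ (Fin d) → OpenPartialHomeomorph M (R2n n))
        (c' : EuclideanSpace ℝ (Fin d) → Fin κ → ℝ),
        IsOpen B' ∧ 0 ∈ B' ∧ B' ⊆ B ∧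
        (∀ b ∈ B', m₀' b ∈ U' ∧ U' ⊆ (φ' b).source ∧ (φ' b).source ⊆ φ.source ∧
          IsNormalForm s (Ω' b) (J' b) (θ' b) (ρ' b) kₑ p q (c' b) (φ' b) (m₀' b)) ∧
        (∀ m ∈ (φ' 0).source, φ' 0 m = φ m) ∧
        IsOpen {bm : EuclideanSpace ℝ (Fin d) × M | bm.1 ∈ B' ∧ bm.2 ∈ (φ' bm.1).source} ∧
        ContMDiffOn (𝓘(ℝ, EuclideanSpace ℝ (Fin d)).prod 𝓘(ℝ, R2n n)) 𝓘(ℝ, R2n n) s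
          (fun bm : EuclideanSpace ℝ (Fin d) × M => φ' bm.1 bm.2)
          {bm | bm.1 ∈ B' ∧ bm.2 ∈ (φ' bm.1).source}

end Manifold

end TorusNormalForm

end

/-! The torus action, the action of Γ and the symplectic form are straightened by explicit
constructions that depend on the system as smoothly, or analytically, as the system itself.
Existence, stability under perturbations and the statement about families are three applications of
this one machine.

In a chart a system is recorded by its data: the form, the differentials of the momenta and the maps
of Γ. Suppose that the data are close to those of a linear model, in which the form is constant and
both groups act by rotations of the complex coordinates. In rotating coordinates the torus action is
the flow of a small field. Averaging "rotate back after acting" over the torus and over Γ gives a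
map near the identity that turns both actions into rotations (`linMap`). In the new coordinates the
form is invariant under these rotations and close to the standard one. Moser's field, built from the
radial primitive, is therefore equivariant, and its time-one map makes the form constant without
spoiling linearity of the actions (`normMap`, `Normalizable.pullback`, `IsSymmetry.normMap_apply`).
The momenta are then fixed up to constants by their Hamiltonian fields. The preimage of a ball is an
invariant domain because rotations preserve balls (`IsSystem.exists_isNormalForm`).

Flows and inverses come from the implicit function theorem, for flows in Banach spaces of continuous
paths. Superposition operators on these spaces are of class C^m for every m, the analytic class
included, so one argument (`contDiffAt_flow`) treats smooth and analytic dependence on points and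
parameters. Every construction costs a few multiples of a small number d from the radius R of the
ball. The smallness conditions hold near any parameter value at which the data equal the linear
model, by compactness (`eventually_normalizable`).

The three applications differ only in the family. For a given family of systems the member 0 is in
normal form, hence its data are the model. For quantitative perturbations all possible perturbations
are put into a single family whose parameter ranges over a Banach space (`perturb`); the estimates
then follow from regularity of one map near the parameter 0. For existence, the system is blown up
by homotheties at the fixed point: as the scale tends to 0 the data tend to those of the linearised
action (`scaledData`).

The linearised action is treated by linear algebra. Averaging gives an invariant inner product, for
which the form is represented by an injective skew operator K. The squares and products formed from
K, the generators and the maps of Γ are commuting symmetric operators. A joint eigenvector w yields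
a plane spanned by w and K w in which everything acts by rotations
(`CommutingOperators.exists_frame`). -/

open Set Topology
open scoped Manifold ContDiff
noncomputable section
namespace TorusNormalForm
set_option linter.unusedSectionVars false
set_option maxSynthPendingDepth 3

/-! ### Superposition operators on spaces of continuous functions -/

section Superposition

variable {Q : Type*} [TopologicalSpace Q] [CompactSpace Q]
  {W F : Type*} [NormedAddCommGroup W] [NormedSpace ℝ W] [NormedAddCommGroup F] [NormedSpace ℝ F]

open Classical in
/-- The superposition operator `w ↦ G ∘ w` on continuous functions (zero if `G ∘ w` is not
continuous). -/
def superpose (G : W → F) (w : C(Q, W)) : C(Q, F) :=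
  if h : Continuous (G ∘ w) then ⟨G ∘ w, h⟩ else 0

theorem superpose_apply {G : W → F} {O : Set W} (hG : ContinuousOn G O) {w : C(Q, W)}
    (hw : ∀ q, w q ∈ O) (q : Q) : superpose G w q = G (w q) := by
  have h : Continuous (G ∘ w) := hG.comp_continuous w.continuous hw
  simp [superpose, h]

theorem isOpen_setOf_forall_mem {O : Set W} (hO : IsOpen O) :
    IsOpen {w : C(Q, W) | ∀ q, w q ∈ O} := by
  have := ContinuousMap.isOpen_setOfPred_mapsTo (X := Q) (Y := W) isCompact_univ hO
  simpa [MapsTo] using this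

/-- The action of a continuous field of multilinear maps on a tuple of continuous functions. -/
def fieldMultilinearAux (k : ℕ) (c : C(Q, W [×k]→L[ℝ] F)) : C(Q, W) [×k]→L[ℝ] C(Q, F) :=
  MultilinearMap.mkContinuous
    { toFun := fun h : Fin k → C(Q, W) => (⟨fun q => c q (fun i => h i q), by fun_prop⟩ : C(Q, F))
      map_update_add' := by
        intro _ m i x y
        ext q
        have (z : C(Q, W)) : (fun j => (Function.update m i z j) q) =
            Function.update (fun j => m j q) i (z q) := by
          ext j; rcases eq_or_ne j i with rfl | h <;> simp [*]
        simp [this]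
      map_update_smul' := by
        intro _ m i x y
        ext q
        have (z : C(Q, W)) : (fun j => (Function.update m i z j) q) =
            Function.update (fun j => m j q) i (z q) := by
          ext j; rcases eq_or_ne j i with rfl | h <;> simp [*]
        simp [this] }
    ‖c‖ (by
      intro h
      rw [ContinuousMap.norm_le _ (by positivity)]
      intro q
      refine ((c q).le_opNorm _).trans ?_
      gcongr
      · exact c.norm_coe_le_norm q
      · exact ContinuousMap.norm_coe_le_norm _ q)

theorem norm_fieldMultilinearAux_le (k : ℕ) (c : C(Q, W [×k]→L[ℝ] F)) :
    ‖fieldMultilinearAux k c‖ ≤ ‖c‖ := by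
  unfold fieldMultilinearAux
  exact MultilinearMap.mkContinuous_norm_le _ (norm_nonneg c) _

/-- A continuous field of multilinear maps acts on tuples of continuous functions. -/
def fieldMultilinear (k : ℕ) :
    C(Q, W [×k]→L[ℝ] F) →L[ℝ] (C(Q, W) [×k]→L[ℝ] C(Q, F)) :=
  let A : C(Q, W [×k]→L[ℝ] F) →ₗ[ℝ] (C(Q, W) [×k]→L[ℝ] C(Q, F)) :=
    { toFun := fieldMultilinearAux k
      map_add' := fun _ _ => rfl
      map_smul' := fun _ _ => rfl }
  ⟨A, AddMonoidHomClass.continuous_of_bound A 1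
    (fun c => (norm_fieldMultilinearAux_le k c).trans (one_mul ‖c‖).ge)⟩

@[simp] theorem fieldMultilinear_apply (k : ℕ) (c : C(Q, W [×k]→L[ℝ] F)) (h : Fin k → C(Q, W))
    (q : Q) : fieldMultilinear k c h q = c q (fun i => h i q) := rfl

theorem norm_fieldMultilinear_apply_le (k : ℕ) (c : C(Q, W [×k]→L[ℝ] F)) :
    ‖fieldMultilinear k c‖ ≤ ‖c‖ :=
  norm_fieldMultilinearAux_le k c

/-- A continuous field of linear maps acts on continuous functions. -/
def fieldLinear : C(Q, W →L[ℝ] F) →L[ℝ] C(Q, W) →L[ℝ] C(Q, F) :=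
  LinearMap.mkContinuous₂
    (LinearMap.mk₂ ℝ (fun (c : C(Q, W →L[ℝ] F)) (h : C(Q, W)) => (⟨fun q => c q (h q), by fun_prop⟩ : C(Q, F)))
      (by intros; ext; simp) (by intros; ext; simp) (by intros; ext; simp) (by intros; ext; simp))
    1 (by
      intro c h
      rw [ContinuousMap.norm_le _ (by positivity), one_mul]
      intro q
      refine ((c q).le_opNorm _).trans ?_
      gcongr
      · exact c.norm_coe_le_norm q
      · exact ContinuousMap.norm_coe_le_norm _ q)

@[simp] theorem fieldLinear_apply (c : C(Q, W →L[ℝ] F)) (h : C(Q, W)) (q : Q) :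
    fieldLinear c h q = c q (h q) := rfl

/-- A function continuous near a compact set is uniformly continuous at the points of this set. -/
theorem exists_pos_forall_dist_lt {O : Set W} (hO : IsOpen O) {G : W → F} (hG : ContinuousOn G O)
    {w : C(Q, W)} (hw : ∀ q, w q ∈ O) {ε : ℝ} (hε : 0 < ε) :
    ∃ δ > 0, ∀ q, ∀ y, dist y (w q) < δ → y ∈ O ∧ dist (G y) (G (w q)) < ε := by
  have hK : IsCompact (range w) := isCompact_range w.continuous
  obtain ⟨δ₁, hδ₁, h₁⟩ := hK.exists_thickening_subset_open hO (range_subset_iff.2 hw)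
  have h₂ := hK.uniformContinuousAt_of_continuousAt (r := {p | dist p.1 p.2 < ε}) G
    (by rintro _ ⟨q, rfl⟩; exact hG.continuousAt (hO.mem_nhds (hw q))) (Metric.dist_mem_uniformity hε)
  obtain ⟨δ₂, hδ₂, h₂⟩ := Metric.mem_uniformity_dist.1 h₂
  refine ⟨min δ₁ δ₂, lt_min hδ₁ hδ₂, fun q y hy => ⟨h₁ ?_, ?_⟩⟩
  · exact Metric.mem_thickening_iff.2 ⟨w q, mem_range_self q, hy.trans_le (min_le_left _ _)⟩
  · have := h₂ (a := w q) (b := y) (by rw [dist_comm]; exact hy.trans_le (min_le_right _ _))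
      (mem_range_self q)
    rw [dist_comm]; exact this

theorem continuousOn_superpose {O : Set W} (hO : IsOpen O) {G : W → F} (hG : ContinuousOn G O) :
    ContinuousOn (superpose (Q := Q) G) {w | ∀ q, w q ∈ O} := by
  intro w hw
  refine ContinuousAt.continuousWithinAt ?_
  rw [Metric.continuousAt_iff]
  intro ε hε
  obtain ⟨δ, hδ, h⟩ := exists_pos_forall_dist_lt hO hG hw (half_pos hε)
  refine ⟨δ, hδ, fun {v} hv => ?_⟩
  have hv' : ∀ q, dist (v q) (w q) < δ := fun q => (ContinuousMap.dist_apply_le_dist q).trans_lt hv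
  refine lt_of_le_of_lt ((ContinuousMap.dist_le (by positivity)).2 fun q => ?_) (half_lt_self hε)
  rw [superpose_apply hG hw, superpose_apply hG (fun q => (h q _ (hv' q)).1)]
  exact (h q _ (hv' q)).2.le

/-- The mean value inequality on balls around the values of `w`, of a radius that compactness of `Q`
makes independent of the point, gives a uniform remainder. The derivative is pointwise application
of `G'`. -/
theorem hasFDerivAt_superpose {O : Set W} (hO : IsOpen O) {G : W → F} {G' : W → W →L[ℝ] F}
    (hG : ∀ y ∈ O, HasFDerivAt G (G' y) y) (hG' : ContinuousOn G' O)
    {w : C(Q, W)} (hw : ∀ q, w q ∈ O) :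
    HasFDerivAt (superpose (Q := Q) G) (fieldLinear (superpose G' w)) w := by
  have hGc : ContinuousOn G O := fun y hy => (hG y hy).continuousAt.continuousWithinAt
  rw [hasFDerivAt_iff_isLittleO, Asymptotics.isLittleO_iff]
  intro ε hε
  obtain ⟨δ, hδ, h⟩ := exists_pos_forall_dist_lt hO hG' hw hε
  filter_upwards [Metric.ball_mem_nhds w hδ] with v hv
  have hv' : ∀ q, dist (v q) (w q) < δ := fun q => (ContinuousMap.dist_apply_le_dist q).trans_lt hv
  rw [ContinuousMap.norm_le _ (by positivity)]
  intro q
  have hb : ∀ y ∈ Metric.ball (w q) δ, ‖G' y - G' (w q)‖ ≤ ε := fun y hy => by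
    rw [← dist_eq_norm]; exact (h q y hy).2.le
  have := (convex_ball (w q) δ).norm_image_sub_le_of_norm_hasFDerivWithin_le'
    (fun y hy => (hG y (h q y hy).1).hasFDerivWithinAt) hb (Metric.mem_ball_self hδ) (hv' q)
  simp only [ContinuousMap.sub_apply, fieldLinear_apply]
  rw [superpose_apply hGc hw, superpose_apply hGc (fun q => (h q _ (hv' q)).1),
    superpose_apply hG' hw]
  refine this.trans ?_
  gcongr
  exact (v - w).norm_coe_le_norm q

/-- The Taylor series is computed pointwise: the k-th derivative is the field of k-linear maps
`iteratedFDeriv ℝ k G ∘ w`, acting on functions. Its continuity and its derivative reduce to the two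
preceding facts applied to the derivatives of `G`. -/
theorem contDiffOn_superpose_enat {O : Set W} (hO : IsOpen O) {G : W → F} {m : ℕ∞}
    (hG : ContDiffOn ℝ m G O) :
    ContDiffOn ℝ m (superpose (Q := Q) G) {w | ∀ q, w q ∈ O} := by
  have hO' := isOpen_setOf_forall_mem (Q := Q) hO
  have hc : ∀ k : ℕ, (k : ℕ∞) ≤ m → ContinuousOn (iteratedFDeriv ℝ k G) O := fun k hk =>
    (hG.continuousOn_iteratedFDerivWithin (by exact_mod_cast hk) hO.uniqueDiffOn).congr
      (fun y hy => (iteratedFDerivWithin_of_isOpen k hO hy).symm)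
  refine HasFTaylorSeriesUpToOn.contDiffOn
    (f' := fun w k => fieldMultilinear k (superpose (iteratedFDeriv ℝ k G) w)) ⟨?_, ?_, ?_⟩
  · intro w hw
    ext q
    rw [ContinuousMultilinearMap.curry0_apply, fieldMultilinear_apply,
      superpose_apply (hc 0 (by simp)) hw, superpose_apply hG.continuousOn hw]
    simp
  · intro k hk w hw
    have hk' : ((k : ℕ∞) : WithTop ℕ∞) < m := hk
    have hk1 : ((k + 1 : ℕ) : ℕ∞) ≤ m := by
      have : (k : ℕ∞) < m := by exact_mod_cast hk'
      exact_mod_cast Order.add_one_le_of_lt this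
    have hd : ∀ y ∈ O, HasFDerivAt (iteratedFDeriv ℝ k G) (fderiv ℝ (iteratedFDeriv ℝ k G) y) y := by
      intro y hy
      refine DifferentiableAt.hasFDerivAt ?_
      have := (hG.differentiableOn_iteratedFDerivWithin hk' hO.uniqueDiffOn) y hy
      refine (this.congr (fun z hz => (iteratedFDerivWithin_of_isOpen k hO hz).symm)
        (iteratedFDerivWithin_of_isOpen k hO hy).symm).differentiableAt (hO.mem_nhds hy)
    have hd' : ContinuousOn (fderiv ℝ (iteratedFDeriv ℝ k G)) O := by
      have := hc (k + 1) hk1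
      rw [iteratedFDeriv_succ_eq_comp_left] at this
      have h2 := ((continuousMultilinearCurryLeftEquiv ℝ (fun _ : Fin (k + 1) => W)
        F).continuous.comp_continuousOn this)
      refine h2.congr (fun y _ => ?_)
      simp
    have := ((fieldMultilinear (Q := Q) (W := W) (F := F) k).hasFDerivAt.comp w
      (hasFDerivAt_superpose hO hd hd' hw)).hasFDerivWithinAt (s := {w : C(Q, W) | ∀ q, w q ∈ O})
    refine this.congr_fderiv ?_
    ext h v q
    simp only [ContinuousLinearMap.comp_apply, fieldMultilinear_apply, fieldLinear_apply,
      ContinuousMultilinearMap.curryLeft_apply]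
    rw [superpose_apply hd' hw, superpose_apply (hc _ hk1) hw, iteratedFDeriv_succ_apply_left]
    rfl
  · intro k hk
    have hk' : (k : ℕ∞) ≤ m := by exact_mod_cast hk
    exact (fieldMultilinear (Q := Q) (W := W) (F := F) k).continuous.comp_continuousOn
      (continuousOn_superpose hO (hc k hk'))

/-- One convergent double series, that of the recentred power series, dominates the Taylor
coefficients at all nearby points at once. Uniformity of the radius `r` and of the bound `C` is what
the compactness argument for the analytic superposition operator needs. -/
theorem exists_taylor_bound_near [CompleteSpace F] {G : W → F} {y₀ : W} (hG : AnalyticAt ℝ G y₀) :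
    ∃ s ∈ 𝓝 y₀, ∃ r > 0, ∃ C, ∀ y ∈ s,
      (∀ k : ℕ, ‖((k.factorial : ℝ)⁻¹) • iteratedFDeriv ℝ k G y‖ * r ^ k ≤ C) ∧
      ∀ h : W, ‖h‖ < r →
        HasSum (fun k : ℕ => ((k.factorial : ℝ)⁻¹) • iteratedFDeriv ℝ k G y (fun _ => h))
          (G (y + h)) := by
  obtain ⟨p, R, hp⟩ := hG
  obtain ⟨ρ, hρ0, hρ⟩ := ENNReal.lt_iff_exists_nnreal_btwn.1 hp.r_pos
  have hρ0' : 0 < ρ := by exact_mod_cast hρ0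
  -- Half of an admissible radius: one half is spent on moving the centre to `y`, the other on the
  -- increment `h`.
  set a : NNReal := ρ / 2 with ha
  have ha0 : 0 < a := half_pos hρ0'
  have haa : a + a = ρ := add_halves ρ
  have hsum : (a + a : ENNReal) < p.radius := by
    have : (a + a : ENNReal) = ρ := by rw [← haa]; push_cast; rfl
    rw [this]; exact hρ.trans_le hp.r_le
  have haR : (a : ENNReal) + a < R := by
    have : (a + a : ENNReal) = ρ := by rw [← haa]; push_cast; rfl
    rw [this]; exact hρ
  have hS := p.changeOriginSeries_summable_aux₁ hsum
  set C := ∑' s : Σ k l : ℕ, { s : Finset (Fin (k + l)) // s.card = l },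
    ‖p (s.1 + s.2.1)‖₊ * a ^ s.2.1 * a ^ s.1 with hC
  have haR' : (a : ENNReal) < R := lt_of_le_of_lt le_self_add haR
  refine ⟨Metric.ball y₀ a, Metric.ball_mem_nhds _ (by exact_mod_cast ha0), a,
    by exact_mod_cast ha0, C, fun y hy => ?_⟩
  have hya : ‖y - y₀‖₊ ≤ a := by
    rw [← NNReal.coe_le_coe]
    simpa [dist_eq_norm] using (Metric.mem_ball.1 hy).le
  have hyR : (‖y - y₀‖₊ : ENNReal) < R := lt_of_le_of_lt (by exact_mod_cast hya) haR'
  have hq := hp.changeOrigin hyR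
  rw [add_sub_cancel] at hq
  refine ⟨fun k => ?_, fun h hh => ?_⟩
  -- The derivative divided by `k!` is the symmetrisation of the k-th recentred coefficient, an
  -- average over permutations, hence not larger in norm.
  · have h1 : ‖((k.factorial : ℝ)⁻¹) • iteratedFDeriv ℝ k G y‖ ≤ ‖p.changeOrigin (y - y₀) k‖ := by
      refine ContinuousMultilinearMap.opNorm_le_bound (norm_nonneg _) fun v => ?_
      rw [smul_apply, hq.iteratedFDeriv_eq_sum_of_completeSpace, norm_smul,
        norm_inv, Real.norm_natCast]
      rw [inv_mul_le_iff₀ (by positivity)]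
      refine (norm_sum_le _ _).trans ?_
      refine (Finset.sum_le_card_nsmul _ _ (‖p.changeOrigin (y - y₀) k‖ * ∏ i, ‖v i‖) ?_).trans ?_
      · intro σ _
        refine ((p.changeOrigin (y - y₀) k).le_opNorm _).trans (le_of_eq ?_)
        rw [Equiv.prod_comp σ (fun i => ‖v i‖)]
      · simp [Fintype.card_perm]
    have h2 : ‖p.changeOrigin (y - y₀) k‖₊ * a ^ k ≤ C := by
      have h3 : ‖p.changeOrigin (y - y₀) k‖₊ ≤
          ∑' s : Σ l : ℕ, { s : Finset (Fin (k + l)) // s.card = l }, ‖p (k + s.1)‖₊ * a ^ s.1 := by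
        refine (p.nnnorm_changeOrigin_le k (hyR.trans_le hp.r_le)).trans ?_
        refine Summable.tsum_le_tsum (fun s => by gcongr) ?_ ?_
        · exact p.changeOriginSeries_summable_aux₂ (hyR.trans_le hp.r_le) k
        · exact p.changeOriginSeries_summable_aux₂ (haR'.trans_le hp.r_le) k
      calc _ ≤ (∑' s : Σ l : ℕ, { s : Finset (Fin (k + l)) // s.card = l },
              ‖p (k + s.1)‖₊ * a ^ s.1) * a ^ k := by gcongr
        _ = ∑' s : Σ l : ℕ, { s : Finset (Fin (k + l)) // s.card = l },
              ‖p (k + s.1)‖₊ * a ^ s.1 * a ^ k := by rw [← NNReal.tsum_mul_right]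
        _ ≤ C := NNReal.tsum_comp_le_tsum_of_inj hS (i := fun s => ⟨k, s⟩)
            (fun s t h => by simpa using h)
    calc _ ≤ ‖p.changeOrigin (y - y₀) k‖ * (a : ℝ) ^ k := by gcongr
      _ ≤ C := by exact_mod_cast h2
  · have := hq.hasSum_iteratedFDeriv (y := h) ?_
    · simpa using this
    · rw [mem_eball_zero_iff]
      have hha : ‖h‖ₑ < a := by
        rw [← ofReal_norm]
        exact (ENNReal.ofReal_lt_coe_iff (norm_nonneg _)).2 hh
      refine hha.trans_le ?_
      refine ENNReal.le_sub_of_add_le_left ENNReal.coe_ne_top (le_trans ?_ haR.le)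
      gcongr

/-- The range of `w` is compact, so Taylor expansions of `G` at its points share a radius and a
bound. The pointwise expansions therefore assemble to a power series that converges in the sup norm.
-/
theorem analyticAt_superpose [CompleteSpace F] {O : Set W} (hO : IsOpen O) {G : W → F}
    (hG : AnalyticOnNhd ℝ G O) {w : C(Q, W)} (hw : ∀ q, w q ∈ O) :
    AnalyticAt ℝ (superpose (Q := Q) G) w := by
  have hK : IsCompact (range w) := isCompact_range w.continuous
  obtain ⟨r₁, hr₁, C, hC⟩ : ∃ r > 0, ∃ C, ∀ y ∈ range w,
      (∀ k : ℕ, ‖((k.factorial : ℝ)⁻¹) • iteratedFDeriv ℝ k G y‖ * r ^ k ≤ C) ∧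
      ∀ h : W, ‖h‖ < r →
        HasSum (fun k : ℕ => ((k.factorial : ℝ)⁻¹) • iteratedFDeriv ℝ k G y (fun _ => h))
          (G (y + h)) := by
    refine hK.induction_on (p := fun s => ∃ r > 0, ∃ C, ∀ y ∈ s,
      (∀ k : ℕ, ‖((k.factorial : ℝ)⁻¹) • iteratedFDeriv ℝ k G y‖ * r ^ k ≤ C) ∧
      ∀ h : W, ‖h‖ < r →
        HasSum (fun k : ℕ => ((k.factorial : ℝ)⁻¹) • iteratedFDeriv ℝ k G y (fun _ => h))
          (G (y + h))) ?_ ?_ ?_ ?_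
    · exact ⟨1, one_pos, 0, by simp⟩
    · rintro s t hst ⟨r, hr, C, h⟩
      exact ⟨r, hr, C, fun y hy => h y (hst hy)⟩
    · rintro s t ⟨r, hr, C, h⟩ ⟨r', hr', C', h'⟩
      refine ⟨min r r', lt_min hr hr', max C C', ?_⟩
      rintro y (hy | hy)
      · refine ⟨fun k => ?_, fun v hv => (h y hy).2 v (hv.trans_le (min_le_left _ _))⟩
        refine le_trans ?_ (((h y hy).1 k).trans (le_max_left _ _))
        gcongr; exact min_le_left _ _
      · refine ⟨fun k => ?_, fun v hv => (h' y hy).2 v (hv.trans_le (min_le_right _ _))⟩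
        refine le_trans ?_ (((h' y hy).1 k).trans (le_max_right _ _))
        gcongr; exact min_le_right _ _
    · rintro _ ⟨q, rfl⟩
      obtain ⟨s, hs, h⟩ := exists_taylor_bound_near (hG _ (hw q))
      exact ⟨s, mem_nhdsWithin_of_mem_nhds hs, h⟩
  obtain ⟨r₂, hr₂, hthick⟩ := hK.exists_thickening_subset_open hO (range_subset_iff.2 hw)
  set r := min r₁ r₂ with hr
  have hr0 : 0 < r := lt_min hr₁ hr₂
  have hcont : ∀ k : ℕ, ContinuousOn (fun y => ((k.factorial : ℝ)⁻¹) • iteratedFDeriv ℝ k G y) O :=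
    fun k => ContinuousOn.fun_const_smul (fun y hy => (((hG y hy).contDiffAt
      (n := ω)).iteratedFDeriv_right (i := k) (m := 0) (by simp)).continuousAt.continuousWithinAt) _
  set c : ∀ k : ℕ, C(Q, W [×k]→L[ℝ] F) := fun k =>
    superpose (fun y => ((k.factorial : ℝ)⁻¹) • iteratedFDeriv ℝ k G y) w with hc
  have hcq : ∀ k q, c k q = ((k.factorial : ℝ)⁻¹) • iteratedFDeriv ℝ k G (w q) := fun k q =>
    superpose_apply (hcont k) hw q
  have hC0 : 0 ≤ max C 0 := le_max_right _ _
  have hck : ∀ k, ‖c k‖ * r ^ k ≤ max C 0 := by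
    intro k
    rw [← le_div_iff₀ (by positivity), ContinuousMap.norm_le _ (by positivity)]
    intro q
    rw [le_div_iff₀ (by positivity), hcq]
    refine le_trans ?_ (((hC _ (mem_range_self q)).1 k).trans (le_max_left _ _))
    gcongr
    exact min_le_left _ _
  refine ⟨fun k => fieldMultilinear k (c k), ENNReal.ofReal r, ?_, by simpa using hr0, ?_⟩
  · refine FormalMultilinearSeries.le_radius_of_bound _ (max C 0) (r := r.toNNReal) fun k => ?_
    rw [Real.coe_toNNReal _ hr0.le]
    refine le_trans ?_ (hck k)
    gcongr
    exact norm_fieldMultilinear_apply_le _ _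
  · intro h hh
    have hh' : ‖h‖ < r := by
      rw [mem_eball_zero_iff, ← ofReal_norm] at hh
      exact (ENNReal.ofReal_lt_ofReal_iff hr0).1 hh
    have hhq : ∀ q, ‖h q‖ < r := fun q => (h.norm_coe_le_norm q).trans_lt hh'
    have hsum : Summable fun k => fieldMultilinear k (c k) (fun _ => h) := by
      refine Summable.of_norm_bounded (g := fun k : ℕ => max C 0 * (‖h‖ / r) ^ k)
        ((summable_geometric_of_lt_one (by positivity) ((div_lt_one hr0).2 hh')).mul_left _) ?_
      intro k
      refine ((fieldMultilinear k (c k)).le_opNorm _).trans ?_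
      rw [Finset.prod_const, Finset.card_univ, Fintype.card_fin, div_pow]
      calc _ ≤ ‖c k‖ * ‖h‖ ^ k := by gcongr; exact norm_fieldMultilinear_apply_le _ _
        _ = ‖c k‖ * r ^ k * (‖h‖ ^ k / r ^ k) := by field_simp
        _ ≤ _ := by gcongr; exact hck k
    have hmem : ∀ q, (w + h) q ∈ O := fun q => hthick (Metric.mem_thickening_iff.2
      ⟨w q, mem_range_self q, by
        simpa [dist_eq_norm] using (hhq q).trans_le (min_le_right _ _)⟩)
    have : ∑' k, fieldMultilinear k (c k) (fun _ => h) = superpose G (w + h) := by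
      ext q
      rw [superpose_apply (O := O) hG.continuousOn hmem]
      have h1 := (ContinuousMap.evalCLM ℝ q : C(Q, F) →L[ℝ] F).hasSum hsum.hasSum
      have h2 := (hC _ (mem_range_self q)).2 (h q) ((hhq q).trans_le (min_le_left _ _))
      refine h1.unique ?_
      convert! h2 using 2 with k
      simp [hcq]
    rw [← this]
    exact hsum.hasSum

theorem contDiffOn_superpose [CompleteSpace F] {O : Set W} (hO : IsOpen O) {G : W → F}
    {m : WithTop ℕ∞} (hG : ContDiffOn ℝ m G O) :
    ContDiffOn ℝ m (superpose (Q := Q) G) {w | ∀ q, w q ∈ O} := by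
  match m with
  | ω =>
    intro w hw
    refine (analyticAt_superpose hO ?_ hw).contDiffAt.contDiffWithinAt
    exact fun y hy => (hG.contDiffAt (hO.mem_nhds hy)).analyticAt
  | (m : ℕ∞) => exact contDiffOn_superpose_enat hO hG

end Superposition

/-! ### Regularity of implicitly defined maps -/

section Implicit

variable {A Y Y' : Type*} [NormedAddCommGroup A] [NormedSpace ℝ A] [CompleteSpace A]
  [NormedAddCommGroup Y] [NormedSpace ℝ Y] [CompleteSpace Y]
  [NormedAddCommGroup Y'] [NormedSpace ℝ Y'] [CompleteSpace Y']

/-- A function that is determined, near a point, by an implicit equation is as smooth as this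
equation. -/
theorem contDiffAt_of_implicit {f : A × Y → Y'} {m : WithTop ℕ∞} (hm : m ≠ 0) {a₀ : A} {s : A → Y}
    (hf : ContDiffAt ℝ m f (a₀, s a₀))
    (hinv : (fderiv ℝ f (a₀, s a₀) ∘L .inr ℝ A Y).IsInvertible)
    (h0 : f (a₀, s a₀) = 0) (huniq : ∀ᶠ z in 𝓝 (a₀, s a₀), f z = 0 → z.2 = s z.1) :
    ContDiffAt ℝ m s a₀ := by
  -- The implicit function is of class C^m, and local uniqueness of solutions identifies it with
  -- `s`; continuity of `s` is not needed beforehand.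
  have hg := hf.contDiffAt_implicitFunction hm hinv
  set g := hf.implicitFunction hm hinv
  have hg0 : g a₀ = s a₀ := hf.implicitFunction_apply_self hm hinv
  have hfg : ∀ᶠ a in 𝓝 a₀, f (a, g a) = f (a₀, s a₀) := hf.eventually_apply_implicitFunction hm hinv
  have ht : Filter.Tendsto (fun a => (a, g a)) (𝓝 a₀) (𝓝 (a₀, s a₀)) := by
    rw [← hg0]
    exact (continuousAt_id.prodMk hg.continuousAt)
  refine hg.congr_of_eventuallyEq ?_
  filter_upwards [hfg, ht.eventually huniq] with a h1 h2
  exact (h2 (h1.trans h0)).symm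

/-- A continuous linear map at distance less than one from the identity is invertible. -/
theorem isInvertible_of_norm_sub_lt_one {f : Y →L[ℝ] Y} (hf : ‖ContinuousLinearMap.id ℝ Y - f‖ < 1) :
    f.IsInvertible := by
  have h := (Units.oneSub (ContinuousLinearMap.id ℝ Y - f) hf).isUnit
  rw [Units.val_oneSub] at h
  have : (1 : Y →L[ℝ] Y) - (ContinuousLinearMap.id ℝ Y - f) = f := by
    change ContinuousLinearMap.id ℝ Y - (ContinuousLinearMap.id ℝ Y - f) = f
    abel
  rw [this] at h
  obtain ⟨u, rfl⟩ := h
  exact ⟨ContinuousLinearEquiv.unitsEquiv ℝ Y u, rfl⟩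

end Implicit

/-! ### Uniform continuity in a parameter -/

section Compactness

variable {P X F : Type*} [TopologicalSpace P] [TopologicalSpace X] [SeminormedAddCommGroup F]

theorem eventually_forall_norm_sub_lt {K : Set X} (hK : IsCompact K) {f : P × X → F} {p₀ : P}
    (hf : ∀ x ∈ K, ContinuousAt f (p₀, x)) {ε : ℝ} (hε : 0 < ε) :
    ∀ᶠ p in 𝓝 p₀, ∀ x ∈ K, ‖f (p, x) - f (p₀, x)‖ < ε := by
  refine hK.eventually_forall_of_forall_eventually fun x hx => ?_
  have h1 : ContinuousAt (fun z : P × X => f (p₀, z.2)) (p₀, x) := by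
    have : ContinuousAt (fun z : P × X => (p₀, z.2)) (p₀, x) := by fun_prop
    exact ContinuousAt.comp (f := fun z : P × X => (p₀, z.2)) (by exact hf x hx) this
  have h2 := ((hf x hx).sub h1).norm
  have h3 : ‖f (p₀, x) - f (p₀, x)‖ < ε := by simpa using hε
  exact h2.eventually (gt_mem_nhds (by simpa using h3))

end Compactness

/-! ### Flows as solutions of integral equations in path spaces -/

section IntegralEquation

variable {T : Type*} [TopologicalSpace T] [CompactSpace T] [FirstCountableTopology T]
  {E : Type*} [NormedAddCommGroup E] [NormedSpace ℝ E] [CompleteSpace E]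

/-- The unit interval of time. -/
abbrev UnitTime : Type := Icc (0 : ℝ) 1

/-- The projection of the real line to the unit interval. -/
def clampTime (t : ℝ) : UnitTime := projIcc 0 1 zero_le_one t

theorem continuous_clampTime : Continuous clampTime :=
  continuous_projIcc (h := zero_le_one)

theorem clampTime_of_mem {t : ℝ} (ht : t ∈ Icc (0 : ℝ) 1) : clampTime t = ⟨t, ht⟩ :=
  projIcc_of_mem _ ht

theorem continuous_timeIntegral (f : C(UnitTime × T, E)) :
    Continuous fun q : UnitTime × T => ∫ s in (0 : ℝ)..q.1, f (clampTime s, q.2) :=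
  intervalIntegral.continuous_parametric_intervalIntegral_of_continuous (a₀ := 0)
    (f := fun (q : UnitTime × T) s => f (clampTime s, q.2))
    (f.continuous.comp ((continuous_clampTime.comp continuous_snd).prodMk
      (continuous_snd.comp continuous_fst))) (continuous_subtype_val.comp continuous_fst)

theorem norm_timeIntegral_le {g : ℝ → E} {C : ℝ} (hC : ∀ s, ‖g s‖ ≤ C) (t : UnitTime) :
    ‖∫ s in (0 : ℝ)..t, g s‖ ≤ C := by
  have := intervalIntegral.norm_integral_le_of_norm_le_const (a := 0) (b := (t : ℝ))
    (f := g) (C := C) (fun s _ => hC s)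
  refine this.trans ?_
  have h0 : 0 ≤ C := (norm_nonneg _).trans (hC 0)
  rw [sub_zero, abs_of_nonneg t.2.1]
  exact mul_le_of_le_one_right h0 t.2.2

theorem intervalIntegrable_clamp (f : C(UnitTime × T, E)) (τ : T) (a b : ℝ) :
    IntervalIntegrable (fun s => f (clampTime s, τ)) MeasureTheory.volume a b :=
  (f.continuous.comp (continuous_clampTime.prodMk continuous_const)).intervalIntegrable _ _

/-- Integration with respect to time, as an operator on continuous functions. -/
def timeIntegral : C(UnitTime × T, E) →L[ℝ] C(UnitTime × T, E) :=
  let A : C(UnitTime × T, E) →ₗ[ℝ] C(UnitTime × T, E) :=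
    { toFun := fun f => ⟨_, continuous_timeIntegral f⟩
      map_add' := fun f g => by
        ext q
        exact intervalIntegral.integral_add (intervalIntegrable_clamp f _ _ _)
          (intervalIntegrable_clamp g _ _ _)
      map_smul' := fun c f => by
        ext q
        exact intervalIntegral.integral_smul _ _ }
  A.mkContinuous 1 (fun f => by
    rw [ContinuousMap.norm_le _ (by positivity), one_mul]
    exact fun q => norm_timeIntegral_le (fun s => f.norm_coe_le_norm _) _)

theorem timeIntegral_apply (f : C(UnitTime × T, E)) (t : UnitTime) (τ : T) :
    timeIntegral f (t, τ) = ∫ s in (0 : ℝ)..t, f (clampTime s, τ) := rfl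

theorem norm_timeIntegral_apply_le (f : C(UnitTime × T, E)) : ‖timeIntegral f‖ ≤ ‖f‖ := by
  rw [ContinuousMap.norm_le _ (by positivity)]
  exact fun q => norm_timeIntegral_le (fun s => f.norm_coe_le_norm _) _

/-- A family of time-dependent vector fields that is bounded by `ρ` and has Lipschitz constant `1/2`
on the ball of radius `r`. -/
structure FieldSmall (g : UnitTime × T → E → E) (r ρ : ℝ) : Prop where
  cont : ContinuousOn (fun z : (UnitTime × T) × E => g z.1 z.2) (univ ×ˢ Metric.closedBall 0 r)
  bound : ∀ q, ∀ y ∈ Metric.closedBall (0 : E) r, ‖g q y‖ ≤ ρ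
  lip : ∀ q, ∀ y ∈ Metric.closedBall (0 : E) r, ∀ y' ∈ Metric.closedBall (0 : E) r,
    ‖g q y - g q y'‖ ≤ 1 / 2 * ‖y - y'‖

/-- `u` solves the integral equation of the flow of `g` with initial value `x`, and stays in the ball
of radius `r`. -/
structure IsFlow (g : UnitTime × T → E → E) (r : ℝ) (x : E) (u : C(UnitTime × T, E)) : Prop where
  mem : ∀ q, u q ∈ Metric.closedBall (0 : E) r
  eq : ∀ (t : UnitTime) (τ : T),
    u (t, τ) = x + ∫ s in (0 : ℝ)..t, g (clampTime s, τ) (u (clampTime s, τ))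

variable {g : UnitTime × T → E → E} {r ρ : ℝ} {x : E} {u v : C(UnitTime × T, E)}

theorem FieldSmall.continuous_comp (hg : FieldSmall g r ρ)
    (hu : ∀ q, u q ∈ Metric.closedBall (0 : E) r) : Continuous fun q => g q (u q) :=
  hg.cont.comp_continuous (continuous_id.prodMk u.continuous) (fun q => ⟨mem_univ _, hu q⟩)

/-- The time interval has length one, so the pointwise Lipschitz constant 1/2 is inherited by
Picard's operator, which is thus a contraction without any restriction to short times. -/
theorem FieldSmall.norm_timeIntegral_sub_le (hg : FieldSmall g r ρ)
    (hu : ∀ q, u q ∈ Metric.closedBall (0 : E) r) (hv : ∀ q, v q ∈ Metric.closedBall (0 : E) r) :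
    ‖timeIntegral ⟨_, hg.continuous_comp hu⟩ - timeIntegral ⟨_, hg.continuous_comp hv⟩‖
      ≤ 1 / 2 * ‖u - v‖ := by
  rw [← map_sub]
  refine (norm_timeIntegral_apply_le _).trans ?_
  rw [ContinuousMap.norm_le _ (by positivity)]
  intro q
  refine (hg.lip q _ (hu q) _ (hv q)).trans ?_
  gcongr
  exact (u - v).norm_coe_le_norm q

theorem IsFlow.eq_timeIntegral (hg : FieldSmall g r ρ) (hu : IsFlow g r x u) :
    u = ContinuousMap.const _ x + timeIntegral ⟨_, hg.continuous_comp hu.mem⟩ := by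
  ext ⟨t, τ⟩
  exact hu.eq t τ

theorem IsFlow.unique (hg : FieldSmall g r ρ) (hu : IsFlow g r x u) (hv : IsFlow g r x v) :
    u = v := by
  have h := hg.norm_timeIntegral_sub_le hu.mem hv.mem
  have h2 : u - v = timeIntegral ⟨_, hg.continuous_comp hu.mem⟩ -
      timeIntegral ⟨_, hg.continuous_comp hv.mem⟩ := by
    conv_lhs => rw [hu.eq_timeIntegral hg, hv.eq_timeIntegral hg]
    abel
  rw [← h2] at h
  have h3 : ‖u - v‖ ≤ 0 := by linarith [norm_nonneg (u - v)]
  exact sub_eq_zero.1 (norm_le_zero_iff.1 h3)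

/-- Banach's fixed point theorem on the closed set of paths in the ball of radius `r`. The field has
norm at most `ρ`, so a start in the ball of radius `r - ρ` keeps Picard's operator inside this set.
-/
theorem FieldSmall.exists_isFlow (hg : FieldSmall g r ρ) (hρ : 0 ≤ ρ) (hx : ‖x‖ ≤ r - ρ) :
    ∃ u, IsFlow g r x u := by
  classical
  set s : Set C(UnitTime × T, E) := {u | ∀ q, u q ∈ Metric.closedBall (0 : E) r} with hs
  have hsc : IsClosed s := by
    have : s = ⋂ q, (fun u : C(UnitTime × T, E) => u q) ⁻¹' Metric.closedBall (0 : E) r := by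
      ext; simp [hs]
    rw [this]
    exact isClosed_iInter fun q => Metric.isClosed_closedBall.preimage
      (ContinuousMap.evalCLM ℝ q : C(UnitTime × T, E) →L[ℝ] E).continuous
  -- The value 0 outside `s` only makes the operator total; the contraction principle uses its
  -- restriction to `s`.
  set Φ : C(UnitTime × T, E) → C(UnitTime × T, E) := fun u =>
    if h : u ∈ s then ContinuousMap.const _ x + timeIntegral ⟨_, hg.continuous_comp h⟩ else 0 with hΦ
  have hΦs : ∀ u (h : u ∈ s), Φ u =
      ContinuousMap.const _ x + timeIntegral ⟨_, hg.continuous_comp h⟩ := fun u h => by simp [hΦ, h]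
  have hmaps : MapsTo Φ s s := by
    intro u hu q
    rw [hΦs u hu, mem_closedBall_zero_iff]
    have h1 : ‖timeIntegral ⟨_, hg.continuous_comp hu⟩ q‖ ≤ ρ :=
      norm_timeIntegral_le (fun s => hg.bound _ _ (hu _)) q.1
    exact (norm_add_le x _).trans (by linarith)
  have hcon : ContractingWith (1 / 2) (hmaps.restrict Φ s s) := by
    refine ⟨by rw [← NNReal.coe_lt_coe]; norm_num, LipschitzWith.of_dist_le_mul ?_⟩
    rintro ⟨u, hu⟩ ⟨v, hv⟩
    simp only [Subtype.dist_eq, MapsTo.val_restrict_apply, dist_eq_norm]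
    rw [hΦs u hu, hΦs v hv, add_sub_add_left_eq_sub]
    simpa using hg.norm_timeIntegral_sub_le hu hv
  have hx0 : ContinuousMap.const _ x ∈ s := fun q => by
    simp only [ContinuousMap.const_apply, mem_closedBall_zero_iff]; linarith
  obtain ⟨u, hus, hu, -⟩ := hcon.exists_fixedPoint' hsc.isComplete hmaps hx0 (edist_ne_top _ _)
  refine ⟨u, hus, fun t τ => ?_⟩
  have := DFunLike.congr_fun (hu.symm.trans (hΦs u hus)) (t, τ)
  exact this

open Classical in
/-- The flow of `g` with initial value `x`. -/
def flow (g : UnitTime × T → E → E) (r : ℝ) (x : E) : C(UnitTime × T, E) :=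
  if h : ∃ u, IsFlow g r x u then h.choose else 0

theorem FieldSmall.isFlow_flow (hg : FieldSmall g r ρ) (hρ : 0 ≤ ρ) (hx : ‖x‖ ≤ r - ρ) :
    IsFlow g r x (flow g r x) := by
  have h := hg.exists_isFlow hρ hx
  rw [flow, dif_pos h]
  exact h.choose_spec

theorem IsFlow.eq_flow (hg : FieldSmall g r ρ) (hu : IsFlow g r x u) : u = flow g r x := by
  have h : ∃ u, IsFlow g r x u := ⟨u, hu⟩
  rw [flow, dif_pos h]
  exact hu.unique hg h.choose_spec

theorem IsFlow.norm_sub_le (hg : FieldSmall g r ρ) (hu : IsFlow g r x u) (q : UnitTime × T) :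
    ‖u q - x‖ ≤ ρ := by
  obtain ⟨t, τ⟩ := q
  rw [hu.eq t τ, add_sub_cancel_left]
  exact norm_timeIntegral_le (fun s => hg.bound _ _ (hu.mem _)) t

variable {V P : Type*} [NormedAddCommGroup V] [NormedSpace ℝ V]
  [NormedAddCommGroup P] [NormedSpace ℝ P]

/-- The constant functions. -/
def constPath : E →L[ℝ] C(UnitTime × T, E) :=
  let A : E →ₗ[ℝ] C(UnitTime × T, E) :=
    { toFun := fun x => ContinuousMap.const _ x
      map_add' := fun _ _ => rfl
      map_smul' := fun _ _ => rfl }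
  A.mkContinuous 1 (fun x => by
    rw [ContinuousMap.norm_le _ (by positivity), one_mul]
    exact fun q => le_rfl)

@[simp] theorem constPath_apply (x : E) (q : UnitTime × T) : constPath x q = x := rfl

/-- The lift of a path of vectors to the path of arguments of a parameter-dependent field. -/
def argPath (ι : C(UnitTime × T, V)) (b : P) (u : C(UnitTime × T, E)) : C(UnitTime × T, V × P × E) :=
  ⟨fun q => (ι q, b, u q), by fun_prop⟩

/-- The linear part of `argPath`. -/
def argPathLinear : P × C(UnitTime × T, E) →L[ℝ] C(UnitTime × T, V × P × E) :=
  let A : P × C(UnitTime × T, E) →ₗ[ℝ] C(UnitTime × T, V × P × E) :=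
    { toFun := fun z => ⟨fun q => (0, z.1, z.2 q), by fun_prop⟩
      map_add' := fun _ _ => by ext <;> simp
      map_smul' := fun _ _ => by ext <;> simp }
  A.mkContinuous 1 (fun z => by
    rw [ContinuousMap.norm_le _ (by positivity), one_mul]
    intro q
    simp only [A, LinearMap.coe_mk, AddHom.coe_mk, ContinuousMap.coe_mk, Prod.norm_def, norm_zero]
    refine max_le (by positivity) (max_le (le_max_left _ _) ?_)
    exact (z.2.norm_coe_le_norm q).trans (le_max_right _ _))

@[simp] theorem argPathLinear_apply (z : P × C(UnitTime × T, E)) (q : UnitTime × T) :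
    (argPathLinear z : C(UnitTime × T, V × P × E)) q = (0, z.1, z.2 q) := rfl

theorem argPath_eq (ι : C(UnitTime × T, V)) (z : P × C(UnitTime × T, E)) :
    argPath ι z.1 z.2 = argPath ι 0 0 + argPathLinear z := by
  ext q <;> simp [argPath]

theorem contDiff_argPath (ι : C(UnitTime × T, V)) {m : WithTop ℕ∞} :
    ContDiff ℝ m fun z : P × C(UnitTime × T, E) => argPath ι z.1 z.2 := by
  simp_rw [argPath_eq ι]
  exact contDiff_const.add
    (ContinuousLinearMap.contDiff (argPathLinear (T := T) (E := E) (V := V) (P := P)))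

/-- The flow is the zero of `u - x - ∫ G(ι, b, u)` in the Banach space of paths. Superposition makes
this expression of class C^m in all variables, and its derivative in `u` differs from the identity
by an operator of norm at most 1/2, so the implicit function theorem applies. Taking `m = ω` gives
analytic dependence with no separate argument. -/
theorem contDiffAt_flow [CompleteSpace P] {G : V × P × E → E} {O : Set (V × P × E)} (hO : IsOpen O)
    {m : WithTop ℕ∞} (hm : m ≠ 0) (hG : ContDiffOn ℝ m G O) {ι : C(UnitTime × T, V)} {B : Set P}
    (hB : IsOpen B) (hρ : 0 ≤ ρ) (hg : ∀ b ∈ B, FieldSmall (fun q y => G (ι q, b, y)) r ρ)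
    (hBO : ∀ q, ∀ b ∈ B, ∀ y ∈ Metric.ball (0 : E) r, (ι q, b, y) ∈ O)
    {b₀ : P} (hb₀ : b₀ ∈ B) {x₀ : E} (hx₀ : ‖x₀‖ < r - ρ) :
    ContDiffAt ℝ m (fun a : P × E => flow (fun q y => G (ι q, a.1, y)) r a.2) (b₀, x₀) := by
  set s : P × E → C(UnitTime × T, E) := fun a => flow (fun q y => G (ι q, a.1, y)) r a.2 with hs
  set u₀ := s (b₀, x₀) with hu₀
  have hsol : IsFlow (fun q y => G (ι q, b₀, y)) r x₀ u₀ := (hg b₀ hb₀).isFlow_flow hρ hx₀.le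
  have hmem : ∀ q, u₀ q ∈ Metric.ball (0 : E) r := fun q => by
    rw [mem_ball_zero_iff]
    have := hsol.norm_sub_le (hg b₀ hb₀) q
    calc ‖u₀ q‖ = ‖x₀ + (u₀ q - x₀)‖ := by congr 1; abel
      _ ≤ ‖x₀‖ + ‖u₀ q - x₀‖ := norm_add_le _ _
      _ < r := by linarith
  set N : P × C(UnitTime × T, E) → C(UnitTime × T, E) := fun z =>
    timeIntegral (superpose G (argPath ι z.1 z.2)) with hN
  have hmemO : ∀ b ∈ B, ∀ u : C(UnitTime × T, E), (∀ q, u q ∈ Metric.ball (0 : E) r) →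
      ∀ q, argPath ι b u q ∈ O := fun b hb u hu q => hBO q b hb _ (hu q)
  have hNc : ContDiffAt ℝ m N (b₀, u₀) := by
    refine ((timeIntegral (T := T) (E := E)).contDiff.contDiffAt).comp _ ?_
    refine ContDiffAt.comp (g := superpose G) _ ?_ (contDiff_argPath ι).contDiffAt
    exact (contDiffOn_superpose hO hG).contDiffAt
      ((isOpen_setOf_forall_mem hO).mem_nhds (hmemO b₀ hb₀ u₀ hmem))
  set f : (P × E) × C(UnitTime × T, E) → C(UnitTime × T, E) := fun z =>
    z.2 - constPath z.1.2 - N (z.1.1, z.2) with hf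
  have hpair : ContDiff ℝ m fun z : (P × E) × C(UnitTime × T, E) => (z.1.1, z.2) := by fun_prop
  have hfc : ContDiffAt ℝ m f ((b₀, x₀), s (b₀, x₀)) := by
    refine ContDiffAt.sub (by fun_prop) ?_
    exact ContDiffAt.comp (g := N) _ hNc hpair.contDiffAt
  have hball : ∀ᶠ z in 𝓝 ((b₀, x₀), u₀), z.1.1 ∈ B ∧ ∀ q, z.2 q ∈ Metric.ball (0 : E) r := by
    have h1 : IsOpen {z : (P × E) × C(UnitTime × T, E) | z.1.1 ∈ B} :=
      hB.preimage (continuous_fst.comp continuous_fst)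
    have h2 : IsOpen {z : (P × E) × C(UnitTime × T, E) | ∀ q, z.2 q ∈ Metric.ball (0 : E) r} :=
      (isOpen_setOf_forall_mem (Q := UnitTime × T) (Metric.isOpen_ball (x := (0 : E)) (ε := r))).preimage
        continuous_snd
    exact (h1.inter h2).mem_nhds ⟨hb₀, hmem⟩
  -- For paths in the open ball the zeros of `f` are exactly the flows; uniqueness of flows then
  -- supplies the local uniqueness required of the implicit solution.
  have hflow : ∀ z : (P × E) × C(UnitTime × T, E), z.1.1 ∈ B →
      (∀ q, z.2 q ∈ Metric.ball (0 : E) r) →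
      (f z = 0 ↔ IsFlow (fun q y => G (ι q, z.1.1, y)) r z.1.2 z.2) := by
    intro z hz1 hz2
    have hap : ∀ q, superpose G (argPath ι z.1.1 z.2) q = G (ι q, z.1.1, z.2 q) := fun q =>
      superpose_apply hG.continuousOn (hmemO _ hz1 _ hz2) q
    constructor
    · intro h
      refine ⟨fun q => Metric.ball_subset_closedBall (hz2 q), fun t τ => ?_⟩
      have := DFunLike.congr_fun h (t, τ)
      simp only [hf, hN, ContinuousMap.sub_apply, ContinuousMap.add_apply, timeIntegral_apply, hap,
        ContinuousMap.zero_apply, constPath_apply, sub_sub,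
        sub_eq_zero] at this
      exact this
    · intro h
      ext ⟨t, τ⟩
      simp only [hf, hN, ContinuousMap.sub_apply, ContinuousMap.add_apply, timeIntegral_apply, hap,
        ContinuousMap.zero_apply, constPath_apply, sub_sub,
        sub_eq_zero]
      exact h.eq t τ
  refine contDiffAt_of_implicit hm hfc ?_ ((hflow _ hb₀ hmem).2 hsol) ?_
  · have hd : HasFDerivAt N (fderiv ℝ N (b₀, u₀)) (b₀, u₀) :=
      (hNc.differentiableAt hm).hasFDerivAt
    -- The operator norm of a derivative is bounded by a local Lipschitz constant, here the 1/2 of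
    -- Picard's operator.
    have hL : ‖(fderiv ℝ N (b₀, u₀)).comp (.inr ℝ P C(UnitTime × T, E))‖ ≤ 1 / 2 := by
      have h1 : HasFDerivAt (fun u => N (b₀, u))
          ((fderiv ℝ N (b₀, u₀)).comp (.inr ℝ P C(UnitTime × T, E))) u₀ :=
        HasFDerivAt.comp u₀ hd (hasFDerivAt_prodMk_right b₀ u₀)
      refine h1.le_of_lip' (by norm_num) ?_
      have h2 := (isOpen_setOf_forall_mem (Q := UnitTime × T)
        (Metric.isOpen_ball (x := (0 : E)) (ε := r))).mem_nhds hmem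
      filter_upwards [h2] with u hu
      have e1 : N (b₀, u) = timeIntegral ⟨_, (hg b₀ hb₀).continuous_comp
          (fun q => Metric.ball_subset_closedBall (hu q))⟩ := by
        refine congrArg timeIntegral ?_
        ext q
        exact superpose_apply hG.continuousOn (hmemO _ hb₀ _ hu) q
      have e2 : N (b₀, u₀) = timeIntegral ⟨_, (hg b₀ hb₀).continuous_comp hsol.mem⟩ := by
        refine congrArg timeIntegral ?_
        ext q
        exact superpose_apply hG.continuousOn (hmemO _ hb₀ _ hmem) q
      rw [e1, e2]
      exact (hg b₀ hb₀).norm_timeIntegral_sub_le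
        (fun q => Metric.ball_subset_closedBall (hu q)) hsol.mem
    refine isInvertible_of_norm_sub_lt_one (lt_of_le_of_lt (le_of_eq_of_le ?_ hL) (by norm_num))
    congr 1
    have hfd : HasFDerivAt (fun u => f ((b₀, x₀), u))
        (ContinuousLinearMap.id ℝ _ - (fderiv ℝ N (b₀, u₀)).comp (.inr ℝ P C(UnitTime × T, E))) u₀ := by
      refine HasFDerivAt.sub (f := fun u => u - constPath x₀) ((hasFDerivAt_id u₀).sub_const _) ?_
      exact HasFDerivAt.comp u₀ hd (hasFDerivAt_prodMk_right b₀ u₀)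
    have hfd' : HasFDerivAt (fun u => f ((b₀, x₀), u))
        ((fderiv ℝ f ((b₀, x₀), s (b₀, x₀))).comp (.inr ℝ (P × E) C(UnitTime × T, E))) u₀ :=
      HasFDerivAt.comp u₀ (hfc.differentiableAt hm).hasFDerivAt (hasFDerivAt_prodMk_right _ u₀)
    rw [hfd'.unique hfd]
    abel
  · filter_upwards [hball] with z hz hfz
    exact ((hflow z hz.1 hz.2).1 hfz).eq_flow (hg _ hz.1)

/-- The equation of variations, obtained by differentiating the integral equation as an identity
between maps into the space of paths. -/
theorem fderiv_flow_apply [CompleteSpace P] {G : V × P × E → E} {O : Set (V × P × E)}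
    (hO : IsOpen O) (hG : ContDiffOn ℝ 1 G O) {ι : C(UnitTime × T, V)} {B : Set P}
    (hB : IsOpen B) (hρ : 0 ≤ ρ) (hg : ∀ b ∈ B, FieldSmall (fun q y => G (ι q, b, y)) r ρ)
    (hBO : ∀ q, ∀ b ∈ B, ∀ y ∈ Metric.ball (0 : E) r, (ι q, b, y) ∈ O)
    {b : P} (hb : b ∈ B) {x : E} (hx : ‖x‖ < r - ρ) (v : E) (t : UnitTime) (τ : T) :
    fderiv ℝ (flow (fun q y => G (ι q, b, y)) r) x v (t, τ) =
      v + ∫ s in (0 : ℝ)..t, fderiv ℝ (fun y => G (ι (clampTime s, τ), b, y))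
        (flow (fun q y => G (ι q, b, y)) r x (clampTime s, τ))
        (fderiv ℝ (flow (fun q y => G (ι q, b, y)) r) x v (clampTime s, τ)) := by
  set U : E → C(UnitTime × T, E) := flow (fun q y => G (ι q, b, y)) r with hU
  have hmem : ∀ x : E, ‖x‖ < r - ρ → ∀ q, U x q ∈ Metric.ball (0 : E) r := fun x hx q => by
    have hsol : IsFlow (fun q y => G (ι q, b, y)) r x (U x) := (hg b hb).isFlow_flow hρ hx.le
    rw [mem_ball_zero_iff]
    have := hsol.norm_sub_le (hg b hb) q
    calc ‖U x q‖ = ‖x + (U x q - x)‖ := by congr 1; abel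
      _ ≤ ‖x‖ + ‖U x q - x‖ := norm_add_le _ _
      _ < r := by linarith
  have hUd : HasFDerivAt U (fderiv ℝ U x) x := by
    have h1 := (contDiffAt_flow hO one_ne_zero hG hB hρ hg hBO hb hx).differentiableAt one_ne_zero
    have h2 : DifferentiableAt ℝ (fun x : E => (b, x)) x := by fun_prop
    exact (h1.comp x h2).hasFDerivAt
  have hmO : ∀ x : E, ‖x‖ < r - ρ → ∀ q, argPath ι b (U x) q ∈ O := fun x hx q =>
    hBO q b hb _ (hmem x hx q)
  have hGd : ∀ z ∈ O, HasFDerivAt G (fderiv ℝ G z) z := fun z hz =>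
    ((hG.contDiffAt (hO.mem_nhds hz)).differentiableAt one_ne_zero).hasFDerivAt
  have hG' : ContinuousOn (fderiv ℝ G) O := hG.continuousOn_fderiv_of_isOpen hO le_rfl
  have heq : U =ᶠ[𝓝 x] fun x => constPath x + timeIntegral (superpose G (argPath ι b (U x))) := by
    filter_upwards [(isOpen_lt continuous_norm continuous_const).mem_nhds hx] with x hx
    ext ⟨t, τ⟩
    have hsol : IsFlow (fun q y => G (ι q, b, y)) r x (U x) := (hg b hb).isFlow_flow hρ hx.le
    simp only [ContinuousMap.add_apply, timeIntegral_apply, constPath_apply,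
      superpose_apply hG.continuousOn (hmO x hx)]
    exact hsol.eq t τ
  have hR : HasFDerivAt (fun x => constPath x + timeIntegral (superpose G (argPath ι b (U x))))
      ((constPath (T := T) (E := E)) + (timeIntegral (T := T) (E := E)).comp
        ((fieldLinear (superpose (fderiv ℝ G) (argPath ι b (U x)))).comp
          ((argPathLinear (T := T) (E := E) (V := V) (P := P)).comp
            ((ContinuousLinearMap.inr ℝ P C(UnitTime × T, E)).comp (fderiv ℝ U x))))) x := by
    refine (constPath (T := T) (E := E)).hasFDerivAt.add ?_
    refine (timeIntegral (T := T) (E := E)).hasFDerivAt.comp x ?_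
    refine HasFDerivAt.comp (f := fun x => argPath ι b (U x)) x (hasFDerivAt_superpose hO hGd hG' (hmO x hx)) ?_
    have : (fun x => argPath ι b (U x)) = fun x => argPath ι (0 : P) 0 +
        argPathLinear (T := T) (E := E) (V := V) (P := P) (b, U x) := by
      ext1 x; exact argPath_eq ι (b, U x)
    rw [this]
    refine HasFDerivAt.const_add _ ?_
    refine (argPathLinear (T := T) (E := E) (V := V) (P := P)).hasFDerivAt.comp x ?_
    exact (hasFDerivAt_prodMk_right b (U x)).comp x hUd
  have := hUd.unique (hR.congr_of_eventuallyEq heq)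
  conv_lhs => rw [this]
  simp only [add_apply, ContinuousLinearMap.comp_apply, ContinuousMap.add_apply,
    constPath_apply, timeIntegral_apply, fieldLinear_apply, argPathLinear_apply,
    superpose_apply hG' (hmO x hx)]
  congr 1
  refine intervalIntegral.integral_congr fun s _ => ?_
  have hpt := hBO (clampTime s, τ) b hb _ (hmem x hx (clampTime s, τ))
  have hc : HasFDerivAt (fun y => G (ι (clampTime s, τ), b, y))
      ((fderiv ℝ G (ι (clampTime s, τ), b, U x (clampTime s, τ))).comp
        ((ContinuousLinearMap.inr ℝ V (P × E)).comp (ContinuousLinearMap.inr ℝ P E)))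
      (U x (clampTime s, τ)) :=
    HasFDerivAt.comp _ (hGd _ hpt) ((hasFDerivAt_prodMk_right _ _).comp _
      (hasFDerivAt_prodMk_right b _))
  rw [hc.fderiv]
  rfl

/-- The integral over the unit interval of a function of class `C^m` is of class `C^m` in the
parameter. -/
theorem contDiffOn_integral_param {A F : Type*} [NormedAddCommGroup A] [NormedSpace ℝ A]
    [CompleteSpace A] [NormedAddCommGroup F] [NormedSpace ℝ F] [CompleteSpace F] {H : ℝ × A → F} {O : Set (ℝ × A)}
    (hO : IsOpen O) {m : WithTop ℕ∞} (hH : ContDiffOn ℝ m H O) {S : Set A}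
    (hS : ∀ a ∈ S, ∀ s ∈ Icc (0 : ℝ) 1, (s, a) ∈ O) :
    ContDiffOn ℝ m (fun a => ∫ s in (0 : ℝ)..1, H (s, a)) S := by
  -- The integral is the value at time one of `timeIntegral` applied to a superposition along this
  -- affine map; `Unit` stands for a family with a single member.
  set w : A → C(UnitTime × Unit, ℝ × A) := fun a => ⟨fun q => (q.1, a), by fun_prop⟩ with hw
  have hwc : ContDiff ℝ m w := by
    have : w = fun a => w 0 + (((ContinuousLinearMap.inr ℝ ℝ A).compLeftContinuous ℝ
        (UnitTime × Unit)).comp (constPath (T := Unit) (E := A))) a := by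
      ext a q <;> simp [hw]
    rw [this]
    exact contDiff_const.add (ContinuousLinearMap.contDiff _)
  have hmem : ∀ a ∈ S, ∀ q, w a q ∈ O := fun a ha q => hS a ha _ q.1.2
  have h1 : ContDiffOn ℝ m (fun a => superpose H (w a)) S :=
    (contDiffOn_superpose hO hH).comp hwc.contDiffOn hmem
  have h2 := (((ContinuousMap.evalCLM ℝ (⟨1, by simp⟩, ()) : C(UnitTime × Unit, F) →L[ℝ] F).comp
    (timeIntegral (T := Unit) (E := F))).contDiff (n := m)).comp_contDiffOn h1
  refine h2.congr fun a ha => ?_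
  simp only [Function.comp_apply, ContinuousLinearMap.comp_apply, ContinuousMap.evalCLM_apply,
    timeIntegral_apply]
  refine intervalIntegral.integral_congr fun s hs => ?_
  rw [uIcc_of_le zero_le_one] at hs
  rw [superpose_apply hH.continuousOn (hmem a ha)]
  simp [hw, clampTime_of_mem hs]

end IntegralEquation

/-! ### Inverting maps close to the identity -/

section NearId

variable {E : Type*} [NormedAddCommGroup E] [NormedSpace ℝ E] [CompleteSpace E]

/-- `f` is `C^1`-close to the identity on the ball of radius `r`. -/
structure NearId (f : E → E) (r d : ℝ) : Prop where
  norm_sub_le : ∀ x, ‖x‖ < r → ‖f x - x‖ ≤ d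
  lip : ∀ x, ‖x‖ < r → ∀ y, ‖y‖ < r → ‖(f x - f y) - (x - y)‖ ≤ 1 / 2 * ‖x - y‖

variable {f : E → E} {r d : ℝ}

theorem NearId.injOn (h : NearId f r d) : InjOn f (Metric.ball 0 r) := by
  intro x hx y hy hxy
  have := h.lip x (by simpa using hx) y (by simpa using hy)
  rw [hxy, sub_self, zero_sub, norm_neg] at this
  have h0 : ‖x - y‖ ≤ 0 := by linarith [norm_nonneg (x - y)]
  exact sub_eq_zero.1 (norm_le_zero_iff.1 h0)

theorem NearId.exists_eq (h : NearId f r d) (hd : 0 ≤ d) {y : E} (hy : ‖y‖ < r - 2 * d) :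
    ∃ x, ‖x‖ < r ∧ f x = y ∧ ‖x - y‖ ≤ 2 * d := by
  have hball : ∀ x ∈ Metric.closedBall y (2 * d), ‖x‖ < r := fun x hx => by
    have h1 : ‖x - y‖ ≤ 2 * d := by simpa [dist_eq_norm] using hx
    calc ‖x‖ = ‖y + (x - y)‖ := by congr 1; abel
      _ ≤ ‖y‖ + ‖x - y‖ := norm_add_le _ _
      _ < r := by linarith
  have hy' : ‖y‖ < r := by linarith
  -- Its fixed points are the solutions of `f x = y`. It is a 1/2-contraction that moves every point
  -- to within `d` of `y`, and the ball of radius `2 * d` about `y` lies in the domain.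
  set Φ : E → E := fun x => y - (f x - x) with hΦ
  have hlip : ∀ x ∈ Metric.closedBall y (2 * d), ∀ z ∈ Metric.closedBall y (2 * d),
      ‖Φ x - Φ z‖ ≤ 1 / 2 * ‖x - z‖ := fun x hx z hz => by
    have := h.lip x (hball x hx) z (hball z hz)
    rwa [show Φ x - Φ z = -((f x - f z) - (x - z)) by
      change (y - (f x - x)) - (y - (f z - z)) = _; abel, norm_neg]
  have hmaps : MapsTo Φ (Metric.closedBall y (2 * d)) (Metric.closedBall y (2 * d)) := by
    intro x hx
    have h1 := h.norm_sub_le x (hball x hx)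
    rw [mem_closedBall_iff_norm]
    simp only [hΦ, sub_sub_cancel_left, norm_neg]
    linarith
  have hcon : ContractingWith (1 / 2) (hmaps.restrict Φ _ _) := by
    refine ⟨by rw [← NNReal.coe_lt_coe]; norm_num, LipschitzWith.of_dist_le_mul ?_⟩
    rintro ⟨u, hu⟩ ⟨v, hv⟩
    simp only [Subtype.dist_eq, MapsTo.val_restrict_apply, dist_eq_norm]
    simpa using hlip u hu v hv
  obtain ⟨x, hx, hfix, -⟩ := hcon.exists_fixedPoint' Metric.isClosed_closedBall.isComplete hmaps
    (Metric.mem_closedBall_self (by linarith)) (edist_ne_top _ _)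
  refine ⟨x, hball x hx, ?_, by simpa [dist_eq_norm] using hx⟩
  have : y - (f x - x) = x := hfix
  have h2 : y - f x = 0 := by
    have := sub_eq_zero.2 this
    rw [← this]; abel
  exact (sub_eq_zero.1 h2).symm

/-- The inverse of a map that is close to the identity on the ball of radius `r`. -/
def invBall (f : E → E) (r : ℝ) : E → E := Function.invFunOn f (Metric.ball 0 r)

theorem NearId.invBall_spec (h : NearId f r d) (hd : 0 ≤ d) {y : E} (hy : ‖y‖ < r - 2 * d) :
    ‖invBall f r y‖ < r ∧ f (invBall f r y) = y := by
  obtain ⟨x, hx, hxy, -⟩ := h.exists_eq hd hy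
  have hex : ∃ x ∈ Metric.ball (0 : E) r, f x = y := ⟨x, by simpa using hx, hxy⟩
  exact ⟨by simpa [invBall] using Function.invFunOn_mem hex, Function.invFunOn_eq hex⟩

theorem NearId.invBall_apply (h : NearId f r d) {x : E} (hx : ‖x‖ < r) : invBall f r (f x) = x :=
  h.injOn.leftInvOn_invFunOn (by simpa using hx)

theorem NearId.norm_invBall_sub_le (h : NearId f r d) (hd : 0 ≤ d) {y : E} (hy : ‖y‖ < r - 2 * d) :
    ‖invBall f r y - y‖ ≤ d := by
  obtain ⟨h1, h2⟩ := h.invBall_spec hd hy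
  have := h.norm_sub_le _ h1
  rw [h2] at this
  rwa [norm_sub_rev]

/-- Since `f - id` is 1/2-Lipschitz near `x`, its derivative has norm at most 1/2; invertibility of
`f'` then follows from the Neumann series. -/
theorem NearId.norm_fderiv_sub_le (h : NearId f r d) {x : E} (hx : ‖x‖ < r) {f' : E →L[ℝ] E}
    (hf : HasFDerivAt f f' x) : ‖ContinuousLinearMap.id ℝ E - f'‖ ≤ 1 / 2 := by
  rw [norm_sub_rev]
  refine (hf.sub (hasFDerivAt_id x)).le_of_lip' (by norm_num) ?_
  filter_upwards [(isOpen_lt continuous_norm continuous_const).mem_nhds hx] with y hy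
  have := h.lip y hy x hx
  convert this using 2
  simp only [Pi.sub_apply, id]; abel

theorem NearId.isInvertible (h : NearId f r d) {x : E} (hx : ‖x‖ < r) {f' : E →L[ℝ] E}
    (hf : HasFDerivAt f f' x) : f'.IsInvertible :=
  isInvertible_of_norm_sub_lt_one ((h.norm_fderiv_sub_le hx hf).trans_lt (by norm_num))

variable {P : Type*} [NormedAddCommGroup P] [NormedSpace ℝ P] [CompleteSpace P]

/-- The inverse solves `f b x - y = 0`, so it is regular jointly in `b` and `y` by the implicit
function theorem; injectivity on the ball gives uniqueness. -/
theorem contDiffAt_invBall {f : P → E → E} {B : Set P} (hB : IsOpen B)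
    (h : ∀ b ∈ B, NearId (f b) r d) (hd : 0 ≤ d) {m : WithTop ℕ∞} (hm : m ≠ 0) {b₀ : P}
    (hb₀ : b₀ ∈ B) {y₀ : E} (hy₀ : ‖y₀‖ < r - 2 * d)
    (hf : ContDiffAt ℝ m (fun z : P × E => f z.1 z.2) (b₀, invBall (f b₀) r y₀)) :
    ContDiffAt ℝ m (fun z : P × E => invBall (f z.1) r z.2) (b₀, y₀) := by
  obtain ⟨hx, hfx⟩ := (h b₀ hb₀).invBall_spec hd hy₀
  set x₀ := invBall (f b₀) r y₀ with hx₀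
  set F : (P × E) × E → E := fun z => f z.1.1 z.2 - z.1.2 with hF
  have hpair : ContDiff ℝ m fun z : (P × E) × E => (z.1.1, z.2) := by fun_prop
  have hFc : ContDiffAt ℝ m F ((b₀, y₀), x₀) := by
    refine ContDiffAt.sub ?_ (by fun_prop)
    exact ContDiffAt.comp (g := fun z : P × E => f z.1 z.2) ((b₀, y₀), x₀) hf hpair.contDiffAt
  refine contDiffAt_of_implicit (f := F) hm hFc ?_ (by simp [hF, ← hx₀, hfx]) ?_
  · have h1 : HasFDerivAt (fun x => F ((b₀, y₀), x))
        ((fderiv ℝ F ((b₀, y₀), x₀)).comp (.inr ℝ (P × E) E)) x₀ :=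
      HasFDerivAt.comp x₀ (hFc.differentiableAt hm).hasFDerivAt (hasFDerivAt_prodMk_right _ x₀)
    have h2 : HasFDerivAt (f b₀) ((fderiv ℝ F ((b₀, y₀), x₀)).comp (.inr ℝ (P × E) E)) x₀ := by
      have := h1.add_const y₀
      simpa [hF] using this
    exact (h b₀ hb₀).isInvertible hx h2
  · have : IsOpen {z : (P × E) × E | z.1.1 ∈ B ∧ ‖z.2‖ < r} :=
      (hB.preimage (continuous_fst.comp continuous_fst)).inter
        (isOpen_lt (continuous_norm.comp continuous_snd) continuous_const)
    filter_upwards [this.mem_nhds ⟨hb₀, hx⟩] with z hz hz0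
    have h3 : f z.1.1 z.2 = z.1.2 := sub_eq_zero.1 hz0
    change z.2 = invBall (f z.1.1) r z.1.2
    rw [← h3, (h _ hz.1).invBall_apply hz.2]

end NearId

/-! ### Smallness for small parameters, by compactness -/

section Soft

variable {E : Type*} [NormedAddCommGroup E] [NormedSpace ℝ E] [CompleteSpace E] [ProperSpace E]
  {P : Type*} [NormedAddCommGroup P] [NormedSpace ℝ P]

/-- The partial derivative with respect to the last variable is jointly continuous. -/
theorem hasFDerivAt_partial {A F : Type*} [NormedAddCommGroup A] [NormedSpace ℝ A]
    [NormedAddCommGroup F] [NormedSpace ℝ F] {f : A × E → F} {a : A} {x : E}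
    (hf : DifferentiableAt ℝ f (a, x)) :
    HasFDerivAt (fun x => f (a, x)) ((fderiv ℝ f (a, x)).comp (.inr ℝ A E)) x :=
  HasFDerivAt.comp x hf.hasFDerivAt (hasFDerivAt_prodMk_right a x)

/-- A family of class `C^1` that vanishes for the parameter `0` is uniformly small, with its
derivative, for small parameters. -/
theorem eventually_small {X : Type*} [TopologicalSpace X] [CompactSpace X]
    {A F : Type*} [NormedAddCommGroup A] [NormedSpace ℝ A] [NormedAddCommGroup F] [NormedSpace ℝ F]
    {f : A × E → F} {O : Set (A × E)} (hO : IsOpen O) (hf : ContDiffOn ℝ 1 f O)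
    {j : P × X → A} (hj : Continuous j) {r r' : ℝ} (hr : r < r')
    (hmem : ∀ q, ∀ y, ‖y‖ ≤ r → (j (0, q), y) ∈ O)
    (h0 : ∀ q, ∀ y, ‖y‖ < r' → f (j (0, q), y) = 0) {ε : ℝ} (hε : 0 < ε) :
    ∀ᶠ b : P in 𝓝 0, ∀ q, (∀ y, ‖y‖ ≤ r → (j (b, q), y) ∈ O ∧ ‖f (j (b, q), y)‖ ≤ ε) ∧
      ∀ y, ‖y‖ ≤ r → ∀ y', ‖y'‖ ≤ r → ‖f (j (b, q), y) - f (j (b, q), y')‖ ≤ ε * ‖y - y'‖ := by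
  have hK : IsCompact ((univ : Set X) ×ˢ Metric.closedBall (0 : E) r) :=
    isCompact_univ.prod (isCompact_closedBall 0 r)
  have hjc : Continuous fun z : P × X × E => (j (z.1, z.2.1), z.2.2) := by fun_prop
  have hmem' : ∀ z ∈ (univ : Set X) ×ˢ Metric.closedBall (0 : E) r, (j (0, z.1), z.2) ∈ O :=
    fun z hz => hmem _ _ (by simpa using hz.2)
  have h1 : ∀ᶠ b : P in 𝓝 0, ∀ z ∈ (univ : Set X) ×ˢ Metric.closedBall (0 : E) r,
      (j (b, z.1), z.2) ∈ O := by
    refine hK.eventually_forall_of_forall_eventually fun z hz => ?_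
    exact (hO.preimage hjc).mem_nhds (hmem' z hz)
  have h2 := eventually_forall_norm_sub_lt (P := P) (p₀ := 0) hK
    (f := fun z : P × X × E => f (j (z.1, z.2.1), z.2.2)) (fun z hz =>
      ContinuousAt.comp (g := f) (hf.continuousOn.continuousAt (hO.mem_nhds (hmem' z hz)))
        hjc.continuousAt) hε
  have hf' : ContinuousOn (fun z => (fderiv ℝ f z).comp (.inr ℝ A E)) O :=
    (hf.continuousOn_fderiv_of_isOpen hO le_rfl).clm_comp continuousOn_const
  have h3 := eventually_forall_norm_sub_lt (P := P) (p₀ := 0) hK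
    (f := fun z : P × X × E => (fderiv ℝ f (j (z.1, z.2.1), z.2.2)).comp (.inr ℝ A E))
    (fun z hz => ContinuousAt.comp (g := fun z => (fderiv ℝ f z).comp (.inr ℝ A E))
      (hf'.continuousAt (hO.mem_nhds (hmem' z hz))) hjc.continuousAt) hε
  filter_upwards [h1, h2, h3] with b h1 h2 h3 q
  have hz : ∀ y, ‖y‖ ≤ r → ((q, y) : X × E) ∈ (univ : Set X) ×ˢ Metric.closedBall (0 : E) r :=
    fun y hy => ⟨mem_univ _, by simpa using hy⟩
  have hd : ∀ b y, (j (b, q), y) ∈ O → HasFDerivAt (fun y => f (j (b, q), y))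
      ((fderiv ℝ f (j (b, q), y)).comp (.inr ℝ A E)) y := fun b y h =>
    hasFDerivAt_partial ((hf.contDiffAt (hO.mem_nhds h)).differentiableAt one_ne_zero)
  refine ⟨fun y hy => ⟨h1 _ (hz y hy), ?_⟩, fun y hy y' hy' => ?_⟩
  · have := h2 _ (hz y hy)
    rw [h0 q y (hy.trans_lt hr), sub_zero] at this
    exact this.le
  · refine (convex_closedBall (0 : E) r).norm_image_sub_le_of_norm_hasFDerivWithin_le
      (f := fun y => f (j (b, q), y)) (C := ε)
      (fun x hx => (hd b x (h1 _ (hz x (by simpa using hx)))).hasFDerivWithinAt) (fun x hx => ?_)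
      (by simpa using hy') (by simpa using hy)
    have hx' : ‖x‖ ≤ r := by simpa using hx
    have h4 := h3 _ (hz x hx')
    -- Here `r < r'` matters: also at points with norm exactly `r` the function vanishes on a whole
    -- neighbourhood.
    have h5 : (fderiv ℝ f (j (0, q), x)).comp (.inr ℝ A E) = 0 := by
      refine (hd 0 x (hmem q x hx')).unique ?_
      refine (hasFDerivAt_const (0 : F) x).congr_of_eventuallyEq ?_
      filter_upwards [(isOpen_lt continuous_norm continuous_const).mem_nhds (hx'.trans_lt hr)] with y hy
      exact h0 q y hy
    simp only [h5, sub_zero] at h4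
    exact h4.le

theorem eventually_fieldSmall {T : Type*} [TopologicalSpace T] [CompactSpace T]
    {V : Type*} [NormedAddCommGroup V] [NormedSpace ℝ V]
    {G : V × P × E → E} {O : Set (V × P × E)} (hO : IsOpen O) (hG : ContDiffOn ℝ 1 G O)
    (ι : C(UnitTime × T, V)) {r r' ρ : ℝ} (hr : r < r') (hρ : 0 < ρ)
    (hmem : ∀ q, ∀ y : E, ‖y‖ ≤ r → (ι q, (0 : P), y) ∈ O)
    (h0 : ∀ q, ∀ y : E, ‖y‖ < r' → G (ι q, (0 : P), y) = 0) :
    ∀ᶠ b : P in 𝓝 0, FieldSmall (fun q y => G (ι q, b, y)) r ρ ∧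
      ∀ q, ∀ y : E, ‖y‖ ≤ r → (ι q, b, y) ∈ O := by
  let e : (V × P) × E → V × P × E := fun z => (z.1.1, z.1.2, z.2)
  have he : ContDiff ℝ 1 e := by fun_prop
  -- A single smallness constant `min ρ (1/2)` serves as the bound and as the Lipschitz constant.
  have := eventually_small (P := P) (X := UnitTime × T) (A := V × P) (f := G ∘ e)
    (O := e ⁻¹' O) (hO.preimage he.continuous) (hG.comp he.contDiffOn fun _ h => h)
    (j := fun z => (ι z.2, z.1)) (by fun_prop) hr hmem h0 (lt_min hρ (by norm_num : (0 : ℝ) < 1 / 2))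
  filter_upwards [this] with b hb
  refine ⟨⟨?_, fun q y hy => ((hb q).1 y (by simpa using hy)).2.trans (min_le_left _ _),
    fun q y hy y' hy' => ((hb q).2 y (by simpa using hy) y' (by simpa using hy')).trans ?_⟩,
    fun q y hy => ((hb q).1 y hy).1⟩
  · refine hG.continuousOn.comp (f := fun z : (UnitTime × T) × E => (ι z.1, b, z.2))
      (by fun_prop) ?_
    rintro ⟨q, y⟩ ⟨-, hy⟩
    exact ((hb q).1 y (by simpa using hy)).1
  · gcongr
    exact min_le_right _ _

theorem eventually_nearId {f : P × E → E} {O : Set (P × E)} (hO : IsOpen O)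
    (hf : ContDiffOn ℝ 1 f O) {r r' d : ℝ} (hr : r < r') (hd : 0 < d)
    (hmem : ∀ y : E, ‖y‖ ≤ r → ((0 : P), y) ∈ O) (h0 : ∀ y : E, ‖y‖ < r' → f ((0 : P), y) = y) :
    ∀ᶠ b : P in 𝓝 0, NearId (fun y => f (b, y)) r d := by
  have hf' : ContDiffOn ℝ 1 (fun z : P × E => f z - z.2) O := hf.sub (by fun_prop)
  have := eventually_small (P := P) (X := Unit) (A := P) hO hf' (j := fun z => z.1) (by fun_prop) hr
    (fun _ => hmem) (fun _ y hy => by simp [h0 y hy]) (lt_min hd (by norm_num : (0 : ℝ) < 1 / 2))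
  filter_upwards [this] with b hb
  refine ⟨fun x hx => ((hb ()).1 x hx.le).2.trans (min_le_left _ _), fun x hx y hy => ?_⟩
  have := (hb ()).2 x hx.le y hy.le
  rw [sub_sub_sub_comm] at this
  refine this.trans ?_
  gcongr
  exact min_le_right _ _

end Soft

/-! ### The linear model: rotations and the standard form -/

section Model

variable {n κ : ℕ}

/-- The point of `ℝ²ⁿ` with given complex coordinates. -/
def ofZ (z : Fin n → ℂ) : R2n n :=
  WithLp.toLp 2 fun ik => if ik.2 = 0 then (z ik.1).re else (z ik.1).im

@[simp] theorem ofZ_zero (z : Fin n → ℂ) (j : Fin n) : ofZ z (j, 0) = (z j).re := by simp [ofZ]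

@[simp] theorem ofZ_one (z : Fin n → ℂ) (j : Fin n) : ofZ z (j, 1) = (z j).im := by simp [ofZ]

@[simp] theorem zc_ofZ (z : Fin n → ℂ) (j : Fin n) : zc (ofZ z) j = z j := by
  apply Complex.ext <;> simp [zc]

@[simp] theorem zc_re (x : R2n n) (j : Fin n) : (zc x j).re = x (j, 0) := rfl

@[simp] theorem zc_im (x : R2n n) (j : Fin n) : (zc x j).im = x (j, 1) := rfl

theorem ext_zc {x y : R2n n} (h : ∀ j, zc x j = zc y j) : x = y := by
  ext ⟨j, k⟩
  fin_cases k
  · exact congrArg Complex.re (h j)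
  · exact congrArg Complex.im (h j)

theorem zc_add (x y : R2n n) (j : Fin n) : zc (x + y) j = zc x j + zc y j := by
  apply Complex.ext <;> simp

theorem zc_smul (t : ℝ) (x : R2n n) (j : Fin n) : zc (t • x) j = t * zc x j := by
  apply Complex.ext <;> simp

theorem norm_sq_eq_sum_zc (x : R2n n) : ‖x‖ ^ 2 = ∑ j, Complex.normSq (zc x j) := by
  rw [EuclideanSpace.norm_sq_eq, Fintype.sum_prod_type]
  refine Finset.sum_congr rfl fun j _ => ?_
  simp [Complex.normSq_apply, Fin.sum_univ_two, sq]

/-- Multiplication of the complex coordinates by complex numbers. -/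
def mulC : (Fin n → ℂ) →L[ℝ] (R2n n →L[ℝ] R2n n) :=
  let A : (Fin n → ℂ) →ₗ[ℝ] (R2n n →L[ℝ] R2n n) :=
    { toFun := fun c => LinearMap.toContinuousLinearMap
        { toFun := fun x => ofZ fun j => c j * zc x j
          map_add' := fun x y => ext_zc fun j => by simp [zc_add, mul_add]
          map_smul' := fun t x => ext_zc fun j => by simp [zc_smul]; ring }
      map_add' := fun c c' => by
        ext1 x; exact ext_zc fun j => by simp [zc_add, add_mul]
      map_smul' := fun t c => by
        ext1 x; exact ext_zc fun j => by simp [zc_smul, mul_assoc] }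
  LinearMap.toContinuousLinearMap A

@[simp] theorem zc_mulC (c : Fin n → ℂ) (x : R2n n) (j : Fin n) : zc (mulC c x) j = c j * zc x j := by
  simp [mulC]

theorem mulC_mul (c c' : Fin n → ℂ) : mulC (c * c') = (mulC c).comp (mulC c') := by
  ext1 x; exact ext_zc fun j => by simp [mul_assoc]

theorem mulC_one : mulC (1 : Fin n → ℂ) = ContinuousLinearMap.id ℝ (R2n n) := by
  ext1 x; exact ext_zc fun j => by simp

/-- Rotation of the complex coordinates. -/
def rotC (c : Fin n → Circle) : R2n n →L[ℝ] R2n n := mulC fun j => (c j : ℂ)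

@[simp] theorem zc_rotC (c : Fin n → Circle) (x : R2n n) (j : Fin n) :
    zc (rotC c x) j = c j * zc x j := zc_mulC _ _ _

theorem rotC_mul_apply (c c' : Fin n → Circle) (x : R2n n) :
    rotC (c * c') x = rotC c (rotC c' x) :=
  ext_zc fun j => by simp [mul_assoc]

@[simp] theorem rotC_one_apply (x : R2n n) : rotC (1 : Fin n → Circle) x = x :=
  ext_zc fun j => by simp

@[simp] theorem rotC_inv_rotC (c : Fin n → Circle) (x : R2n n) : rotC c⁻¹ (rotC c x) = x := by
  rw [← rotC_mul_apply, inv_mul_cancel, rotC_one_apply]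

@[simp] theorem rotC_rotC_inv (c : Fin n → Circle) (x : R2n n) : rotC c (rotC c⁻¹ x) = x := by
  rw [← rotC_mul_apply, mul_inv_cancel, rotC_one_apply]

@[simp] theorem norm_rotC (c : Fin n → Circle) (x : R2n n) : ‖rotC c x‖ = ‖x‖ := by
  have : ‖rotC c x‖ ^ 2 = ‖x‖ ^ 2 := by
    rw [norm_sq_eq_sum_zc, norm_sq_eq_sum_zc]
    refine Finset.sum_congr rfl fun j _ => ?_
    simp
  exact (pow_left_inj₀ (norm_nonneg _) (norm_nonneg _) two_ne_zero).1 this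

/-- The standard symplectic form. -/
def stdBil : R2n n →L[ℝ] R2n n →L[ℝ] ℝ :=
  let A : R2n n →ₗ[ℝ] (R2n n →L[ℝ] ℝ) :=
    { toFun := fun u => ∑ j, (u (j, 0) • EuclideanSpace.proj (j, 1) -
        u (j, 1) • EuclideanSpace.proj (j, 0))
      map_add' := fun u v => by
        rw [← Finset.sum_add_distrib]
        refine Finset.sum_congr rfl fun j _ => ?_
        simp only [PiLp.add_apply, add_smul]; abel
      map_smul' := fun t u => by
        simp only [PiLp.smul_apply, smul_eq_mul, mul_smul, RingHom.id_apply, Finset.smul_sum, smul_sub] }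
  LinearMap.toContinuousLinearMap A

theorem stdBil_apply (u v : R2n n) :
    stdBil u v = ∑ j, (u (j, 0) * v (j, 1) - u (j, 1) * v (j, 0)) := by
  simp [stdBil, sum_apply]

theorem stdBil_eq_zc (u v : R2n n) :
    stdBil u v = ∑ j, (starRingEnd ℂ (zc u j) * zc v j).im := by
  rw [stdBil_apply]
  refine Finset.sum_congr rfl fun j _ => ?_
  simp [Complex.mul_im]; ring

theorem stdBil_swap (u v : R2n n) : stdBil u v = -stdBil v u := by
  rw [stdBil_apply, stdBil_apply, ← Finset.sum_neg_distrib]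
  refine Finset.sum_congr rfl fun j _ => ?_
  ring

theorem stdBil_rotC (c : Fin n → Circle) (u v : R2n n) :
    stdBil (rotC c u) (rotC c v) = stdBil u v := by
  rw [stdBil_eq_zc, stdBil_eq_zc]
  refine Finset.sum_congr rfl fun j _ => ?_
  have h : starRingEnd ℂ (c j : ℂ) * (c j : ℂ) = 1 := by
    rw [mul_comm, Complex.mul_conj]; simp
  rw [zc_rotC, zc_rotC, map_mul, mul_mul_mul_comm, h, one_mul]

theorem isInvertible_of_injective {E : Type*} [NormedAddCommGroup E] [NormedSpace ℝ E]
    [FiniteDimensional ℝ E] {f : E →L[ℝ] E →L[ℝ] ℝ} (hf : Function.Injective f) :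
    f.IsInvertible := by
  have hd : Module.finrank ℝ E = Module.finrank ℝ (E →L[ℝ] ℝ) := by
    rw [← (LinearMap.toContinuousLinearMap (𝕜 := ℝ) (E := E) (F' := ℝ)).finrank_eq]
    exact (Subspace.dual_finrank_eq (K := ℝ) (V := E)).symm
  exact ⟨(LinearMap.linearEquivOfInjective (f : E →ₗ[ℝ] E →L[ℝ] ℝ) hf hd).toContinuousLinearEquiv,
    rfl⟩

/-- Pairing `u` with `i u` gives the square of the norm of `u`, so the form has no kernel. -/
theorem stdBil_isInvertible : (stdBil : R2n n →L[ℝ] R2n n →L[ℝ] ℝ).IsInvertible := by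
  refine isInvertible_of_injective ((injective_iff_map_eq_zero _).2 fun u hu => ?_)
  have h := DFunLike.congr_fun hu (mulC (fun _ => Complex.I) u)
  rw [stdBil_eq_zc] at h
  have h2 : ∑ j, (starRingEnd ℂ (zc u j) * zc (mulC (fun _ => Complex.I) u) j).im = ‖u‖ ^ 2 := by
    rw [norm_sq_eq_sum_zc]
    refine Finset.sum_congr rfl fun j _ => ?_
    simp [Complex.mul_im, Complex.normSq_apply]
  rw [h2] at h
  simpa using h

/-- The weight of the torus element `g` in the `j`-th coordinate. -/
def torusWeight (p : Fin n → Fin κ → ℤ) (g : Torus κ) : Fin n → Circle :=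
  fun j => ∏ l, g l ^ p j l

theorem torusWeight_mul (p : Fin n → Fin κ → ℤ) (g h : Torus κ) :
    torusWeight p (g * h) = torusWeight p g * torusWeight p h := by
  ext1 j
  simp [torusWeight, mul_zpow, Finset.prod_mul_distrib]

/-- The exponential map of the torus. -/
def expT (τ : Fin κ → ℝ) : Torus κ := fun l => Circle.exp (τ l)

/-- The linear torus action with weights `p`, lifted to the Lie algebra. -/
def rotT (p : Fin n → Fin κ → ℤ) (τ : Fin κ → ℝ) : R2n n →L[ℝ] R2n n :=
  mulC fun j => Complex.exp (((∑ l, (p j l : ℝ) * τ l : ℝ) : ℂ) * Complex.I)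

/-- The infinitesimal generator of the `l`-th circle. -/
def gen (p : Fin n → Fin κ → ℤ) (l : Fin κ) : R2n n →L[ℝ] R2n n :=
  mulC fun j => (p j l : ℂ) * Complex.I

/-- The weights are integers, so the linear action of the Lie algebra descends to the torus. -/
theorem rotT_eq (p : Fin n → Fin κ → ℤ) (τ : Fin κ → ℝ) :
    rotT p τ = rotC (torusWeight p (expT τ)) := by
  rw [rotT, rotC]
  congr 1
  ext1 j
  have : torusWeight p (expT τ) j = Circle.exp (∑ l, (p j l : ℝ) * τ l) := by
    rw [torusWeight]
    have h : ∀ s : Finset (Fin κ), ∏ l ∈ s, expT τ l ^ p j l = Circle.exp (∑ l ∈ s, (p j l : ℝ) * τ l) := by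
      intro s
      classical
      induction s using Finset.induction_on with
      | empty => simp
      | insert l s hl ih =>
        rw [Finset.prod_insert hl, Finset.sum_insert hl, Circle.exp_add, ih, expT]
        congr 1
        rw [← zsmul_eq_mul, Circle.exp_zsmul]
    exact h _
  rw [this, Circle.coe_exp]

theorem norm_rotT (p : Fin n → Fin κ → ℤ) (τ : Fin κ → ℝ) (x : R2n n) : ‖rotT p τ x‖ = ‖x‖ := by
  rw [rotT_eq, norm_rotC]

theorem rotT_add (p : Fin n → Fin κ → ℤ) (τ σ : Fin κ → ℝ) (x : R2n n) :
    rotT p (τ + σ) x = rotT p τ (rotT p σ x) := by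
  refine ext_zc fun j => ?_
  simp only [rotT, zc_mulC, ← mul_assoc, ← Complex.exp_add]
  congr 2
  rw [← add_mul, ← Complex.ofReal_add, ← Finset.sum_add_distrib]
  simp [mul_add]

@[simp] theorem rotT_zero (p : Fin n → Fin κ → ℤ) (x : R2n n) : rotT p 0 x = x :=
  ext_zc fun j => by simp [rotT]

theorem rotT_rotT_neg (p : Fin n → Fin κ → ℤ) (τ : Fin κ → ℝ) (x : R2n n) :
    rotT p τ (rotT p (-τ) x) = x := by
  rw [← rotT_add, add_neg_cancel, rotT_zero]

theorem contDiff_rotT (p : Fin n → Fin κ → ℤ) {m : WithTop ℕ∞} : ContDiff ℝ m (rotT p) := by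
  refine (mulC (n := n)).contDiff.comp (contDiff_pi.2 fun j => ?_)
  refine ContDiff.cexp (ContDiff.mul ?_ contDiff_const)
  have h : ContDiff ℝ m fun τ : Fin κ → ℝ => ∑ l, (p j l : ℝ) * τ l :=
    ContDiff.sum fun l _ => contDiff_const.mul (contDiff_apply _ _ l)
  exact Complex.ofRealCLM.contDiff.comp h

theorem hasDerivAt_rotT_smul (p : Fin n → Fin κ → ℤ) (τ : Fin κ → ℝ) (t : ℝ) :
    HasDerivAt (fun t : ℝ => rotT p (t • τ))
      ((∑ l, τ l • gen p l).comp (rotT p (t • τ))) t := by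
  have h1 : HasDerivAt (fun t : ℝ => fun j : Fin n =>
      Complex.exp (((∑ l, (p j l : ℝ) * (t • τ) l : ℝ) : ℂ) * Complex.I))
      (fun j => Complex.exp (((∑ l, (p j l : ℝ) * (t • τ) l : ℝ) : ℂ) * Complex.I) *
        (((∑ l, (p j l : ℝ) * τ l : ℝ) : ℂ) * Complex.I)) t := by
    rw [hasDerivAt_pi]
    intro j
    refine HasDerivAt.cexp (HasDerivAt.mul_const ?_ _)
    have : HasDerivAt (fun t : ℝ => ∑ l, (p j l : ℝ) * (t • τ) l) (∑ l, (p j l : ℝ) * τ l) t := by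
      refine HasDerivAt.fun_sum fun l _ => ?_
      simpa using ((hasDerivAt_id t).mul_const (τ l)).const_mul (p j l : ℝ)
    exact this.ofReal_comp
  have h2 := (mulC (n := n)).hasFDerivAt.comp_hasDerivAt t h1
  refine h2.congr_deriv ?_
  ext1 x
  refine ext_zc fun j => ?_
  have e : ∑ l, τ l • gen p l = mulC fun j => ((∑ l, (p j l : ℝ) * τ l : ℝ) : ℂ) * Complex.I := by
    simp only [gen, ← map_smul, ← map_sum]
    congr 1
    ext1 j
    simp only [Finset.sum_apply, Pi.smul_apply, Complex.real_smul]
    push_cast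
    rw [Finset.sum_mul]
    refine Finset.sum_congr rfl fun l _ => by ring
  rw [e]
  simp only [ContinuousLinearMap.comp_apply, zc_mulC, rotT]
  ring

end Model

/-! ### Averaging over the torus -/

section Haar

variable {κ : ℕ}

instance : MeasurableSpace (Torus κ) := borel _

instance : BorelSpace (Torus κ) := ⟨rfl⟩

/-- The invariant probability measure of the torus. -/
def torusMeasure (κ : ℕ) : MeasureTheory.Measure (Torus κ) :=
  MeasureTheory.Measure.haarMeasure ⊤

instance : MeasureTheory.IsProbabilityMeasure (torusMeasure κ) :=
  ⟨MeasureTheory.Measure.haarMeasure_self⟩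

instance : (torusMeasure κ).IsMulLeftInvariant := by
  unfold torusMeasure; infer_instance

instance : (torusMeasure κ).IsMulRightInvariant := by
  constructor
  intro g
  have : (fun x : Torus κ => x * g) = fun x => g * x := by ext1 x; exact mul_comm _ _
  rw [this]
  exact MeasureTheory.map_mul_left_eq_self _ g

/-- The cube of angles. -/
abbrev AngleCube (κ : ℕ) : Type := Icc (fun _ : Fin κ => -Real.pi) (fun _ => Real.pi)

/-- The angles of an element of the torus. -/
def argT (g : Torus κ) : AngleCube κ :=
  ⟨fun l => Complex.arg (g l), fun _ => (Complex.neg_pi_lt_arg _).le, fun _ => Complex.arg_le_pi _⟩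

theorem expT_argT (g : Torus κ) : expT (argT g : Fin κ → ℝ) = g := by
  ext1 l
  exact Circle.exp_arg _

/-- The choice of angles jumps where an angle equals π. Measurability is all that averaging along
this section needs. -/
theorem measurable_argT : Measurable (argT (κ := κ)) := by
  refine Measurable.subtype_mk (measurable_pi_lambda _ fun l => ?_)
  exact Complex.measurable_arg.comp
    (continuous_subtype_val.comp (continuous_apply l)).measurable

variable {E : Type*} [NormedAddCommGroup E] [NormedSpace ℝ E] [FiniteDimensional ℝ E]

theorem integrable_path (u : C(UnitTime × AngleCube κ, E)) :
    MeasureTheory.Integrable (fun g => u (1, argT g)) (torusMeasure κ) := by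
  borelize E
  refine MeasureTheory.Integrable.of_bound (C := ‖u‖) ?_ (Filter.Eventually.of_forall fun g =>
    u.norm_coe_le_norm _)
  have : Continuous fun τ : AngleCube κ => u (1, τ) := by fun_prop
  exact (this.measurable.comp measurable_argT).aestronglyMeasurable

/-- The average over the torus of the time-one values of a family of paths. -/
def haarAvg : C(UnitTime × AngleCube κ, E) →L[ℝ] E :=
  let A : C(UnitTime × AngleCube κ, E) →ₗ[ℝ] E :=
    { toFun := fun u => ∫ g, u (1, argT g) ∂torusMeasure κ
      map_add' := fun u v => MeasureTheory.integral_add (integrable_path u) (integrable_path v)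
      map_smul' := fun c u => MeasureTheory.integral_smul _ _ }
  A.mkContinuous 1 (fun u => by
    have := MeasureTheory.norm_integral_le_of_norm_le_const (μ := torusMeasure κ)
      (f := fun g => u (1, argT g)) (C := ‖u‖) (Filter.Eventually.of_forall fun g =>
        u.norm_coe_le_norm _)
    rw [MeasureTheory.probReal_univ, mul_one] at this
    rwa [one_mul])

theorem haarAvg_apply (u : C(UnitTime × AngleCube κ, E)) :
    haarAvg u = ∫ g, u (1, argT g) ∂torusMeasure κ := rfl

theorem haarAvg_constPath (x : E) : haarAvg (constPath x : C(UnitTime × AngleCube κ, E)) = x := by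
  rw [haarAvg_apply]
  simp

end Haar

/-! ### Linearising the two actions by averaging -/

section Linearization

variable {n κ : ℕ} {Γ : Type*} [Fintype Γ]

/-- The values of the symplectic form, of the differentials of the momenta and of the maps of the
finite group at a point. -/
abbrev DataSpace (n κ : ℕ) (Γ : Type*) : Type _ :=
  (R2n n →L[ℝ] R2n n →L[ℝ] ℝ) × (Fin κ → R2n n →L[ℝ] ℝ) × (Γ → R2n n)

/-- The value of the `l`-th Hamiltonian vector field. -/
def hamVF (z : DataSpace n κ Γ) (l : Fin κ) : R2n n := -(z.1.inverse (z.2.1 l))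

/-- The data of the linear model. -/
def model (p : Fin n → Fin κ → ℤ) (a : Γ → Fin n → Circle) (x : R2n n) : DataSpace n κ Γ :=
  (stdBil, fun l => -stdBil (gen p l x), fun ψ => rotC (a ψ) x)

/-- The convention dJ = Ω(·, X) means Ω(X, ·) = -dJ. This explains the sign in `hamVF` and the sign
of the differentials in `model`, which cancel here. -/
theorem hamVF_model (p : Fin n → Fin κ → ℤ) (a : Γ → Fin n → Circle) (x : R2n n) (l : Fin κ) :
    hamVF (model p a x) l = gen p l x := by
  have h := stdBil_isInvertible (n := n)
  simp only [hamVF, model, map_neg, neg_neg]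
  exact DFunLike.congr_fun h.inverse_comp_self (gen p l x)

/-- The field whose flow is the nonlinear torus action in rotating coordinates. -/
def linField (p : Fin n → Fin κ → ℤ) (D : R2n n → DataSpace n κ Γ) (v : ℝ × (Fin κ → ℝ))
    (y : R2n n) : R2n n :=
  ∑ l, v.2 l • rotT p (-(v.1 • v.2))
    (hamVF (D (rotT p (v.1 • v.2) y)) l - gen p l (rotT p (v.1 • v.2) y))

/-- The time and the angles. -/
def angleArg (κ : ℕ) : C(UnitTime × AngleCube κ, ℝ × (Fin κ → ℝ)) :=
  ⟨fun q => (q.1, q.2), by fun_prop⟩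

/-- The torus action in rotating coordinates. -/
def torusFlow (p : Fin n → Fin κ → ℤ) (D : R2n n → DataSpace n κ Γ) (r : ℝ) (x : R2n n) :
    C(UnitTime × AngleCube κ, R2n n) :=
  flow (fun q y => linField p D (angleArg κ q) y) r x

/-- The map that linearizes the torus action. -/
def avgT (p : Fin n → Fin κ → ℤ) (D : R2n n → DataSpace n κ Γ) (r : ℝ) (x : R2n n) : R2n n :=
  haarAvg (torusFlow p D r x)

/-- The map that linearizes the action of the torus and of the finite group. -/
def linMap (p : Fin n → Fin κ → ℤ) (a : Γ → Fin n → Circle) (D : R2n n → DataSpace n κ Γ) (r : ℝ)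
    (x : R2n n) : R2n n :=
  (Fintype.card Γ : ℝ)⁻¹ • ∑ ψ, rotC (a ψ)⁻¹ (avgT p D r ((D x).2.2 ψ))

/-- Smallness conditions under which the linearizing map is defined on the ball of radius
`R - 3 * d`. -/
structure Linearizable (p : Fin n → Fin κ → ℤ) (a : Γ → Fin n → Circle)
    (D : R2n n → DataSpace n κ Γ) (R d : ℝ) : Prop where
  invertible : ∀ x, ‖x‖ ≤ R - d → (D x).1.IsInvertible
  small : FieldSmall (fun q y => linField p D (angleArg κ q) y) (R - d) d
  finite : ∀ ψ x, ‖x‖ < R - d → ‖(D x).2.2 ψ - rotC (a ψ) x‖ ≤ d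

theorem isOpen_setOf_isInvertible {E F : Type*} [NormedAddCommGroup E] [NormedSpace ℝ E]
    [CompleteSpace E] [NormedAddCommGroup F] [NormedSpace ℝ F] :
    IsOpen {f : E →L[ℝ] F | f.IsInvertible} := by
  have := ContinuousLinearEquiv.isOpen (𝕜 := ℝ) (E := E) (F := F)
  exact this

variable {P : Type*} [NormedAddCommGroup P] [NormedSpace ℝ P]
  {p : Fin n → Fin κ → ℤ} {a : Γ → Fin n → Circle} {D : P → R2n n → DataSpace n κ Γ}
  {B : Set P} {R d : ℝ} {m : WithTop ℕ∞}

/-- The set where the symplectic form of a family of data is nondegenerate. -/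
def nondegSet (D : P → R2n n → DataSpace n κ Γ) (B : Set P) (R : ℝ) : Set (P × R2n n) :=
  (B ×ˢ Metric.ball 0 R) ∩ (fun z => (D z.1 z.2).1) ⁻¹' {f | f.IsInvertible}

theorem isOpen_nondegSet (hB : IsOpen B)
    (hD : ContinuousOn (fun z : P × R2n n => D z.1 z.2) (B ×ˢ Metric.ball 0 R)) :
    IsOpen (nondegSet D B R) :=
  (continuous_fst.comp_continuousOn hD).isOpen_inter_preimage (hB.prod Metric.isOpen_ball)
    isOpen_setOf_isInvertible

theorem contDiffOn_hamVF
    (hD : ContDiffOn ℝ m (fun z : P × R2n n => D z.1 z.2) (B ×ˢ Metric.ball 0 R)) (l : Fin κ) :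
    ContDiffOn ℝ m (fun z : P × R2n n => hamVF (D z.1 z.2) l) (nondegSet D B R) := by
  have hD' := hD.mono (inter_subset_left : nondegSet D B R ⊆ _)
  refine ContDiffOn.neg (ContDiffOn.clm_apply ?_ ?_)
  · intro z hz
    exact ContDiffAt.comp_contDiffWithinAt z
      ((show (D z.1 z.2).1.IsInvertible from hz.2).contDiffAt_map_inverse)
      ((contDiff_fst.comp_contDiffOn hD') z hz)
  · exact (contDiff_apply ℝ (R2n n →L[ℝ] ℝ) l).comp_contDiffOn
      (contDiff_fst.comp_contDiffOn (contDiff_snd.comp_contDiffOn hD'))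

/-- The domain of the field of the torus action in rotating coordinates. -/
def linFieldSet (p : Fin n → Fin κ → ℤ) (D : P → R2n n → DataSpace n κ Γ) (B : Set P) (R : ℝ) :
    Set ((ℝ × (Fin κ → ℝ)) × P × R2n n) :=
  (fun z => (z.2.1, rotT p (z.1.1 • z.1.2) z.2.2)) ⁻¹' nondegSet D B R

theorem contDiff_rotated (p : Fin n → Fin κ → ℤ) :
    ContDiff ℝ m fun z : (ℝ × (Fin κ → ℝ)) × P × R2n n =>
      (z.2.1, rotT p (z.1.1 • z.1.2) z.2.2) := by
  refine ContDiff.prodMk (by fun_prop) (ContDiff.clm_apply ?_ (by fun_prop))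
  exact (contDiff_rotT p).comp (by fun_prop)

theorem isOpen_linFieldSet (hB : IsOpen B)
    (hD : ContinuousOn (fun z : P × R2n n => D z.1 z.2) (B ×ˢ Metric.ball 0 R)) :
    IsOpen (linFieldSet p D B R) :=
  (isOpen_nondegSet hB hD).preimage (contDiff_rotated (m := 0) p).continuous

theorem contDiffOn_linField
    (hD : ContDiffOn ℝ m (fun z : P × R2n n => D z.1 z.2) (B ×ˢ Metric.ball 0 R)) :
    ContDiffOn ℝ m (fun z : (ℝ × (Fin κ → ℝ)) × P × R2n n => linField p (D z.2.1) z.1 z.2.2)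
      (linFieldSet p D B R) := by
  refine ContDiffOn.sum fun l _ => ContDiffOn.fun_smul ?_ (ContDiffOn.clm_apply ?_ (ContDiffOn.sub ?_ ?_))
  · exact ((contDiff_apply ℝ ℝ l).comp (contDiff_snd.comp contDiff_fst)).contDiffOn
  · exact ((contDiff_rotT p).comp (by fun_prop)).contDiffOn
  · exact (contDiffOn_hamVF hD l).comp (contDiff_rotated p).contDiffOn fun _ h => h
  · exact ((gen p l).contDiff.comp (contDiff_snd.comp (contDiff_rotated p))).contDiffOn

/-- Rotations preserve the norm, so passing to rotating coordinates does not change the ball. -/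
theorem mem_linFieldSet {z : (ℝ × (Fin κ → ℝ)) × P × R2n n} (hb : z.2.1 ∈ B) (hy : ‖z.2.2‖ < R)
    (hi : (D z.2.1 (rotT p (z.1.1 • z.1.2) z.2.2)).1.IsInvertible) : z ∈ linFieldSet p D B R :=
  ⟨⟨hb, by simpa [norm_rotT] using hy⟩, hi⟩

theorem contDiffOn_torusFlow [CompleteSpace P] (hB : IsOpen B) (hd : 0 ≤ d) (hm : m ≠ 0)
    (hD : ContDiffOn ℝ m (fun z : P × R2n n => D z.1 z.2) (B ×ˢ Metric.ball 0 R))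
    (hL : ∀ b ∈ B, Linearizable p a (D b) R d) :
    ContDiffOn ℝ m (fun z : P × R2n n => torusFlow p (D z.1) (R - d) z.2)
      (B ×ˢ Metric.ball 0 (R - 2 * d)) := by
  rintro ⟨b, x⟩ ⟨hb, hx⟩
  have hx' : ‖x‖ < R - d - d := by
    have : ‖x‖ < R - 2 * d := by simpa using hx
    linarith
  refine ContDiffAt.contDiffWithinAt ?_
  refine contDiffAt_flow (G := fun z : (ℝ × (Fin κ → ℝ)) × P × R2n n => linField p (D z.2.1) z.1 z.2.2)
    (isOpen_linFieldSet hB hD.continuousOn) hm (contDiffOn_linField hD) (ι := angleArg κ) hB hd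
    (fun b hb => (hL b hb).small) (fun q b hb y hy => ?_) hb hx'
  have hy' : ‖y‖ < R - d := by simpa using hy
  exact mem_linFieldSet hb (by change ‖y‖ < R; linarith)
    ((hL b hb).invertible _ (by rw [norm_rotT]; exact hy'.le))

theorem Linearizable.norm_finite_lt {D : R2n n → DataSpace n κ Γ} (h : Linearizable p a D R d)
    {x : R2n n} {r : ℝ} (hr : r ≤ R - d) (hx : ‖x‖ < r) (ψ : Γ) : ‖(D x).2.2 ψ‖ < r + d := by
  have h1 := h.finite ψ x (hx.trans_le hr)
  calc ‖(D x).2.2 ψ‖ = ‖rotC (a ψ) x + ((D x).2.2 ψ - rotC (a ψ) x)‖ := by congr 1; abel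
    _ ≤ ‖rotC (a ψ) x‖ + ‖(D x).2.2 ψ - rotC (a ψ) x‖ := norm_add_le _ _
    _ < r + d := by rw [norm_rotC]; linarith

/-- Radii: Γ moves a point of the ball of radius `R - 3 * d` to norm less than `R - 2 * d`, which is
where the torus flow, of displacement at most `d`, is available. -/
theorem contDiffOn_linMap [CompleteSpace P] (hB : IsOpen B) (hd : 0 ≤ d) (hm : m ≠ 0)
    (hD : ContDiffOn ℝ m (fun z : P × R2n n => D z.1 z.2) (B ×ˢ Metric.ball 0 R))
    (hL : ∀ b ∈ B, Linearizable p a (D b) R d) :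
    ContDiffOn ℝ m (fun z : P × R2n n => linMap p a (D z.1) (R - d) z.2)
      (B ×ˢ Metric.ball 0 (R - 3 * d)) := by
  refine ContDiffOn.const_smul _ (ContDiffOn.sum fun ψ _ => ?_)
  refine (rotC (a ψ)⁻¹).contDiff.comp_contDiffOn ?_
  refine (haarAvg (κ := κ) (E := R2n n)).contDiff.comp_contDiffOn ?_
  have hsub : (B ×ˢ Metric.ball (0 : R2n n) (R - 3 * d)) ⊆ B ×ˢ Metric.ball 0 R :=
    prod_mono_right (Metric.ball_subset_ball (by linarith))
  refine (contDiffOn_torusFlow hB hd hm hD hL).comp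
    (f := fun z : P × R2n n => (z.1, (D z.1 z.2).2.2 ψ)) (contDiffOn_fst.prodMk ?_) ?_
  · exact (contDiff_apply ℝ (R2n n) ψ).comp_contDiffOn
      (contDiff_snd.comp_contDiffOn (contDiff_snd.comp_contDiffOn (hD.mono hsub)))
  · rintro ⟨b, x⟩ ⟨hb, hx⟩
    refine ⟨hb, ?_⟩
    have := (hL b hb).norm_finite_lt (r := R - 3 * d) (by linarith) (by simpa using hx) ψ
    rw [mem_ball_zero_iff]
    linarith

/-- For the model the Hamiltonian fields coincide with the linear generators, so the field in
rotating coordinates vanishes identically. Near the model it is therefore small together with its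
Lipschitz constant. -/
theorem eventually_linearizable (hB : IsOpen B) (h0 : (0 : P) ∈ B) (hd : 0 < d)
    (hD : ContDiffOn ℝ 1 (fun z : P × R2n n => D z.1 z.2) (B ×ˢ Metric.ball 0 R))
    (hmodel : ∀ x, ‖x‖ < R → D 0 x = model p a x) :
    ∀ᶠ b in 𝓝 (0 : P), Linearizable p a (D b) R d := by
  have hr : R - d < R := by linarith
  have h1 := eventually_fieldSmall (P := P)
    (G := fun z : (ℝ × (Fin κ → ℝ)) × P × R2n n => linField p (D z.2.1) z.1 z.2.2)
    (isOpen_linFieldSet hB hD.continuousOn) (contDiffOn_linField hD) (angleArg κ) hr hd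
    (fun q y hy => mem_linFieldSet h0 (lt_of_le_of_lt hy hr) (by
      rw [hmodel _ (by rw [norm_rotT]; exact lt_of_le_of_lt hy hr)]
      exact stdBil_isInvertible))
    (fun q y hy => by
      refine Finset.sum_eq_zero fun l _ => ?_
      simp only
      rw [hmodel _ (by rw [norm_rotT]; exact hy), hamVF_model, sub_self, map_zero, smul_zero])
  have h2 : ∀ ψ : Γ, ∀ᶠ b in 𝓝 (0 : P), ∀ x, ‖x‖ ≤ R - d →
      ‖(D b x).2.2 ψ - rotC (a ψ) x‖ ≤ d := by
    intro ψ
    have hf : ContDiffOn ℝ 1 (fun z : P × R2n n => (D z.1 z.2).2.2 ψ - rotC (a ψ) z.2)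
        (B ×ˢ Metric.ball 0 R) := by
      refine ContDiffOn.sub ?_ ((rotC (a ψ)).contDiff.comp contDiff_snd).contDiffOn
      exact (contDiff_apply ℝ (R2n n) ψ).comp_contDiffOn
        (contDiff_snd.comp_contDiffOn (contDiff_snd.comp_contDiffOn hD))
    have := eventually_small (P := P) (X := Unit) (A := P) (hB.prod Metric.isOpen_ball) hf
      (j := fun z => z.1) (by fun_prop) hr
      (fun _ y hy => ⟨h0, by simpa using lt_of_le_of_lt hy hr⟩)
      (fun _ y hy => by simp only; rw [hmodel y hy]; simp [model]) hd
    filter_upwards [this] with b hb x hx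
    exact ((hb ()).1 x hx).2
  filter_upwards [h1, Filter.eventually_all.2 h2] with b h1 h2
  refine ⟨fun x hx => ?_, h1.1, fun ψ x hx => h2 ψ x hx.le⟩
  -- Time 0 and zero angles, for which the rotation is the identity, turn membership in
  -- `linFieldSet` into invertibility at `x` itself.
  have := (h1.2 (0, ⟨0, fun _ => by simp [Real.pi_pos.le], fun _ => by simp [Real.pi_pos.le]⟩) x hx).2
  simpa [angleArg] using this

/-- In rotating coordinates the paths of the model are constant, so each average returns its
starting point. -/
theorem linMap_model {D : R2n n → DataSpace n κ Γ} [Nonempty Γ] (hd : 0 ≤ d)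
    (hL : Linearizable p a D R d)
    (hmodel : ∀ x, ‖x‖ < R → D x = model p a x) {x : R2n n} (hx : ‖x‖ < R - 3 * d) :
    linMap p a D (R - d) x = x := by
  have hflow : ∀ y : R2n n, ‖y‖ < R - 2 * d → avgT p D (R - d) y = y := by
    intro y hy
    have : constPath y = torusFlow p D (R - d) y := by
      refine IsFlow.eq_flow hL.small ⟨fun q => ?_, fun t τ => ?_⟩
      · simp only [constPath_apply, mem_closedBall_zero_iff]; linarith
      · have : ∀ s : ℝ, linField p D (angleArg κ (clampTime s, τ)) y = 0 := fun s => by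
          refine Finset.sum_eq_zero fun l _ => ?_
          rw [hmodel _ (by rw [norm_rotT]; linarith), hamVF_model, sub_self, map_zero, smul_zero]
        simp [this]
    rw [avgT, ← this, haarAvg_constPath]
  have hρ : ∀ ψ, (D x).2.2 ψ = rotC (a ψ) x := fun ψ => by
    rw [hmodel x (by linarith)]; rfl
  have : ∀ ψ, rotC (a ψ)⁻¹ (avgT p D (R - d) ((D x).2.2 ψ)) = x := fun ψ => by
    rw [hρ, hflow _ (by rw [norm_rotC]; linarith), rotC_inv_rotC]
  rw [linMap]
  simp [this, ← Nat.cast_smul_eq_nsmul ℝ, smul_smul]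

end Linearization

/-! ### Differentiation along flows -/

section Calculus

variable {E : Type*} [NormedAddCommGroup E] [NormedSpace ℝ E] [CompleteSpace E]

/-- Only interior times are covered: `clampTime` is constant beyond the end points, where a
two-sided derivative may fail to exist. -/
theorem hasDerivAt_of_eq_integral {h : UnitTime → E} (hh : Continuous h) {U : UnitTime → E} {x : E}
    (hU : ∀ t : UnitTime, U t = x + ∫ s in (0 : ℝ)..t, h (clampTime s)) {t : ℝ}
    (ht : t ∈ Ioo (0 : ℝ) 1) :
    HasDerivAt (fun s => U (clampTime s)) (h (clampTime t)) t := by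
  have hc : Continuous fun s => h (clampTime s) := hh.comp continuous_clampTime
  have h1 : HasDerivAt (fun t : ℝ => x + ∫ s in (0 : ℝ)..t, h (clampTime s)) (h (clampTime t)) t :=
    (intervalIntegral.integral_hasDerivAt_right (hc.intervalIntegrable _ _)
      (hc.stronglyMeasurableAtFilter _ _) hc.continuousAt).const_add x
  refine h1.congr_of_eventuallyEq ?_
  filter_upwards [isOpen_Ioo.mem_nhds ht] with s hs
  rw [hU, clampTime_of_mem ⟨hs.1.le, hs.2.le⟩]

theorem eq_of_hasDerivAt_zero {f : ℝ → ℝ} (hf : ContinuousOn f (Icc 0 1))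
    (hf' : ∀ t ∈ Ioo (0 : ℝ) 1, HasDerivAt f 0 t) : f 1 = f 0 := by
  obtain ⟨c, -, hc⟩ := exists_hasDerivAt_eq_slope f (fun _ => 0) one_pos hf hf'
  simp only [sub_zero, div_one] at hc
  linarith

theorem _root_.HasFDerivAt.partial_right {A E F : Type*} [NormedAddCommGroup A] [NormedSpace ℝ A]
    [NormedAddCommGroup E] [NormedSpace ℝ E] [NormedAddCommGroup F] [NormedSpace ℝ F] {f : A × E → F}
    {f' : A × E →L[ℝ] F} {a : A} {x : E} (hf : HasFDerivAt f f' (a, x)) :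
    HasFDerivAt (fun x => f (a, x)) (f'.comp (.inr ℝ A E)) x :=
  HasFDerivAt.comp x hf (hasFDerivAt_prodMk_right a x)

/-- Differentiation under the integral sign. -/
theorem fderiv_integral_param {A F : Type*} [NormedAddCommGroup A] [NormedSpace ℝ A]
    [CompleteSpace A] [NormedAddCommGroup F] [NormedSpace ℝ F] [CompleteSpace F] {H : ℝ × A → F}
    {O : Set (ℝ × A)} (hO : IsOpen O) (hH : ContDiffOn ℝ 1 H O) {S : Set A} (hSo : IsOpen S)
    (hS : ∀ a ∈ S, ∀ s ∈ Icc (0 : ℝ) 1, (s, a) ∈ O) {a : A} (ha : a ∈ S) (v : A) :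
    fderiv ℝ (fun a => ∫ s in (0 : ℝ)..1, H (s, a)) a v =
      ∫ s in (0 : ℝ)..1, fderiv ℝ H (s, a) (0, v) := by
  set L : A →L[ℝ] C(UnitTime × Unit, ℝ × A) := ((ContinuousLinearMap.inr ℝ ℝ A).compLeftContinuous ℝ
        (UnitTime × Unit)).comp (constPath (T := Unit) (E := A)) with hL
  set w : A → C(UnitTime × Unit, ℝ × A) := fun a => ⟨fun q => (q.1, a), by fun_prop⟩ with hw
  have hwd : HasFDerivAt w L a := by
    have : w = fun a => w 0 + L a := by
      ext a q <;> simp [hw, hL]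
    rw [this]
    exact L.hasFDerivAt.const_add _
  have hmem : ∀ a ∈ S, ∀ q, w a q ∈ O := fun a ha q => hS a ha _ q.1.2
  have hGd : ∀ z ∈ O, HasFDerivAt H (fderiv ℝ H z) z := fun z hz =>
    ((hH.contDiffAt (hO.mem_nhds hz)).differentiableAt one_ne_zero).hasFDerivAt
  have hG' : ContinuousOn (fderiv ℝ H) O := hH.continuousOn_fderiv_of_isOpen hO le_rfl
  have h1 := (hasFDerivAt_superpose hO hGd hG' (hmem a ha)).comp a hwd
  set I : C(UnitTime × Unit, F) →L[ℝ] F :=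
    (ContinuousMap.evalCLM ℝ (⟨1, by simp⟩, ()) : C(UnitTime × Unit, F) →L[ℝ] F).comp
    (timeIntegral (T := Unit) (E := F)) with hI
  have hIapp : ∀ f : C(UnitTime × Unit, F), I f = ∫ s in (0 : ℝ)..1, f (clampTime s, ()) :=
    fun f => rfl
  have h2 := I.hasFDerivAt.comp a h1
  have h3 : (fun a => ∫ s in (0 : ℝ)..1, H (s, a)) =ᶠ[𝓝 a] I ∘ (superpose H) ∘ w := by
    filter_upwards [hSo.mem_nhds ha] with a ha
    simp only [Function.comp_apply, hIapp]
    refine intervalIntegral.integral_congr fun s hs => ?_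
    rw [uIcc_of_le zero_le_one] at hs
    rw [superpose_apply hH.continuousOn (hmem a ha)]
    simp [hw, clampTime_of_mem hs]
  rw [(h2.congr_of_eventuallyEq h3).fderiv]
  simp only [ContinuousLinearMap.comp_apply, hIapp]
  refine intervalIntegral.integral_congr fun s hs => ?_
  rw [uIcc_of_le zero_le_one] at hs
  simp only [fieldLinear_apply, superpose_apply hG' (hmem a ha)]
  simp [hw, hL, clampTime_of_mem hs]

/-- The derivative of a time-dependent closed two-form along the flow of a time-dependent vector field
(Cartan's formula). -/
theorem hasDerivAt_form_along {Ω : ℝ × E → E →L[ℝ] E →L[ℝ] ℝ} {Ω' : ℝ × E →L[ℝ] E →L[ℝ] E →L[ℝ] ℝ}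
    {γ u v : ℝ → E} {Y : E → E} {Y' : E →L[ℝ] E} {α : E → E →L[ℝ] ℝ} {α' : E →L[ℝ] E →L[ℝ] ℝ} {t : ℝ}
    (hΩ : HasFDerivAt Ω Ω' (t, γ t)) (hγ : HasDerivAt γ (Y (γ t)) t)
    (hu : HasDerivAt u (Y' (u t)) t) (hv : HasDerivAt v (Y' (v t)) t)
    (hY : HasFDerivAt Y Y' (γ t)) (hα : HasFDerivAt α α' (γ t))
    (hYα : ∀ᶠ y in 𝓝 (γ t), Ω (t, y) (Y y) = -α y)
    (halt : ∀ᶠ y in 𝓝 (γ t), ∀ a b, Ω (t, y) a b = -Ω (t, y) b a)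
    (hcl : ∀ a b c, Ω' (0, a) b c + Ω' (0, b) c a + Ω' (0, c) a b = 0)
    (hdα : ∀ a b, α' a b - α' b a = Ω' (1, 0) a b) :
    HasDerivAt (fun t => Ω (t, γ t) (u t) (v t)) 0 t := by
  have h1 : HasDerivAt (fun t => Ω (t, γ t)) (Ω' (1, Y (γ t))) t := by
    have hp : HasDerivAt (fun t => (t, γ t)) (1, Y (γ t)) t := (hasDerivAt_id' t).prodMk hγ
    exact HasFDerivAt.comp_hasDerivAt (l := Ω) (l' := Ω') (f := fun t => (t, γ t)) t hΩ hp
  have h2 := (h1.clm_apply hu).clm_apply hv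
  have hx : HasFDerivAt (fun y => Ω (t, y)) (Ω'.comp (.inr ℝ ℝ E)) (γ t) := by
    exact HasFDerivAt.partial_right (f := Ω) (f' := Ω') hΩ
  -- Antisymmetry holds near the point, hence passes to the spatial derivative of the form.
  have halt' : ∀ a b c, Ω' (0, a) b c = -Ω' (0, a) c b := by
    intro a b c
    have e1 : HasFDerivAt (fun y => Ω (t, y) b c)
        (((Ω'.comp (.inr ℝ ℝ E)).flip b).flip c) (γ t) := by
      have := (hx.clm_apply (hasFDerivAt_const b (γ t))).clm_apply (hasFDerivAt_const c (γ t))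
      refine this.congr_fderiv ?_
      ext z; simp
    have e2 : HasFDerivAt (fun y => -Ω (t, y) c b)
        (-((Ω'.comp (.inr ℝ ℝ E)).flip c).flip b) (γ t) := by
      have := ((hx.clm_apply (hasFDerivAt_const c (γ t))).clm_apply (hasFDerivAt_const b (γ t))).neg
      refine this.congr_fderiv ?_
      ext z; simp
    have := e1.unique (e2.congr_of_eventuallyEq (halt.mono fun y hy => hy b c))
    simpa using DFunLike.congr_fun this a
  have hprod := hx.clm_apply hY
  -- This is the derivative of the relation ι_Y Ω = -α.
  have hD : ∀ a b, Ω' (0, a) (Y (γ t)) b + Ω (t, γ t) (Y' a) b = -α' a b := by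
    intro a b
    have := hprod.unique (hα.neg.congr_of_eventuallyEq hYα)
    have := DFunLike.congr_fun (DFunLike.congr_fun this a) b
    simp only [_root_.add_apply, ContinuousLinearMap.comp_apply, _root_.neg_apply,
      ContinuousLinearMap.flip_apply, ContinuousLinearMap.inr_apply] at this
    linarith
  refine h2.congr_deriv ?_
  -- What remains is Cartan's formula in coordinates: the derivative is ∂ₜΩ + d(ι_Y Ω) + ι_Y dΩ,
  -- where the first two terms are dα and -dα and the third vanishes by closedness.
  have hsplit : Ω' (1, Y (γ t)) = Ω' (1, 0) + Ω' (0, Y (γ t)) := by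
    rw [← map_add]; simp
  simp only [hsplit, _root_.add_apply]
  have k1 := hD (u t) (v t)
  have k2 := hD (v t) (u t)
  have k3 := hcl (Y (γ t)) (u t) (v t)
  have k4 := halt' (u t) (v t) (Y (γ t))
  have k5 := halt.self_of_nhds (u t) (Y' (v t))
  have k6 := hdα (u t) (v t)
  linarith

end Calculus

/-! ### Closed forms and pullbacks -/

section Forms

variable {E : Type*} [NormedAddCommGroup E] [NormedSpace ℝ E]

/-- A field of bilinear forms is closed at a point. -/
def IsClosedAt (w : E → E →L[ℝ] E →L[ℝ] ℝ) (y : E) : Prop :=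
  ∀ a b c, fderiv ℝ w y a b c + fderiv ℝ w y b c a + fderiv ℝ w y c a b = 0

/-- The pullback of a bilinear form under a linear map. -/
def pullB (β : E →L[ℝ] E →L[ℝ] ℝ) (L : E →L[ℝ] E) : E →L[ℝ] E →L[ℝ] ℝ :=
  ((ContinuousLinearMap.compL ℝ E E ℝ).flip L).comp (β.comp L)

@[simp] theorem pullB_apply (β : E →L[ℝ] E →L[ℝ] ℝ) (L : E →L[ℝ] E) (u v : E) :
    pullB β L u v = β (L u) (L v) := rfl

theorem ContDiffOn.pullB {A : Type*} [NormedAddCommGroup A] [NormedSpace ℝ A] {m : WithTop ℕ∞}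
    {β : A → E →L[ℝ] E →L[ℝ] ℝ} {L : A → E →L[ℝ] E} {S : Set A} (hβ : ContDiffOn ℝ m β S)
    (hL : ContDiffOn ℝ m L S) : ContDiffOn ℝ m (fun a => TorusNormalForm.pullB (β a) (L a)) S :=
  ContDiffOn.clm_comp ((ContinuousLinearMap.contDiff _).comp_contDiffOn hL) (hβ.clm_comp hL)

/-- The pullback of a closed form is closed. -/
theorem IsClosedAt.pullback {w : E → E →L[ℝ] E →L[ℝ] ℝ} {f : E → E} {y : E}
    (h : IsClosedAt w (f y)) (hw : DifferentiableAt ℝ w (f y)) (hf : ContDiffAt ℝ 2 f y)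
    (halt : ∀ a b, w (f y) a b = -w (f y) b a) :
    IsClosedAt (fun y => pullB (w (f y)) (fderiv ℝ f y)) y := by
  have hf1 : HasFDerivAt f (fderiv ℝ f y) y := (hf.differentiableAt two_ne_zero).hasFDerivAt
  have hf2 : HasFDerivAt (fderiv ℝ f) (fderiv ℝ (fderiv ℝ f) y) y :=
    ((hf.fderiv_right (m := 1) (by norm_num)).differentiableAt one_ne_zero).hasFDerivAt
  -- Terms with second derivatives of `f` cancel in the cyclic sum by this symmetry and antisymmetry
  -- of `w`; the rest is closedness at `f y`.
  have hsymm : ∀ a b, fderiv ℝ (fderiv ℝ f) y a b = fderiv ℝ (fderiv ℝ f) y b a := fun a b =>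
    (hf.isSymmSndFDerivAt (by simp)).eq a b
  have key : HasFDerivAt (fun y => pullB (w (f y)) (fderiv ℝ f y)) _ y :=
    HasFDerivAt.clm_comp
      (HasFDerivAt.comp y (ContinuousLinearMap.compL ℝ E E ℝ).flip.hasFDerivAt hf2)
      (HasFDerivAt.clm_comp (HasFDerivAt.comp y hw.hasFDerivAt hf1) hf2)
  have happ : ∀ a b c, fderiv ℝ (fun y => pullB (w (f y)) (fderiv ℝ f y)) y a b c =
      fderiv ℝ w (f y) (fderiv ℝ f y a) (fderiv ℝ f y b) (fderiv ℝ f y c) +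
      w (f y) (fderiv ℝ (fderiv ℝ f) y a b) (fderiv ℝ f y c) +
      w (f y) (fderiv ℝ f y b) (fderiv ℝ (fderiv ℝ f) y a c) := by
    intro a b c
    rw [key.fderiv]
    simp
    ring
  intro a b c
  rw [happ, happ, happ]
  have k := h (fderiv ℝ f y a) (fderiv ℝ f y b) (fderiv ℝ f y c)
  rw [hsymm b a, hsymm c a, hsymm c b, halt (fderiv ℝ f y b) , halt (fderiv ℝ f y c),
    halt (fderiv ℝ f y a)]
  linarith

end Forms

/-! ### Moser's method with the radial primitive -/

section Moser

variable {E : Type*} [NormedAddCommGroup E] [NormedSpace ℝ E] [CompleteSpace E] [ProperSpace E]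

/-- The segment between a form and the standard one. -/
def moserForm (σ : E →L[ℝ] E →L[ℝ] ℝ) (w : E → E →L[ℝ] E →L[ℝ] ℝ) (t : ℝ) (y : E) :
    E →L[ℝ] E →L[ℝ] ℝ := w y + t • (σ - w y)

/-- The primitive of the difference of the standard form and a given one. -/
def prim (σ : E →L[ℝ] E →L[ℝ] ℝ) (w : E → E →L[ℝ] E →L[ℝ] ℝ) (y : E) : E →L[ℝ] ℝ :=
  ∫ s in (0 : ℝ)..1, s • (σ - w (s • y)) y

/-- Moser's vector field. -/
def moserField (σ : E →L[ℝ] E →L[ℝ] ℝ) (w : E → E →L[ℝ] E →L[ℝ] ℝ) (t : ℝ) (y : E) : E :=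
  -((moserForm σ w t y).inverse (prim σ w y))

/-- The time variable. -/
def timePath : C(UnitTime × Unit, ℝ) := ⟨fun q => q.1, by fun_prop⟩

@[simp] theorem timePath_apply (q : UnitTime × Unit) : timePath q = q.1 := rfl

/-- The time-one map of Moser's vector field. -/
def moserMap (σ : E →L[ℝ] E →L[ℝ] ℝ) (w : E → E →L[ℝ] E →L[ℝ] ℝ) (r : ℝ) (y : E) : E :=
  flow (fun q y => moserField σ w (timePath q) y) r y (1, ())

/-- Smallness conditions under which Moser's map is defined on the ball of radius `r - d`. -/
structure Moserable (σ : E →L[ℝ] E →L[ℝ] ℝ) (w : E → E →L[ℝ] E →L[ℝ] ℝ) (r d : ℝ) : Prop where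
  invertible : ∀ t ∈ Icc (0 : ℝ) 1, ∀ y, ‖y‖ ≤ r → (moserForm σ w t y).IsInvertible
  small : FieldSmall (fun q y => moserField σ w (timePath q) y) r d

theorem norm_smul_lt {y : E} {s r : ℝ} (hs : s ∈ Icc (0 : ℝ) 1) (hy : ‖y‖ < r) :
    ‖s • y‖ < r := by
  rw [norm_smul, Real.norm_of_nonneg hs.1]
  exact (mul_le_of_le_one_left (norm_nonneg y) hs.2).trans_lt hy

variable {P : Type*} [NormedAddCommGroup P] [NormedSpace ℝ P]
  {σ : E →L[ℝ] E →L[ℝ] ℝ} {w : P → E → E →L[ℝ] E →L[ℝ] ℝ} {B : Set P} {r r₀ d : ℝ} {m : WithTop ℕ∞}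

/-- The domain of the integrand of the primitive. -/
def primSet (B : Set P) (r₀ : ℝ) : Set (ℝ × P × E) :=
  (fun z => (z.2.1, z.1 • z.2.2)) ⁻¹' (B ×ˢ Metric.ball 0 r₀)

theorem isOpen_primSet (hB : IsOpen B) : IsOpen (primSet (E := E) B r₀) :=
  (hB.prod Metric.isOpen_ball).preimage (by fun_prop)

theorem contDiffOn_primIntegrand
    (hw : ContDiffOn ℝ m (fun z : P × E => w z.1 z.2) (B ×ˢ Metric.ball 0 r₀)) :
    ContDiffOn ℝ m (fun z : ℝ × P × E => z.1 • (σ - w z.2.1 (z.1 • z.2.2)) z.2.2)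
      (primSet B r₀) := by
  refine ContDiffOn.fun_smul contDiffOn_fst (ContDiffOn.clm_apply (contDiffOn_const.sub ?_)
    (by fun_prop))
  exact hw.comp (f := fun z : ℝ × P × E => (z.2.1, z.1 • z.2.2)) (by fun_prop) fun _ h => h

theorem contDiffOn_prim [CompleteSpace P] (hB : IsOpen B)
    (hw : ContDiffOn ℝ m (fun z : P × E => w z.1 z.2) (B ×ˢ Metric.ball 0 r₀)) :
    ContDiffOn ℝ m (fun z : P × E => prim σ (w z.1) z.2) (B ×ˢ Metric.ball 0 r₀) :=
  contDiffOn_integral_param (A := P × E) (isOpen_primSet hB) (contDiffOn_primIntegrand hw)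
    (fun _ ha _ hs => ⟨ha.1, by simpa using norm_smul_lt hs (by simpa using ha.2)⟩)

/-- The domain of Moser's field. -/
def moserSet (σ : E →L[ℝ] E →L[ℝ] ℝ) (w : P → E → E →L[ℝ] E →L[ℝ] ℝ) (B : Set P) (r₀ : ℝ) :
    Set (ℝ × P × E) :=
  (univ ×ˢ (B ×ˢ Metric.ball 0 r₀)) ∩
    (fun z => moserForm σ (w z.2.1) z.1 z.2.2) ⁻¹' {f | f.IsInvertible}

theorem contDiffOn_moserForm
    (hw : ContDiffOn ℝ m (fun z : P × E => w z.1 z.2) (B ×ˢ Metric.ball 0 r₀)) :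
    ContDiffOn ℝ m (fun z : ℝ × P × E => moserForm σ (w z.2.1) z.1 z.2.2)
      (univ ×ˢ (B ×ˢ Metric.ball 0 r₀)) := by
  have h : ContDiffOn ℝ m (fun z : ℝ × P × E => w z.2.1 z.2.2)
      (univ ×ˢ (B ×ˢ Metric.ball 0 r₀)) :=
    hw.comp (f := fun z : ℝ × P × E => z.2) (by fun_prop) fun _ h => h.2
  exact h.add (ContDiffOn.fun_smul contDiffOn_fst (contDiffOn_const.sub h))

theorem isOpen_moserSet (hB : IsOpen B)
    (hw : ContinuousOn (fun z : P × E => w z.1 z.2) (B ×ˢ Metric.ball 0 r₀)) :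
    IsOpen (moserSet σ w B r₀) := by
  have : ContinuousOn (fun z : ℝ × P × E => moserForm σ (w z.2.1) z.1 z.2.2)
      (univ ×ˢ (B ×ˢ Metric.ball 0 r₀)) :=
    (contDiffOn_moserForm (m := 0) (contDiffOn_zero.2 hw)).continuousOn
  exact this.isOpen_inter_preimage (isOpen_univ.prod (hB.prod Metric.isOpen_ball))
    isOpen_setOf_isInvertible

theorem contDiffOn_moserField [CompleteSpace P] (hB : IsOpen B)
    (hw : ContDiffOn ℝ m (fun z : P × E => w z.1 z.2) (B ×ˢ Metric.ball 0 r₀)) :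
    ContDiffOn ℝ m (fun z : ℝ × P × E => moserField σ (w z.2.1) z.1 z.2.2) (moserSet σ w B r₀) := by
  refine ContDiffOn.neg (ContDiffOn.clm_apply ?_ ?_)
  · intro z hz
    exact ContDiffAt.comp_contDiffWithinAt z
      ((show (moserForm σ (w z.2.1) z.1 z.2.2).IsInvertible from hz.2).contDiffAt_map_inverse)
      (((contDiffOn_moserForm hw).mono inter_subset_left) z hz)
  · exact (contDiffOn_prim hB hw).comp (f := fun z : ℝ × P × E => z.2) (by fun_prop)
      fun _ h => h.1.2

theorem Moserable.mem_moserSet (hM : ∀ b ∈ B, Moserable σ (w b) r d) (hr : r < r₀)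
    (q : UnitTime × Unit) {b : P} (hb : b ∈ B) {y : E} (hy : y ∈ Metric.ball (0 : E) r) :
    (timePath q, b, y) ∈ moserSet σ w B r₀ := by
  have hy' : ‖y‖ < r := by simpa using hy
  exact ⟨⟨mem_univ _, hb, by simpa using hy'.trans hr⟩, (hM b hb).invertible _ q.1.2 y hy'.le⟩

theorem contDiffOn_moserMap [CompleteSpace P] (hB : IsOpen B) (hd : 0 ≤ d) (hm : m ≠ 0) (hr : r < r₀)
    (hw : ContDiffOn ℝ m (fun z : P × E => w z.1 z.2) (B ×ˢ Metric.ball 0 r₀))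
    (hM : ∀ b ∈ B, Moserable σ (w b) r d) :
    ContDiffOn ℝ m (fun z : P × E => moserMap σ (w z.1) r z.2) (B ×ˢ Metric.ball 0 (r - d)) := by
  rintro ⟨b, x⟩ ⟨hb, hx⟩
  refine ContDiffAt.contDiffWithinAt ?_
  have := contDiffAt_flow
    (G := fun z : ℝ × P × E => moserField σ (w z.2.1) z.1 z.2.2)
    (isOpen_moserSet hB hw.continuousOn) hm (contDiffOn_moserField hB hw) (ι := timePath) hB hd
    (fun b hb => (hM b hb).small) (fun q b hb y hy => Moserable.mem_moserSet hM hr q hb hy)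
    hb (x₀ := x) (by simpa using hx)
  exact ((ContinuousMap.evalCLM ℝ (1, ()) : C(UnitTime × Unit, E) →L[ℝ] E).contDiff
    (n := m)).contDiffAt.comp (b, x) this

theorem prim_eq_zero {w : E → E →L[ℝ] E →L[ℝ] ℝ}
    (hw : ∀ y, ‖y‖ < r₀ → w y = σ) {y : E} (hy : ‖y‖ < r₀) : prim σ w y = 0 := by
  rw [prim, intervalIntegral.integral_congr (g := fun _ => 0), intervalIntegral.integral_zero]
  intro s hs
  rw [uIcc_of_le zero_le_one] at hs
  simp only
  rw [hw _ (norm_smul_lt hs hy), sub_self, _root_.zero_apply, smul_zero]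

/-- Where the form is already standard the primitive vanishes and so does Moser's field; smallness
nearby follows by compactness. -/
theorem eventually_moserable [CompleteSpace P] (hB : IsOpen B) (h0 : (0 : P) ∈ B) (hd : 0 < d)
    (hr : r < r₀)
    (hσ : σ.IsInvertible)
    (hw : ContDiffOn ℝ 1 (fun z : P × E => w z.1 z.2) (B ×ˢ Metric.ball 0 r₀))
    (hstd : ∀ y, ‖y‖ < r₀ → w 0 y = σ) :
    ∀ᶠ b in 𝓝 (0 : P), Moserable σ (w b) r d := by
  have h1 := eventually_fieldSmall (P := P)
    (G := fun z : ℝ × P × E => moserField σ (w z.2.1) z.1 z.2.2)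
    (isOpen_moserSet hB hw.continuousOn) (contDiffOn_moserField hB hw) timePath hr hd
    (fun q y hy => by
      refine ⟨⟨mem_univ _, h0, by simpa using lt_of_le_of_lt hy hr⟩, ?_⟩
      change (moserForm σ (w 0) _ y).IsInvertible
      rw [moserForm, hstd y (lt_of_le_of_lt hy hr), sub_self, smul_zero, add_zero]
      exact hσ)
    (fun q y hy => by
      simp only
      rw [moserField, prim_eq_zero hstd hy, map_zero, neg_zero])
  filter_upwards [h1] with b h1
  exact ⟨fun t ht y hy => (h1.2 (⟨t, ht⟩, ()) y hy).2, h1.1⟩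

/-- A zero of the primitive is a rest point of Moser's field at all times. This serves the model,
where the primitive vanishes everywhere, and the origin, where the radial primitive vanishes for
every form. -/
theorem moserMap_of_field_eq_zero {w : E → E →L[ℝ] E →L[ℝ] ℝ} (hd : 0 ≤ d)
    (hM : Moserable σ w r d) {y : E} (hy : ‖y‖ < r - d) (h : prim σ w y = 0) : moserMap σ w r y = y := by
  have : constPath y = flow (fun q y => moserField σ w (timePath q) y) r y := by
    refine IsFlow.eq_flow hM.small ⟨fun q => ?_, fun t τ => ?_⟩
    · simp only [constPath_apply, mem_closedBall_zero_iff]; linarith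
    · simp [moserField, h]
  rw [moserMap, ← this, constPath_apply]

/-- The primitive is an integral over the segment from 0 to `y`, and a linear map carries segments
from the origin to such segments. -/
theorem prim_equivariant {w : E → E →L[ℝ] E →L[ℝ] ℝ} {A : E →L[ℝ] E} (hA : ∀ x, ‖A x‖ = ‖x‖)
    (hσA : ∀ u v, σ (A u) (A v) = σ u v)
    (hw : ContinuousOn w (Metric.ball 0 r₀))
    (hc : ∀ y, ‖y‖ < r₀ → ∀ u v, w (A y) (A u) (A v) = w y u v) {y : E}
    (hy : ‖y‖ < r₀) (v : E) : prim σ w (A y) (A v) = prim σ w y v := by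
  have hcont : ∀ y : E, ‖y‖ < r₀ → IntervalIntegrable
      (fun s : ℝ => s • (σ - w (s • y)) y) MeasureTheory.volume 0 1 := fun y hy => by
    refine ContinuousOn.intervalIntegrable ?_
    rw [uIcc_of_le zero_le_one]
    have : ContinuousOn (fun s : ℝ => w (s • y)) (Icc 0 1) :=
      hw.comp (by fun_prop) fun s hs => by simpa using norm_smul_lt hs hy
    exact continuousOn_id.smul ((continuousOn_const.sub this).clm_apply continuousOn_const)
  have hy' : ‖A y‖ < r₀ := by rwa [hA]
  rw [prim, prim, ContinuousLinearMap.intervalIntegral_apply (hcont _ hy'),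
    ContinuousLinearMap.intervalIntegral_apply (hcont _ hy)]
  refine intervalIntegral.integral_congr fun s hs => ?_
  rw [uIcc_of_le zero_le_one] at hs
  simp only [_root_.smul_apply, _root_.sub_apply, hσA, ← map_smul A]
  rw [hc _ (norm_smul_lt hs hy)]

/-- Both sides have the same pairing with every vector under the interpolating form at `A y`, which
is nondegenerate; surjectivity of `A` provides enough test vectors. -/
theorem moserField_equivariant {w : E → E →L[ℝ] E →L[ℝ] ℝ} {A : E →L[ℝ] E} (hA : ∀ x, ‖A x‖ = ‖x‖)
    (hAs : Function.Surjective A) (hσA : ∀ u v, σ (A u) (A v) = σ u v)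
    (hw : ContinuousOn w (Metric.ball 0 r₀))
    (hc : ∀ y, ‖y‖ < r₀ → ∀ u v, w (A y) (A u) (A v) = w y u v) {y : E}
    (hy : ‖y‖ < r₀) {t : ℝ} (hi : (moserForm σ w t y).IsInvertible)
    (hi' : (moserForm σ w t (A y)).IsInvertible) :
    moserField σ w t (A y) = A (moserField σ w t y) := by
  have key : moserForm σ w t (A y) (moserField σ w t (A y)) =
      moserForm σ w t (A y) (A (moserField σ w t y)) := by
    have e : ∀ z, (moserForm σ w t z).IsInvertible → moserForm σ w t z (moserField σ w t z) = -prim σ w z :=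
      fun z hz => by
        rw [moserField, map_neg]
        congr 1
        exact DFunLike.congr_fun hz.self_comp_inverse _
    rw [e _ hi']
    ext v
    obtain ⟨v, rfl⟩ : ∃ v', A v' = v := hAs v
    have h1 : moserForm σ w t (A y) (A (moserField σ w t y)) (A v) =
        moserForm σ w t y (moserField σ w t y) v := by
      simp only [moserForm, _root_.add_apply, _root_.smul_apply, _root_.sub_apply, hc y hy,
        hσA]
    rw [h1, e _ hi, _root_.neg_apply, _root_.neg_apply, prim_equivariant hA hσA hw hc hy]
  exact hi'.injective key

/-- The image under `A` of a flow path solves the integral equation with initial value `A y`;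
uniqueness of flows concludes. -/
theorem moserMap_equivariant {w : E → E →L[ℝ] E →L[ℝ] ℝ} {A : E →L[ℝ] E} (hA : ∀ x, ‖A x‖ = ‖x‖)
    (hAs : Function.Surjective A) (hσA : ∀ u v, σ (A u) (A v) = σ u v)
    (hd : 0 ≤ d)
    (hr : r < r₀) (hw : ContinuousOn w (Metric.ball 0 r₀)) (hM : Moserable σ w r d)
    (hc : ∀ y, ‖y‖ < r₀ → ∀ u v, w (A y) (A u) (A v) = w y u v) {y : E}
    (hy : ‖y‖ < r - d) : moserMap σ w r (A y) = A (moserMap σ w r y) := by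
  have hsol := hM.small.isFlow_flow hd hy.le
  set u := flow (fun q y => moserField σ w (timePath q) y) r y with hu
  have : (⟨fun q => A (u q), by fun_prop⟩ : C(UnitTime × Unit, E)) =
      flow (fun q y => moserField σ w (timePath q) y) r (A y) := by
    have hmem : ∀ q, ‖u q‖ ≤ r := fun q => by simpa using hsol.mem q
    refine IsFlow.eq_flow hM.small ⟨fun q => ?_, fun t τ => ?_⟩
    · simpa only [ContinuousMap.coe_mk, mem_closedBall_zero_iff, hA] using hmem q
    · have hcomm := hsol.eq t τ
      simp only [ContinuousMap.coe_mk]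
      conv_lhs => rw [hcomm]
      rw [map_add]
      congr 1
      rw [← ContinuousLinearMap.intervalIntegral_comp_comm]
      · refine intervalIntegral.integral_congr fun s _ => ?_
        simp only [timePath_apply]
        rw [moserField_equivariant hA hAs hσA hw hc ((hmem _).trans_lt hr)
          (hM.invertible _ (clampTime s).2 _ (hmem _))
          (hM.invertible _ (clampTime s).2 _ (by rw [hA]; exact hmem _))]
      · exact ((hM.small.continuous_comp hsol.mem).comp
          (continuous_clampTime.prodMk continuous_const)).intervalIntegrable _ _
  rw [moserMap, ← this]
  rfl

theorem fderiv_prim {w : E → E →L[ℝ] E →L[ℝ] ℝ}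
    (hw : ContDiffOn ℝ 1 w (Metric.ball 0 r₀)) {y : E} (hy : ‖y‖ < r₀) (a b : E) :
    fderiv ℝ (prim σ w) y a b = ∫ s in (0 : ℝ)..1,
      (s * ((σ - w (s • y)) a b) - s ^ 2 * fderiv ℝ w (s • y) a y b) := by
  have hd : ∀ s ∈ Icc (0 : ℝ) 1, DifferentiableAt ℝ w (s • y) := fun s hs =>
    (hw.contDiffAt (Metric.isOpen_ball.mem_nhds (by simpa using norm_smul_lt hs hy))).differentiableAt
      one_ne_zero
  set O : Set (ℝ × E) := (fun z => z.1 • z.2) ⁻¹' Metric.ball 0 r₀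
  set H : ℝ × E → (E →L[ℝ] ℝ) := fun z => z.1 • (σ - w (z.1 • z.2)) z.2 with hH
  have hO : IsOpen O := Metric.isOpen_ball.preimage (by fun_prop)
  have hHc : ContDiffOn ℝ 1 H O := by
    refine ContDiffOn.fun_smul contDiffOn_fst (ContDiffOn.clm_apply (contDiffOn_const.sub ?_)
      (by fun_prop))
    exact hw.comp (f := fun z : ℝ × E => z.1 • z.2) (by fun_prop) fun _ h => h
  have hmemO : ∀ a ∈ Metric.ball (0 : E) r₀, ∀ s ∈ Icc (0 : ℝ) 1, (s, a) ∈ O := fun a ha s hs => by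
    have := norm_smul_lt hs (mem_ball_zero_iff.1 ha)
    simpa [O] using this
  have hy' : y ∈ Metric.ball (0 : E) r₀ := by simpa using hy
  have h1 := fderiv_integral_param hO hHc Metric.isOpen_ball hmemO hy' a
  have h2 : fderiv ℝ (prim σ w) y a = ∫ s in (0 : ℝ)..1, fderiv ℝ H (s, y) (0, a) := h1
  have hInt : IntervalIntegrable (fun s : ℝ => fderiv ℝ H (s, y) (0, a)) MeasureTheory.volume 0 1 := by
    refine ContinuousOn.intervalIntegrable ?_
    rw [uIcc_of_le zero_le_one]
    refine ContinuousOn.clm_apply ?_ continuousOn_const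
    exact (hHc.continuousOn_fderiv_of_isOpen hO le_rfl).comp (by fun_prop) fun s hs => hmemO y hy' s hs
  rw [h2, ContinuousLinearMap.intervalIntegral_apply hInt]
  refine intervalIntegral.integral_congr fun s hs => ?_
  rw [uIcc_of_le zero_le_one] at hs
  have e1 : HasFDerivAt (fun y => H (s, y)) ((fderiv ℝ H (s, y)).comp (.inr ℝ ℝ (E))) y :=
    HasFDerivAt.partial_right (((hHc.contDiffAt (hO.mem_nhds (hmemO y hy' s hs))).differentiableAt
      one_ne_zero).hasFDerivAt)
  have hsm : HasFDerivAt (fun y : E => s • y) (s • ContinuousLinearMap.id ℝ (E)) y :=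
    (hasFDerivAt_id y).const_smul s
  have e2 := (((((hd s hs).hasFDerivAt.comp y hsm).const_sub σ).clm_apply
    (hasFDerivAt_id y)).const_smul s)
  have e3 := DFunLike.congr_fun (DFunLike.congr_fun (e1.unique
    (show HasFDerivAt (fun y => H (s, y)) _ y from e2)) a) b
  simp only [ContinuousLinearMap.comp_apply, ContinuousLinearMap.inr_apply] at e3
  rw [e3]
  simp
  ring

/-- The Poincaré lemma. -/
theorem prim_spec {w : E → E →L[ℝ] E →L[ℝ] ℝ}
    (hw : ContDiffOn ℝ 1 w (Metric.ball 0 r₀))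
    (hσs : ∀ a b, σ a b = -σ b a) (halt : ∀ y, ‖y‖ < r₀ → ∀ a b, w y a b = -w y b a)
    (hcl : ∀ y, ‖y‖ < r₀ → IsClosedAt w y) {y : E} (hy : ‖y‖ < r₀) (a b : E) :
    fderiv ℝ (prim σ w) y a b - fderiv ℝ (prim σ w) y b a = σ a b - w y a b := by
  have hmem : ∀ s ∈ Icc (0 : ℝ) 1, s • y ∈ Metric.ball (0 : E) r₀ := fun s hs => by
    simpa using norm_smul_lt hs hy
  have hd : ∀ s ∈ Icc (0 : ℝ) 1, DifferentiableAt ℝ w (s • y) := fun s hs =>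
    (hw.contDiffAt (Metric.isOpen_ball.mem_nhds (hmem s hs))).differentiableAt one_ne_zero
  have halt' : ∀ y, ‖y‖ < r₀ → ∀ a b c, fderiv ℝ w y a b c = -fderiv ℝ w y a c b := by
    intro y hy a b c
    have hdy : DifferentiableAt ℝ w y :=
      (hw.contDiffAt (Metric.isOpen_ball.mem_nhds (by simpa using hy))).differentiableAt one_ne_zero
    have e1 := (hdy.hasFDerivAt.clm_apply (hasFDerivAt_const b y)).clm_apply (hasFDerivAt_const c y)
    have e2 := ((hdy.hasFDerivAt.clm_apply (hasFDerivAt_const c y)).clm_apply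
      (hasFDerivAt_const b y)).neg
    have e3 := e1.unique (e2.congr_of_eventuallyEq (by
      filter_upwards [(isOpen_lt continuous_norm continuous_const).mem_nhds hy] with z hz
      exact halt z hz b c))
    simpa using DFunLike.congr_fun e3 a
  have hwc : ContinuousOn (fun s : ℝ => w (s • y)) (Icc 0 1) :=
    hw.continuousOn.comp (by fun_prop) hmem
  have hw'c : ContinuousOn (fun s : ℝ => fderiv ℝ w (s • y)) (Icc 0 1) :=
    (hw.continuousOn_fderiv_of_isOpen Metric.isOpen_ball le_rfl).comp (by fun_prop) hmem
  have hInt : ∀ a b : E, IntervalIntegrable (fun s : ℝ => s * ((σ - w (s • y)) a b) -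
      s ^ 2 * fderiv ℝ w (s • y) a y b) MeasureTheory.volume 0 1 := fun a b => by
    refine ContinuousOn.intervalIntegrable ?_
    rw [uIcc_of_le zero_le_one]
    exact (continuousOn_id.mul (((continuousOn_const.sub hwc).clm_apply continuousOn_const).clm_apply
      continuousOn_const)).sub ((continuousOn_id.pow 2).mul (((hw'c.clm_apply
        continuousOn_const).clm_apply continuousOn_const).clm_apply continuousOn_const))
  -- The integrand of dα(a, b) is a total derivative in s, thanks to closedness and antisymmetry;
  -- the boundary terms are `(σ - w y) a b` at s = 1 and 0 at s = 0.
  have hderiv : ∀ s ∈ uIcc (0 : ℝ) 1, HasDerivAt (fun s : ℝ => s ^ 2 * (σ - w (s • y)) a b)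
      ((s * ((σ - w (s • y)) a b) - s ^ 2 * fderiv ℝ w (s • y) a y b) -
        (s * ((σ - w (s • y)) b a) - s ^ 2 * fderiv ℝ w (s • y) b y a)) s := by
    intro s hs
    rw [uIcc_of_le zero_le_one] at hs
    have hsm : HasDerivAt (fun s : ℝ => s • y) y s := by
      simpa using (hasDerivAt_id s).smul_const y
    have e1 : HasDerivAt (fun s : ℝ => w (s • y)) (fderiv ℝ w (s • y) y) s :=
      HasFDerivAt.comp_hasDerivAt (l := w) (l' := fderiv ℝ w (s • y)) (f := fun s : ℝ => s • y) s
        (hd s hs).hasFDerivAt hsm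
    have e2 := (hasDerivAt_pow 2 s).mul (((e1.const_sub σ).clm_apply
      (hasDerivAt_const s a)).clm_apply (hasDerivAt_const s b))
    refine e2.congr_deriv ?_
    have k1 := hcl (s • y) (norm_smul_lt hs hy) y a b
    have k2 := halt' (s • y) (norm_smul_lt hs hy) a b y
    have k3 := halt (s • y) (norm_smul_lt hs hy) b a
    have k4 := hσs b a
    simp only [_root_.sub_apply, map_zero, _root_.neg_apply, _root_.add_apply, k3, k4]
    have k5 : fderiv ℝ w (s • y) y a b = fderiv ℝ w (s • y) a y b - fderiv ℝ w (s • y) b y a := by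
      linarith
    rw [k5]
    norm_num
    ring
  rw [fderiv_prim hw hy, fderiv_prim hw hy, ← intervalIntegral.integral_sub (hInt a b) (hInt b a),
    intervalIntegral.integral_eq_sub_of_hasDerivAt hderiv ((hInt a b).sub (hInt b a))]
  simp

/-- Along the flow the pullback of the interpolating form is constant: the field satisfies ι_Y ω_t =
-α, while dα = σ - w is the time derivative of ω_t. Comparing the times 0 and 1 gives the claim. -/
theorem moserMap_pullback {w : E → E →L[ℝ] E →L[ℝ] ℝ} (hd : 0 ≤ d) (hr : r < r₀)
    (hw : ContDiffOn ℝ 1 w (Metric.ball 0 r₀)) (hM : Moserable σ w r d)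
    (hσs : ∀ a b, σ a b = -σ b a) (halt : ∀ y, ‖y‖ < r₀ → ∀ a b, w y a b = -w y b a)
    (hcl : ∀ y, ‖y‖ < r₀ → IsClosedAt w y) {y : E} (hy : ‖y‖ < r - d) (a b : E) :
    σ (fderiv ℝ (moserMap σ w r) y a) (fderiv ℝ (moserMap σ w r) y b) = w y a b := by
  have hy0 : y ∈ Metric.ball (0 : E) (r - d) := by simpa using hy
  -- The middle real variable is a dummy parameter; the flow lemmas are stated for families.
  set G : ℝ × ℝ × E → E := fun z => moserField σ w z.1 z.2.2 with hG
  have hW : ContDiffOn ℝ 1 (fun z : ℝ × E => w z.2) (univ ×ˢ Metric.ball 0 r₀) :=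
    hw.comp contDiffOn_snd fun _ h => h.2
  have hO := isOpen_moserSet (σ := σ) (w := fun _ : ℝ => w) isOpen_univ hW.continuousOn
  set O := moserSet σ (fun _ : ℝ => w) univ r₀
  have hGc : ContDiffOn ℝ 1 G O := contDiffOn_moserField isOpen_univ hW
  have hBO : ∀ q, ∀ b ∈ (univ : Set ℝ), ∀ y ∈ Metric.ball (0 : E) r, (timePath q, b, y) ∈ O :=
    fun q b hb y hy => Moserable.mem_moserSet (w := fun _ : ℝ => w) (fun _ _ => hM) hr q hb hy
  have hsol := hM.small.isFlow_flow hd hy.le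
  have hvar := fun a t => fderiv_flow_apply hO hGc (ι := timePath) isOpen_univ hd
    (fun _ _ => hM.small) hBO (mem_univ (0 : ℝ)) hy a t ()
  have hflowd : HasFDerivAt (flow (fun q y => G (timePath q, 0, y)) r)
      (fderiv ℝ (flow (fun q y => G (timePath q, 0, y)) r) y) y := by
    have h1 := (contDiffAt_flow hO one_ne_zero hGc isOpen_univ hd (fun _ _ => hM.small) hBO
      (mem_univ (0 : ℝ)) hy).differentiableAt one_ne_zero
    have h2 : DifferentiableAt ℝ (fun x : E => ((0 : ℝ), x)) y := by fun_prop
    exact (h1.comp y h2).hasFDerivAt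
  set U := flow (fun q y => G (timePath q, 0, y)) r with hU
  change IsFlow (fun q y => G (timePath q, 0, y)) r y (U y) at hsol
  have hmem : ∀ q, U y q ∈ Metric.ball (0 : E) r := fun q => by
    have := hsol.norm_sub_le hM.small q
    rw [mem_ball_zero_iff]
    calc ‖U y q‖ = ‖y + (U y q - y)‖ := by congr 1; abel
      _ ≤ ‖y‖ + ‖U y q - y‖ := norm_add_le _ _
      _ < r := by linarith
  have hmapd : ∀ a, fderiv ℝ (moserMap σ w r) y a = fderiv ℝ U y a (1, ()) := by
    intro a
    have := (ContinuousMap.evalCLM ℝ (1, ()) : C(UnitTime × Unit, E) →L[ℝ] E).hasFDerivAt.comp y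
      hflowd
    have h2 : HasFDerivAt (moserMap σ w r) _ y := this
    rw [h2.fderiv]
    rfl
  have hGd : ∀ q : UnitTime × Unit, HasFDerivAt (fun y => moserField σ w (timePath q) y)
      ((fderiv ℝ G (timePath q, 0, U y q)).comp ((ContinuousLinearMap.inr ℝ ℝ (ℝ × E)).comp
        (ContinuousLinearMap.inr ℝ ℝ E))) (U y q) := fun q => by
    have h1 := ((hGc.contDiffAt (hO.mem_nhds (hBO q 0 (mem_univ _) _ (hmem q)))).differentiableAt
      one_ne_zero).hasFDerivAt
    exact HasFDerivAt.partial_right (f := fun z : ℝ × E => G (timePath q, z))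
      (HasFDerivAt.partial_right h1)
  have hcontG : Continuous fun q => fderiv ℝ G (timePath q, 0, U y q) :=
    (hGc.continuousOn_fderiv_of_isOpen hO le_rfl).comp_continuous (by fun_prop)
      fun q => hBO q 0 (mem_univ _) _ (hmem q)
  have hγ : ∀ t ∈ Ioo (0 : ℝ) 1, HasDerivAt (fun s => U y (clampTime s, ()))
      (moserField σ w t (U y (clampTime t, ()))) t := by
    intro t ht
    have := hasDerivAt_of_eq_integral (U := fun t => U y (t, ())) (x := y)
      (h := fun t => G (timePath (t, ()), 0, U y (t, ())))
      ((hM.small.continuous_comp hsol.mem).comp (by fun_prop)) (fun t => hsol.eq t ()) ht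
    refine this.congr_deriv ?_
    simp [hG, clampTime_of_mem ⟨ht.1.le, ht.2.le⟩]
  have hua : ∀ a, ∀ t ∈ Ioo (0 : ℝ) 1, HasDerivAt (fun s => fderiv ℝ U y a (clampTime s, ()))
      (fderiv ℝ (fun y => moserField σ w t y) (U y (clampTime t, ()))
        (fderiv ℝ U y a (clampTime t, ()))) t := by
    intro a t ht
    have := hasDerivAt_of_eq_integral (U := fun t => fderiv ℝ U y a (t, ())) (x := a)
      (h := fun t => fderiv ℝ (fun y => moserField σ w (timePath (t, ())) y) (U y (t, ()))
        (fderiv ℝ U y a (t, ()))) (by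
          have : (fun t => fderiv ℝ (fun y => moserField σ w (timePath (t, ())) y) (U y (t, ()))
              (fderiv ℝ U y a (t, ()))) = fun t => fderiv ℝ G (timePath (t, ()), 0, U y (t, ()))
              (0, 0, fderiv ℝ U y a (t, ())) := by
            ext1 t
            rw [(hGd (t, ())).fderiv]
            rfl
          rw [this]
          exact (hcontG.comp (by fun_prop : Continuous fun t : UnitTime => (t, ()))).clm_apply
            (by fun_prop)) (fun t => hvar a t) ht
    refine this.congr_deriv ?_
    simp [clampTime_of_mem ⟨ht.1.le, ht.2.le⟩]
  have hprimd : ∀ z, ‖z‖ < r₀ → DifferentiableAt ℝ (prim σ w) z := fun z hz => by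
    have h1 : ContDiffOn ℝ 1 (fun z : ℝ × E => prim σ w z.2) (univ ×ˢ Metric.ball 0 r₀) :=
      contDiffOn_prim (w := fun _ : ℝ => w) isOpen_univ hW
    have h2 := (h1.contDiffAt ((isOpen_univ.prod Metric.isOpen_ball).mem_nhds
      (show ((0 : ℝ), z) ∈ _ from ⟨mem_univ _, by simpa using hz⟩))).differentiableAt one_ne_zero
    exact (HasFDerivAt.partial_right h2.hasFDerivAt).differentiableAt
  have hformd : ∀ t z, ‖z‖ < r₀ → HasFDerivAt (fun z : ℝ × E => moserForm σ w z.1 z.2)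
      ((fderiv ℝ w z).comp (.snd ℝ ℝ E) + (t • (-(fderiv ℝ w z).comp (.snd ℝ ℝ E)) +
        (ContinuousLinearMap.fst ℝ ℝ E).smulRight (σ - w z))) (t, z) := by
    intro t z hz
    have h1 : HasFDerivAt w (fderiv ℝ w z) z := ((hw.contDiffAt (Metric.isOpen_ball.mem_nhds
      (by simpa using hz))).differentiableAt one_ne_zero).hasFDerivAt
    have h2 : HasFDerivAt (fun z : ℝ × E => w z.2) ((fderiv ℝ w z).comp (.snd ℝ ℝ E)) (t, z) :=
      HasFDerivAt.comp (g := w) (g' := fderiv ℝ w z) (t, z) h1 hasFDerivAt_snd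
    exact h2.add (HasFDerivAt.fun_smul hasFDerivAt_fst (h2.const_sub σ))
  have hconst := eq_of_hasDerivAt_zero (f := fun t => moserForm σ w t (U y (clampTime t, ()))
    (fderiv ℝ U y a (clampTime t, ())) (fderiv ℝ U y b (clampTime t, ()))) (by
      have hwc : Continuous fun t : ℝ => w (U y (clampTime t, ())) :=
        hw.continuousOn.comp_continuous ((U y).continuous.comp
          (continuous_clampTime.prodMk continuous_const)) fun t => by
            have := hmem (clampTime t, ())
            simp only [mem_ball_zero_iff] at this ⊢
            exact this.trans hr
      have hcl := continuous_clampTime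
      have hV : ∀ a, Continuous fun t : ℝ => fderiv ℝ U y a (clampTime t, ()) := fun a =>
        (fderiv ℝ U y a).continuous.comp (continuous_clampTime.prodMk continuous_const)
      refine Continuous.continuousOn (((hwc.add (continuous_id.smul
        (continuous_const.sub hwc))).clm_apply (hV a)).clm_apply (hV b))) (fun t ht => by
      have hz : ‖U y (clampTime t, ())‖ < r := by simpa using hmem (clampTime t, ())
      have hnear : ∀ᶠ z in 𝓝 (U y (clampTime t, ())), ‖z‖ < r :=
        (isOpen_lt continuous_norm continuous_const).mem_nhds hz
      have htI : t ∈ Icc (0 : ℝ) 1 := ⟨ht.1.le, ht.2.le⟩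
      have hYd : DifferentiableAt ℝ (fun y => moserField σ w t y) (U y (clampTime t, ())) := by
        have := (hGd (clampTime t, ())).differentiableAt
        simpa [clampTime_of_mem htI] using this
      refine hasDerivAt_form_along (hformd t _ (hz.trans hr)) (hγ t ht) (hua a t ht) (hua b t ht)
        hYd.hasFDerivAt (hprimd _ (hz.trans hr)).hasFDerivAt ?_ ?_ ?_ ?_
      · filter_upwards [hnear] with z hz
        simp only [moserField, map_neg]
        congr 1
        exact DFunLike.congr_fun (hM.invertible t htI z hz.le).self_comp_inverse _
      · filter_upwards [hnear] with z hz a b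
        simp only [moserForm, _root_.add_apply, _root_.smul_apply, _root_.sub_apply,
          halt z (hz.trans hr) a b, hσs a b]
        simp only [smul_eq_mul]
        ring
      · intro a b c
        have := hcl _ (hz.trans hr) a b c
        simp [-neg_smul]
        linear_combination (1 - t) * this
      · intro a b
        rw [prim_spec hw hσs halt hcl (hz.trans hr)]
        simp)
  have h1 : (clampTime 1) = 1 := clampTime_of_mem (by simp)
  have h0 : (clampTime 0) = 0 := clampTime_of_mem (by simp)
  -- The flow and its derivative start as the identity, so time 0 contributes `w y a b`.
  have hU0 : U y (0, ()) = y := by rw [hsol.eq 0 ()]; simp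
  have hV0 : ∀ a, fderiv ℝ U y a (0, ()) = a := fun a => by rw [hvar a 0]; simp
  simp only [h1, h0, hU0, hV0, moserForm, one_smul, zero_smul, add_zero, add_sub_cancel] at hconst
  rw [hmapd, hmapd]
  exact hconst

end Moser

/-! ### The normalising map and its domain -/

section Normalization

variable {n κ : ℕ} {Γ : Type*} [Fintype Γ]

/-- The symplectic form in the coordinates in which the action is linear. -/
def linForm (p : Fin n → Fin κ → ℤ) (a : Γ → Fin n → Circle) (D : R2n n → DataSpace n κ Γ) (R d : ℝ)
    (y : R2n n) : R2n n →L[ℝ] R2n n →L[ℝ] ℝ :=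
  pullB (D (invBall (linMap p a D (R - d)) (R - 4 * d) y)).1
    (fderiv ℝ (invBall (linMap p a D (R - d)) (R - 4 * d)) y)

/-- The map to coordinates in which the action is linear and the symplectic form is constant. -/
def normMap (p : Fin n → Fin κ → ℤ) (a : Γ → Fin n → Circle) (D : R2n n → DataSpace n κ Γ) (R d : ℝ)
    (x : R2n n) : R2n n :=
  moserMap stdBil (linForm p a D R d) (R - 7 * d) (linMap p a D (R - d) x)

/-- Smallness conditions under which the normalizing map is a diffeomorphism onto its image on the
ball of radius `R - 10 * d`. -/
structure Normalizable (p : Fin n → Fin κ → ℤ) (a : Γ → Fin n → Circle)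
    (D : R2n n → DataSpace n κ Γ) (R d : ℝ) : Prop where
  lin : Linearizable p a D R d
  nearLin : NearId (linMap p a D (R - d)) (R - 4 * d) d
  moser : Moserable stdBil (linForm p a D R d) (R - 7 * d) d
  near : NearId (normMap p a D R d) (R - 10 * d) d

variable {P : Type*} [NormedAddCommGroup P] [NormedSpace ℝ P] [CompleteSpace P]
  {p : Fin n → Fin κ → ℤ} {a : Γ → Fin n → Circle} {D : P → R2n n → DataSpace n κ Γ}
  {B : Set P} {R d : ℝ} {m m' : WithTop ℕ∞}

/-- Inverting a map that is `d`-close to the identity on the ball of radius `R - 4 * d` costs `2 *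
d` of the radius. -/
theorem contDiffOn_invBall_linMap (hB : IsOpen B) (hd : 0 ≤ d) (hm : m ≠ 0)
    (hD : ContDiffOn ℝ m (fun z : P × R2n n => D z.1 z.2) (B ×ˢ Metric.ball 0 R))
    (hL : ∀ b ∈ B, Linearizable p a (D b) R d)
    (hN : ∀ b ∈ B, NearId (linMap p a (D b) (R - d)) (R - 4 * d) d) :
    ContDiffOn ℝ m (fun z : P × R2n n => invBall (linMap p a (D z.1) (R - d)) (R - 4 * d) z.2)
      (B ×ˢ Metric.ball 0 (R - 6 * d)) := by
  rintro ⟨b, y⟩ ⟨hb, hy⟩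
  have hy' : ‖y‖ < R - 4 * d - 2 * d := by
    have : ‖y‖ < R - 6 * d := by simpa using hy
    linarith
  refine (contDiffAt_invBall hB hN hd hm hb hy' ?_).contDiffWithinAt
  have h := ((hN b hb).invBall_spec hd hy').1
  exact (contDiffOn_linMap hB hd hm hD hL).contDiffAt ((hB.prod Metric.isOpen_ball).mem_nhds
    ⟨hb, by rw [mem_ball_zero_iff]; linarith⟩)

theorem NearId.norm_lt {E : Type*} [NormedAddCommGroup E] [NormedSpace ℝ E] [CompleteSpace E]
    {f : E → E} {r r' d : ℝ} (h : NearId f r d) (hr : r' ≤ r) {x : E} (hx : ‖x‖ < r') :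
    ‖f x‖ < r' + d := by
  have := h.norm_sub_le x (hx.trans_le hr)
  calc ‖f x‖ = ‖x + (f x - x)‖ := by congr 1; abel
    _ ≤ ‖x‖ + ‖f x - x‖ := norm_add_le _ _
    _ < r' + d := by linarith

theorem NearId.norm_invBall_lt {E : Type*} [NormedAddCommGroup E] [NormedSpace ℝ E] [CompleteSpace E]
    {f : E → E} {r r' d : ℝ} (h : NearId f r d) (hd : 0 ≤ d) (hr : r' ≤ r - 2 * d) {y : E}
    (hy : ‖y‖ < r') : ‖invBall f r y‖ < r' + d := by
  have := h.norm_invBall_sub_le hd (hy.trans_le hr)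
  calc ‖invBall f r y‖ = ‖y + (invBall f r y - y)‖ := by congr 1; abel
    _ ≤ ‖y‖ + ‖invBall f r y - y‖ := norm_add_le _ _
    _ < r' + d := by linarith

/-- The derivative of the inverse enters the pullback, whence the loss of one order `m' + 1 ≤ m`. In
the smooth and analytic classes nothing is lost; in the quantitative estimates this order is
counted. -/
theorem contDiffOn_linForm (hB : IsOpen B) (hd : 0 ≤ d) (hm : m' + 1 ≤ m)
    (hD : ContDiffOn ℝ m (fun z : P × R2n n => D z.1 z.2) (B ×ˢ Metric.ball 0 R))
    (hL : ∀ b ∈ B, Linearizable p a (D b) R d)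
    (hN : ∀ b ∈ B, NearId (linMap p a (D b) (R - d)) (R - 4 * d) d) :
    ContDiffOn ℝ m' (fun z : P × R2n n => linForm p a (D z.1) R d z.2)
      (B ×ˢ Metric.ball 0 (R - 6 * d)) := by
  have hm0 : m ≠ 0 := by
    rintro rfl
    simp at hm
  have hm' : m' ≤ m := le_self_add.trans hm
  have hO : IsOpen (B ×ˢ Metric.ball (0 : R2n n) (R - 6 * d)) := hB.prod Metric.isOpen_ball
  have hinv := contDiffOn_invBall_linMap hB hd hm0 hD hL hN
  refine ContDiffOn.pullB ?_ ?_
  · refine contDiff_fst.comp_contDiffOn ?_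
    refine (hD.of_le hm').comp (f := fun z : P × R2n n =>
      (z.1, invBall (linMap p a (D z.1) (R - d)) (R - 4 * d) z.2))
      (contDiffOn_fst.prodMk (hinv.of_le hm')) ?_
    rintro ⟨b, y⟩ ⟨hb, hy⟩
    refine ⟨hb, ?_⟩
    have := (hN b hb).norm_invBall_lt hd (r' := R - 6 * d) (by linarith) (by simpa using hy)
    rw [mem_ball_zero_iff]
    linarith
  · have h1 : ContDiffOn ℝ m' (fun z : P × R2n n => (fderiv ℝ (fun z : P × R2n n =>
        invBall (linMap p a (D z.1) (R - d)) (R - 4 * d) z.2) z).comp (.inr ℝ P (R2n n)))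
        (B ×ˢ Metric.ball 0 (R - 6 * d)) :=
      (hinv.fderiv_of_isOpen hO hm).clm_comp contDiffOn_const
    refine h1.congr fun z hz => ?_
    have := (hinv.contDiffAt (hO.mem_nhds hz)).differentiableAt hm0
    exact (HasFDerivAt.partial_right (a := z.1) (x := z.2) this.hasFDerivAt).fderiv

theorem contDiffOn_normMap (hB : IsOpen B) (hd : 0 < d) (hm : m' + 1 ≤ m) (hm0 : m' ≠ 0)
    (hD : ContDiffOn ℝ m (fun z : P × R2n n => D z.1 z.2) (B ×ˢ Metric.ball 0 R))
    (hL : ∀ b ∈ B, Linearizable p a (D b) R d)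
    (hN : ∀ b ∈ B, NearId (linMap p a (D b) (R - d)) (R - 4 * d) d)
    (hM : ∀ b ∈ B, Moserable stdBil (linForm p a (D b) R d) (R - 7 * d) d) :
    ContDiffOn ℝ m' (fun z : P × R2n n => normMap p a (D z.1) R d z.2)
      (B ×ˢ Metric.ball 0 (R - 9 * d)) := by
  have hm' : m' ≤ m := le_self_add.trans hm
  refine (contDiffOn_moserMap hB hd.le hm0 (by linarith) (contDiffOn_linForm hB hd.le hm hD hL hN)
    hM).comp (f := fun z : P × R2n n => (z.1, linMap p a (D z.1) (R - d) z.2))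
    (contDiffOn_fst.prodMk ?_) ?_
  · exact (contDiffOn_linMap hB hd.le hm0 (hD.of_le hm') hL).mono
      (prod_mono_right (Metric.ball_subset_ball (by linarith)))
  · rintro ⟨b, x⟩ ⟨hb, hx⟩
    refine ⟨hb, ?_⟩
    have := (hN b hb).norm_lt (r' := R - 9 * d) (by linarith) (by simpa using hx)
    rw [mem_ball_zero_iff]
    linarith

section Model

variable {D : R2n n → DataSpace n κ Γ} [Nonempty Γ]

theorem linForm_model (hd : 0 < d) (hL : Linearizable p a D R d)
    (hN : NearId (linMap p a D (R - d)) (R - 4 * d) d)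
    (hmodel : ∀ x, ‖x‖ < R → D x = model p a x) {y : R2n n} (hy : ‖y‖ < R - 6 * d) :
    linForm p a D R d y = stdBil := by
  have hinv : ∀ y, ‖y‖ < R - 4 * d → invBall (linMap p a D (R - d)) (R - 4 * d) y = y := by
    intro y hy
    have := hN.invBall_apply hy
    rwa [linMap_model hd.le hL hmodel (by linarith)] at this
  have hder : fderiv ℝ (invBall (linMap p a D (R - d)) (R - 4 * d)) y =
      ContinuousLinearMap.id ℝ (R2n n) := by
    refine ((hasFDerivAt_id y).congr_of_eventuallyEq ?_).fderiv
    have hy' : ‖y‖ < R - 4 * d := by linarith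
    filter_upwards [(isOpen_lt continuous_norm continuous_const).mem_nhds hy'] with z hz
    exact hinv z hz
  rw [linForm, hder, hinv y (by linarith), hmodel y (by linarith)]
  rfl

theorem normMap_model (hd : 0 < d) (hL : Linearizable p a D R d)
    (hN : NearId (linMap p a D (R - d)) (R - 4 * d) d)
    (hM : Moserable stdBil (linForm p a D R d) (R - 7 * d) d)
    (hmodel : ∀ x, ‖x‖ < R → D x = model p a x) {x : R2n n} (hx : ‖x‖ < R - 9 * d) :
    normMap p a D R d x = x := by
  rw [normMap, linMap_model hd.le hL hmodel (by linarith)]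
  refine moserMap_of_field_eq_zero hd.le hM (by linarith) ?_
  exact prim_eq_zero (r₀ := R - 6 * d) (fun y hy => linForm_model hd hL hN hmodel hy) (by linarith)

end Model

theorem exists_open_of_eventually {Q : P → Prop} (hB : IsOpen B) (h0 : (0 : P) ∈ B)
    (h : ∀ᶠ b in 𝓝 (0 : P), Q b) :
    ∃ B' ⊆ B, IsOpen B' ∧ (0 : P) ∈ B' ∧ ∀ b ∈ B', Q b := by
  obtain ⟨S, hS, hSo, hS0⟩ := eventually_nhds_iff.1 h
  exact ⟨B ∩ S, inter_subset_left, hB.inter hSo, ⟨h0, hS0⟩, fun b hb => hS b hb.2⟩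

/-- The four conditions are secured one after another on shrinking neighbourhoods of 0, since each
concerns a map whose regularity rests on the earlier ones. At the parameter 0 every map involved is
the identity and every form standard. C^2 data suffice: pulling back the form costs one derivative,
and the smallness of Moser's field requires a C^1 form. -/
theorem eventually_normalizable [Nonempty Γ] (hB : IsOpen B) (h0 : (0 : P) ∈ B) (hd : 0 < d)
    (hD : ContDiffOn ℝ 2 (fun z : P × R2n n => D z.1 z.2) (B ×ˢ Metric.ball 0 R))
    (hmodel : ∀ x, ‖x‖ < R → D 0 x = model p a x) :
    ∀ᶠ b in 𝓝 (0 : P), Normalizable p a (D b) R d := by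
  have hball : ∀ {r : ℝ} (B : Set P), 0 ∈ B → ∀ {r' : ℝ}, r' < r → ∀ y : R2n n, ‖y‖ ≤ r' →
      ((0 : P), y) ∈ B ×ˢ Metric.ball (0 : R2n n) r := fun B h0 r' hr y hy =>
    ⟨h0, by rw [mem_ball_zero_iff]; linarith⟩
  have e1 := eventually_linearizable (p := p) (a := a) hB h0 hd (hD.of_le (by norm_num)) hmodel
  obtain ⟨B₁, hBB, hB₁, h01, hL⟩ := exists_open_of_eventually hB h0 e1
  have hD₁ := hD.mono (prod_mono_left hBB : B₁ ×ˢ Metric.ball (0 : R2n n) R ⊆ _)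
  have e2 := eventually_nearId (P := P) (hB₁.prod Metric.isOpen_ball)
    ((contDiffOn_linMap hB₁ hd.le two_ne_zero hD₁ hL).of_le (by norm_num)) (r := R - 4 * d)
    (r' := R - 3 * d) (by linarith) hd (hball B₁ h01 (by linarith))
    (fun y hy => linMap_model hd.le (hL 0 h01) hmodel hy)
  obtain ⟨B₂, hBB₂, hB₂, h02, hN⟩ := exists_open_of_eventually hB₁ h01 e2
  have hD₂ := hD₁.mono (prod_mono_left hBB₂ : B₂ ×ˢ Metric.ball (0 : R2n n) R ⊆ _)
  have hL₂ : ∀ b ∈ B₂, Linearizable p a (D b) R d := fun b hb => hL b (hBB₂ hb)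
  have e3 := eventually_moserable (σ := stdBil) (w := fun b => linForm p a (D b) R d) (r := R - 7 * d) (d := d) hB₂ h02 hd (by linarith)
    stdBil_isInvertible
    (contDiffOn_linForm (m' := 1) hB₂ hd.le (by norm_num) hD₂ hL₂ hN)
    (fun y hy => linForm_model hd (hL₂ 0 h02) (hN 0 h02) hmodel hy)
  obtain ⟨B₃, hBB₃, hB₃, h03, hM⟩ := exists_open_of_eventually hB₂ h02 e3
  have hD₃ := hD₂.mono (prod_mono_left hBB₃ : B₃ ×ˢ Metric.ball (0 : R2n n) R ⊆ _)
  have e4 := eventually_nearId (P := P) (hB₃.prod Metric.isOpen_ball)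
    (contDiffOn_normMap hB₃ hd (by norm_num) one_ne_zero hD₃ (fun b hb => hL₂ b (hBB₃ hb))
      (fun b hb => hN b (hBB₃ hb)) hM) (r := R - 10 * d)
    (r' := R - 9 * d) (by linarith) hd (hball B₃ h03 (by linarith))
    (fun y hy => normMap_model hd (hL₂ 0 h02) (hN 0 h02) (hM 0 h03) hmodel hy)
  filter_upwards [e4, hB₃.mem_nhds h03] with b hb hb3
  exact ⟨hL₂ b (hBB₃ hb3), hN b (hBB₃ hb3), hM b hb3, hb⟩

theorem Normalizable.contDiffOn_normMap_family (hB : IsOpen B) (hd : 0 < d) (hm : m' + 1 ≤ m)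
    (hm0 : m' ≠ 0)
    (hD : ContDiffOn ℝ m (fun z : P × R2n n => D z.1 z.2) (B ×ˢ Metric.ball 0 R))
    (hN : ∀ b ∈ B, Normalizable p a (D b) R d) :
    ContDiffOn ℝ m' (fun z : P × R2n n => normMap p a (D z.1) R d z.2)
      (B ×ˢ Metric.ball 0 (R - 9 * d)) :=
  contDiffOn_normMap hB hd hm hm0 hD (fun b hb => (hN b hb).lin) (fun b hb => (hN b hb).nearLin)
    (fun b hb => (hN b hb).moser)

end Normalization

/-! ### A single system: pullback of the form, symmetries, the origin -/

section Single

variable {n κ : ℕ} {Γ : Type*} [Fintype Γ] {p : Fin n → Fin κ → ℤ} {a : Γ → Fin n → Circle}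
  {D : R2n n → DataSpace n κ Γ} {R d : ℝ} {m m' : WithTop ℕ∞}

/-- A single system is viewed as a constant family over a real parameter, so that the parametric
regularity statements specialise to it. -/
theorem contDiffOn_const_family {E F : Type*} [NormedAddCommGroup E] [NormedSpace ℝ E]
    [NormedAddCommGroup F] [NormedSpace ℝ F] {f : E → F} {S : Set E} :
    ContDiffOn ℝ m (fun z : ℝ × E => f z.2) (univ ×ˢ S) ↔ ContDiffOn ℝ m f S :=
  ⟨fun h => h.comp (f := fun x : E => ((0 : ℝ), x)) (by fun_prop) fun _ hx => ⟨mem_univ _, hx⟩,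
    fun h => h.comp contDiffOn_snd fun _ hx => hx.2⟩

theorem Normalizable.contDiffOn_normMap (h : Normalizable p a D R d) (hd : 0 < d) (hm : m' + 1 ≤ m)
    (hm0 : m' ≠ 0) (hD : ContDiffOn ℝ m D (Metric.ball 0 R)) :
    ContDiffOn ℝ m' (normMap p a D R d) (Metric.ball 0 (R - 9 * d)) :=
  contDiffOn_const_family.1 (Normalizable.contDiffOn_normMap_family (D := fun _ : ℝ => D)
    isOpen_univ hd hm hm0 (contDiffOn_const_family.2 hD) fun _ _ => h)

theorem Normalizable.contDiffOn_linMap (h : Normalizable p a D R d) (hd : 0 < d) (hm0 : m ≠ 0)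
    (hD : ContDiffOn ℝ m D (Metric.ball 0 R)) :
    ContDiffOn ℝ m (linMap p a D (R - d)) (Metric.ball 0 (R - 3 * d)) :=
  contDiffOn_const_family.1 (TorusNormalForm.contDiffOn_linMap (D := fun _ : ℝ => D)
    isOpen_univ hd.le hm0 (contDiffOn_const_family.2 hD) fun _ _ => h.lin)

theorem Normalizable.contDiffOn_invBall (h : Normalizable p a D R d) (hd : 0 < d) (hm0 : m ≠ 0)
    (hD : ContDiffOn ℝ m D (Metric.ball 0 R)) :
    ContDiffOn ℝ m (invBall (linMap p a D (R - d)) (R - 4 * d)) (Metric.ball 0 (R - 6 * d)) :=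
  contDiffOn_const_family.1 (contDiffOn_invBall_linMap (D := fun _ : ℝ => D)
    isOpen_univ hd.le hm0 (contDiffOn_const_family.2 hD) (fun _ _ => h.lin) fun _ _ => h.nearLin)

theorem Normalizable.contDiffOn_linForm (h : Normalizable p a D R d) (hd : 0 < d) (hm : m' + 1 ≤ m)
    (hD : ContDiffOn ℝ m D (Metric.ball 0 R)) :
    ContDiffOn ℝ m' (linForm p a D R d) (Metric.ball 0 (R - 6 * d)) :=
  contDiffOn_const_family.1 (TorusNormalForm.contDiffOn_linForm (D := fun _ : ℝ => D)
    isOpen_univ hd.le hm (contDiffOn_const_family.2 hD) (fun _ _ => h.lin) fun _ _ => h.nearLin)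

theorem differentiableAt_of_contDiffOn_ball {E F : Type*} [NormedAddCommGroup E] [NormedSpace ℝ E]
    [NormedAddCommGroup F] [NormedSpace ℝ F] {f : E → F} {r : ℝ} (hf : ContDiffOn ℝ 1 f (Metric.ball 0 r))
    {x : E} (hx : ‖x‖ < r) : DifferentiableAt ℝ f x :=
  (hf.contDiffAt (Metric.isOpen_ball.mem_nhds (by simpa using hx))).differentiableAt one_ne_zero

theorem Normalizable.norm_invBall_lt (h : Normalizable p a D R d) (hd : 0 < d) {y : R2n n}
    (hy : ‖y‖ < R - 6 * d) : ‖invBall (linMap p a D (R - d)) (R - 4 * d) y‖ < R - 5 * d := by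
  have := h.nearLin.norm_invBall_lt hd.le (r' := R - 6 * d) (by linarith) hy
  linarith

theorem linForm_apply (y u v : R2n n) : linForm p a D R d y u v =
    (D (invBall (linMap p a D (R - d)) (R - 4 * d) y)).1
      (fderiv ℝ (invBall (linMap p a D (R - d)) (R - 4 * d)) y u)
      (fderiv ℝ (invBall (linMap p a D (R - d)) (R - 4 * d)) y v) := rfl

theorem Normalizable.linForm_swap (h : Normalizable p a D R d) (hd : 0 < d)
    (halt : ∀ x, ‖x‖ < R → ∀ u v, (D x).1 u v = -(D x).1 v u) {y : R2n n} (hy : ‖y‖ < R - 6 * d)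
    (u v : R2n n) : linForm p a D R d y u v = -linForm p a D R d y v u := by
  rw [linForm_apply, linForm_apply]
  exact halt _ (by linarith [h.norm_invBall_lt hd hy]) _ _

theorem Normalizable.linForm_isClosedAt (h : Normalizable p a D R d) (hd : 0 < d)
    (hD : ContDiffOn ℝ 2 D (Metric.ball 0 R))
    (halt : ∀ x, ‖x‖ < R → ∀ u v, (D x).1 u v = -(D x).1 v u)
    (hcl : ∀ x, ‖x‖ < R → IsClosedAt (fun x => (D x).1) x) {y : R2n n} (hy : ‖y‖ < R - 6 * d) :
    IsClosedAt (linForm p a D R d) y := by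
  have hy' : ‖invBall (linMap p a D (R - d)) (R - 4 * d) y‖ < R := by
    linarith [h.norm_invBall_lt hd hy]
  have hD1 : ContDiffOn ℝ 1 (fun x => (D x).1) (Metric.ball 0 R) :=
    contDiff_fst.comp_contDiffOn (hD.of_le (by norm_num))
  exact IsClosedAt.pullback (w := fun x => (D x).1) (hcl _ hy')
    (differentiableAt_of_contDiffOn_ball hD1 hy')
    ((h.contDiffOn_invBall hd two_ne_zero hD).contDiffAt
      (Metric.isOpen_ball.mem_nhds (by simpa using hy))) (halt _ hy')

theorem Normalizable.fderiv_invBall_fderiv (h : Normalizable p a D R d) (hd : 0 < d)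
    (hD : ContDiffOn ℝ 1 D (Metric.ball 0 R)) {x : R2n n} (hx : ‖x‖ < R - 7 * d) (u : R2n n) :
    fderiv ℝ (invBall (linMap p a D (R - d)) (R - 4 * d)) (linMap p a D (R - d) x)
      (fderiv ℝ (linMap p a D (R - d)) x u) = u := by
  have hΦx : ‖linMap p a D (R - d) x‖ < R - 6 * d := by
    have := h.nearLin.norm_lt (r' := R - 7 * d) (by linarith) hx
    linarith
  have hΦd := differentiableAt_of_contDiffOn_ball (h.contDiffOn_linMap hd one_ne_zero hD)
    (show ‖x‖ < R - 3 * d by linarith)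
  have hΨd := differentiableAt_of_contDiffOn_ball (h.contDiffOn_invBall hd one_ne_zero hD) hΦx
  have h1 := HasFDerivAt.comp x hΨd.hasFDerivAt hΦd.hasFDerivAt
  have h2 := (hasFDerivAt_id (𝕜 := ℝ) x).congr_of_eventuallyEq (f₁ := invBall (linMap p a D (R - d)) (R - 4 * d)
      ∘ linMap p a D (R - d)) (by
    have hx' : ‖x‖ < R - 4 * d := by linarith
    filter_upwards [(isOpen_lt continuous_norm continuous_const).mem_nhds hx'] with z hz
    exact h.nearLin.invBall_apply hz)
  exact DFunLike.congr_fun (h1.unique h2) u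

/-- Moser's map pulls the standard form back to the linearised one, which the linearising map pulls
back to the original: the latter form was defined through the inverse of this map. -/
theorem Normalizable.pullback (h : Normalizable p a D R d) (hd : 0 < d)
    (hD : ContDiffOn ℝ 2 D (Metric.ball 0 R))
    (halt : ∀ x, ‖x‖ < R → ∀ u v, (D x).1 u v = -(D x).1 v u)
    (hcl : ∀ x, ‖x‖ < R → IsClosedAt (fun x => (D x).1) x) {x : R2n n} (hx : ‖x‖ < R - 9 * d)
    (u v : R2n n) :
    stdBil (fderiv ℝ (normMap p a D R d) x u) (fderiv ℝ (normMap p a D R d) x v) = (D x).1 u v := by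
  have hlf1 : ContDiffOn ℝ 1 (linForm p a D R d) (Metric.ball 0 (R - 6 * d)) :=
    h.contDiffOn_linForm hd (by norm_num) hD
  have hD1 : ContDiffOn ℝ 1 D (Metric.ball 0 R) := hD.of_le (by norm_num)
  have hΦx : ‖linMap p a D (R - d) x‖ < R - 7 * d - d := by
    have := h.nearLin.norm_lt (r' := R - 9 * d) (by linarith) hx
    linarith
  have hΦd := differentiableAt_of_contDiffOn_ball (h.contDiffOn_linMap hd one_ne_zero hD1)
    (show ‖x‖ < R - 3 * d by linarith)
  have hMc : ContDiffOn ℝ 1 (moserMap stdBil (linForm p a D R d) (R - 7 * d))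
      (Metric.ball 0 (R - 7 * d - d)) :=
    contDiffOn_const_family.1 (contDiffOn_moserMap (w := fun _ : ℝ => linForm p a D R d)
      isOpen_univ hd.le one_ne_zero (by linarith) (contDiffOn_const_family.2 hlf1)
      fun _ _ => h.moser)
  have hMd := differentiableAt_of_contDiffOn_ball hMc hΦx
  have hm := moserMap_pullback hd.le (by linarith) hlf1 h.moser stdBil_swap
    (fun y hy a b => h.linForm_swap hd halt hy a b)
    (fun y hy => h.linForm_isClosedAt hd hD halt hcl hy) hΦx
  have hcomp := (HasFDerivAt.comp x hMd.hasFDerivAt hΦd.hasFDerivAt).fderiv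
  have hcomp' : ∀ u, fderiv ℝ (normMap p a D R d) x u =
      fderiv ℝ (moserMap stdBil (linForm p a D R d) (R - 7 * d)) (linMap p a D (R - d) x)
        (fderiv ℝ (linMap p a D (R - d)) x u) := fun u => DFunLike.congr_fun hcomp u
  rw [hcomp', hcomp', hm, linForm_apply, h.fderiv_invBall_fderiv hd hD1 (by linarith),
    h.fderiv_invBall_fderiv hd hD1 (by linarith), h.nearLin.invBall_apply (by linarith)]

/-- A symmetry of the local system that is close to a rotation and is linearized by the linearizing
map. -/
structure IsSymmetry (p : Fin n → Fin κ → ℤ) (a : Γ → Fin n → Circle) (D : R2n n → DataSpace n κ Γ)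
    (R d : ℝ) (c : Fin n → Circle) (f : R2n n → R2n n) : Prop where
  norm_lt : ∀ r, r ≤ R - 2 * d → ∀ x, ‖x‖ < r → ‖f x‖ < r + d
  differentiableAt : ∀ x, ‖x‖ < R - 5 * d → DifferentiableAt ℝ f x
  symplectic : ∀ x, ‖x‖ < R - 5 * d → ∀ u v,
    (D (f x)).1 (fderiv ℝ f x u) (fderiv ℝ f x v) = (D x).1 u v
  commute : ∀ x, ‖x‖ < R - 5 * d →
    linMap p a D (R - d) (f x) = rotC c (linMap p a D (R - d) x)

/-- Conjugation by the linearising map turns the symmetry `f` into a rotation, and `f` preserves the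
original form; hence the rotation preserves the form in the new coordinates. -/
theorem IsSymmetry.linForm_rotC {c : Fin n → Circle} {f : R2n n → R2n n}
    (hf : IsSymmetry p a D R d c f) (h : Normalizable p a D R d) (hd : 0 < d)
    (hD : ContDiffOn ℝ 1 D (Metric.ball 0 R)) {y : R2n n} (hy : ‖y‖ < R - 6 * d) (u v : R2n n) :
    linForm p a D R d (rotC c y) (rotC c u) (rotC c v) = linForm p a D R d y u v := by
  set Φ := linMap p a D (R - d) with hΦ
  set Ψ := invBall Φ (R - 4 * d) with hΨ
  have hinv : ContDiffOn ℝ 1 Ψ (Metric.ball 0 (R - 6 * d)) := h.contDiffOn_invBall hd one_ne_zero hD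
  have hΨn : ∀ y, ‖y‖ < R - 6 * d → ‖Ψ y‖ < R - 5 * d := fun y hy => by
    have := h.nearLin.norm_invBall_lt hd.le (r' := R - 6 * d) (by linarith) hy
    linarith
  have heq : ∀ y, ‖y‖ < R - 6 * d → Ψ (rotC c y) = f (Ψ y) := by
    intro y hy
    have h1 := hf.commute _ (hΨn y hy)
    rw [(h.nearLin.invBall_spec hd.le (by linarith)).2] at h1
    rw [← h1]
    refine h.nearLin.invBall_apply ?_
    have := hf.norm_lt (R - 5 * d) (by linarith) _ (hΨn y hy)
    linarith
  have hder : ∀ u, fderiv ℝ Ψ (rotC c y) (rotC c u) = fderiv ℝ f (Ψ y) (fderiv ℝ Ψ y u) := by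
    have hyr : ‖rotC c y‖ < R - 6 * d := by rwa [norm_rotC]
    have h1 : HasFDerivAt (fun y => Ψ (rotC c y)) ((fderiv ℝ Ψ (rotC c y)).comp (rotC c)) y :=
      HasFDerivAt.comp y (differentiableAt_of_contDiffOn_ball hinv hyr).hasFDerivAt
        (rotC c).hasFDerivAt
    have h2 : HasFDerivAt (fun y => f (Ψ y)) ((fderiv ℝ f (Ψ y)).comp (fderiv ℝ Ψ y)) y :=
      HasFDerivAt.comp y (hf.differentiableAt _ (hΨn y hy)).hasFDerivAt
        (differentiableAt_of_contDiffOn_ball hinv hy).hasFDerivAt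
    have h3 := h1.unique (h2.congr_of_eventuallyEq (by
      filter_upwards [(isOpen_lt continuous_norm continuous_const).mem_nhds hy] with z hz
      exact heq z hz))
    exact fun u => DFunLike.congr_fun h3 u
  change (D (Ψ (rotC c y))).1 (fderiv ℝ Ψ (rotC c y) (rotC c u)) (fderiv ℝ Ψ (rotC c y) (rotC c v)) =
    (D (Ψ y)).1 (fderiv ℝ Ψ y u) (fderiv ℝ Ψ y v)
  rw [hder, hder, heq y hy]
  exact hf.symplectic _ (hΨn y hy) _ _

/-- The linearising map turns `f` into a rotation, and Moser's map commutes with this rotation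
because the form it starts from is invariant. -/
theorem IsSymmetry.normMap_apply {c : Fin n → Circle} {f : R2n n → R2n n}
    (hf : IsSymmetry p a D R d c f) (h : Normalizable p a D R d) (hd : 0 < d)
    (hD : ContDiffOn ℝ 2 D (Metric.ball 0 R)) {x : R2n n} (hx : ‖x‖ < R - 9 * d) :
    normMap p a D R d (f x) = rotC c (normMap p a D R d x) := by
  rw [normMap, hf.commute x (by linarith)]
  have hlf1 : ContDiffOn ℝ 1 (linForm p a D R d) (Metric.ball 0 (R - 6 * d)) :=
    h.contDiffOn_linForm hd (by norm_num) hD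
  refine moserMap_equivariant (norm_rotC c) (fun v => ⟨rotC c⁻¹ v, rotC_rotC_inv _ _⟩)
    (stdBil_rotC c) hd.le (by linarith) hlf1.continuousOn h.moser
    (fun y hy u v => hf.linForm_rotC h hd (hD.of_le (by norm_num)) hy u v) ?_
  have := h.nearLin.norm_lt (r' := R - 9 * d) (by linarith) hx
  linarith

/-- The origin is at rest under the Hamiltonian fields and fixed by Γ, so averaging leaves it in
place; the radial primitive vanishes there, so Moser's map does as well. -/
theorem Normalizable.normMap_zero [Nonempty Γ] (h : Normalizable p a D R d) (hd : 0 < d)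
    (hR : 0 < R - 9 * d) (h0 : ∀ l, hamVF (D 0) l = 0) (hρ : ∀ ψ, (D 0).2.2 ψ = 0) :
    normMap p a D R d 0 = 0 := by
  have hflow : (constPath 0 : C(UnitTime × AngleCube κ, R2n n)) = torusFlow p D (R - d) 0 := by
    refine IsFlow.eq_flow h.lin.small ⟨fun q => ?_, fun t τ => ?_⟩
    · simp only [constPath_apply, mem_closedBall_zero_iff, norm_zero]; linarith
    · have : ∀ s : ℝ, linField p D (angleArg κ (clampTime s, τ)) 0 = 0 := fun s =>
        Finset.sum_eq_zero fun l _ => by simp [h0]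
      simp [this]
  have hlin : linMap p a D (R - d) 0 = 0 := by
    have : ∀ ψ, rotC (a ψ)⁻¹ (avgT p D (R - d) ((D 0).2.2 ψ)) = 0 := fun ψ => by
      rw [hρ, avgT, ← hflow, haarAvg_constPath, map_zero]
    simp [linMap, this]
  rw [normMap, hlin]
  refine moserMap_of_field_eq_zero hd.le h.moser (by rw [norm_zero]; linarith) ?_
  simp [prim]

end Single

/-! ### The nonlinear torus action and its invariance properties -/

section TorusAct

variable {n κ : ℕ} {Γ : Type*} [Fintype Γ] {p : Fin n → Fin κ → ℤ} {a : Γ → Fin n → Circle}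
  {D : R2n n → DataSpace n κ Γ} {R d : ℝ} {m : WithTop ℕ∞}

theorem hasFDerivAt_linField {v : ℝ × (Fin κ → ℝ)} {y : R2n n} {X' : Fin κ → R2n n →L[ℝ] R2n n}
    (hX : ∀ l, HasFDerivAt (fun y => hamVF (D y) l) (X' l) (rotT p (v.1 • v.2) y)) :
    HasFDerivAt (linField p D v) (∑ l, v.2 l • (rotT p (-(v.1 • v.2))).comp
      ((X' l - gen p l).comp (rotT p (v.1 • v.2)))) y := by
  refine HasFDerivAt.fun_sum fun l _ => ?_
  have h1 : HasFDerivAt (fun y => hamVF (D y) l - gen p l y) (X' l - gen p l)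
      (rotT p (v.1 • v.2) y) := (hX l).sub (gen p l).hasFDerivAt
  have h2 := HasFDerivAt.comp y h1 (rotT p (v.1 • v.2)).hasFDerivAt
  exact ((rotT p (-(v.1 • v.2))).hasFDerivAt.comp y h2).fun_const_smul (v.2 l)

/-- The curve of the torus action through `x` in the direction of `τ`. -/
def torusCurve (p : Fin n → Fin κ → ℤ) (D : R2n n → DataSpace n κ Γ) (r : ℝ) (x : R2n n)
    (τ : AngleCube κ) (s : ℝ) : R2n n :=
  rotT p (s • (τ : Fin κ → ℝ)) (torusFlow p D r x (clampTime s, τ))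

/-- The torus action. -/
def torusAct (p : Fin n → Fin κ → ℤ) (D : R2n n → DataSpace n κ Γ) (r : ℝ) (g : Torus κ)
    (x : R2n n) : R2n n :=
  rotC (torusWeight p g) (torusFlow p D r x (1, argT g))

theorem continuous_torusCurve (r : ℝ) (x : R2n n) (τ : AngleCube κ) :
    Continuous (torusCurve p D r x τ) := by
  refine Continuous.clm_apply ?_ ?_
  · exact (contDiff_rotT (m := 0) p).continuous.comp (by fun_prop)
  · exact (torusFlow p D r x).continuous.comp (continuous_clampTime.prodMk continuous_const)

theorem torusCurve_one (r : ℝ) (x : R2n n) (g : Torus κ) :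
    torusCurve p D r x (argT g) 1 = torusAct p D r g x := by
  have h1 : (clampTime 1) = 1 := clampTime_of_mem (by simp)
  rw [torusCurve, torusAct, h1, one_smul, rotT_eq, expT_argT]

theorem Linearizable.isFlow (h : Linearizable p a D R d) (hd : 0 ≤ d) {x : R2n n}
    (hx : ‖x‖ ≤ R - 2 * d) :
    IsFlow (fun q y => linField p D (angleArg κ q) y) (R - d) x (torusFlow p D (R - d) x) :=
  h.small.isFlow_flow hd (by linarith)

theorem Linearizable.torusCurve_zero (h : Linearizable p a D R d) (hd : 0 ≤ d) {x : R2n n}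
    (hx : ‖x‖ ≤ R - 2 * d) (τ : AngleCube κ) : torusCurve p D (R - d) x τ 0 = x := by
  have h0 : (clampTime 0) = 0 := clampTime_of_mem (by simp)
  rw [torusCurve, zero_smul, rotT_zero, h0, (h.isFlow hd hx).eq 0 τ]
  simp

theorem Linearizable.norm_torusFlow_lt (h : Linearizable p a D R d) (hd : 0 ≤ d) {x : R2n n} {r : ℝ}
    (hr : r ≤ R - 2 * d) (hx : ‖x‖ < r) (q : UnitTime × AngleCube κ) :
    ‖torusFlow p D (R - d) x q‖ < r + d := by
  have := (h.isFlow hd (hx.le.trans hr)).norm_sub_le h.small q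
  calc ‖torusFlow p D (R - d) x q‖ = ‖x + (torusFlow p D (R - d) x q - x)‖ := by congr 1; abel
    _ ≤ ‖x‖ + ‖torusFlow p D (R - d) x q - x‖ := norm_add_le _ _
    _ < r + d := by linarith

theorem Linearizable.norm_torusCurve_lt (h : Linearizable p a D R d) (hd : 0 ≤ d) {x : R2n n} {r : ℝ}
    (hr : r ≤ R - 2 * d) (hx : ‖x‖ < r) (τ : AngleCube κ) (s : ℝ) :
    ‖torusCurve p D (R - d) x τ s‖ < r + d := by
  rw [torusCurve, norm_rotT]
  exact h.norm_torusFlow_lt hd hr hx _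

theorem Linearizable.norm_torusAct_lt (h : Linearizable p a D R d) (hd : 0 ≤ d) {x : R2n n} {r : ℝ}
    (hr : r ≤ R - 2 * d) (hx : ‖x‖ < r) (g : Torus κ) :
    ‖torusAct p D (R - d) g x‖ < r + d := by
  rw [torusAct, norm_rotC]
  exact h.norm_torusFlow_lt hd hr hx _

/-- Passing from rotating coordinates to fixed ones. -/
theorem hasDerivAt_rotating {τ : Fin κ → ℝ} {t : ℝ} {u : ℝ → R2n n} {u' : Fin κ → R2n n}
    (hu : HasDerivAt u (∑ l, τ l • rotT p (-(t • τ)) (u' l - gen p l (rotT p (t • τ) (u t)))) t) :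
    HasDerivAt (fun s => rotT p (s • τ) (u s)) (∑ l, τ l • u' l) t := by
  refine ((hasDerivAt_rotT_smul p τ t).clm_apply hu).congr_deriv ?_
  simp only [ContinuousLinearMap.comp_apply, _root_.sum_apply, _root_.smul_apply, map_sum, map_smul,
    rotT_rotT_neg, ← Finset.sum_add_distrib, ← smul_add]
  refine Finset.sum_congr rfl fun l _ => ?_
  rw [add_sub_cancel]

theorem Linearizable.hasDerivAt_torusCurve (h : Linearizable p a D R d) (hd : 0 ≤ d) {x : R2n n}
    (hx : ‖x‖ ≤ R - 2 * d) (τ : AngleCube κ) {t : ℝ} (ht : t ∈ Ioo (0 : ℝ) 1) :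
    HasDerivAt (torusCurve p D (R - d) x τ)
      (∑ l, (τ : Fin κ → ℝ) l • hamVF (D (torusCurve p D (R - d) x τ t)) l) t := by
  have hsol := h.isFlow hd hx
  refine hasDerivAt_rotating ?_
  have := hasDerivAt_of_eq_integral (U := fun t => torusFlow p D (R - d) x (t, τ)) (x := x)
    (h := fun t => linField p D (angleArg κ (t, τ)) (torusFlow p D (R - d) x (t, τ)))
    ((h.small.continuous_comp hsol.mem).comp (by fun_prop)) (fun t => hsol.eq t τ) ht
  refine this.congr_deriv ?_
  simp only [linField, angleArg, ContinuousMap.coe_mk, clampTime_of_mem ⟨ht.1.le, ht.2.le⟩,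
    torusCurve]

theorem Linearizable.contDiffOn_torusFlow (h : Linearizable p a D R d) (hd : 0 ≤ d) (hm0 : m ≠ 0)
    (hD : ContDiffOn ℝ m D (Metric.ball 0 R)) :
    ContDiffOn ℝ m (torusFlow p D (R - d)) (Metric.ball 0 (R - 2 * d)) :=
  contDiffOn_const_family.1 (TorusNormalForm.contDiffOn_torusFlow (D := fun _ : ℝ => D)
    isOpen_univ hd hm0 (contDiffOn_const_family.2 hD) fun _ _ => h)

theorem Linearizable.differentiableAt_hamVF (h : Linearizable p a D R d) (hd : 0 < d)
    (hD : ContDiffOn ℝ 1 D (Metric.ball 0 R)) {x : R2n n} (hx : ‖x‖ < R - d) (l : Fin κ) :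
    DifferentiableAt ℝ (fun x => hamVF (D x) l) x := by
  have hD' := contDiffOn_const_family.2 hD
  have h1 := contDiffOn_hamVF (D := fun _ : ℝ => D) hD' l
  have h2 := (h1.contDiffAt ((isOpen_nondegSet isOpen_univ hD'.continuousOn).mem_nhds
    (show ((0 : ℝ), x) ∈ _ from ⟨⟨mem_univ _, by simpa using (by linarith : ‖x‖ < R)⟩,
      h.invertible x hx.le⟩))).differentiableAt one_ne_zero
  exact (HasFDerivAt.partial_right h2.hasFDerivAt).differentiableAt

/-- The equation of variations, rotated back to fixed coordinates, has the derivative of the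
Hamiltonian field as its coefficient. This is the input needed for transporting the form along the
curve. -/
theorem Linearizable.fderiv_torusFlow (h : Linearizable p a D R d) (hd : 0 < d)
    (hD : ContDiffOn ℝ 1 D (Metric.ball 0 R)) {x : R2n n} (hx : ‖x‖ < R - 2 * d) (u : R2n n)
    (τ : AngleCube κ) {t : ℝ} (ht : t ∈ Ioo (0 : ℝ) 1) :
    HasDerivAt (fun s : ℝ => rotT p (s • (τ : Fin κ → ℝ))
        (fderiv ℝ (torusFlow p D (R - d)) x u (clampTime s, τ)))
      (∑ l, (τ : Fin κ → ℝ) l • fderiv ℝ (fun y => hamVF (D y) l) (torusCurve p D (R - d) x τ t)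
        (rotT p (t • (τ : Fin κ → ℝ)) (fderiv ℝ (torusFlow p D (R - d)) x u (clampTime t, τ)))) t := by
  have hD' := contDiffOn_const_family.2 hD
  set G : (ℝ × (Fin κ → ℝ)) × ℝ × R2n n → R2n n := fun z => linField p D z.1 z.2.2 with hG
  set O := linFieldSet p (fun _ : ℝ => D) univ R with hOdef
  have hO : IsOpen O := isOpen_linFieldSet isOpen_univ hD'.continuousOn
  have hGc : ContDiffOn ℝ 1 G O := contDiffOn_linField (D := fun _ : ℝ => D) hD'
  have hBO : ∀ q, ∀ b ∈ (univ : Set ℝ), ∀ y ∈ Metric.ball (0 : R2n n) (R - d),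
      (angleArg κ q, b, y) ∈ O := fun q b hb y hy => by
    have hy' : ‖y‖ < R - d := by simpa using hy
    exact mem_linFieldSet (mem_univ _) (by change ‖y‖ < R; linarith)
      (h.invertible _ (by rw [norm_rotT]; exact hy'.le))
  set U := torusFlow p D (R - d) with hU
  have hvar : ∀ t, fderiv ℝ U x u (t, τ) = u + ∫ s in (0 : ℝ)..t,
      fderiv ℝ (fun y => G (angleArg κ (clampTime s, τ), 0, y)) (U x (clampTime s, τ))
        (fderiv ℝ U x u (clampTime s, τ)) := fun t =>
    fderiv_flow_apply hO hGc (ι := angleArg κ) isOpen_univ hd.le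
      (fun _ _ => h.small) hBO (mem_univ (0 : ℝ)) (show ‖x‖ < R - d - d by linarith) u t τ
  have hmem : ∀ q, U x q ∈ Metric.ball (0 : R2n n) (R - d) := fun q => by
    have := h.norm_torusFlow_lt hd.le le_rfl hx q
    rw [mem_ball_zero_iff]
    linarith
  have hGd : ∀ q, HasFDerivAt (fun y => G (angleArg κ q, 0, y))
      ((fderiv ℝ G (angleArg κ q, 0, U x q)).comp ((ContinuousLinearMap.inr ℝ _ (ℝ × R2n n)).comp
        (ContinuousLinearMap.inr ℝ ℝ (R2n n)))) (U x q) := fun q => by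
    have h1 := ((hGc.contDiffAt (hO.mem_nhds (hBO q 0 (mem_univ _) _ (hmem q)))).differentiableAt
      one_ne_zero).hasFDerivAt
    exact HasFDerivAt.partial_right (f := fun z : ℝ × R2n n => G (angleArg κ q, z))
      (HasFDerivAt.partial_right h1)
  have hcontG : Continuous fun q => fderiv ℝ G (angleArg κ q, 0, U x q) :=
    (hGc.continuousOn_fderiv_of_isOpen hO le_rfl).comp_continuous (by fun_prop)
      fun q => hBO q 0 (mem_univ _) _ (hmem q)
  refine hasDerivAt_rotating ?_
  have hder := hasDerivAt_of_eq_integral (U := fun t => fderiv ℝ U x u (t, τ)) (x := u)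
      (h := fun t => fderiv ℝ (fun y => G (angleArg κ (t, τ), 0, y)) (U x (t, τ))
        (fderiv ℝ U x u (t, τ))) (by
          have : (fun t => fderiv ℝ (fun y => G (angleArg κ (t, τ), 0, y)) (U x (t, τ))
              (fderiv ℝ U x u (t, τ))) = fun t => fderiv ℝ G (angleArg κ (t, τ), 0, U x (t, τ))
              (0, 0, fderiv ℝ U x u (t, τ)) := by
            ext1 t
            rw [(hGd (t, τ)).fderiv]
            rfl
          rw [this]
          exact (hcontG.comp (by fun_prop : Continuous fun t : UnitTime => (t, τ))).clm_apply
            (by fun_prop)) (fun t => hvar t) ht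
  refine hder.congr_deriv ?_
  have htI : t ∈ Icc (0 : ℝ) 1 := ⟨ht.1.le, ht.2.le⟩
  have harg : angleArg κ (clampTime t, τ) = (t, (τ : Fin κ → ℝ)) := by
    simp [angleArg, clampTime_of_mem htI]
  have hcurve : ‖torusCurve p D (R - d) x τ t‖ < R - d := by
    have := h.norm_torusCurve_lt hd.le le_rfl hx τ t
    linarith
  have hlf := hasFDerivAt_linField (p := p) (D := D) (v := (t, (τ : Fin κ → ℝ)))
    (y := U x (clampTime t, τ))
    (X' := fun l => fderiv ℝ (fun y => hamVF (D y) l) (torusCurve p D (R - d) x τ t))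
    (fun l => (h.differentiableAt_hamVF hd hD hcurve l).hasFDerivAt)
  have hGlin : (fun y => G (angleArg κ (clampTime t, τ), 0, y)) = linField p D (t, (τ : Fin κ → ℝ)) := by
    rw [harg]
  rw [hGlin, hlf.fderiv]
  simp only [_root_.sum_apply, _root_.smul_apply, ContinuousLinearMap.comp_apply, _root_.sub_apply]

/-- The element g is reached at time one along the curve with angles `argT g`, an integral curve of
a Hamiltonian field X. With a time-independent closed form and a closed form ι_X Ω (closedness is
the symmetry `hμ`), Cartan's formula makes the transported form constant. -/
theorem Linearizable.torusAct_symplectic (h : Linearizable p a D R d) (hd : 0 < d)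
    (hD : ContDiffOn ℝ 1 D (Metric.ball 0 R))
    (halt : ∀ x, ‖x‖ < R → ∀ u v, (D x).1 u v = -(D x).1 v u)
    (hcl : ∀ x, ‖x‖ < R → IsClosedAt (fun x => (D x).1) x)
    (hμ : ∀ x, ‖x‖ < R → ∀ l u v, fderiv ℝ (fun x => (D x).2.1 l) x u v =
      fderiv ℝ (fun x => (D x).2.1 l) x v u) (g : Torus κ)
    {x : R2n n} (hx : ‖x‖ < R - 2 * d) (u v : R2n n) :
    (D (torusAct p D (R - d) g x)).1 (fderiv ℝ (torusAct p D (R - d) g) x u)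
      (fderiv ℝ (torusAct p D (R - d) g) x v) = (D x).1 u v := by
  have hDd : ∀ x, ‖x‖ < R → DifferentiableAt ℝ D x := fun x hx =>
    differentiableAt_of_contDiffOn_ball hD hx
  have hΩd : ∀ x, ‖x‖ < R → DifferentiableAt ℝ (fun x => (D x).1) x := fun x hx => (hDd x hx).fst
  have hμd : ∀ x l, ‖x‖ < R → DifferentiableAt ℝ (fun x => (D x).2.1 l) x := fun x l hx =>
    differentiableAt_pi.1 ((hDd x hx).snd.fst) l
  set U := torusFlow p D (R - d) with hU
  have hUd : DifferentiableAt ℝ U x :=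
    differentiableAt_of_contDiffOn_ball (h.contDiffOn_torusFlow hd.le one_ne_zero hD) hx
  set τ := argT g with hτ
  have hfd : ∀ u, fderiv ℝ (torusAct p D (R - d) g) x u =
      rotT p ((1 : ℝ) • (τ : Fin κ → ℝ)) (fderiv ℝ U x u (clampTime 1, τ)) := by
    intro u
    have h1 : (clampTime 1) = 1 := clampTime_of_mem (by simp)
    have : HasFDerivAt (torusAct p D (R - d) g) _ x :=
      (rotC (torusWeight p g)).hasFDerivAt.comp x
      ((ContinuousMap.evalCLM ℝ (1, argT g) : C(UnitTime × AngleCube κ, R2n n) →L[ℝ] R2n n).hasFDerivAt.comp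
        x hUd.hasFDerivAt)
    rw [this.fderiv, one_smul, rotT_eq, expT_argT, h1]
    rfl
  have hcurve : ∀ t, ‖torusCurve p D (R - d) x τ t‖ < R - d := fun t => by
    have := h.norm_torusCurve_lt hd.le le_rfl hx τ t
    linarith
  have hconst := eq_of_hasDerivAt_zero (f := fun t : ℝ => (D (torusCurve p D (R - d) x τ t)).1
    (rotT p (t • (τ : Fin κ → ℝ)) (fderiv ℝ U x u (clampTime t, τ)))
    (rotT p (t • (τ : Fin κ → ℝ)) (fderiv ℝ U x v (clampTime t, τ)))) (by
      have hΩc : Continuous fun t : ℝ => (D (torusCurve p D (R - d) x τ t)).1 :=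
        continuous_fst.comp (hD.continuousOn.comp_continuous (continuous_torusCurve _ _ _)
          fun t => by rw [mem_ball_zero_iff]; linarith [hcurve t])
      have hV : ∀ u, Continuous fun t : ℝ => rotT p (t • (τ : Fin κ → ℝ))
          (fderiv ℝ U x u (clampTime t, τ)) := fun u => by
        refine Continuous.clm_apply ((contDiff_rotT (m := 0) p).continuous.comp (by fun_prop)) ?_
        exact (fderiv ℝ U x u).continuous.comp (continuous_clampTime.prodMk continuous_const)
      exact ((hΩc.clm_apply (hV u)).clm_apply (hV v)).continuousOn) (fun t ht => by
      have hz := hcurve t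
      have hzR : ‖torusCurve p D (R - d) x τ t‖ < R := by linarith
      have hnear : ∀ᶠ z in 𝓝 (torusCurve p D (R - d) x τ t), ‖z‖ < R - d :=
        (isOpen_lt continuous_norm continuous_const).mem_nhds hz
      have hΩ' : HasFDerivAt (fun z : ℝ × R2n n => (D z.2).1)
          ((fderiv ℝ (fun x => (D x).1) (torusCurve p D (R - d) x τ t)).comp
            (.snd ℝ ℝ (R2n n))) (t, torusCurve p D (R - d) x τ t) :=
        HasFDerivAt.comp (g := fun x => (D x).1) (t, torusCurve p D (R - d) x τ t)
          (hΩd _ hzR).hasFDerivAt hasFDerivAt_snd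
      have hY : HasFDerivAt (fun y => ∑ l, (τ : Fin κ → ℝ) l • hamVF (D y) l)
          (∑ l, (τ : Fin κ → ℝ) l • fderiv ℝ (fun y => hamVF (D y) l)
            (torusCurve p D (R - d) x τ t)) (torusCurve p D (R - d) x τ t) :=
        HasFDerivAt.fun_sum fun l _ =>
          ((h.differentiableAt_hamVF hd hD hz l).hasFDerivAt).fun_const_smul _
      have hα : HasFDerivAt (fun y => ∑ l, (τ : Fin κ → ℝ) l • (D y).2.1 l)
          (∑ l, (τ : Fin κ → ℝ) l • fderiv ℝ (fun y => (D y).2.1 l)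
            (torusCurve p D (R - d) x τ t)) (torusCurve p D (R - d) x τ t) :=
        HasFDerivAt.fun_sum fun l _ => ((hμd _ l hzR).hasFDerivAt).fun_const_smul _
      refine hasDerivAt_form_along (Ω := fun z : ℝ × R2n n => (D z.2).1)
        (γ := torusCurve p D (R - d) x τ) (Y := fun y => ∑ l, (τ : Fin κ → ℝ) l • hamVF (D y) l) hΩ'
        (h.hasDerivAt_torusCurve hd.le hx.le τ ht)
        ((h.fderiv_torusFlow hd hD hx u τ ht).congr_deriv ?_)
        ((h.fderiv_torusFlow hd hD hx v τ ht).congr_deriv ?_) hY hα ?_ ?_ ?_ ?_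
      · simp only [_root_.sum_apply, _root_.smul_apply]; rfl
      · simp only [_root_.sum_apply, _root_.smul_apply]; rfl
      · filter_upwards [hnear] with z hz
        simp only [map_sum, map_smul, hamVF, map_neg, smul_neg, Finset.sum_neg_distrib]
        congr 1
        refine Finset.sum_congr rfl fun l _ => ?_
        congr 1
        exact DFunLike.congr_fun (h.invertible z hz.le).self_comp_inverse _
      · filter_upwards [hnear] with z hz a b
        exact halt z (by linarith) a b
      · intro a b c
        exact hcl _ hzR a b c
      · intro a b
        simp only [_root_.sum_apply, _root_.smul_apply, hμ _ hzR _ a b, sub_self,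
          ContinuousLinearMap.comp_apply, ContinuousLinearMap.coe_snd', map_zero, _root_.zero_apply])
  have hU0 : ∀ u, fderiv ℝ U x u (clampTime 0, τ) = u := by
    have h0 : (clampTime 0) = 0 := clampTime_of_mem (by simp)
    have heq : ∀ᶠ y in 𝓝 x, U y (0, τ) = y := by
      filter_upwards [(isOpen_lt continuous_norm continuous_const).mem_nhds hx] with y hy
      rw [(h.isFlow hd.le (le_of_lt hy)).eq 0 τ]
      simp
    have h1 := (ContinuousMap.evalCLM ℝ (0, τ) :
      C(UnitTime × AngleCube κ, R2n n) →L[ℝ] R2n n).hasFDerivAt.comp x hUd.hasFDerivAt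
    have h2 := h1.unique ((hasFDerivAt_id (𝕜 := ℝ) x).congr_of_eventuallyEq heq)
    rw [h0]
    exact fun u => DFunLike.congr_fun h2 u
  rw [hfd, hfd, ← torusCurve_one]
  refine hconst.trans ?_
  simp only [zero_smul, rotT_zero, hU0]
  rw [h.torusCurve_zero hd.le hx.le]

theorem Linearizable.differentiableAt_torusAct (h : Linearizable p a D R d) (hd : 0 < d)
    (hD : ContDiffOn ℝ 1 D (Metric.ball 0 R)) (g : Torus κ)
    {x : R2n n} (hx : ‖x‖ < R - 2 * d) : DifferentiableAt ℝ (torusAct p D (R - d) g) x := by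
  have hUd : DifferentiableAt ℝ (torusFlow p D (R - d)) x :=
    differentiableAt_of_contDiffOn_ball (h.contDiffOn_torusFlow hd.le one_ne_zero hD) hx
  exact ((rotC (torusWeight p g)).hasFDerivAt.comp x
      ((ContinuousMap.evalCLM ℝ (1, argT g) : C(UnitTime × AngleCube κ, R2n n) →L[ℝ] R2n n).hasFDerivAt.comp
        x hUd.hasFDerivAt)).differentiableAt

end TorusAct

/-! ### Bochner averaging intertwines the actions with rotations -/

section LocalSystem

variable {n κ : ℕ} {Γ : Type*} [Fintype Γ] [Group Γ] {p : Fin n → Fin κ → ℤ}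
  {a : Γ → Fin n → Circle} {D : R2n n → DataSpace n κ Γ} {R d : ℝ}

/-- The coordinate expression of a system on a ball. -/
structure IsLocalSystem (p : Fin n → Fin κ → ℤ) (D : R2n n → DataSpace n κ Γ)
    (R d : ℝ) : Prop where
  contDiffOn : ContDiffOn ℝ 2 D (Metric.ball 0 R)
  swap : ∀ x, ‖x‖ < R → ∀ u v, (D x).1 u v = -(D x).1 v u
  closed : ∀ x, ‖x‖ < R → IsClosedAt (fun x => (D x).1) x
  momentum_closed : ∀ x, ‖x‖ < R → ∀ l u v, fderiv ℝ (fun x => (D x).2.1 l) x u v =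
    fderiv ℝ (fun x => (D x).2.1 l) x v u
  finite_symplectic : ∀ ψ x, ‖x‖ < R - 5 * d → ∀ u v,
    (D ((D x).2.2 ψ)).1 (fderiv ℝ (fun x => (D x).2.2 ψ) x u) (fderiv ℝ (fun x => (D x).2.2 ψ) x v) =
      (D x).1 u v
  torus_mul : ∀ g h x, ‖x‖ < R - 4 * d → torusAct p D (R - d) (g * h) x =
    torusAct p D (R - d) g (torusAct p D (R - d) h x)
  finite_mul : ∀ ψ χ x, ‖x‖ < R - 5 * d → (D x).2.2 (ψ * χ) = (D ((D x).2.2 χ)).2.2 ψ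
  torus_finite : ∀ ψ g x, ‖x‖ < R - 5 * d →
    (D (torusAct p D (R - d) g x)).2.2 ψ = torusAct p D (R - d) g ((D x).2.2 ψ)

/-- The paths are written in rotating coordinates, so their end points are already "act by g, then
rotate back by g". -/
theorem avgT_eq (r : ℝ) (x : R2n n) : avgT p D r x =
    ∫ g, rotC (torusWeight p g)⁻¹ (torusAct p D r g x) ∂torusMeasure κ := by
  rw [avgT, haarAvg_apply]
  refine MeasureTheory.integral_congr_ae (Filter.Eventually.of_forall fun g => ?_)
  simp only [torusAct, rotC_inv_rotC]

/-- Substituting k ↦ k g in the integral; the invariance of Haar measure leaves only the rotation by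
the weight of g. -/
theorem IsLocalSystem.avgT_torusAct (h : IsLocalSystem p D R d) (g : Torus κ) {x : R2n n}
    (hx : ‖x‖ < R - 4 * d) : avgT p D (R - d) (torusAct p D (R - d) g x) =
      rotC (torusWeight p g) (avgT p D (R - d) x) := by
  rw [avgT_eq, avgT_eq]
  have h1 : ∀ k, rotC (torusWeight p k)⁻¹ (torusAct p D (R - d) k (torusAct p D (R - d) g x)) =
      rotC (torusWeight p g) ((fun k => rotC (torusWeight p k)⁻¹ (torusAct p D (R - d) k x))
        (k * g)) := by
    intro k
    simp only
    rw [h.torus_mul k g x hx, ← rotC_mul_apply, torusWeight_mul, mul_inv, mul_comm, mul_assoc,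
      inv_mul_cancel, mul_one]
  simp_rw [h1]
  rw [ContinuousLinearMap.integral_comp_comm]
  · congr 1
    exact MeasureTheory.integral_mul_right_eq_self (μ := torusMeasure κ)
      (fun k => rotC (torusWeight p k)⁻¹ (torusAct p D (R - d) k x)) g
  · have h2 : MeasureTheory.Integrable
        (fun k => rotC (torusWeight p k)⁻¹ (torusAct p D (R - d) k x)) (torusMeasure κ) := by
      refine (integrable_path (torusFlow p D (R - d) x)).congr
        (Filter.Eventually.of_forall fun g => ?_)
      simp only [torusAct, rotC_inv_rotC]
    exact h2.comp_mul_right g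

/-- Γ commutes with the torus, so in each summand the element g can be moved into the torus average,
which turns it into a rotation; rotations commute with one another. -/
theorem IsLocalSystem.isSymmetry_torusAct (h : IsLocalSystem p D R d) (hN : Normalizable p a D R d)
    (hd : 0 < d) (g : Torus κ) :
    IsSymmetry p a D R d (torusWeight p g) (torusAct p D (R - d) g) where
  norm_lt r hr x hx := hN.lin.norm_torusAct_lt hd.le hr hx g
  differentiableAt x hx :=
    hN.lin.differentiableAt_torusAct hd (h.contDiffOn.of_le (by norm_num)) g (by linarith)
  symplectic x hx u v := hN.lin.torusAct_symplectic hd (h.contDiffOn.of_le (by norm_num)) h.swap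
    h.closed h.momentum_closed g (by linarith) u v
  commute x hx := by
    rw [linMap, linMap, map_smul, map_sum]
    congr 1
    refine Finset.sum_congr rfl fun ψ _ => ?_
    have hlt := hN.lin.norm_finite_lt (r := R - 5 * d) (by linarith) hx ψ
    rw [h.torus_finite ψ g x hx, h.avgT_torusAct g (by linarith), ← rotC_mul_apply, mul_comm,
      rotC_mul_apply]

theorem IsLocalSystem.isSymmetry_finite (h : IsLocalSystem p D R d) (hN : Normalizable p a D R d)
    (ha : ∀ ψ χ, a (ψ * χ) = a ψ * a χ) (hd : 0 < d) (ψ : Γ) :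
    IsSymmetry p a D R d (a ψ) (fun x => (D x).2.2 ψ) where
  norm_lt r hr x hx := hN.lin.norm_finite_lt (by linarith) hx ψ
  differentiableAt x hx := by
    have := differentiableAt_of_contDiffOn_ball (h.contDiffOn.of_le (by norm_num))
      (show ‖x‖ < R by linarith)
    exact differentiableAt_pi.1 this.snd.snd ψ
  symplectic x hx u v := h.finite_symplectic ψ x hx u v
  commute x hx := by
    rw [linMap, linMap, map_smul, map_sum]
    congr 1
    -- Reindexing the average over Γ by right translation is the finite analogue of the invariance
    -- of Haar measure.
    refine Fintype.sum_equiv (Equiv.mulRight ψ) _ _ fun χ => ?_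
    rw [Equiv.coe_mulRight, h.finite_mul χ ψ x hx, ← rotC_mul_apply, ha, mul_inv, mul_comm, mul_assoc,
      inv_mul_cancel, mul_one]

end LocalSystem

/-! ### Passing between the manifold and a chart -/

section Chart

variable {n : ℕ} {M : Type*} [TopologicalSpace M] [ChartedSpace (R2n n) M] {s : WithTop ℕ∞}
  [IsManifold 𝓘(ℝ, R2n n) s M] {φ : OpenPartialHomeomorph M (R2n n)}

/-- The derivative of the inverse of a chart. -/
def chartDeriv (φ : OpenPartialHomeomorph M (R2n n)) (x : R2n n) : R2n n →L[ℝ] R2n n :=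
  mfderiv 𝓘(ℝ, R2n n) 𝓘(ℝ, R2n n) φ.symm x

theorem mdifferentiable_of_mem_maximalAtlas (hs : s ≠ 0)
    (hφ : φ ∈ IsManifold.maximalAtlas 𝓘(ℝ, R2n n) s M) :
    φ.MDifferentiable 𝓘(ℝ, R2n n) 𝓘(ℝ, R2n n) :=
  ⟨(contMDiffOn_of_mem_maximalAtlas hφ).mdifferentiableOn hs,
    (contMDiffOn_symm_of_mem_maximalAtlas hφ).mdifferentiableOn hs⟩

section

variable {E' : Type*} [NormedAddCommGroup E'] [NormedSpace ℝ E'] {f : E' → M} {x : E'}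

theorem differentiableAt_chart_comp (hφ : φ.MDifferentiable 𝓘(ℝ, R2n n) 𝓘(ℝ, R2n n))
    (hf : MDifferentiableAt 𝓘(ℝ, E') 𝓘(ℝ, R2n n) f x) (hx : f x ∈ φ.source) :
    DifferentiableAt ℝ (φ ∘ f) x :=
  ((hφ.mdifferentiableAt hx).comp x hf).differentiableAt

theorem mfderiv_eq_chartDeriv_comp (hφ : φ.MDifferentiable 𝓘(ℝ, R2n n) 𝓘(ℝ, R2n n))
    (hf : MDifferentiableAt 𝓘(ℝ, E') 𝓘(ℝ, R2n n) f x) (hx : f x ∈ φ.source) :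
    (show E' →L[ℝ] R2n n from mfderiv 𝓘(ℝ, E') 𝓘(ℝ, R2n n) f x) =
      (chartDeriv φ (φ (f x))).comp (fderiv ℝ (φ ∘ f) x) := by
  have h1 : φ.symm ∘ (φ ∘ f) =ᶠ[𝓝 x] f := by
    filter_upwards [hf.continuousAt.preimage_mem_nhds (φ.open_source.mem_nhds hx)] with y hy
    exact φ.left_inv hy
  have h2 : MDifferentiableAt 𝓘(ℝ, R2n n) 𝓘(ℝ, R2n n) φ.symm ((φ ∘ f) x) :=
    hφ.mdifferentiableAt_symm (φ.map_source hx)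
  have h3 : MDifferentiableAt 𝓘(ℝ, E') 𝓘(ℝ, R2n n) (φ ∘ f) x :=
    (differentiableAt_chart_comp hφ hf hx).mdifferentiableAt
  have h4 := mfderiv_comp x h2 h3
  rw [mfderiv_eq_fderiv] at h4
  have h5 : (show E' →L[ℝ] R2n n from mfderiv 𝓘(ℝ, E') 𝓘(ℝ, R2n n) (φ.symm ∘ (φ ∘ f)) x) =
      (show E' →L[ℝ] R2n n from mfderiv 𝓘(ℝ, E') 𝓘(ℝ, R2n n) f x) := h1.mfderiv_eq
  rw [← h5]
  exact h4

end

theorem bijective_chartDeriv (hφ : φ.MDifferentiable 𝓘(ℝ, R2n n) 𝓘(ℝ, R2n n)) {x : R2n n}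
    (hx : x ∈ φ.target) : Function.Bijective (chartDeriv φ x) :=
  ⟨(hφ.symm.mfderiv_injective hx), (hφ.symm.mfderiv_surjective hx)⟩

theorem vec_update_zero (u u' v : R2n n) : Function.update ![u, v] 0 u' = ![u', v] := by
  ext i : 1
  fin_cases i <;> rfl

theorem vec_update_one (u v v' : R2n n) : Function.update ![u, v] 1 v' = ![u, v'] := by
  ext i : 1
  fin_cases i <;> rfl

/-- The bilinear form that corresponds to an alternating map of two variables. -/
def bilOf : (R2n n [⋀^Fin 2]→L[ℝ] ℝ) →L[ℝ] (R2n n →L[ℝ] R2n n →L[ℝ] ℝ) :=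
  let A : (R2n n [⋀^Fin 2]→L[ℝ] ℝ) →ₗ[ℝ] (R2n n →L[ℝ] R2n n →L[ℝ] ℝ) :=
    { toFun := fun β => LinearMap.mkContinuous₂ (LinearMap.mk₂ ℝ (fun u v => β ![u, v])
        (fun u u' v => by
          have := β.map_update_add ![u, v] 0 u u'
          simpa only [vec_update_zero] using this)
        (fun c u v => by
          have := β.map_update_smul ![u, v] 0 c u
          simpa only [vec_update_zero] using this)
        (fun u v v' => by
          have := β.map_update_add ![u, v] 1 v v'
          simpa only [vec_update_one] using this)
        (fun c u v => by
          have := β.map_update_smul ![u, v] 1 c v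
          simpa only [vec_update_one] using this)) ‖β‖ (fun u v => by
            have := β.le_opNorm ![u, v]
            simpa [Fin.prod_univ_two, mul_assoc] using this)
      map_add' := fun β β' => by ext; simp
      map_smul' := fun c β => by ext; simp }
  A.mkContinuous 1 (fun β => by
    rw [one_mul]
    refine ContinuousLinearMap.opNorm_le_bound₂ _ (norm_nonneg _) fun u v => ?_
    have := β.le_opNorm ![u, v]
    simpa [A, Fin.prod_univ_two, mul_assoc] using this)

@[simp] theorem bilOf_apply (β : R2n n [⋀^Fin 2]→L[ℝ] ℝ) (u v : R2n n) :
    bilOf β u v = β ![u, v] := rfl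

theorem bilOf_swap (β : R2n n [⋀^Fin 2]→L[ℝ] ℝ) (u v : R2n n) : bilOf β u v = -bilOf β v u := by
  have h : β (![v, u] ∘ Equiv.swap 0 1) = -β ![v, u] :=
    β.toAlternatingMap.map_swap ![v, u] (i := 0) (j := 1) (by simp)
  rw [bilOf_apply, bilOf_apply, ← h]
  congr 1
  ext i : 1
  fin_cases i <;> rfl

theorem bilOf_injective : Function.Injective (bilOf (n := n)) := by
  intro β β' h
  ext v
  have h1 : v = ![v 0, v 1] := by
    ext i : 1
    fin_cases i <;> rfl
  rw [h1]
  exact DFunLike.congr_fun (DFunLike.congr_fun h (v 0)) (v 1)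

/-- A left inverse of `bilOf`. -/
theorem exists_leftInverse_bilOf : ∃ L : (R2n n →L[ℝ] R2n n →L[ℝ] ℝ) →L[ℝ] (R2n n [⋀^Fin 2]→L[ℝ] ℝ),
    ∀ β, L (bilOf β) = β := by
  obtain ⟨L, hL⟩ := LinearMap.exists_leftInverse_of_injective (bilOf (n := n)).toLinearMap
    (LinearMap.ker_eq_bot.2 bilOf_injective)
  exact ⟨LinearMap.toContinuousLinearMap L, fun β => DFunLike.congr_fun hL β⟩

/-- `bilOf` is injective and linear in finite dimension, so a continuous left inverse transfers
regularity from bilinear forms back to alternating maps. -/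
theorem contDiffAt_of_bilOf {A : Type*} [NormedAddCommGroup A] [NormedSpace ℝ A] {k : WithTop ℕ∞}
    {f : A → R2n n [⋀^Fin 2]→L[ℝ] ℝ} {x : A} (h : ContDiffAt ℝ k (fun x => bilOf (f x)) x) :
    ContDiffAt ℝ k f x := by
  obtain ⟨L, hL⟩ := exists_leftInverse_bilOf (n := n)
  have := L.contDiff.contDiffAt.comp x h
  exact this.congr_of_eventuallyEq (Filter.Eventually.of_forall fun y => (hL _).symm)

/-- The alternating sum in `extDeriv` has three terms; antisymmetry of the middle one turns it into
the cyclic sum of `IsClosedAt`. -/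
theorem isClosedAt_bilOf {f : R2n n → R2n n [⋀^Fin 2]→L[ℝ] ℝ} {x : R2n n}
    (hf : DifferentiableAt ℝ f x) (h : extDeriv f x = 0) : IsClosedAt (fun x => bilOf (f x)) x := by
  have hd : fderiv ℝ (fun x => bilOf (f x)) x = bilOf.comp (fderiv ℝ f x) :=
    (bilOf.hasFDerivAt.comp x hf.hasFDerivAt).fderiv
  intro a b c
  have h1 := DFunLike.congr_fun h ![a, b, c]
  rw [extDeriv_apply hf] at h1
  rw [hd]
  simp only [ContinuousLinearMap.comp_apply]
  have e0 : (0 : Fin 3).removeNth ![a, b, c] = ![b, c] := by ext i : 1; fin_cases i <;> rfl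
  have e1 : (1 : Fin 3).removeNth ![a, b, c] = ![a, c] := by ext i : 1; fin_cases i <;> rfl
  have e2 : (2 : Fin 3).removeNth ![a, b, c] = ![a, b] := by ext i : 1; fin_cases i <;> rfl
  have h2 : bilOf (fderiv ℝ f x a) b c - bilOf (fderiv ℝ f x b) a c +
      bilOf (fderiv ℝ f x c) a b = 0 := by
    have key : ∀ a b c, fderiv ℝ (fun x => f x ![b, c]) x a = bilOf (fderiv ℝ f x a) b c := by
      intro a b c
      have h1 := ((bilOf.hasFDerivAt.comp x hf.hasFDerivAt).clm_apply
        (hasFDerivAt_const b x)).clm_apply (hasFDerivAt_const c x)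
      have h2 : HasFDerivAt (fun x => f x ![b, c]) _ x := h1
      rw [h2.fderiv]
      simp
    rw [← key, ← key, ← key]
    simpa [Fin.sum_univ_three, e0, e1, e2, ← sub_eq_add_neg] using h1
  rw [bilOf_swap (fderiv ℝ f x b) c a]
  linarith

variable {Ω : TwoForm n M}

/-- A two-form, as a function with values in the alternating maps of the model space. -/
def rawForm (Ω : TwoForm n M) (m : M) : R2n n [⋀^Fin 2]→L[ℝ] ℝ := Ω m

theorem formInChart_apply (φ : OpenPartialHomeomorph M (R2n n)) (Ω : TwoForm n M) (x : R2n n)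
    (v : Fin 2 → R2n n) :
    formInChart φ Ω x v = rawForm Ω (φ.symm x) (fun i => chartDeriv φ x (v i)) := rfl

theorem bilOf_formInChart (φ : OpenPartialHomeomorph M (R2n n)) (Ω : TwoForm n M) (x u v : R2n n) :
    bilOf (formInChart φ Ω x) u v = bilOf (rawForm Ω (φ.symm x)) (chartDeriv φ x u)
      (chartDeriv φ x v) := by
  rw [bilOf_apply, bilOf_apply, formInChart_apply]
  congr 1
  ext i : 1
  fin_cases i <;> rfl

/-- The change of coordinates of a two-form. -/
theorem formInChart_eq_pullback {e : OpenPartialHomeomorph M (R2n n)}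
    (hφ : φ.MDifferentiable 𝓘(ℝ, R2n n) 𝓘(ℝ, R2n n))
    (he : e.MDifferentiable 𝓘(ℝ, R2n n) 𝓘(ℝ, R2n n)) {x : R2n n} (hx : x ∈ φ.target)
    (hxe : φ.symm x ∈ e.source) :
    bilOf (formInChart φ Ω x) = pullB (bilOf (formInChart e Ω (e (φ.symm x))))
      (fderiv ℝ (e ∘ φ.symm) x) := by
  have h := mfderiv_eq_chartDeriv_comp he (hφ.mdifferentiableAt_symm hx) hxe
  have h' : ∀ u, chartDeriv φ x u = chartDeriv e (e (φ.symm x)) (fderiv ℝ (e ∘ φ.symm) x u) :=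
    fun u => DFunLike.congr_fun h u
  ext u v : 2
  rw [pullB_apply, bilOf_formInChart, bilOf_formInChart, e.left_inv hxe, h', h']

theorem contDiffOn_transition {e : OpenPartialHomeomorph M (R2n n)}
    (hφ : φ ∈ IsManifold.maximalAtlas 𝓘(ℝ, R2n n) s M)
    (he : e ∈ IsManifold.maximalAtlas 𝓘(ℝ, R2n n) s M) :
    ContDiffOn ℝ s (e ∘ φ.symm) (φ.target ∩ φ.symm ⁻¹' e.source) := by
  rw [← contMDiffOn_iff_contDiffOn]
  exact (contMDiffOn_of_mem_maximalAtlas he).comp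
    ((contMDiffOn_symm_of_mem_maximalAtlas hφ).mono inter_subset_left) fun x hx => hx.2

theorem add_one_le_of_smooth (hs : s = ∞ ∨ s = ω) : s + 1 ≤ s := by
  rcases hs with rfl | rfl <;> exact le_rfl

theorem ne_zero_of_smooth (hs : s = ∞ ∨ s = ω) : s ≠ 0 := by
  rcases hs with rfl | rfl <;> simp

theorem two_le_of_smooth (hs : s = ∞ ∨ s = ω) : (2 : WithTop ℕ∞) ≤ s := by
  rcases hs with rfl | rfl
  · exact WithTop.coe_le_coe.2 le_top
  · exact le_top

/-- The definition speaks of charts of the atlas only. For a chart of the maximal atlas the form is,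
near each point, the pullback of such an expression under a transition map. -/
theorem IsSymplecticOn.form_spec {N : Set M} (hs : s = ∞ ∨ s = ω) (hΩ : IsSymplecticOn s Ω N)
    (hN : IsOpen N) (hφ : φ ∈ IsManifold.maximalAtlas 𝓘(ℝ, R2n n) s M)
    {x : R2n n} (hx : x ∈ φ.target) (hxN : φ.symm x ∈ N) :
    ContDiffAt ℝ s (fun x => bilOf (formInChart φ Ω x)) x ∧
      IsClosedAt (fun x => bilOf (formInChart φ Ω x)) x := by
  set e := chartAt (R2n n) (φ.symm x) with he
  have hea : e ∈ atlas (R2n n) M := chart_mem_atlas _ _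
  have hem : e ∈ IsManifold.maximalAtlas 𝓘(ℝ, R2n n) s M := IsManifold.chart_mem_maximalAtlas _
  have hxe : φ.symm x ∈ e.source := mem_chart_source _ _
  have hφd := mdifferentiable_of_mem_maximalAtlas (ne_zero_of_smooth hs) hφ
  have hed := mdifferentiable_of_mem_maximalAtlas (ne_zero_of_smooth hs) hem
  set S := φ.target ∩ φ.symm ⁻¹' (e.source ∩ N) with hS
  have hSo : IsOpen S := φ.isOpen_inter_preimage_symm (e.open_source.inter hN)
  have hxS : x ∈ S := ⟨hx, hxe, hxN⟩
  have hf : ContDiffOn ℝ s (e ∘ φ.symm) S :=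
    (contDiffOn_transition hφ hem).mono fun y hy => ⟨hy.1, hy.2.1⟩
  have hmaps : MapsTo (e ∘ φ.symm) S (e.target ∩ e.symm ⁻¹' N) := fun y hy =>
    ⟨e.map_source hy.2.1, by
      simp only [mem_preimage, Function.comp_apply]
      rw [e.left_inv hy.2.1]; exact hy.2.2⟩
  have hTo : IsOpen (e.target ∩ e.symm ⁻¹' N) := e.isOpen_inter_preimage_symm hN
  have hΩe : ContDiffOn ℝ s (fun y => bilOf (formInChart e Ω y)) (e.target ∩ e.symm ⁻¹' N) :=
    bilOf.contDiff.comp_contDiffOn (hΩ.contDiffOn e hea)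
  have hev : (fun y => bilOf (formInChart φ Ω y)) =ᶠ[𝓝 x] fun y =>
      pullB (bilOf (formInChart e Ω ((e ∘ φ.symm) y))) (fderiv ℝ (e ∘ φ.symm) y) := by
    filter_upwards [hSo.mem_nhds hxS] with y hy
    exact formInChart_eq_pullback hφd hed hy.1 hy.2.1
  have hs1 : (1 : WithTop ℕ∞) ≤ s := le_trans (by norm_num) (two_le_of_smooth hs)
  refine ⟨?_, ?_⟩
  · have h1 : ContDiffOn ℝ s (fun y => pullB (bilOf (formInChart e Ω ((e ∘ φ.symm) y)))
        (fderiv ℝ (e ∘ φ.symm) y)) S :=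
      ContDiffOn.pullB (hΩe.comp hf hmaps) (hf.fderiv_of_isOpen hSo (add_one_le_of_smooth hs))
    exact (h1.contDiffAt (hSo.mem_nhds hxS)).congr_of_eventuallyEq hev
  · have hd1 : DifferentiableAt ℝ (formInChart e Ω) ((e ∘ φ.symm) x) :=
      (((hΩ.contDiffOn e hea).contDiffAt (hTo.mem_nhds (hmaps hxS))).differentiableAt
        (ne_zero_of_smooth hs))
    have h1 := IsClosedAt.pullback (w := fun y => bilOf (formInChart e Ω y)) (f := e ∘ φ.symm) (y := x)
      (isClosedAt_bilOf hd1 (hΩ.closed e hea _ (hmaps hxS)))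
      (bilOf.differentiableAt.comp _ hd1)
      ((hf.contDiffAt (hSo.mem_nhds hxS)).of_le (two_le_of_smooth hs)) (bilOf_swap _)
    intro a b c
    rw [hev.fderiv_eq]
    exact h1 a b c

theorem IsSymplecticOn.isInvertible {N : Set M} (hΩ : IsSymplecticOn s Ω N)
    (hφ : φ.MDifferentiable 𝓘(ℝ, R2n n) 𝓘(ℝ, R2n n))
    {x : R2n n} (hx : x ∈ φ.target) (hxN : φ.symm x ∈ N) :
    (bilOf (formInChart φ Ω x)).IsInvertible := by
  refine isInvertible_of_injective ((injective_iff_map_eq_zero _).2 fun u hu => ?_)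
  by_contra hne
  obtain ⟨w, hw⟩ := hΩ.nondegenerate (φ.symm x) hxN (chartDeriv φ x u) (fun h0 => hne
    ((bijective_chartDeriv hφ hx).1 (h0.trans (map_zero (chartDeriv φ x)).symm)))
  obtain ⟨v, hv⟩ := (bijective_chartDeriv hφ hx).2 w
  have h1 := DFunLike.congr_fun hu v
  rw [bilOf_formInChart, hv] at h1
  exact hw h1

end Chart

/-! ### Characterisation of Hamiltonian vectors -/

section HamVF

variable {n κ : ℕ} {Γ : Type*}

theorem hamVF_spec {z : DataSpace n κ Γ} (hi : z.1.IsInvertible) (hsw : ∀ u v, z.1 u v = -z.1 v u)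
    (l : Fin κ) (v : R2n n) : z.1 v (hamVF z l) = z.2.1 l v := by
  have h : z.1 (z.1.inverse (z.2.1 l)) = z.2.1 l := DFunLike.congr_fun hi.self_comp_inverse _
  rw [hsw, hamVF, map_neg, _root_.neg_apply, neg_neg, h]

theorem hamVF_eq {z : DataSpace n κ Γ} (hi : z.1.IsInvertible) (hsw : ∀ u v, z.1 u v = -z.1 v u)
    {l : Fin κ} {X : R2n n} (hX : ∀ v, z.1 v X = z.2.1 l v) : hamVF z l = X := by
  refine hi.injective ?_
  ext v
  rw [hsw, hamVF_spec hi hsw, ← hX, hsw, neg_neg]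

end HamVF

/-! ### The coordinate expression of a system -/

section ChartData

variable {n κ : ℕ} {M : Type*} [TopologicalSpace M] [ChartedSpace (R2n n) M] {s : WithTop ℕ∞}
  [IsManifold 𝓘(ℝ, R2n n) s M] {φ : OpenPartialHomeomorph M (R2n n)} {Γ : Type*} [Group Γ]
  {Ω : TwoForm n M} {J : Fin κ → M → ℝ} {θ : Torus κ → M → M} {N : Set M} {ρ : Γ → M → M}
  {N' : Set M}

/-- The coordinate expression of a system. -/
def chartData (φ : OpenPartialHomeomorph M (R2n n)) (Ω : TwoForm n M) (J : Fin κ → M → ℝ)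
    (ρ : Γ → M → M) (x : R2n n) : DataSpace n κ Γ :=
  (bilOf (formInChart φ Ω x), fun l => fderiv ℝ (J l ∘ φ.symm) x, fun ψ => φ (ρ ψ (φ.symm x)))

theorem chartData_swap (x u v : R2n n) :
    (chartData φ Ω J ρ x).1 u v = -(chartData φ Ω J ρ x).1 v u := bilOf_swap _ _ _

theorem contDiffOn_momentum (hJ : ∀ l, ContMDiffOn 𝓘(ℝ, R2n n) 𝓘(ℝ, ℝ) s (J l) N)
    (hφ : φ ∈ IsManifold.maximalAtlas 𝓘(ℝ, R2n n) s M) (hsub : φ.source ⊆ N) (l : Fin κ) :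
    ContDiffOn ℝ s (J l ∘ φ.symm) φ.target := by
  rw [← contMDiffOn_iff_contDiffOn]
  exact (hJ l).comp (contMDiffOn_symm_of_mem_maximalAtlas hφ) fun x hx => hsub (φ.map_target hx)

variable [Fintype Γ]

theorem IsSystem.contDiffAt_finite (h : IsSystem s Ω J θ N ρ N')
    (hφ : φ ∈ IsManifold.maximalAtlas 𝓘(ℝ, R2n n) s M) (hsub : φ.source ⊆ N') {x : R2n n}
    (hx : x ∈ φ.target) {ψ : Γ} (hxρ : ρ ψ (φ.symm x) ∈ φ.source) :
    ContDiffAt ℝ s (fun x => φ (ρ ψ (φ.symm x))) x := by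
  rw [← contMDiffAt_iff_contDiffAt]
  have h1 : ContMDiffAt 𝓘(ℝ, R2n n) 𝓘(ℝ, R2n n) s φ.symm x :=
    (contMDiffOn_symm_of_mem_maximalAtlas hφ).contMDiffAt (φ.open_target.mem_nhds hx)
  have h2 : ContMDiffAt 𝓘(ℝ, R2n n) 𝓘(ℝ, R2n n) s (ρ ψ) (φ.symm x) :=
    (h.finite.contMDiffOn ψ).contMDiffAt (h.isOpen'.mem_nhds (hsub (φ.map_target hx)))
  have h3 : ContMDiffAt 𝓘(ℝ, R2n n) 𝓘(ℝ, R2n n) s φ (ρ ψ (φ.symm x)) :=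
    (contMDiffOn_of_mem_maximalAtlas hφ).contMDiffAt (φ.open_source.mem_nhds hxρ)
  exact ContMDiffAt.comp x h3 (ContMDiffAt.comp x h2 h1)

theorem IsSystem.contDiffAt_chartData (hs : s = ∞ ∨ s = ω) (h : IsSystem s Ω J θ N ρ N')
    (hφ : φ ∈ IsManifold.maximalAtlas 𝓘(ℝ, R2n n) s M) (hsub : φ.source ⊆ N') {x : R2n n}
    (hx : x ∈ φ.target) (hxρ : ∀ ψ, ρ ψ (φ.symm x) ∈ φ.source) :
    ContDiffAt ℝ s (chartData φ Ω J ρ) x := by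
  have hxN' := hsub (φ.map_target hx)
  refine ContDiffAt.prodMk (h.symplectic.form_spec hs h.isOpen hφ hx (h.subset hxN')).1
    (ContDiffAt.prodMk (contDiffAt_pi.2 fun l => ?_) (contDiffAt_pi.2 fun ψ => ?_))
  · exact ((contDiffOn_momentum h.torus.contMDiffOn_J hφ (hsub.trans h.subset) l).fderiv_of_isOpen
      φ.open_target (add_one_le_of_smooth hs)).contDiffAt (φ.open_target.mem_nhds hx)
  · exact h.contDiffAt_finite hφ hsub hx (hxρ ψ)

theorem IsSystem.momentum_symm (hs : s = ∞ ∨ s = ω) (h : IsSystem s Ω J θ N ρ N')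
    (hφ : φ ∈ IsManifold.maximalAtlas 𝓘(ℝ, R2n n) s M) (hsub : φ.source ⊆ N') {x : R2n n}
    (hx : x ∈ φ.target) (l : Fin κ) (u v : R2n n) :
    fderiv ℝ (fun x => (chartData φ Ω J ρ x).2.1 l) x u v =
      fderiv ℝ (fun x => (chartData φ Ω J ρ x).2.1 l) x v u := by
  have h1 : ContDiffAt ℝ 2 (J l ∘ φ.symm) x :=
    ((contDiffOn_momentum h.torus.contMDiffOn_J hφ (hsub.trans h.subset) l).contDiffAt
      (φ.open_target.mem_nhds hx)).of_le (two_le_of_smooth hs)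
  exact (h1.isSymmSndFDerivAt (by simp)).eq u v

theorem fderiv_momentum (hφ : φ.MDifferentiable 𝓘(ℝ, R2n n) 𝓘(ℝ, R2n n)) {F : M → ℝ} {x : R2n n}
    (hx : x ∈ φ.target) (hF : MDifferentiableAt 𝓘(ℝ, R2n n) 𝓘(ℝ, ℝ) F (φ.symm x)) (v : R2n n) :
    fderiv ℝ (F ∘ φ.symm) x v =
      (show R2n n →L[ℝ] ℝ from mfderiv 𝓘(ℝ, R2n n) 𝓘(ℝ, ℝ) F (φ.symm x)) (chartDeriv φ x v) := by
  have h := mfderiv_comp x hF (hφ.mdifferentiableAt_symm hx)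
  rw [mfderiv_eq_fderiv] at h
  exact DFunLike.congr_fun h v

theorem IsSystem.finite_symplectic (hs : s = ∞ ∨ s = ω) (h : IsSystem s Ω J θ N ρ N')
    (hφ : φ ∈ IsManifold.maximalAtlas 𝓘(ℝ, R2n n) s M) (hsub : φ.source ⊆ N') {x : R2n n}
    (hx : x ∈ φ.target) {ψ : Γ} (hxρ : ρ ψ (φ.symm x) ∈ φ.source) (u v : R2n n) :
    bilOf (formInChart φ Ω (φ (ρ ψ (φ.symm x)))) (fderiv ℝ (fun x => φ (ρ ψ (φ.symm x))) x u)
      (fderiv ℝ (fun x => φ (ρ ψ (φ.symm x))) x v) = bilOf (formInChart φ Ω x) u v := by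
  have hs0 := ne_zero_of_smooth hs
  have hφd := mdifferentiable_of_mem_maximalAtlas hs0 hφ
  have hxN' := hsub (φ.map_target hx)
  have hρd : MDifferentiableAt 𝓘(ℝ, R2n n) 𝓘(ℝ, R2n n) (ρ ψ) (φ.symm x) :=
    ((h.finite.contMDiffOn ψ).contMDiffAt (h.isOpen'.mem_nhds hxN')).mdifferentiableAt hs0
  have hc := mfderiv_comp x hρd (hφd.mdifferentiableAt_symm hx)
  have hc' := mfderiv_eq_chartDeriv_comp (f := ρ ψ ∘ φ.symm) (x := x) hφd
    (hρd.comp x (hφd.mdifferentiableAt_symm hx)) hxρ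
  set L : R2n n →L[ℝ] R2n n := mfderiv 𝓘(ℝ, R2n n) 𝓘(ℝ, R2n n) (ρ ψ) (φ.symm x) with hL
  have key : ∀ u, chartDeriv φ (φ (ρ ψ (φ.symm x))) (fderiv ℝ (fun x => φ (ρ ψ (φ.symm x))) x u) =
      L (chartDeriv φ x u) := fun u =>
    (DFunLike.congr_fun hc' u).symm.trans (DFunLike.congr_fun hc u)
  rw [bilOf_formInChart, bilOf_formInChart, key, key, φ.left_inv hxρ]
  have hsy := h.finite.symplectic ψ (φ.symm x) hxN'
  have hsy' : (rawForm Ω (ρ ψ (φ.symm x))).compContinuousLinearMap L = rawForm Ω (φ.symm x) := hsy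
  rw [← hsy', bilOf_apply, bilOf_apply, ContinuousAlternatingMap.compContinuousLinearMap_apply]
  congr 1
  ext i : 1
  fin_cases i <;> rfl

/-- A symplectic map that preserves J preserves the Hamiltonian field of J. The defining relation at
the image point is tested on vectors `L v`, which suffices because a map preserving a nondegenerate
form is injective, hence surjective. -/
theorem IsSystem.finite_hamVF (hs : s = ∞ ∨ s = ω) (h : IsSystem s Ω J θ N ρ N')
    (hφ : φ ∈ IsManifold.maximalAtlas 𝓘(ℝ, R2n n) s M) (hsub : φ.source ⊆ N') {x : R2n n}
    (hx : x ∈ φ.target) {ψ : Γ} (hxρ : ρ ψ (φ.symm x) ∈ φ.source) (l : Fin κ) :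
    fderiv ℝ (fun x => φ (ρ ψ (φ.symm x))) x (hamVF (chartData φ Ω J ρ x) l) =
      hamVF (chartData φ Ω J ρ (φ (ρ ψ (φ.symm x)))) l := by
  have hs0 := ne_zero_of_smooth hs
  have hφd := mdifferentiable_of_mem_maximalAtlas hs0 hφ
  have hxN' := hsub (φ.map_target hx)
  have hi : ∀ x ∈ φ.target, (chartData φ Ω J ρ x).1.IsInvertible := fun x hx =>
    h.symplectic.isInvertible hφd hx (h.subset (hsub (φ.map_target hx)))
  set L := fderiv ℝ (fun x => φ (ρ ψ (φ.symm x))) x with hL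
  set y := φ (ρ ψ (φ.symm x)) with hy
  have hyt : y ∈ φ.target := φ.map_source hxρ
  have hsym := h.finite_symplectic hs hφ hsub hx hxρ
  have hinj : Function.Injective L := by
    refine (injective_iff_map_eq_zero _).2 fun u hu => ?_
    refine (hi x hx).injective ?_
    ext v
    have := hsym u v
    rw [← hL, hu] at this
    rw [map_zero, _root_.zero_apply]
    change bilOf (formInChart φ Ω x) u v = 0
    rw [← this, map_zero, _root_.zero_apply]
  have hsurj : Function.Surjective L := LinearMap.surjective_of_injective (f := L.toLinearMap) hinj
  have hd : HasFDerivAt (fun x => φ (ρ ψ (φ.symm x))) L x :=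
    ((h.contDiffAt_finite hφ hsub hx hxρ).differentiableAt hs0).hasFDerivAt
  have hJd : ∀ y ∈ φ.target, DifferentiableAt ℝ (J l ∘ φ.symm) y := fun y hy =>
    ((contDiffOn_momentum h.torus.contMDiffOn_J hφ (hsub.trans h.subset) l).contDiffAt
      (φ.open_target.mem_nhds hy)).differentiableAt hs0
  have hμ : ∀ v, fderiv ℝ (J l ∘ φ.symm) y (L v) = fderiv ℝ (J l ∘ φ.symm) x v := by
    have h1 : HasFDerivAt (fun x => (J l ∘ φ.symm) (φ (ρ ψ (φ.symm x)))) _ x :=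
      HasFDerivAt.comp (g := J l ∘ φ.symm) x (hJd y hyt).hasFDerivAt hd
    have h2 := h1.unique ((hJd x hx).hasFDerivAt.congr_of_eventuallyEq (by
      have hcont : ContinuousAt (fun x => ρ ψ (φ.symm x)) x := by
        have h3 : ContinuousAt (ρ ψ) (φ.symm x) :=
          ((h.finite.contMDiffOn ψ).contMDiffAt (h.isOpen'.mem_nhds hxN')).continuousAt
        exact ContinuousAt.comp h3 (φ.continuousAt_symm hx)
      filter_upwards [hcont.preimage_mem_nhds (φ.open_source.mem_nhds hxρ),
        φ.open_target.mem_nhds hx] with z hz hzt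
      simp only [Function.comp_apply]
      rw [φ.left_inv hz]
      exact h.finite.preserves_J ψ l _ (hsub (φ.map_target hzt))))
    exact fun v => DFunLike.congr_fun h2 v
  refine (hamVF_eq (hi y hyt) (fun u v => chartData_swap _ _ _) fun v => ?_).symm
  obtain ⟨v, rfl⟩ := hsurj v
  calc (chartData φ Ω J ρ y).1 (L v) (L (hamVF (chartData φ Ω J ρ x) l))
      = (chartData φ Ω J ρ x).1 v (hamVF (chartData φ Ω J ρ x) l) := hsym _ _
    _ = (chartData φ Ω J ρ x).2.1 l v := hamVF_spec (hi x hx) (fun u v => chartData_swap _ _ _) l v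
    _ = (chartData φ Ω J ρ y).2.1 l (L v) := (hμ v).symm

theorem expT_add (σ τ : Fin κ → ℝ) : expT (σ + τ) = expT σ * expT τ := by
  ext1 l
  simp [expT, Circle.exp_add]

theorem expT_zero : expT (0 : Fin κ → ℝ) = 1 := by
  ext1 l
  simp [expT]

theorem expT_smul_single (l : Fin κ) (t : ℝ) :
    expT (t • (Pi.single l 1 : Fin κ → ℝ)) = Pi.mulSingle l (Circle.exp t) := by
  ext1 i
  by_cases hi : i = l
  · subst hi; simp [expT]
  · simp [expT, hi]

/-- The generator of the torus action in a chart. -/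
theorem IsHamiltonianTorusAction.hasDerivAt_zero (hs : s = ∞ ∨ s = ω)
    (h : IsHamiltonianTorusAction s Ω J θ N) (hN : IsOpen N) (hΩ : IsSymplecticOn s Ω N)
    (hφ : φ ∈ IsManifold.maximalAtlas 𝓘(ℝ, R2n n) s M) {m : M} (hm : m ∈ φ.source) (hmN : m ∈ N)
    (τ : Fin κ → ℝ) :
    HasDerivAt (fun t : ℝ => φ (θ (expT (t • τ)) m))
      (∑ l, τ l • hamVF (chartData φ Ω J ρ (φ m)) l) 0 := by
  have hs0 := ne_zero_of_smooth hs
  have hφd := mdifferentiable_of_mem_maximalAtlas hs0 hφ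
  set F : (Fin κ → ℝ) → M := fun σ => θ (expT σ) m with hF
  have hF0 : F 0 = m := by rw [hF]; simp only [expT_zero]; exact h.one m hmN
  have hFd : MDifferentiable 𝓘(ℝ, Fin κ → ℝ) 𝓘(ℝ, R2n n) F := by
    intro σ
    have h1 : ContMDiffAt (𝓘(ℝ, Fin κ → ℝ).prod 𝓘(ℝ, R2n n)) 𝓘(ℝ, R2n n) s
        (fun τm : (Fin κ → ℝ) × M => θ (fun l => Circle.exp (τm.1 l)) τm.2) (σ, m) :=
      h.contMDiffOn.contMDiffAt ((isOpen_univ.prod hN).mem_nhds ⟨mem_univ _, hmN⟩)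
    have h2 : ContMDiffAt 𝓘(ℝ, Fin κ → ℝ) (𝓘(ℝ, Fin κ → ℝ).prod 𝓘(ℝ, R2n n)) s
        (fun σ : Fin κ → ℝ => (σ, m)) σ := contMDiffAt_id.prodMk contMDiffAt_const
    exact (ContMDiffAt.comp (g := fun τm : (Fin κ → ℝ) × M => θ (fun l => Circle.exp (τm.1 l)) τm.2)
      σ h1 h2).mdifferentiableAt hs0
  have hHd : DifferentiableAt ℝ (φ ∘ F) 0 :=
    differentiableAt_chart_comp hφd (hFd 0) (by rw [hF0]; exact hm)
  set H' := fderiv ℝ (φ ∘ F) 0 with hH'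
  have hline : ∀ τ : Fin κ → ℝ, HasDerivAt (fun t : ℝ => (φ ∘ F) (t • τ)) (H' τ) 0 := by
    intro τ
    have h1 : HasDerivAt (fun t : ℝ => t • τ) τ 0 := by simpa using (hasDerivAt_id (0 : ℝ)).smul_const τ
    have h2 : HasFDerivAt (φ ∘ F) H' ((0 : ℝ) • τ) := by rw [zero_smul]; exact hHd.hasFDerivAt
    exact h2.comp_hasDerivAt (0 : ℝ) h1
  have hxt : φ m ∈ φ.target := φ.map_source hm
  -- The hypothesis on generators concerns single circles; linearity of the derivative of σ ↦ θ(exp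
  -- σ) m at 0 extends it to all directions.
  have hgen : ∀ l, hamVF (chartData φ Ω J ρ (φ m)) l = H' (Pi.single l 1) := by
    intro l
    obtain ⟨X, hX, hJX⟩ := h.generates l m hmN
    set c : ℝ → M := fun t : ℝ => θ (Pi.mulSingle l (Circle.exp t)) m with hc
    have hcF : c = F ∘ fun t : ℝ => t • (Pi.single l 1 : Fin κ → ℝ) := by
      ext1 t
      simp only [hc, hF, Function.comp_apply, expT_smul_single]
    have hc0 : c 0 = m := by rw [hcF]; simp only [Function.comp_apply, zero_smul]; exact hF0
    have hcd : MDifferentiableAt 𝓘(ℝ, ℝ) 𝓘(ℝ, R2n n) c 0 := by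
      rw [hcF]
      refine MDifferentiableAt.comp (0 : ℝ) (hFd _) ?_
      exact DifferentiableAt.mdifferentiableAt (by fun_prop)
    have h1 := mfderiv_eq_chartDeriv_comp hφd hcd (by rw [hc0]; exact hm)
    have h2 : fderiv ℝ (φ ∘ c) 0 1 = H' (Pi.single l 1) := by
      have : HasDerivAt (φ ∘ c) (H' (Pi.single l 1)) 0 := by
        rw [hcF]; exact hline _
      rw [fderiv_apply_one_eq_deriv, this.deriv]
    have h3 : (show R2n n from X) = chartDeriv φ (φ m) (H' (Pi.single l 1)) := by
      have h4 := DFunLike.congr_fun h1 1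
      rw [ContinuousLinearMap.comp_apply, h2, hc0] at h4
      exact hX.trans h4
    refine hamVF_eq (hΩ.isInvertible hφd hxt (by rwa [φ.left_inv hm]))
      (fun u v => chartData_swap _ _ _) fun v => ?_
    have hJd : MDifferentiableAt 𝓘(ℝ, R2n n) 𝓘(ℝ, ℝ) (J l) (φ.symm (φ m)) := by
      rw [φ.left_inv hm]
      exact ((h.contMDiffOn_J l).contMDiffAt (hN.mem_nhds hmN)).mdifferentiableAt hs0
    change bilOf (formInChart φ Ω (φ m)) v _ = fderiv ℝ (J l ∘ φ.symm) (φ m) v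
    rw [fderiv_momentum hφd hxt hJd, bilOf_formInChart, ← h3, φ.left_inv hm]
    exact (hJX _).symm
  refine (hline τ).congr_deriv ?_
  have hτ : τ = ∑ l, τ l • (Pi.single l 1 : Fin κ → ℝ) := by
    ext i
    simp [Finset.sum_apply, Pi.single_apply]
  conv_lhs => rw [hτ]
  simp only [map_sum, map_smul, hgen]

/-- By the group law the derivative at time t is the derivative at time 0 for the point reached at
time t. -/
theorem IsHamiltonianTorusAction.hasDerivAt_curve (hs : s = ∞ ∨ s = ω)
    (h : IsHamiltonianTorusAction s Ω J θ N) (hN : IsOpen N) (hΩ : IsSymplecticOn s Ω N)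
    (hφ : φ ∈ IsManifold.maximalAtlas 𝓘(ℝ, R2n n) s M) {m : M} (hmN : m ∈ N)
    (τ : Fin κ → ℝ) {t : ℝ} (ht : θ (expT (t • τ)) m ∈ φ.source) :
    HasDerivAt (fun t : ℝ => φ (θ (expT (t • τ)) m))
      (∑ l, τ l • hamVF (chartData φ Ω J ρ (φ (θ (expT (t • τ)) m))) l) t := by
  have h1 := h.hasDerivAt_zero (ρ := ρ) hs hN hΩ hφ ht (h.mapsTo _ hmN) τ
  have h2 : HasDerivAt (fun r : ℝ => φ (θ (expT ((r - t) • τ)) (θ (expT (t • τ)) m)))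
      (∑ l, τ l • hamVF (chartData φ Ω J ρ (φ (θ (expT (t • τ)) m))) l) t :=
    HasDerivAt.comp_sub_const (f := fun r : ℝ => φ (θ (expT (r • τ)) (θ (expT (t • τ)) m))) t t
      (by rw [sub_self]; exact h1)
  refine h2.congr_of_eventuallyEq (Filter.Eventually.of_forall fun r => ?_)
  simp only
  rw [← h.mul _ _ m hmN, ← expT_add, ← add_smul, sub_add_cancel]

theorem IsHamiltonianTorusAction.continuous_curve
    (h : IsHamiltonianTorusAction s Ω J θ N) {m : M} (hmN : m ∈ N) (τ : Fin κ → ℝ) :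
    Continuous fun t : ℝ => θ (expT (t • τ)) m := by
  have h1 : ContinuousOn (fun τm : (Fin κ → ℝ) × M => θ (fun l => Circle.exp (τm.1 l)) τm.2)
    (univ ×ˢ N) := h.contMDiffOn.continuousOn
  exact h1.comp_continuous (f := fun t : ℝ => (t • τ, m)) (by fun_prop) fun t => ⟨mem_univ _, hmN⟩

end ChartData

/-! ### Uniqueness of integral curves -/

section Uniqueness

variable {n κ : ℕ} {Γ : Type*} [Fintype Γ] {p : Fin n → Fin κ → ℤ} {a : Γ → Fin n → Circle}
  {D : R2n n → DataSpace n κ Γ} {R d : ℝ}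

/-- The one-sided version includes the initial time, as uniqueness of solutions requires. -/
theorem Linearizable.hasDerivWithinAt_torusCurve (h : Linearizable p a D R d) (hd : 0 ≤ d)
    {x : R2n n} (hx : ‖x‖ ≤ R - 2 * d) (τ : AngleCube κ) {t : ℝ} (ht : t ∈ Ico (0 : ℝ) 1) :
    HasDerivWithinAt (torusCurve p D (R - d) x τ)
      (∑ l, (τ : Fin κ → ℝ) l • hamVF (D (torusCurve p D (R - d) x τ t)) l) (Ici t) t := by
  have hsol := h.isFlow hd hx
  have htI : t ∈ Icc (0 : ℝ) 1 := ⟨ht.1, ht.2.le⟩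
  set g : ℝ → R2n n := fun s => linField p D (angleArg κ (clampTime s, τ))
    (torusFlow p D (R - d) x (clampTime s, τ)) with hg
  have hc : Continuous g := (h.small.continuous_comp hsol.mem).comp
    (continuous_clampTime.prodMk continuous_const)
  have h1 : HasDerivAt (fun t : ℝ => x + ∫ s in (0 : ℝ)..t, g s) (g t) t :=
    (intervalIntegral.integral_hasDerivAt_right (hc.intervalIntegrable _ _)
      (hc.stronglyMeasurableAtFilter _ _) hc.continuousAt).const_add x
  have h2 : HasDerivWithinAt (fun s => torusFlow p D (R - d) x (clampTime s, τ)) (g t) (Ici t) t := by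
    have hev : ∀ s ∈ Icc (0 : ℝ) 1, torusFlow p D (R - d) x (clampTime s, τ) =
        x + ∫ s in (0 : ℝ)..s, g s := fun s hs => by
      rw [hsol.eq, clampTime_of_mem hs]
    refine h1.hasDerivWithinAt.congr_of_eventuallyEq ?_ (hev t htI)
    filter_upwards [Icc_mem_nhdsGE ht.2] with s hs
    exact hev s ⟨ht.1.trans hs.1, hs.2⟩
  refine ((hasDerivAt_rotT_smul p (τ : Fin κ → ℝ) t).hasDerivWithinAt.clm_apply h2).congr_deriv ?_
  simp only [hg, linField, angleArg, ContinuousMap.coe_mk, clampTime_of_mem htI, torusCurve,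
    ContinuousLinearMap.comp_apply, _root_.sum_apply, _root_.smul_apply, map_sum, map_smul,
    rotT_rotT_neg, ← Finset.sum_add_distrib, ← smul_add]
  refine Finset.sum_congr rfl fun l _ => ?_
  rw [add_sub_cancel]

/-- At time 0 the rotating coordinates agree with the fixed ones, so the Hamiltonian field is a
1/2-Lipschitz field plus a linear one. -/
theorem Linearizable.lipschitz_hamVF (h : Linearizable p a D R d) (τ : AngleCube κ) :
    ∃ K, LipschitzOnWith K (fun y => ∑ l, (τ : Fin κ → ℝ) l • hamVF (D y) l)
      (Metric.closedBall 0 (R - d)) := by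
  set L : R2n n →L[ℝ] R2n n := ∑ l, (τ : Fin κ → ℝ) l • gen p l with hL
  refine ⟨⟨1 / 2 + ‖L‖, by positivity⟩, LipschitzOnWith.of_dist_le_mul fun y hy y' hy' => ?_⟩
  have h1 := h.small.lip (0, τ) y hy y' hy'
  have h2 : ∀ y, (∑ l, (τ : Fin κ → ℝ) l • hamVF (D y) l) =
      linField p D (angleArg κ (0, τ)) y + L y := by
    intro y
    simp only [linField, angleArg, ContinuousMap.coe_mk, hL, _root_.sum_apply, _root_.smul_apply,
      ← Finset.sum_add_distrib]
    refine Finset.sum_congr rfl fun l _ => ?_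
    simp [rotT_zero, smul_sub]
  rw [dist_eq_norm, dist_eq_norm, h2, h2, add_sub_add_comm, ← map_sub]
  calc _ ≤ 1 / 2 * ‖y - y'‖ + ‖L‖ * ‖y - y'‖ :=
        (norm_add_le _ _).trans (add_le_add h1 (L.le_opNorm _))
    _ = (1 / 2 + ‖L‖) * ‖y - y'‖ := by ring

theorem Linearizable.eqOn_torusCurve (h : Linearizable p a D R d) (hd : 0 ≤ d)
    {x : R2n n} (hx : ‖x‖ < R - 2 * d) (τ : AngleCube κ) {f : ℝ → R2n n} {t₀ t₁ : ℝ} (h0 : 0 ≤ t₀)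
    (h1 : t₁ ≤ 1) (hf : ContinuousOn f (Icc t₀ t₁))
    (hf' : ∀ t ∈ Ico t₀ t₁, HasDerivWithinAt f (∑ l, (τ : Fin κ → ℝ) l • hamVF (D (f t)) l) (Ici t) t)
    (hfR : ∀ t ∈ Ico t₀ t₁, ‖f t‖ ≤ R - d) (heq : f t₀ = torusCurve p D (R - d) x τ t₀) :
    EqOn f (torusCurve p D (R - d) x τ) (Icc t₀ t₁) := by
  obtain ⟨K, hK⟩ := h.lipschitz_hamVF τ
  refine ODE_solution_unique_of_mem_Icc_right (v := fun _ y => ∑ l, (τ : Fin κ → ℝ) l • hamVF (D y) l)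
    (s := fun _ => Metric.closedBall 0 (R - d)) (fun _ _ => hK) hf hf'
    (fun t ht => by simpa using hfR t ht) (continuous_torusCurve _ _ _).continuousOn
    (fun t ht => h.hasDerivWithinAt_torusCurve hd hx.le τ ⟨h0.trans ht.1, ht.2.trans_le h1⟩)
    (fun t ht => ?_) heq
  have := h.norm_torusCurve_lt hd le_rfl hx τ t
  rw [mem_closedBall_zero_iff]
  linarith

end Uniqueness

/-! ### The action on the manifold agrees with the flow in the chart -/

section SystemInChart

variable {n κ : ℕ} {M : Type*} [TopologicalSpace M] [T2Space M] [ChartedSpace (R2n n) M]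
  {s : WithTop ℕ∞} [IsManifold 𝓘(ℝ, R2n n) s M] {φ : OpenPartialHomeomorph M (R2n n)} {Γ : Type*}
  [Group Γ] [Fintype Γ] {Ω : TwoForm n M} {J : Fin κ → M → ℝ} {θ : Torus κ → M → M} {N : Set M}
  {ρ : Γ → M → M} {N' : Set M} {p : Fin n → Fin κ → ℤ} {a : Γ → Fin n → Circle} {R d : ℝ}
  {D : R2n n → DataSpace n κ Γ}

/-- An orbit on the manifold is not known in advance to stay in the chart, so agreement is proved by
continuation: the set of times of agreement is closed, because M is Hausdorff, and extends to the
right by local uniqueness, since the curve in the chart stays strictly inside the ball. -/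
theorem IsSystem.curve_eq (hs : s = ∞ ∨ s = ω) (h : IsSystem s Ω J θ N ρ N')
    (hφ : φ ∈ IsManifold.maximalAtlas 𝓘(ℝ, R2n n) s M) (hsub : φ.source ⊆ N')
    (hball : Metric.ball 0 R ⊆ φ.target)
    (hDeq : ∀ x, ‖x‖ < R → D x = chartData φ Ω J ρ x) (hL : Linearizable p a D R d)
    (hd : 0 < d) {x : R2n n} (hx : ‖x‖ < R - 2 * d) (τ : AngleCube κ) {t : ℝ}
    (ht : t ∈ Icc (0 : ℝ) 1) :
    θ (expT (t • (τ : Fin κ → ℝ))) (φ.symm x) =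
      φ.symm (torusCurve p D (R - d) x τ t) := by
  set c := torusCurve p D (R - d) x τ with hc
  have hcn : ∀ t, ‖c t‖ < R - d := fun t => by
    have := hL.norm_torusCurve_lt hd.le le_rfl hx τ t
    linarith
  have hct : ∀ t, c t ∈ φ.target := fun t => hball (by rw [mem_ball_zero_iff]; linarith [hcn t])
  have hcc : Continuous c := continuous_torusCurve _ _ _
  have hmc : Continuous fun t => φ.symm (c t) := φ.continuousOn_symm.comp_continuous hcc hct
  have hxt : x ∈ φ.target := hball (by rw [mem_ball_zero_iff]; linarith)
  have hmN : φ.symm x ∈ N := h.subset (hsub (φ.map_target hxt))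
  have hγc := h.torus.continuous_curve hmN (τ : Fin κ → ℝ)
  set γ : ℝ → M := fun t => θ (expT (t • (τ : Fin κ → ℝ))) (φ.symm x) with hγ
  suffices hS : Icc (0 : ℝ) 1 ⊆ {t | γ t = φ.symm (c t)} from hS ht
  refine IsClosed.Icc_subset_of_forall_mem_nhdsWithin ((isClosed_eq hγc hmc).inter isClosed_Icc) ?_ ?_
  · simp only [Set.mem_ofPred_eq, hγ, zero_smul, expT_zero, hc]
    rw [hL.torusCurve_zero hd.le hx.le, h.torus.one _ hmN]
  · rintro t₀ ⟨ht₀, ht₀I⟩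
    have ht₀' : γ t₀ = φ.symm (c t₀) := ht₀
    have hmem : γ t₀ ∈ φ.source ∩ φ ⁻¹' Metric.ball 0 (R - d) := by
      rw [ht₀']
      refine ⟨φ.map_target (hct t₀), ?_⟩
      rw [mem_preimage, φ.right_inv (hct t₀), mem_ball_zero_iff]
      exact hcn t₀
    have hopen : IsOpen (φ.source ∩ φ ⁻¹' Metric.ball 0 (R - d)) :=
      φ.isOpen_inter_preimage Metric.isOpen_ball
    obtain ⟨δ, hδ, hball'⟩ := Metric.isOpen_iff.1 (hopen.preimage hγc) t₀ hmem
    -- On this short interval the orbit stays in the chart, within the ball where the field is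
    -- Lipschitz.
    set t₁ := min 1 (t₀ + δ / 2) with ht₁
    have ht01 : t₀ < t₁ := lt_min ht₀I.2 (by linarith)
    have hin : ∀ t ∈ Icc t₀ t₁, γ t ∈ φ.source ∩ φ ⁻¹' Metric.ball 0 (R - d) := by
      intro t ht
      refine hball' ?_
      rw [Metric.mem_ball, Real.dist_eq, abs_of_nonneg (by linarith [ht.1])]
      have : t ≤ t₀ + δ / 2 := ht.2.trans (min_le_right _ _)
      linarith
    have heq := hL.eqOn_torusCurve hd.le hx τ (f := fun t => φ (γ t)) (t₀ := t₀) (t₁ := t₁) ht₀I.1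
      (min_le_left _ _)
      (φ.continuousOn.comp hγc.continuousOn fun t ht => (hin t ht).1)
      (fun t ht => by
        have h1 := hin t ⟨ht.1, ht.2.le⟩
        have h2 := mem_ball_zero_iff.1 h1.2
        rw [hDeq _ (by linarith)]
        exact (h.torus.hasDerivAt_curve hs h.isOpen h.symplectic hφ hmN τ h1.1).hasDerivWithinAt)
      (fun t ht => by
        have := (hin t ⟨ht.1, ht.2.le⟩).2
        simp only [mem_preimage, mem_ball_zero_iff] at this
        exact this.le)
      (by simp only [ht₀']; exact φ.right_inv (hct t₀))
    filter_upwards [Icc_mem_nhdsGT ht01] with t ht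
    have h2 : φ (γ t) = c t := heq ht
    change γ t = φ.symm (c t)
    rw [← h2, φ.left_inv (hin t ht).1]

theorem IsSystem.torus_eq (hs : s = ∞ ∨ s = ω) (h : IsSystem s Ω J θ N ρ N')
    (hφ : φ ∈ IsManifold.maximalAtlas 𝓘(ℝ, R2n n) s M) (hsub : φ.source ⊆ N')
    (hball : Metric.ball 0 R ⊆ φ.target)
    (hDeq : ∀ x, ‖x‖ < R → D x = chartData φ Ω J ρ x) (hL : Linearizable p a D R d)
    (hd : 0 < d) {x : R2n n} (hx : ‖x‖ < R - 2 * d) (g : Torus κ) :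
    θ g (φ.symm x) = φ.symm (torusAct p D (R - d) g x) := by
  have := h.curve_eq hs hφ hsub hball hDeq hL hd hx (argT g) (t := 1) (by simp)
  rwa [one_smul, expT_argT, torusCurve_one] at this

theorem IsSystem.isLocalSystem (hs : s = ∞ ∨ s = ω) (h : IsSystem s Ω J θ N ρ N')
    (hφ : φ ∈ IsManifold.maximalAtlas 𝓘(ℝ, R2n n) s M) (hsub : φ.source ⊆ N')
    (hball : Metric.ball 0 R ⊆ φ.target)
    (hρ : ∀ ψ x, ‖x‖ < R → ρ ψ (φ.symm x) ∈ φ.source)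
    (hDeq : ∀ x, ‖x‖ < R → D x = chartData φ Ω J ρ x) (hL : Linearizable p a D R d) (hd : 0 < d) :
    IsLocalSystem p D R d := by
  have hmem : ∀ x : R2n n, ‖x‖ < R → x ∈ φ.target := fun x hx => hball (by simpa using hx)
  have hD : ContDiffOn ℝ 2 D (Metric.ball 0 R) := ContDiffOn.congr (f := chartData φ Ω J ρ)
    (fun x hx => ((h.contDiffAt_chartData hs hφ hsub (hball hx) fun ψ =>
      hρ ψ x (by simpa using hx)).of_le (two_le_of_smooth hs)).contDiffWithinAt)
    (fun x hx => hDeq x (by simpa using hx))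
  have hev : ∀ x, ‖x‖ < R → D =ᶠ[𝓝 x] chartData φ Ω J ρ := fun x hx => by
    filter_upwards [Metric.isOpen_ball.mem_nhds (mem_ball_zero_iff.2 hx)] with y hy
    exact hDeq y (by simpa using hy)
  have hfinR : ∀ ψ x, ‖x‖ < R - d → ‖(chartData φ Ω J ρ x).2.2 ψ‖ < R := fun ψ x hx => by
    have := hL.norm_finite_lt (r := R - d) le_rfl hx ψ
    rwa [hDeq x (by linarith), sub_add_cancel] at this
  refine ⟨hD, fun x hx u v => by rw [hDeq x hx]; exact chartData_swap x u v, fun x hx a b c => ?_,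
    fun x hx l u v => ?_, fun ψ x hx u v => ?_, ?_, ?_, ?_⟩
  · have h1 : (fun x => (D x).1) =ᶠ[𝓝 x] fun x => (chartData φ Ω J ρ x).1 :=
      (hev x hx).fun_comp Prod.fst
    rw [h1.fderiv_eq]
    exact (h.symplectic.form_spec hs h.isOpen hφ (hmem x hx)
      (h.subset (hsub (φ.map_target (hmem x hx))))).2 a b c
  · have h1 : (fun x => (D x).2.1 l) =ᶠ[𝓝 x] fun x => (chartData φ Ω J ρ x).2.1 l :=
      (hev x hx).fun_comp fun z => z.2.1 l
    rw [h1.fderiv_eq]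
    exact h.momentum_symm hs hφ hsub (hmem x hx) l u v
  · have h1 : (fun x => (D x).2.2 ψ) =ᶠ[𝓝 x] fun x => (chartData φ Ω J ρ x).2.2 ψ :=
      (hev x (by linarith)).fun_comp fun z => z.2.2 ψ
    rw [h1.fderiv_eq, hDeq x (by linarith),
      hDeq _ (hfinR ψ x (by linarith))]
    exact h.finite_symplectic hs hφ hsub (hmem x (by linarith)) (hρ ψ x (by linarith)) u v
  · intro g k x hx
    have hy := hL.norm_torusAct_lt hd.le (r := R - 4 * d) (by linarith) hx k
    have h1 := h.torus_eq hs hφ hsub hball hDeq hL hd (x := x) (by linarith) (g * k)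
    have hmN : φ.symm x ∈ N := h.subset (hsub (φ.map_target (hmem x (by linarith))))
    rw [h.torus.mul _ _ _ hmN, h.torus_eq hs hφ hsub hball hDeq hL hd (by linarith) k,
      h.torus_eq hs hφ hsub hball hDeq hL hd (by linarith) g] at h1
    refine (φ.symm.injOn (hmem _ ?_) (hmem _ ?_) h1).symm
    · have := hL.norm_torusAct_lt hd.le (r := R - 4 * d + d) (by linarith) hy g
      linarith
    · have := hL.norm_torusAct_lt hd.le (r := R - 4 * d) (by linarith) hx (g * k)
      linarith
  · intro ψ χ x hx
    rw [hDeq x (by linarith), hDeq _ (hfinR χ x (by linarith))]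
    change φ (ρ (ψ * χ) (φ.symm x)) = φ (ρ ψ (φ.symm (φ (ρ χ (φ.symm x)))))
    rw [φ.left_inv (hρ χ x (by linarith)), h.finite.mul _ _ _
      (hsub (φ.map_target (hmem x (by linarith))))]
  · intro ψ g x hx
    have hcn : ∀ t, ‖torusCurve p D (R - d) x (argT g) t‖ < R - 4 * d := fun t => by
      have := hL.norm_torusCurve_lt hd.le (r := R - 5 * d) (by linarith) hx (argT g) t
      linarith
    have hfin : ∀ y, ‖y‖ < R - 4 * d → ‖φ (ρ ψ (φ.symm y))‖ < R - 3 * d := fun y hy => by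
      have := hL.norm_finite_lt (r := R - 4 * d) (by linarith) hy ψ
      rw [hDeq y (by linarith)] at this
      change ‖φ (ρ ψ (φ.symm y))‖ < _ at this
      linarith
    have hρd : ∀ y, ‖y‖ < R → HasFDerivAt (fun x => φ (ρ ψ (φ.symm x)))
        (fderiv ℝ (fun x => φ (ρ ψ (φ.symm x))) y) y := fun y hy =>
      ((h.contDiffAt_finite hφ hsub (hmem y hy) (hρ ψ y hy)).differentiableAt
        (ne_zero_of_smooth hs)).hasFDerivAt
    -- Since ρ(ψ) preserves the Hamiltonian fields, it carries the torus curve through x to an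
    -- integral curve through the image of x; uniqueness identifies the two, so the actions commute.
    -- Commutation is not a hypothesis: it follows from invariance of the momenta.
    have heq := hL.eqOn_torusCurve hd.le (x := φ (ρ ψ (φ.symm x))) (t₀ := 0) (t₁ := 1)
      (by have := hfin x (by linarith); linarith) (argT g)
      (f := fun t => φ (ρ ψ (φ.symm (torusCurve p D (R - d) x (argT g) t))))
      le_rfl le_rfl (by
        refine Continuous.continuousOn (continuous_iff_continuousAt.2 fun t => ?_)
        exact ContinuousAt.comp (g := fun x => φ (ρ ψ (φ.symm x)))
          (hρd _ (by linarith [hcn t])).continuousAt (continuous_torusCurve _ _ _).continuousAt)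
      (fun t ht => by
        have h1 := (hρd _ (by linarith [hcn t])).comp_hasDerivWithinAt t
          (hL.hasDerivWithinAt_torusCurve hd.le (show ‖x‖ ≤ R - 2 * d by linarith) (argT g) ht)
        refine h1.congr_deriv ?_
        simp only [map_sum, map_smul]
        refine Finset.sum_congr rfl fun l _ => ?_
        congr 1
        rw [hDeq _ (by linarith [hcn t]), hDeq _ (by linarith [hfin _ (hcn t)])]
        exact h.finite_hamVF hs hφ hsub (hmem _ (by linarith [hcn t]))
          (hρ ψ _ (by linarith [hcn t])) l)
      (fun t ht => by have := hfin _ (hcn t); linarith)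
      (by
        rw [hL.torusCurve_zero hd.le (by linarith), hL.torusCurve_zero hd.le
          (by have := hfin x (by linarith); linarith)])
    have h1 := heq (show (1 : ℝ) ∈ Icc (0 : ℝ) 1 by simp)
    simp only [torusCurve_one] at h1
    rw [hDeq x (by linarith), hDeq _ (by
      have := hcn 1
      rw [torusCurve_one] at this
      linarith)]
    exact h1

end SystemInChart

/-! ### Near-identity maps as changes of coordinates -/

section NearIdChart

variable {E : Type*} [NormedAddCommGroup E] [NormedSpace ℝ E] [CompleteSpace E] {f : E → E}
  {r r' d : ℝ} {m : WithTop ℕ∞}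

theorem NearId.contDiffOn_invBall (h : NearId f r d) (hd : 0 ≤ d) (hm : m ≠ 0)
    (hf : ContDiffOn ℝ m f (Metric.ball 0 r)) (hr' : r' ≤ r - 2 * d) :
    ContDiffOn ℝ m (invBall f r) (Metric.ball 0 r') := by
  intro y hy
  have hy' : ‖y‖ < r - 2 * d := (mem_ball_zero_iff.1 hy).trans_le hr'
  have hx := (h.invBall_spec hd hy').1
  have h1 : ContDiffAt ℝ m f (invBall f r y) :=
    hf.contDiffAt (Metric.isOpen_ball.mem_nhds (by simpa using hx))
  have h2 : ContDiffAt ℝ m (fun z : ℝ × E => f z.2) (0, invBall f r y) :=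
    ContDiffAt.comp (g := f) (f := Prod.snd) (0, invBall f r y) h1 contDiffAt_snd
  have h3 := contDiffAt_invBall (P := ℝ) (f := fun _ => f) isOpen_univ (fun _ _ => h) hd hm
    (mem_univ (0 : ℝ)) hy' h2
  exact (ContDiffAt.comp (g := fun z : ℝ × E => invBall f r z.2) (f := fun y => ((0 : ℝ), y)) y h3
    (contDiffAt_const.prodMk contDiffAt_id)).contDiffWithinAt

/-- A map close to the identity, as a partial homeomorphism onto a ball. -/
def NearId.toHomeomorph (h : NearId f r d) (hd : 0 ≤ d) (hf : ContDiffOn ℝ 1 f (Metric.ball 0 r))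
    (hr' : r' ≤ r - 2 * d) : OpenPartialHomeomorph E E where
  toFun := f
  invFun := invBall f r
  source := Metric.ball 0 r ∩ f ⁻¹' Metric.ball 0 r'
  target := Metric.ball 0 r'
  map_source' := fun x hx => hx.2
  map_target' := fun y hy => by
    have := h.invBall_spec hd (y := y) ((mem_ball_zero_iff.1 hy).trans_le hr')
    refine ⟨by simpa using this.1, ?_⟩
    rw [mem_preimage, this.2]
    exact hy
  left_inv' := fun x hx => h.invBall_apply (mem_ball_zero_iff.1 hx.1)
  right_inv' := fun y hy => (h.invBall_spec hd ((mem_ball_zero_iff.1 hy).trans_le hr')).2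
  open_source := hf.continuousOn.isOpen_inter_preimage Metric.isOpen_ball Metric.isOpen_ball
  open_target := Metric.isOpen_ball
  continuousOn_toFun := hf.continuousOn.mono inter_subset_left
  continuousOn_invFun := (h.contDiffOn_invBall hd one_ne_zero hf hr').continuousOn

end NearIdChart

/-! ### Composition of charts -/

section Trans

variable {n : ℕ} {M : Type*} [TopologicalSpace M] [ChartedSpace (R2n n) M] {s : WithTop ℕ∞}
  [IsManifold 𝓘(ℝ, R2n n) s M] {φ : OpenPartialHomeomorph M (R2n n)}

theorem trans_mem_maximalAtlas (hφ : φ ∈ IsManifold.maximalAtlas 𝓘(ℝ, R2n n) s M)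
    {e : OpenPartialHomeomorph (R2n n) (R2n n)} (he : ContDiffOn ℝ s e e.source)
    (he' : ContDiffOn ℝ s e.symm e.target) :
    φ.trans e ∈ IsManifold.maximalAtlas 𝓘(ℝ, R2n n) s M := by
  rw [IsManifold.mem_maximalAtlas_iff_contMDiffOn]
  refine ⟨?_, ?_⟩
  · exact (contMDiffOn_iff_contDiffOn.2 he).comp
      ((contMDiffOn_of_mem_maximalAtlas hφ).mono (φ.trans_source e ▸ inter_subset_left))
      fun x hx => by rw [φ.trans_source] at hx; exact hx.2
  · exact (contMDiffOn_symm_of_mem_maximalAtlas hφ).comp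
      ((contMDiffOn_iff_contDiffOn.2 he').mono (φ.trans_target e ▸ inter_subset_left))
      fun x hx => by rw [φ.trans_target] at hx; exact hx.2

end Trans

/-! ### Momenta of a linear action -/

section Momentum

variable {n κ : ℕ}

theorem hasFDerivAt_quadratic (p : Fin n → Fin κ → ℤ) (l : Fin κ) (w : R2n n) :
    HasFDerivAt (fun w : R2n n => ∑ j, (p j l : ℝ) * ((w (j, 0) ^ 2 + w (j, 1) ^ 2) / 2))
      (stdBil.flip (gen p l w)) w := by
  have hc : ∀ i, HasFDerivAt (fun w : R2n n => w i) (EuclideanSpace.proj (𝕜 := ℝ) i) w :=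
    fun i => (EuclideanSpace.proj (𝕜 := ℝ) i).hasFDerivAt
  have h := HasFDerivAt.fun_sum (u := Finset.univ) fun j _ =>
    ((((hc (j, 0)).pow 2).add ((hc (j, 1)).pow 2)).mul_const (1 / 2 : ℝ)).const_mul (p j l : ℝ)
  refine (h.congr_of_eventuallyEq (Filter.Eventually.of_forall fun w => ?_)).congr_fderiv ?_
  · refine Finset.sum_congr rfl fun j _ => ?_
    simp only [Pi.add_apply]
    ring
  · ext v
    simp only [_root_.sum_apply, _root_.smul_apply, _root_.add_apply, ContinuousLinearMap.flip_apply,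
      stdBil_apply]
    refine Finset.sum_congr rfl fun j _ => ?_
    have h0 : (gen p l w) (j, 0) = -(p j l : ℝ) * w (j, 1) := by
      rw [← zc_re, gen, zc_mulC]; simp
    have h1 : (gen p l w) (j, 1) = (p j l : ℝ) * w (j, 0) := by
      rw [← zc_im, gen, zc_mulC]; simp
    rw [h0, h1]
    simp
    ring

theorem sum_filter_quadratic (p : Fin n → Fin κ → ℤ) {kₑ : ℕ}
    (hp : ∀ (j : Fin n) l, kₑ ≤ j.val → p j l = 0) (l : Fin κ) (w : R2n n) :
    ∑ j with j.val < kₑ, (p j l : ℝ) * ((w (j, 0) ^ 2 + w (j, 1) ^ 2) / 2) =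
      ∑ j, (p j l : ℝ) * ((w (j, 0) ^ 2 + w (j, 1) ^ 2) / 2) := by
  rw [Finset.sum_filter]
  refine Finset.sum_congr rfl fun j _ => ?_
  split_ifs with h
  · rfl
  · rw [hp j l (not_lt.1 h)]; simp

variable {M : Type*} [TopologicalSpace M] [ChartedSpace (R2n n) M]
  {s : WithTop ℕ∞} [IsManifold 𝓘(ℝ, R2n n) s M] {φ : OpenPartialHomeomorph M (R2n n)} {Γ : Type*}
  [Group Γ] [Fintype Γ] {Ω : TwoForm n M} {J : Fin κ → M → ℝ} {θ : Torus κ → M → M} {N : Set M}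
  {ρ : Γ → M → M} {N' : Set M} {p : Fin n → Fin κ → ℤ} {r : ℝ}

/-- The momentum map of a linear torus action. -/
theorem IsSystem.momentum_eq (hs : s = ∞ ∨ s = ω) (h : IsSystem s Ω J θ N ρ N')
    (hφ : φ ∈ IsManifold.maximalAtlas 𝓘(ℝ, R2n n) s M) (hsub : φ.source ⊆ N')
    (htarget : φ.target = Metric.ball 0 r) (hr : 0 < r)
    (hform : ∀ w ∈ φ.target, bilOf (formInChart φ Ω w) = stdBil)
    (hθ : ∀ g, ∀ m ∈ φ.source, φ (θ g m) = rotC (torusWeight p g) (φ m)) (l : Fin κ) {m : M}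
    (hm : m ∈ φ.source) :
    J l m = J l (φ.symm 0) + ∑ j, (p j l : ℝ) * ((φ m (j, 0) ^ 2 + φ m (j, 1) ^ 2) / 2) := by
  have hsN : φ.source ⊆ N := hsub.trans h.subset
  have hJ := contDiffOn_momentum h.torus.contMDiffOn_J hφ hsN l
  -- In these coordinates the action is linear, so differentiating an orbit at time 0 identifies the
  -- Hamiltonian field with the linear generator.
  have hgen : ∀ w ∈ φ.target, hamVF (chartData φ Ω J ρ w) l = gen p l w := by
    intro w hw
    have hm := φ.map_target hw
    have h1 := h.torus.hasDerivAt_zero (ρ := ρ) hs h.isOpen h.symplectic hφ hm (hsN hm)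
      (Pi.single l 1)
    have h2 := ((hasDerivAt_rotT_smul p (Pi.single l 1) 0).clm_apply (hasDerivAt_const 0 w))
    have h3 : (fun t : ℝ => φ (θ (expT (t • Pi.single l 1)) (φ.symm w))) =
        fun t : ℝ => rotT p (t • Pi.single l 1) w := by
      ext1 t
      rw [hθ _ _ hm, rotT_eq, φ.right_inv hw]
    rw [h3] at h1
    have h4 := h1.unique h2
    rw [φ.right_inv hw] at h4
    simpa [Pi.single_apply, _root_.sum_apply] using h4
  have hd : ∀ w ∈ φ.target, HasFDerivAt (J l ∘ φ.symm) (stdBil.flip (gen p l w)) w := by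
    intro w hw
    have h1 : HasFDerivAt (J l ∘ φ.symm) (fderiv ℝ (J l ∘ φ.symm) w) w :=
      ((hJ.contDiffAt (φ.open_target.mem_nhds hw)).differentiableAt
        (ne_zero_of_smooth hs)).hasFDerivAt
    refine h1.congr_fderiv ?_
    ext v
    have h2 : (chartData φ Ω J ρ w).1 = stdBil := hform w hw
    have h3 := hamVF_spec (z := chartData φ Ω J ρ w) (h2 ▸ stdBil_isInvertible)
      (chartData_swap w) l v
    rw [h2, hgen w hw] at h3
    exact h3.symm
  -- The momentum and the quadratic function have equal differentials; the target is a ball, so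
  -- their difference is its value at the centre.
  have hconst := (htarget ▸ Metric.isOpen_ball).is_const_of_fderiv_eq_zero
    (f := fun w => J l (φ.symm w) - ∑ j, (p j l : ℝ) * ((w (j, 0) ^ 2 + w (j, 1) ^ 2) / 2))
    (s := φ.target) (𝕜 := ℝ)
    (htarget ▸ (convex_ball (0 : R2n n) r).isPreconnected)
    (fun w hw => (HasFDerivAt.fun_sub (hd w hw) (hasFDerivAt_quadratic p l w)).differentiableAt.differentiableWithinAt)
    (fun w hw => (HasFDerivAt.fun_sub (hd w hw) (hasFDerivAt_quadratic p l w)).fderiv.trans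
      (sub_self _))
    (φ.map_source hm) (show (0 : R2n n) ∈ φ.target by rw [htarget]; simpa using hr)
  rw [φ.left_inv hm] at hconst
  simp at hconst
  linarith

end Momentum

/-! ### Normal form of a system close to the linear model -/

section NormalForm

variable {n κ : ℕ} {M : Type*} [TopologicalSpace M] [T2Space M] [ChartedSpace (R2n n) M]
  {s : WithTop ℕ∞} [IsManifold 𝓘(ℝ, R2n n) s M] {φ : OpenPartialHomeomorph M (R2n n)} {Γ : Type*}
  [Group Γ] [Fintype Γ] {Ω : TwoForm n M} {J : Fin κ → M → ℝ} {θ : Torus κ → M → M} {N : Set M}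
  {ρ : Γ → M → M} {N' : Set M} {p : Fin n → Fin κ → ℤ} {a : Γ → Fin n → Circle} {R d r' : ℝ}

/-- The coordinates are `φ` followed by the normalising map, cut down to the preimage of a ball.
There both actions are rotations, which preserve the ball, so the domain is invariant. The preimage
of the centre is the new fixed point, and the momenta are recovered from their differentials. -/
theorem IsSystem.exists_isNormalForm (hs : s = ∞ ∨ s = ω) (h : IsSystem s Ω J θ N ρ N')
    (hφ : φ ∈ IsManifold.maximalAtlas 𝓘(ℝ, R2n n) s M) (hsub : φ.source ⊆ N')
    (hball : Metric.ball 0 R ⊆ φ.target)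
    (hρ : ∀ ψ x, ‖x‖ < R → ρ ψ (φ.symm x) ∈ φ.source)
    {D : R2n n → DataSpace n κ Γ}
    (hDeq : ∀ x, ‖x‖ < R → D x = chartData φ Ω J ρ x) (hN : Normalizable p a D R d) (hd : 0 < d)
    (ha : ∀ ψ χ, a (ψ * χ) = a ψ * a χ) {q : Γ → Fin n → ℚ}
    (haq : ∀ ψ j, (a ψ j : ℂ) = Complex.exp (2 * Real.pi * Complex.I * (q ψ j : ℂ))) {kₑ : ℕ}
    (hp : ∀ (j : Fin n) l, kₑ ≤ j.val → p j l = 0) (hr0 : 0 < r') (hr' : r' ≤ R - 12 * d) :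
    ∃ φ' : OpenPartialHomeomorph M (R2n n),
      (∀ m, φ' m = normMap p a D R d (φ m)) ∧
      φ'.source = φ.source ∩ φ ⁻¹' (Metric.ball 0 (R - 10 * d) ∩
        normMap p a D R d ⁻¹' Metric.ball 0 r') ∧
      φ'.target = Metric.ball 0 r' ∧
      IsNormalForm s Ω J θ ρ kₑ p q
        (fun l => J l (φ.symm (invBall (normMap p a D R d) (R - 10 * d) 0))) φ'
        (φ.symm (invBall (normMap p a D R d) (R - 10 * d) 0)) := by
  have hloc := h.isLocalSystem hs hφ hsub hball hρ hDeq hN.lin hd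
  set η := normMap p a D R d with hη
  have hmem : ∀ x : R2n n, ‖x‖ < R → x ∈ φ.target := fun x hx => hball (by simpa using hx)
  have hDs : ContDiffOn ℝ s D (Metric.ball 0 R) := ContDiffOn.congr (f := chartData φ Ω J ρ)
    (fun x hx => (h.contDiffAt_chartData hs hφ hsub (hball hx) fun ψ =>
      hρ ψ x (by simpa using hx)).contDiffWithinAt) (fun x hx => hDeq x (by simpa using hx))
  have hD2 : ContDiffOn ℝ 2 D (Metric.ball 0 R) := hDs.of_le (two_le_of_smooth hs)
  have hηs : ContDiffOn ℝ s η (Metric.ball 0 (R - 10 * d)) :=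
    (hN.contDiffOn_normMap hd (add_one_le_of_smooth hs) (ne_zero_of_smooth hs) hDs).mono
      (Metric.ball_subset_ball (by linarith))
  have h1s : (1 : WithTop ℕ∞) ≤ s := le_trans (by norm_num) (two_le_of_smooth hs)
  have hr'' : r' ≤ R - 10 * d - 2 * d := by linarith
  set e := hN.near.toHomeomorph hd.le (hηs.of_le h1s) hr'' with he
  have hes : e.symm = invBall η (R - 10 * d) := rfl
  have het : e.target = Metric.ball 0 r' := rfl
  have hesrc : e.source = Metric.ball 0 (R - 10 * d) ∩ η ⁻¹' Metric.ball 0 r' := rfl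
  set φ' := φ.trans e with hφ'
  have hφ's : φ' ∈ IsManifold.maximalAtlas 𝓘(ℝ, R2n n) s M :=
    trans_mem_maximalAtlas hφ (hηs.mono inter_subset_left)
      (hN.near.contDiffOn_invBall hd.le (ne_zero_of_smooth hs) hηs hr'')
  have hsrc : φ'.source = φ.source ∩ φ ⁻¹' (Metric.ball 0 (R - 10 * d) ∩ η ⁻¹' Metric.ball 0 r') := by
    rw [hφ', φ.trans_source, hesrc]
  have hinv : ∀ y : R2n n, ‖y‖ < r' → ‖invBall η (R - 10 * d) y‖ < R - 10 * d := fun y hy =>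
    (hN.near.invBall_spec hd.le (by linarith)).1
  have htgt : φ'.target = Metric.ball 0 r' := by
    rw [hφ', φ.trans_target, het]
    refine inter_eq_left.2 fun y hy => ?_
    rw [mem_preimage, hes]
    exact hmem _ (by linarith [hinv y (by simpa using hy)])
  have hφ'a : ∀ m, φ' m = η (φ m) := fun m => rfl
  have hφ'symm : ∀ y, φ'.symm y = φ.symm (invBall η (R - 10 * d) y) := fun y => rfl
  have hmemsrc : ∀ m, m ∈ φ'.source ↔ m ∈ φ.source ∧ ‖φ m‖ < R - 10 * d ∧ ‖η (φ m)‖ < r' := by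
    intro m
    rw [hsrc]
    simp
  -- The image has norm less than `R - 12 * d` and the map moves points by at most `d`. The
  -- remaining margin `d` ensures that group elements do not leave the ball of radius `R - 10 * d`,
  -- where the map is injective.
  have hnorm : ∀ m ∈ φ'.source, ‖φ m‖ < R - 11 * d := by
    intro m hm
    obtain ⟨-, h1, h2⟩ := (hmemsrc m).1 hm
    have h3 := hN.near.norm_sub_le (φ m) h1
    have h4 : ‖φ m‖ ≤ ‖η (φ m)‖ + ‖η (φ m) - φ m‖ := by
      have := norm_sub_le (η (φ m)) (η (φ m) - φ m)
      rwa [sub_sub_cancel] at this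
    linarith
  have hsub' : φ'.source ⊆ φ.source := fun m hm => ((hmemsrc m).1 hm).1
  have hθφ : ∀ g, ∀ m ∈ φ'.source, θ g m ∈ φ.source ∧ ‖φ (θ g m)‖ < R - 10 * d ∧
      η (φ (θ g m)) = rotC (torusWeight p g) (η (φ m)) := by
    intro g m hm
    have hx := hnorm m hm
    have h1 := h.torus_eq hs hφ hsub hball hDeq hN.lin hd (x := φ m) (by linarith) g
    rw [φ.left_inv (hsub' hm)] at h1
    have h2 := hN.lin.norm_torusAct_lt hd.le (r := R - 11 * d) (by linarith) hx g
    have h3 := hmem _ (show ‖torusAct p D (R - d) g (φ m)‖ < R by linarith)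
    rw [h1]
    refine ⟨φ.map_target h3, ?_, ?_⟩
    · rw [φ.right_inv h3]; linarith
    · rw [φ.right_inv h3]
      exact (hloc.isSymmetry_torusAct hN hd g).normMap_apply hN hd hD2 (by linarith)
  have hρφ : ∀ ψ, ∀ m ∈ φ'.source, ρ ψ m ∈ φ.source ∧ ‖φ (ρ ψ m)‖ < R - 10 * d ∧
      η (φ (ρ ψ m)) = rotC (a ψ) (η (φ m)) := by
    intro ψ m hm
    have hx := hnorm m hm
    have h1 : (D (φ m)).2.2 ψ = φ (ρ ψ m) := by
      rw [hDeq _ (by linarith)]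
      change φ (ρ ψ (φ.symm (φ m))) = _
      rw [φ.left_inv (hsub' hm)]
    have h2 := hN.lin.norm_finite_lt (r := R - 11 * d) (by linarith) hx ψ
    have h3 := hρ ψ (φ m) (by linarith)
    rw [φ.left_inv (hsub' hm)] at h3
    refine ⟨h3, ?_, ?_⟩
    · rw [← h1]; linarith
    · rw [← h1]
      exact (hloc.isSymmetry_finite hN ha hd ψ).normMap_apply hN hd hD2 (by linarith)
  have hθsrc : ∀ g, MapsTo (θ g) φ'.source φ'.source := fun g m hm => by
    obtain ⟨h1, h2, h3⟩ := hθφ g m hm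
    refine (hmemsrc _).2 ⟨h1, h2, ?_⟩
    rw [h3, norm_rotC]
    exact ((hmemsrc m).1 hm).2.2
  have hρsrc : ∀ ψ, MapsTo (ρ ψ) φ'.source φ'.source := fun ψ m hm => by
    obtain ⟨h1, h2, h3⟩ := hρφ ψ m hm
    refine (hmemsrc _).2 ⟨h1, h2, ?_⟩
    rw [h3, norm_rotC]
    exact ((hmemsrc m).1 hm).2.2
  have h0t : (0 : R2n n) ∈ φ'.target := by rw [htgt]; simpa using hr0
  have hm0 : φ'.symm 0 ∈ φ'.source := φ'.map_target h0t
  have hform : ∀ w ∈ φ'.target, bilOf (formInChart φ' Ω w) = stdBil := by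
    intro w hw
    have hmd' := mdifferentiable_of_mem_maximalAtlas (ne_zero_of_smooth hs) hφ's
    have hmd := mdifferentiable_of_mem_maximalAtlas (ne_zero_of_smooth hs) hφ
    have hws := φ'.map_target hw
    have hwφ := hsub' hws
    have h1 := formInChart_eq_pullback (Ω := Ω) hmd' hmd hw hwφ
    have h2 := differentiableAt_chart_comp hmd (hmd'.mdifferentiableAt_symm hw) hwφ
    set x := φ (φ'.symm w) with hx
    have hxn : ‖x‖ < R - 11 * d := hnorm _ hws
    have h3 : DifferentiableAt ℝ η x :=
      (hηs.contDiffAt (Metric.isOpen_ball.mem_nhds (by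
        rw [mem_ball_zero_iff]; linarith))).differentiableAt (ne_zero_of_smooth hs)
    have h4 : HasFDerivAt (η ∘ (φ ∘ φ'.symm)) ((fderiv ℝ η x).comp (fderiv ℝ (φ ∘ φ'.symm) w)) w :=
      HasFDerivAt.comp (g := η) (f := φ ∘ φ'.symm) w h3.hasFDerivAt h2.hasFDerivAt
    have h5 : HasFDerivAt (η ∘ (φ ∘ φ'.symm)) (ContinuousLinearMap.id ℝ (R2n n)) w := by
      refine (hasFDerivAt_id (𝕜 := ℝ) w).congr_of_eventuallyEq ?_
      filter_upwards [φ'.open_target.mem_nhds hw] with y hy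
      exact φ'.right_inv hy
    have h6 := h4.unique h5
    have h7 : ∀ u, fderiv ℝ η x (fderiv ℝ (φ ∘ φ'.symm) w u) = u := fun u =>
      DFunLike.congr_fun h6 u
    rw [h1]
    ext1 u
    ext1 v
    rw [pullB_apply]
    have h8 := hN.pullback hd hD2 hloc.swap hloc.closed (x := x) (by linarith)
      (fderiv ℝ (φ ∘ φ'.symm) w u) (fderiv ℝ (φ ∘ φ'.symm) w v)
    rw [h7, h7, hDeq x (by linarith)] at h8
    exact h8.symm
  refine ⟨φ', hφ'a, hsrc, htgt, ⟨hφ's, hm0, φ'.right_inv h0t, fun g => ?_, fun ψ => ?_, hθsrc, hρsrc,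
    fun w hw u v => ?_, fun l m hm => ?_, fun ψ j m hm => ?_⟩⟩
  -- A rotation fixes the origin, so by injectivity of the coordinates its preimage is fixed.
  · refine φ'.injOn (hθsrc g hm0) hm0 ?_
    rw [hφ'a]
    erw [(hθφ g _ hm0).2.2, ← hφ'a, φ'.right_inv h0t]
    exact map_zero _
  · refine φ'.injOn (hρsrc ψ hm0) hm0 ?_
    rw [hφ'a]
    erw [(hρφ ψ _ hm0).2.2, ← hφ'a, φ'.right_inv h0t]
    exact map_zero _
  · rw [← bilOf_apply, hform w hw, stdBil_apply]
  · rw [sum_filter_quadratic p hp]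
    exact h.momentum_eq hs hφ's (hsub'.trans hsub) htgt hr0 hform
      (fun g m hm => (hθφ g m hm).2.2) l hm
  · rw [hφ'a, (hρφ ψ m hm).2.2, zc_rotC, haq, hφ'a]

end NormalForm

/-! ### Choice of radii -/

section Radii

variable {n κ : ℕ} {M : Type*} [TopologicalSpace M] [ChartedSpace (R2n n) M]
  {φ : OpenPartialHomeomorph M (R2n n)} {m₀ : M} {R₀ : ℝ}

theorem exists_radii (hm : m₀ ∈ φ.source) (h0 : φ m₀ = 0) (ht : φ.target = Metric.ball 0 R₀)
    {U : Set M} (hU : U ∈ 𝓝 m₀) (hc : IsCompact (closure U)) (hsub : closure U ⊆ φ.source) :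
    ∃ R d : ℝ, 0 < d ∧ 12 * d < R ∧ R < R₀ ∧ (∀ m ∈ U, ‖φ m‖ < R - 14 * d) ∧
      ∀ x, ‖x‖ ≤ d → φ.symm x ∈ U := by
  have hne : (closure U).Nonempty := ⟨m₀, subset_closure (mem_of_mem_nhds hU)⟩
  obtain ⟨m₁, hm₁, hmax⟩ := hc.exists_isMaxOn hne (φ.continuousOn.mono hsub).norm
  have hr0 : ‖φ m₁‖ < R₀ := by
    have := φ.map_source (hsub hm₁)
    rwa [ht, mem_ball_zero_iff] at this
  set r₀ := ‖φ m₁‖ with hr₀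
  have hr₀n : 0 ≤ r₀ := norm_nonneg _
  have h0t : (0 : R2n n) ∈ φ.target := h0 ▸ φ.map_source hm
  have hsymm0 : φ.symm 0 = m₀ := by rw [← h0, φ.left_inv hm]
  have hU' : φ.symm ⁻¹' U ∈ 𝓝 (0 : R2n n) := by
    refine (φ.continuousAt_symm h0t).preimage_mem_nhds ?_
    rwa [hsymm0]
  obtain ⟨δ, hδ, hball⟩ := Metric.mem_nhds_iff.1 hU'
  -- Halfway between the largest norm on the closure of `U` and `R₀`. The bound by (R₀ - r₀)/30
  -- keeps 14 d below half the gap R₀ - r₀; the bound by δ/2 places the new fixed point in `U`.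
  refine ⟨(r₀ + R₀) / 2, min ((R₀ - r₀) / 30) (δ / 2), ?_, ?_, ?_, ?_, ?_⟩
  · exact lt_min (by linarith) (by linarith)
  · have := min_le_left ((R₀ - r₀) / 30) (δ / 2)
    linarith
  · linarith
  · intro m hmU
    have h1 : ‖φ m‖ ≤ r₀ := hmax (subset_closure hmU)
    have := min_le_left ((R₀ - r₀) / 30) (δ / 2)
    linarith
  · intro x hx
    refine hball ?_
    rw [mem_ball_zero_iff]
    have := min_le_right ((R₀ - r₀) / 30) (δ / 2)
    linarith

end Radii

/-! ### A system in normal form has the data of the model -/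

section Model

variable {n κ : ℕ} {M : Type*} [TopologicalSpace M] [ChartedSpace (R2n n) M]
  {s r : WithTop ℕ∞} {φ : OpenPartialHomeomorph M (R2n n)} {Γ : Type*}
  {Ω Ω' : TwoForm n M} {J J' : Fin κ → M → ℝ} {θ : Torus κ → M → M}
  {ρ ρ' : Γ → M → M} {p : Fin n → Fin κ → ℤ} {q : Γ → Fin n → ℚ} {c : Fin κ → ℝ}
  {a : Γ → Fin n → Circle} {kₑ : ℕ} {m₀ : M}

theorem chartData_congr (h : ∀ m ∈ φ.source, Ω' m = Ω m ∧ (∀ l, J' l m = J l m) ∧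
    ∀ ψ, ρ' ψ m = ρ ψ m) {x : R2n n} (hx : x ∈ φ.target) :
    chartData φ Ω' J' ρ' x = chartData φ Ω J ρ x := by
  have h1 := h _ (φ.map_target hx)
  have h2 : formInChart φ Ω' x = formInChart φ Ω x := by rw [formInChart, formInChart, h1.1]
  refine Prod.ext ?_ (Prod.ext ?_ ?_)
  · exact congrArg bilOf h2
  · ext1 l
    refine Filter.EventuallyEq.fderiv_eq ?_
    filter_upwards [φ.open_target.mem_nhds hx] with y hy
    exact (h _ (φ.map_target hy)).2.1 l
  · ext1 ψ
    change φ (ρ' ψ (φ.symm x)) = φ (ρ ψ (φ.symm x))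
    rw [h1.2.2 ψ]

theorem IsNormalForm.hasFDerivAt_momentum (h : IsNormalForm s Ω J θ ρ kₑ p q c φ m₀)
    (hp : ∀ (j : Fin n) l, kₑ ≤ j.val → p j l = 0) {x : R2n n} (hx : x ∈ φ.target) (l : Fin κ) :
    HasFDerivAt (J l ∘ φ.symm) (-stdBil (gen p l x)) x := by
  have h1 := (hasFDerivAt_quadratic p l x).const_add (c l)
  have h2 : HasFDerivAt (J l ∘ φ.symm) (stdBil.flip (gen p l x)) x := by
    refine HasFDerivAt.congr_of_eventuallyEq (f₁ := J l ∘ φ.symm) h1 ?_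
    filter_upwards [φ.open_target.mem_nhds hx] with y hy
    rw [Function.comp_apply, h.J_eq l _ (φ.map_target hy), sum_filter_quadratic p hp,
      φ.right_inv hy]
  refine h2.congr_fderiv (ContinuousLinearMap.ext fun v => ?_)
  rw [ContinuousLinearMap.flip_apply, stdBil_swap, _root_.neg_apply]

/-- This makes a system in normal form an admissible base point of a family: all smallness
conditions hold near it. -/
theorem IsNormalForm.chartData_eq (h : IsNormalForm s Ω J θ ρ kₑ p q c φ m₀)
    (haq : ∀ ψ j, (a ψ j : ℂ) = Complex.exp (2 * Real.pi * Complex.I * (q ψ j : ℂ)))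
    (hp : ∀ (j : Fin n) l, kₑ ≤ j.val → p j l = 0) {x : R2n n} (hx : x ∈ φ.target) :
    chartData φ Ω J ρ x = model p a x := by
  refine Prod.ext ?_ (Prod.ext ?_ ?_)
  · change bilOf (formInChart φ Ω x) = stdBil
    ext1 u
    ext1 v
    rw [bilOf_apply, h.form_eq x hx, stdBil_apply]
  · ext1 l
    change fderiv ℝ (J l ∘ φ.symm) x = -stdBil (gen p l x)
    exact (h.hasFDerivAt_momentum hp hx l).fderiv
  · ext1 ψ
    change φ (ρ ψ (φ.symm x)) = rotC (a ψ) x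
    refine ext_zc fun j => ?_
    rw [h.finite_eq ψ j _ (φ.map_target hx), φ.right_inv hx, zc_rotC, haq]

theorem mem_maximalAtlas_of_le [IsManifold 𝓘(ℝ, R2n n) r M] [IsManifold 𝓘(ℝ, R2n n) s M]
    (hsr : s ≤ r) (hφ : φ ∈ IsManifold.maximalAtlas 𝓘(ℝ, R2n n) r M) :
    φ ∈ IsManifold.maximalAtlas 𝓘(ℝ, R2n n) s M := by
  rw [IsManifold.mem_maximalAtlas_iff_contMDiffOn] at hφ ⊢
  exact ⟨hφ.1.of_le hsr, hφ.2.of_le hsr⟩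

end Model

/-! ### Regularity of the data of a family -/

section Family

variable {n κ d : ℕ} {M : Type*} [TopologicalSpace M] [ChartedSpace (R2n n) M]
  {s : WithTop ℕ∞} [IsManifold 𝓘(ℝ, R2n n) s M] {φ : OpenPartialHomeomorph M (R2n n)} {Γ : Type*}
  [Group Γ] [Fintype Γ] {B : Set (EuclideanSpace ℝ (Fin d))}
  {Ω : EuclideanSpace ℝ (Fin d) → TwoForm n M} {J : EuclideanSpace ℝ (Fin d) → Fin κ → M → ℝ}
  {θ : EuclideanSpace ℝ (Fin d) → Torus κ → M → M} {N : Set M}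
  {ρ : EuclideanSpace ℝ (Fin d) → Γ → M → M} {N' : Set M}

theorem contMDiffAt_pair_symm {P : Type*} [NormedAddCommGroup P] [NormedSpace ℝ P]
    (hφ : φ ∈ IsManifold.maximalAtlas 𝓘(ℝ, R2n n) s M)
    {b : P} {x : R2n n} (hx : x ∈ φ.target) :
    ContMDiffAt 𝓘(ℝ, P × R2n n)
      (𝓘(ℝ, P).prod 𝓘(ℝ, R2n n)) s
      (fun z : P × R2n n => (z.1, φ.symm z.2)) (b, x) := by
  have h1 : ContMDiffAt 𝓘(ℝ, R2n n) 𝓘(ℝ, R2n n) s φ.symm x :=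
    (contMDiffOn_symm_of_mem_maximalAtlas hφ).contMDiffAt (φ.open_target.mem_nhds hx)
  have h2 : ContMDiffAt 𝓘(ℝ, P × R2n n) 𝓘(ℝ, R2n n) s
      (fun z : P × R2n n => z.2) (b, x) :=
    contDiff_snd.contMDiff.contMDiffAt
  have h3 : ContMDiffAt 𝓘(ℝ, P × R2n n) 𝓘(ℝ, P) s
      (fun z : P × R2n n => z.1) (b, x) :=
    contDiff_fst.contMDiff.contMDiffAt
  exact h3.prodMk (ContMDiffAt.comp (b, x) (g := φ.symm) (f := Prod.snd) h1 h2)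

theorem contMDiffOn_comp_chart (hφ : φ ∈ IsManifold.maximalAtlas 𝓘(ℝ, R2n n) s M)
    {H : EuclideanSpace ℝ (Fin d) × R2n n → R2n n} {S : Set (EuclideanSpace ℝ (Fin d) × R2n n)}
    (hH : ContDiffOn ℝ s H S) {T : Set (EuclideanSpace ℝ (Fin d) × M)}
    (hT : ∀ z ∈ T, z.2 ∈ φ.source) (hTS : MapsTo (fun z => (z.1, φ z.2)) T S) :
    ContMDiffOn (𝓘(ℝ, EuclideanSpace ℝ (Fin d)).prod 𝓘(ℝ, R2n n)) 𝓘(ℝ, R2n n) s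
      (fun z : EuclideanSpace ℝ (Fin d) × M => H (z.1, φ z.2)) T := by
  have h1 : ContMDiffOn (𝓘(ℝ, EuclideanSpace ℝ (Fin d)).prod 𝓘(ℝ, R2n n))
      𝓘(ℝ, EuclideanSpace ℝ (Fin d) × R2n n) s
      (fun z : EuclideanSpace ℝ (Fin d) × M => (z.1, φ z.2)) T :=
    contMDiffOn_fst.prodMk_space
      ((contMDiffOn_of_mem_maximalAtlas hφ).comp contMDiffOn_snd hT)
  exact (contMDiffOn_iff_contDiffOn.2 hH).comp h1 hTS

theorem IsSystemFamily.contDiffAt_momentum (h : IsSystemFamily s B Ω J θ N ρ N')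
    (hφ : φ ∈ IsManifold.maximalAtlas 𝓘(ℝ, R2n n) s M) (hN : IsOpen N) (hsub : φ.source ⊆ N)
    {b : EuclideanSpace ℝ (Fin d)} (hb : b ∈ B) {x : R2n n} (hx : x ∈ φ.target) (l : Fin κ) :
    ContDiffAt ℝ s (fun z : EuclideanSpace ℝ (Fin d) × R2n n => J z.1 l (φ.symm z.2)) (b, x) := by
  rw [← contMDiffAt_iff_contDiffAt]
  have h1 := (h.J_contMDiffOn l).contMDiffAt (x := (b, φ.symm x))
    ((h.isOpen.prod hN).mem_nhds ⟨hb, hsub (φ.map_target hx)⟩)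
  exact ContMDiffAt.comp (b, x)
    (g := fun bm : EuclideanSpace ℝ (Fin d) × M => J bm.1 l bm.2) h1 (contMDiffAt_pair_symm hφ hx)

theorem IsSystemFamily.contMDiffAt_finite (h : IsSystemFamily s B Ω J θ N ρ N')
    (hφ : φ ∈ IsManifold.maximalAtlas 𝓘(ℝ, R2n n) s M) (hN : IsOpen N') (hsub : φ.source ⊆ N')
    {b : EuclideanSpace ℝ (Fin d)} (hb : b ∈ B) {x : R2n n} (hx : x ∈ φ.target) (ψ : Γ) :
    ContMDiffAt 𝓘(ℝ, EuclideanSpace ℝ (Fin d) × R2n n) 𝓘(ℝ, R2n n) s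
      (fun z : EuclideanSpace ℝ (Fin d) × R2n n => ρ z.1 ψ (φ.symm z.2)) (b, x) := by
  have h1 := (h.finite_contMDiffOn ψ).contMDiffAt (x := (b, φ.symm x))
    ((h.isOpen.prod hN).mem_nhds ⟨hb, hsub (φ.map_target hx)⟩)
  exact ContMDiffAt.comp (b, x)
    (g := fun bm : EuclideanSpace ℝ (Fin d) × M => ρ bm.1 ψ bm.2) h1 (contMDiffAt_pair_symm hφ hx)

theorem IsSystemFamily.contDiffAt_form (hs : s = ∞ ∨ s = ω) (h : IsSystemFamily s B Ω J θ N ρ N')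
    (hφ : φ ∈ IsManifold.maximalAtlas 𝓘(ℝ, R2n n) s M) (hN : IsOpen N)
    {b : EuclideanSpace ℝ (Fin d)} (hb : b ∈ B) {x : R2n n} (hx : x ∈ φ.target)
    (hxN : φ.symm x ∈ N) :
    ContDiffAt ℝ s (fun z : EuclideanSpace ℝ (Fin d) × R2n n => bilOf (formInChart φ (Ω z.1) z.2))
      (b, x) := by
  set e := chartAt (R2n n) (φ.symm x) with he
  have hea : e ∈ atlas (R2n n) M := chart_mem_atlas _ _
  have hem : e ∈ IsManifold.maximalAtlas 𝓘(ℝ, R2n n) s M := IsManifold.chart_mem_maximalAtlas _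
  have hxe : φ.symm x ∈ e.source := mem_chart_source _ _
  have hφd := mdifferentiable_of_mem_maximalAtlas (ne_zero_of_smooth hs) hφ
  have hed := mdifferentiable_of_mem_maximalAtlas (ne_zero_of_smooth hs) hem
  set S := φ.target ∩ φ.symm ⁻¹' (e.source ∩ N) with hS
  have hSo : IsOpen S := φ.isOpen_inter_preimage_symm (e.open_source.inter hN)
  have hxS : x ∈ S := ⟨hx, hxe, hxN⟩
  have hf : ContDiffOn ℝ s (e ∘ φ.symm) S :=
    (contDiffOn_transition hφ hem).mono fun y hy => ⟨hy.1, hy.2.1⟩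
  have hmaps : MapsTo (e ∘ φ.symm) S (e.target ∩ e.symm ⁻¹' N) := fun y hy =>
    ⟨e.map_source hy.2.1, by
      simp only [mem_preimage, Function.comp_apply]
      rw [e.left_inv hy.2.1]; exact hy.2.2⟩
  have hf2 : ContDiffOn ℝ s (fun z : EuclideanSpace ℝ (Fin d) × R2n n =>
      (z.1, (e ∘ φ.symm) z.2)) (B ×ˢ S) :=
    contDiffOn_fst.prodMk (hf.comp contDiffOn_snd fun z hz => hz.2)
  have h1 : ContDiffOn ℝ s (fun z : EuclideanSpace ℝ (Fin d) × R2n n =>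
      bilOf (formInChart e (Ω z.1) ((e ∘ φ.symm) z.2))) (B ×ˢ S) :=
    bilOf.contDiff.comp_contDiffOn ((h.form_contDiffOn e hea).comp hf2 fun z hz => ⟨hz.1, hmaps hz.2⟩)
  have h2 : ContDiffOn ℝ s (fun z : EuclideanSpace ℝ (Fin d) × R2n n =>
      fderiv ℝ (e ∘ φ.symm) z.2) (B ×ˢ S) :=
    (hf.fderiv_of_isOpen hSo (add_one_le_of_smooth hs)).comp contDiffOn_snd fun z hz => hz.2
  have h3 := (ContDiffOn.pullB h1 h2).contDiffAt (x := (b, x)) ((h.isOpen.prod hSo).mem_nhds ⟨hb, hxS⟩)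
  refine h3.congr_of_eventuallyEq ?_
  filter_upwards [(h.isOpen.prod hSo).mem_nhds (show (b, x) ∈ B ×ˢ S from ⟨hb, hxS⟩)] with z hz
  exact formInChart_eq_pullback hφd hed hz.2.1 hz.2.2.1

theorem IsSystemFamily.contDiffAt_chartData (hs : s = ∞ ∨ s = ω)
    (h : IsSystemFamily s B Ω J θ N ρ N')
    (hφ : φ ∈ IsManifold.maximalAtlas 𝓘(ℝ, R2n n) s M) (hsub : φ.source ⊆ N')
    {b : EuclideanSpace ℝ (Fin d)} (hb : b ∈ B) {x : R2n n} (hx : x ∈ φ.target)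
    (hxρ : ∀ ψ, ρ b ψ (φ.symm x) ∈ φ.source) :
    ContDiffAt ℝ s (fun z : EuclideanSpace ℝ (Fin d) × R2n n =>
      chartData φ (Ω z.1) (J z.1) (ρ z.1) z.2) (b, x) := by
  have hsys := h.system b hb
  have hxN' := hsub (φ.map_target hx)
  have hsN := hsub.trans hsys.subset
  refine ContDiffAt.prodMk (h.contDiffAt_form hs hφ hsys.isOpen hb hx (hsys.subset hxN'))
    (ContDiffAt.prodMk (contDiffAt_pi.2 fun l => ?_) (contDiffAt_pi.2 fun ψ => ?_))
  · set F : EuclideanSpace ℝ (Fin d) × R2n n → ℝ := fun z => J z.1 l (φ.symm z.2) with hF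
    have hFs : ∀ z ∈ B ×ˢ φ.target, ContDiffAt ℝ s F z := fun z hz =>
      h.contDiffAt_momentum hφ hsys.isOpen hsN hz.1 hz.2 l
    have ho : IsOpen (B ×ˢ φ.target) := h.isOpen.prod φ.open_target
    have hF' : ContDiffOn ℝ s F (B ×ˢ φ.target) := fun z hz => (hFs z hz).contDiffWithinAt
    have h1 := (hF'.fderiv_of_isOpen ho (add_one_le_of_smooth hs)).contDiffAt
      (ho.mem_nhds (show (b, x) ∈ B ×ˢ φ.target from ⟨hb, hx⟩))
    have h2 := h1.clm_comp (contDiffAt_const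
      (c := ContinuousLinearMap.inr ℝ (EuclideanSpace ℝ (Fin d)) (R2n n)))
    refine h2.congr_of_eventuallyEq ?_
    filter_upwards [ho.mem_nhds (show (b, x) ∈ B ×ˢ φ.target from ⟨hb, hx⟩)] with z hz
    have h3 : HasFDerivAt F (fderiv ℝ F z) (z.1, z.2) :=
      ((hFs z hz).differentiableAt (ne_zero_of_smooth hs)).hasFDerivAt
    exact (HasFDerivAt.partial_right h3).fderiv
  · rw [← contMDiffAt_iff_contDiffAt]
    have h3 : ContMDiffAt 𝓘(ℝ, R2n n) 𝓘(ℝ, R2n n) s φ (ρ b ψ (φ.symm x)) :=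
      (contMDiffOn_of_mem_maximalAtlas hφ).contMDiffAt (φ.open_source.mem_nhds (hxρ ψ))
    exact ContMDiffAt.comp (b, x) (g := φ) h3
      (h.contMDiffAt_finite hφ hsys.isOpen' hsub hb hx ψ)

/-- Tube argument: the member 0 maps a compact ball into the open domain of the chart, hence so do
the members with nearby parameters. -/
theorem IsSystemFamily.eventually_mem_source (h : IsSystemFamily s B Ω J θ N ρ N')
    (hφ : φ ∈ IsManifold.maximalAtlas 𝓘(ℝ, R2n n) s M) (hsub : φ.source ⊆ N') (h0 : 0 ∈ B)
    {R : ℝ} (hball : Metric.closedBall 0 R ⊆ φ.target)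
    (hρ : ∀ ψ x, ‖x‖ ≤ R → ρ 0 ψ (φ.symm x) ∈ φ.source) :
    ∀ᶠ b in 𝓝 (0 : EuclideanSpace ℝ (Fin d)), ∀ ψ x, ‖x‖ ≤ R → ρ b ψ (φ.symm x) ∈ φ.source := by
  rw [Filter.eventually_all]
  intro ψ
  have h1 := (isCompact_closedBall (0 : R2n n) R).eventually_forall_of_forall_eventually
    (x₀ := (0 : EuclideanSpace ℝ (Fin d)))
    (P := fun b x => ρ b ψ (φ.symm x) ∈ φ.source) fun x hx => by
      have h2 := (h.contMDiffAt_finite hφ (h.system 0 h0).isOpen' hsub h0 (hball hx) ψ).continuousAt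
      exact h2.preimage_mem_nhds (φ.open_source.mem_nhds (hρ ψ x (by simpa using hx)))
  filter_upwards [h1] with b hb x hx
  exact hb x (by simpa using hx)

end Family

/-! ### Persistence in families -/

section Persistence

variable {n κ : ℕ} {M : Type*} [TopologicalSpace M] [T2Space M] [ChartedSpace (R2n n) M]
  {r : WithTop ℕ∞} [IsManifold 𝓘(ℝ, R2n n) r M] {φ : OpenPartialHomeomorph M (R2n n)} {Γ : Type*}
  [Group Γ] [Finite Γ] {Ω : TwoForm n M} {J : Fin κ → M → ℝ} {θ : Torus κ → M → M}
  {ρ : Γ → M → M} {p : Fin n → Fin κ → ℤ} {q : Γ → Fin n → ℚ} {c : Fin κ → ℝ}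
  {a : Γ → Fin n → Circle} {kₑ : ℕ} {m₀ : M} {R₀ : ℝ}

/-- In the coordinates of the given normal form the member 0 has exactly the data of the model, so
for small b the normalising map exists, and it is jointly regular in b and the point. For b = 0 it
is the identity, which is why the coordinates are restrictions of the given ones. -/
theorem IsNormalForm.persistsInFamilies (h : IsNormalForm r Ω J θ ρ kₑ p q c φ m₀)
    (ht : φ.target = Metric.ball 0 R₀) (ha : ∀ ψ χ, a (ψ * χ) = a ψ * a χ)
    (haq : ∀ ψ j, (a ψ j : ℂ) = Complex.exp (2 * Real.pi * Complex.I * (q ψ j : ℂ)))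
    (hp : ∀ (j : Fin n) l, kₑ ≤ j.val → p j l = 0) :
    PersistsInFamilies r Ω J ρ kₑ p q φ m₀ := by
  have := Fintype.ofFinite Γ
  intro U' hU' hc hsub s hs hsr d B Ω' J' θ' N ρ' N' hfam h0 hN' heq
  have : IsManifold 𝓘(ℝ, R2n n) s M := IsManifold.of_le hsr
  have hφ := mem_maximalAtlas_of_le hsr h.smooth
  obtain ⟨R, δ, hδ, hδR, hR, hUR, hUδ⟩ := exists_radii h.mem_source h.centred ht hU' hc hsub
  set D := fun b => chartData φ (Ω' b) (J' b) (ρ' b) with hD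
  have hcb : Metric.closedBall (0 : R2n n) R ⊆ φ.target := by
    rw [ht]; exact Metric.closedBall_subset_ball hR
  have hball : Metric.ball (0 : R2n n) R ⊆ φ.target := Metric.ball_subset_closedBall.trans hcb
  have hmodel : ∀ x ∈ φ.target, D 0 x = model p a x := fun x hx =>
    (chartData_congr heq hx).trans (h.chartData_eq haq hp hx)
  have hρ0 : ∀ ψ x, ‖x‖ ≤ R → ρ' 0 ψ (φ.symm x) ∈ φ.source := fun ψ x hx => by
    have hx' := φ.map_target (hcb (by simpa using hx))
    rw [(heq _ hx').2.2]
    exact h.finite_invariant ψ hx'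
  obtain ⟨B₁, hB₁, hB₁o, h0B₁⟩ := eventually_nhds_iff.1
    ((hfam.eventually_mem_source hφ hN' h0 hcb hρ0).and (hfam.isOpen.mem_nhds h0))
  have hDs : ContDiffOn ℝ s (fun z : EuclideanSpace ℝ (Fin d) × R2n n => D z.1 z.2)
      (B₁ ×ˢ Metric.ball 0 R) := fun z hz =>
    (hfam.contDiffAt_chartData hs hφ hN' (hB₁ _ hz.1).2 (hball hz.2) fun ψ =>
      (hB₁ _ hz.1).1 ψ _ (mem_ball_zero_iff.1 hz.2).le).contDiffWithinAt
  obtain ⟨B', hB', hB'o, h0B'⟩ := eventually_nhds_iff.1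
    ((eventually_normalizable (p := p) (a := a) hB₁o h0B₁ hδ (hDs.of_le (two_le_of_smooth hs))
      fun x hx => hmodel x (hball (by simpa using hx))).and (hB₁o.mem_nhds h0B₁))
  -- The chart `φ` is a default for parameters outside `B'`, so that a choice can be made for every
  -- b.
  have hex : ∀ b, ∃ φ' : OpenPartialHomeomorph M (R2n n), b ∈ B' →
      (∀ m, φ' m = normMap p a (D b) R δ (φ m)) ∧
      φ'.source = φ.source ∩ φ ⁻¹' (Metric.ball 0 (R - 10 * δ) ∩
        normMap p a (D b) R δ ⁻¹' Metric.ball 0 (R - 12 * δ)) ∧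
      IsNormalForm s (Ω' b) (J' b) (θ' b) (ρ' b) kₑ p q
        (fun l => J' b l (φ.symm (invBall (normMap p a (D b) R δ) (R - 10 * δ) 0))) φ'
        (φ.symm (invBall (normMap p a (D b) R δ) (R - 10 * δ) 0)) := by
    intro b
    by_cases hb : b ∈ B'
    · obtain ⟨φ', h1, h2, -, h3⟩ := (hfam.system b (hB₁ b (hB' b hb).2).2).exists_isNormalForm hs hφ hN'
        hball (fun ψ x hx => (hB₁ b (hB' b hb).2).1 ψ x hx.le) (fun _ _ => rfl) (hB' b hb).1 hδ ha haq hp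
        (r' := R - 12 * δ) (by linarith) le_rfl
      exact ⟨φ', fun _ => ⟨h1, h2, h3⟩⟩
    · exact ⟨φ, fun h => absurd h hb⟩
  choose φ' hφ' using hex
  have hηs := Normalizable.contDiffOn_normMap_family hB'o hδ (add_one_le_of_smooth hs)
    (ne_zero_of_smooth hs) (hDs.mono (prod_mono (fun b hb => (hB' b hb).2) Subset.rfl))
    fun b hb => (hB' b hb).1
  set T : Set (EuclideanSpace ℝ (Fin d) × M) :=
    B' ×ˢ (φ.source ∩ φ ⁻¹' Metric.ball 0 (R - 10 * δ)) with hT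
  have hTo : IsOpen T := hB'o.prod (φ.isOpen_inter_preimage Metric.isOpen_ball)
  have hfs : ContMDiffOn (𝓘(ℝ, EuclideanSpace ℝ (Fin d)).prod 𝓘(ℝ, R2n n)) 𝓘(ℝ, R2n n) s
      (fun bm : EuclideanSpace ℝ (Fin d) × M => normMap p a (D bm.1) R δ (φ bm.2)) T := by
    refine contMDiffOn_comp_chart hφ hηs (fun z hz => hz.2.1) fun z hz => ⟨hz.1, ?_⟩
    exact Metric.ball_subset_ball (by linarith) hz.2.2
  -- The total domain is the preimage of a ball under the jointly continuous normalising map; this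
  -- shows that it is open.
  have hset : {bm : EuclideanSpace ℝ (Fin d) × M | bm.1 ∈ B' ∧ bm.2 ∈ (φ' bm.1).source} =
      T ∩ (fun bm : EuclideanSpace ℝ (Fin d) × M => normMap p a (D bm.1) R δ (φ bm.2)) ⁻¹'
        Metric.ball 0 (R - 12 * δ) := by
    ext bm
    constructor
    · rintro ⟨h1, h2⟩
      rw [(hφ' _ h1).2.1] at h2
      exact ⟨⟨h1, h2.1, h2.2.1⟩, h2.2.2⟩
    · rintro ⟨⟨h1, h2, h3⟩, h4⟩
      refine ⟨h1, ?_⟩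
      rw [(hφ' _ h1).2.1]
      exact ⟨h2, h3, h4⟩
  refine ⟨B', fun b => φ.symm (invBall (normMap p a (D b) R δ) (R - 10 * δ) 0), φ',
    fun b l => J' b l (φ.symm (invBall (normMap p a (D b) R δ) (R - 10 * δ) 0)), hB'o, h0B',
    fun b hb => (hB₁ b (hB' b hb).2).2, fun b hb => ⟨?_, ?_, ?_, (hφ' b hb).2.2⟩, ?_, ?_, ?_⟩
  · refine hUδ _ ?_
    simpa using (hB' b hb).1.near.norm_invBall_sub_le hδ.le (y := 0) (by simp; linarith)
  · intro m hm
    rw [(hφ' b hb).2.1]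
    have h1 := hUR m hm
    refine ⟨hsub (subset_closure hm), ?_, ?_⟩
    · rw [mem_ball_zero_iff]; linarith
    · have := (hB' b hb).1.near.norm_lt (r' := R - 14 * δ) (by linarith) h1
      rw [mem_preimage, mem_ball_zero_iff]; linarith
  · rw [(hφ' b hb).2.1]
    exact inter_subset_left
  · intro m hm
    rw [(hφ' 0 h0B').1]
    rw [(hφ' 0 h0B').2.1] at hm
    have hN := (hB' 0 h0B').1
    refine normMap_model hδ hN.lin hN.nearLin hN.moser
      (fun x hx => hmodel x (hball (by simpa using hx))) ?_
    have := mem_ball_zero_iff.1 hm.2.1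
    linarith
  · rw [hset]
    exact hfs.continuousOn.isOpen_inter_preimage hTo Metric.isOpen_ball
  · rw [hset]
    refine (hfs.mono inter_subset_left).congr fun z hz => ?_
    exact (hφ' _ hz.1.1).1 _

end Persistence

open scoped BoundedContinuousFunction

/-! ### A universal family containing all perturbations -/

section UniformFamily

universe u

variable {E : Type} [NormedAddCommGroup E] [NormedSpace ℝ E] {I : Type*} [TopologicalSpace I]
  [DiscreteTopology I]

open Classical in
/-- A bounded family, as an element of the space of bounded functions. -/
def bddFun {F : Type*} [NormedAddCommGroup F] (f : I → F) : I →ᵇ F :=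
  if h : ∃ C, ∀ i, ‖f i‖ ≤ C then
    BoundedContinuousFunction.ofNormedAddCommGroupDiscrete f h.choose h.choose_spec else 0

theorem bddFun_apply {F : Type*} [NormedAddCommGroup F] {f : I → F} {C : ℝ} (h : ∀ i, ‖f i‖ ≤ C)
    (i : I) : bddFun f i = f i := by
  rw [bddFun, dif_pos ⟨C, h⟩]
  rfl

theorem norm_bddFun_apply_le {F : Type*} [NormedAddCommGroup F] [NormedSpace ℝ F]
    (A : I →ᵇ (E →L[ℝ] F)) (v : E) (i : I) : ‖A i v‖ ≤ ‖A‖ * ‖v‖ :=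
  (A i).le_of_opNorm_le (A.norm_coe_le_norm i) v

/-- The linear map defined by a bounded family of linear maps. -/
def applyFam {F : Type*} [NormedAddCommGroup F] [NormedSpace ℝ F] :
    (I →ᵇ (E →L[ℝ] F)) →L[ℝ] (E →L[ℝ] (I →ᵇ F)) :=
  LinearMap.mkContinuous₂ (LinearMap.mk₂ ℝ (fun A v => bddFun fun i => A i v)
    (fun A A' v => by
      ext i
      rw [BoundedContinuousFunction.add_apply, bddFun_apply (norm_bddFun_apply_le (A + A') v),
        bddFun_apply (norm_bddFun_apply_le A v), bddFun_apply (norm_bddFun_apply_le A' v)]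
      rfl)
    (fun c A v => by
      ext i
      rw [BoundedContinuousFunction.smul_apply, bddFun_apply (norm_bddFun_apply_le (c • A) v),
        bddFun_apply (norm_bddFun_apply_le A v)]
      rfl)
    (fun A v v' => by
      ext i
      rw [BoundedContinuousFunction.add_apply, bddFun_apply (norm_bddFun_apply_le A (v + v')),
        bddFun_apply (norm_bddFun_apply_le A v), bddFun_apply (norm_bddFun_apply_le A v'), map_add])
    (fun c A v => by
      ext i
      rw [BoundedContinuousFunction.smul_apply, bddFun_apply (norm_bddFun_apply_le A (c • v)),
        bddFun_apply (norm_bddFun_apply_le A v), map_smul])) 1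
    (fun A v => by
      rw [one_mul, LinearMap.mk₂_apply, BoundedContinuousFunction.norm_le (by positivity)]
      intro i
      rw [bddFun_apply (norm_bddFun_apply_le A v)]
      exact norm_bddFun_apply_le A v i)

theorem applyFam_apply {F : Type*} [NormedAddCommGroup F] [NormedSpace ℝ F]
    (A : I →ᵇ (E →L[ℝ] F)) (v : E) (i : I) : applyFam A v i = A i v :=
  bddFun_apply (norm_bddFun_apply_le A v) i

theorem norm_taylor_le {F : Type*} [NormedAddCommGroup F] [NormedSpace ℝ F] {f : E → F} {S : Set E}
    {C : ℝ} (hS : IsOpen S) (hSc : Convex ℝ S) (hf : ContDiffOn ℝ 2 f S)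
    (hC : ∀ x ∈ S, ‖iteratedFDeriv ℝ 2 f x‖ ≤ C) {x y : E} (hx : x ∈ S) (hy : y ∈ S) :
    ‖f y - f x - fderiv ℝ f x (y - x)‖ ≤ C * ‖y - x‖ * ‖y - x‖ := by
  have hC0 : 0 ≤ C := (norm_nonneg _).trans (hC x hx)
  have hf' : ContDiffOn ℝ 1 (fderiv ℝ f) S := hf.fderiv_of_isOpen hS le_rfl
  have hlip : ∀ z ∈ S, ‖fderiv ℝ f z - fderiv ℝ f x‖ ≤ C * ‖z - x‖ := fun z hz =>
    hSc.norm_image_sub_le_of_norm_fderiv_le (𝕜 := ℝ)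
      (fun w hw => (hf'.contDiffAt (hS.mem_nhds hw)).differentiableAt one_ne_zero)
      (fun w hw => by
        rw [← norm_iteratedFDeriv_one, norm_iteratedFDeriv_fderiv]
        exact hC w hw) hx hz
  refine (hSc.inter (convex_closedBall x ‖y - x‖)).norm_image_sub_le_of_norm_fderiv_le' (𝕜 := ℝ)
    (fun w hw => (hf.contDiffAt (hS.mem_nhds hw.1)).differentiableAt two_ne_zero)
    (fun w hw => (hlip w hw.1).trans ?_) ⟨hx, by simp⟩ ⟨hy, by simp [dist_eq_norm]⟩
  have : ‖w - x‖ ≤ ‖y - x‖ := by simpa [dist_eq_norm] using hw.2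
  gcongr

/-- The bound on second derivatives is uniform in i, so the Taylor remainders are uniformly of
second order, which is differentiability in the sup norm. -/
theorem hasFDerivAt_bddFun {F : Type*} [NormedAddCommGroup F] [NormedSpace ℝ F] {f : I → E → F}
    {S : Set E} {C : ℝ} (hS : IsOpen S) (hSc : Convex ℝ S) (hf : ∀ i, ContDiffOn ℝ 2 (f i) S)
    (hC : ∀ i, ∀ j ≤ 2, ∀ x ∈ S, ‖iteratedFDeriv ℝ j (f i) x‖ ≤ C) {x : E} (hx : x ∈ S) :
    HasFDerivAt (fun x => bddFun fun i => f i x) (applyFam (bddFun fun i => fderiv ℝ (f i) x)) x := by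
  have h0 : ∀ y ∈ S, ∀ i, ‖f i y‖ ≤ C := fun y hy i => by
    simpa using hC i 0 (by norm_num) y hy
  have h1 : ∀ i, ‖fderiv ℝ (f i) x‖ ≤ C := fun i => by
    simpa [norm_iteratedFDeriv_one] using hC i 1 (by norm_num) x hx
  rw [hasFDerivAt_iff_isLittleO]
  refine Asymptotics.IsLittleO.of_bound fun c hc => ?_
  have hC1 : 0 < |C| + 1 := by positivity
  filter_upwards [hS.mem_nhds hx, Metric.ball_mem_nhds x (div_pos hc hC1)] with y hy hyb
  rw [Metric.mem_ball, dist_eq_norm, lt_div_iff₀ hC1] at hyb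
  rw [BoundedContinuousFunction.norm_le (by positivity)]
  intro i
  rw [BoundedContinuousFunction.sub_apply, BoundedContinuousFunction.sub_apply, applyFam_apply,
    bddFun_apply (h0 y hy), bddFun_apply (h0 x hx), bddFun_apply h1]
  refine (norm_taylor_le hS hSc (hf i) (hC i 2 le_rfl) hx hy).trans ?_
  gcongr
  calc C * ‖y - x‖ ≤ ‖y - x‖ * (|C| + 1) := by
        nlinarith [norm_nonneg (y - x), le_abs_self C]
    _ ≤ c := hyb.le

/-- One order is lost: the derivative of order m of the whole family is continuous in the sup norm
because a common bound on derivatives of order m + 1 makes it Lipschitz. -/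
theorem contDiffOn_bddFun {S : Set E} (hS : IsOpen S) (hSc : Convex ℝ S) (m : ℕ) {C : ℝ} :
    ∀ {F : Type u} [NormedAddCommGroup F] [NormedSpace ℝ F] {f : I → E → F},
      (∀ i, ContDiffOn ℝ (m + 1) (f i) S) →
      (∀ i, ∀ j ≤ m + 1, ∀ x ∈ S, ‖iteratedFDeriv ℝ j (f i) x‖ ≤ C) →
      ContDiffOn ℝ m (fun x => bddFun fun i => f i x) S := by
  induction m with
  | zero =>
    intro F _ _ f hf hC
    have h0 : ∀ y ∈ S, ∀ i, ‖f i y‖ ≤ C := fun y hy i => by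
      simpa using hC i 0 (by norm_num) y hy
    rw [Nat.cast_zero, contDiffOn_zero]
    have hlip : LipschitzOnWith (Real.toNNReal C) (fun x => bddFun fun i => f i x) S := by
      refine LipschitzOnWith.of_dist_le_mul fun x hx y hy => ?_
      have hfd : ∀ i, ‖f i x - f i y‖ ≤ C * ‖x - y‖ := fun i =>
        hSc.norm_image_sub_le_of_norm_fderiv_le (𝕜 := ℝ)
          (fun w hw => ((hf i).contDiffAt (hS.mem_nhds hw)).differentiableAt (by simp))
          (fun w hw => by rw [← norm_iteratedFDeriv_one]; exact hC i 1 (by norm_num) w hw) hy hx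
      rw [dist_eq_norm, BoundedContinuousFunction.norm_le (by positivity)]
      intro i
      rw [BoundedContinuousFunction.sub_apply, bddFun_apply (h0 x hx), bddFun_apply (h0 y hy),
        dist_eq_norm]
      refine (hfd i).trans ?_
      gcongr
      exact Real.le_coe_toNNReal C
    exact hlip.continuousOn
  | succ m ih =>
    intro F _ _ f hf hC
    have hf2 : ∀ i, ContDiffOn ℝ 2 (f i) S := fun i => (hf i).of_le (by
      norm_cast; omega)
    have hd : ∀ x ∈ S, HasFDerivAt (fun x => bddFun fun i => f i x)
        (applyFam (bddFun fun i => fderiv ℝ (f i) x)) x := fun x hx =>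
      hasFDerivAt_bddFun hS hSc hf2 (fun i j hj x hx => hC i j (by omega) x hx) hx
    push_cast
    rw [contDiffOn_succ_iff_fderiv_of_isOpen hS]
    refine ⟨fun x hx => (hd x hx).differentiableAt.differentiableWithinAt, fun h => by simp at h, ?_⟩
    have h1 : ContDiffOn ℝ m (fun x => bddFun fun i => fderiv ℝ (f i) x) S := by
      refine ih (fun i => (hf i).fderiv_of_isOpen hS (by norm_cast)) fun i j hj x hx => ?_
      rw [norm_iteratedFDeriv_fderiv]
      exact hC i (j + 1) (by omega) x hx
    have h2 := (applyFam (E := E) (I := I) (F := F)).contDiff.comp_contDiffOn h1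
    exact h2.congr fun x hx => (hd x hx).fderiv

/-- The unit ball of the space of maps of class `C^m` on `S`. -/
structure UnitMap (E : Type) [NormedAddCommGroup E] [NormedSpace ℝ E] (Z : Type u)
    [NormedAddCommGroup Z] [NormedSpace ℝ Z] (S : Set E) (m : ℕ) where
  /-- The underlying map. -/
  toFun : E → Z
  contDiffOn : ContDiffOn ℝ m toFun S
  bound : ∀ j ≤ m, ∀ x ∈ S, ‖iteratedFDeriv ℝ j toFun x‖ ≤ 1

variable {Z : Type u} [NormedAddCommGroup Z] [NormedSpace ℝ Z] {S : Set E} {m : ℕ}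

/-- With the discrete topology the bounded continuous functions on the unit ball are all bounded
functions. -/
instance : TopologicalSpace (UnitMap E Z S m) := ⊥

instance : DiscreteTopology (UnitMap E Z S m) := ⟨rfl⟩

/-- A parameter space for perturbations of a map. -/
abbrev Perturbation (E : Type) [NormedAddCommGroup E] [NormedSpace ℝ E] (Z : Type u)
    [NormedAddCommGroup Z] [NormedSpace ℝ Z] (S : Set E) (m : ℕ) : Type u :=
  (UnitMap E Z S m →ᵇ Z) →L[ℝ] Z

instance [CompleteSpace Z] : CompleteSpace (Perturbation E Z S m) :=
  ContinuousLinearMap.instCompleteSpace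

/-- The map `f`, perturbed with the parameter `b`. -/
def perturb (f : E → Z) (b : Perturbation E Z S m) (x : E) : Z :=
  f x + b (bddFun fun g : UnitMap E Z S m => g.toFun x)

/-- The parameter that corresponds to an element of the unit ball. -/
def evalAt (g : UnitMap E Z S m) : Perturbation E Z S m := BoundedContinuousFunction.evalCLM ℝ g

theorem norm_evalAt_le (g : UnitMap E Z S m) : ‖evalAt g‖ ≤ 1 :=
  ContinuousLinearMap.opNorm_le_bound _ zero_le_one fun f => by
    rw [one_mul]; exact f.norm_coe_le_norm g

theorem perturb_evalAt (f : E → Z) (g : UnitMap E Z S m) (t : ℝ) {x : E} (hx : x ∈ S) :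
    perturb f (t • evalAt g) x = f x + t • g.toFun x := by
  rw [perturb, _root_.smul_apply]
  congr 2
  exact bddFun_apply (C := 1) (fun g => by simpa using g.bound 0 (by omega) x hx) g

theorem perturb_zero (f : E → Z) (x : E) : perturb f (0 : Perturbation E Z S m) x = f x := by
  simp [perturb]

/-- The bounded family of all elements of the unit ball is a C^m map of the point, and the
parameter, an operator on bounded functions, acts on it linearly. A perturbation of size ε is the
member with parameter ε times an evaluation, of norm at most ε. Uniform estimates over all
perturbations thus become estimates for one map near the parameter 0. -/
theorem contDiffOn_perturb (hS : IsOpen S) (hSc : Convex ℝ S) {f : E → Z}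
    (hf : ContDiffOn ℝ m f S) :
    ContDiffOn ℝ m (fun z : Perturbation E Z S (m + 1) × E => perturb f z.1 z.2) (univ ×ˢ S) := by
  have h1 : ContDiffOn ℝ m (fun x => bddFun fun g : UnitMap E Z S (m + 1) => g.toFun x) S :=
    contDiffOn_bddFun hS hSc m (C := 1) (fun g => by exact_mod_cast g.contDiffOn) fun g => g.bound
  exact (hf.comp contDiffOn_snd fun z hz => hz.2).add
    (contDiffOn_fst.clm_apply (h1.comp contDiffOn_snd fun z hz => hz.2))

end UniformFamily

/-! ### Linear estimates in the parameter -/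

section Quantitative

universe u

variable {E : Type} [NormedAddCommGroup E] [NormedSpace ℝ E] {P : Type*} [NormedAddCommGroup P]
  [NormedSpace ℝ P] {B : Set P} {S K : Set E}

/-- A C^1 map is locally Lipschitz in both variables; compactness of `K` gives a common constant. -/
theorem exists_norm_sub_le (hB : IsOpen B) (h0 : (0 : P) ∈ B) (hS : IsOpen S) (hK : IsCompact K)
    (hKS : K ⊆ S) {F : Type*} [NormedAddCommGroup F] [NormedSpace ℝ F] {H : P × E → F}
    (hH : ContDiffOn ℝ 1 H (B ×ˢ S)) :
    ∃ C, ∀ᶠ b in 𝓝 (0 : P), ∀ x ∈ K, ‖H (b, x) - H (0, x)‖ ≤ C * ‖b‖ := by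
  refine hK.induction_on ⟨0, by simp⟩ (fun s t hst ⟨C, hC⟩ => ⟨C, ?_⟩)
    (fun s t ⟨C, hC⟩ ⟨C', hC'⟩ => ⟨max C C', ?_⟩) fun x hx => ?_
  · filter_upwards [hC] with b hb x hx using hb x (hst hx)
  · filter_upwards [hC, hC'] with b hb hb' x hx
    rcases hx with hx | hx
    · exact (hb x hx).trans (by gcongr; exact le_max_left _ _)
    · exact (hb' x hx).trans (by gcongr; exact le_max_right _ _)
  · obtain ⟨L, t, ht, hL⟩ := (hH.contDiffAt
      ((hB.prod hS).mem_nhds (show ((0 : P), x) ∈ B ×ˢ S from ⟨h0, hKS hx⟩))).exists_lipschitzOnWith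
    rw [nhds_prod_eq, Filter.mem_prod_iff] at ht
    obtain ⟨t₁, ht₁, t₂, ht₂, hsub⟩ := ht
    refine ⟨t₂, mem_nhdsWithin_of_mem_nhds ht₂, L, ?_⟩
    filter_upwards [ht₁] with b hb y hy
    have := hL.dist_le_mul (b, y) (hsub ⟨hb, hy⟩) (0, y) (hsub ⟨mem_of_mem_nhds ht₁, hy⟩)
    simpa [dist_eq_norm, Prod.norm_def] using this

/-- Induction on the order through the partial derivative in x; the last derivative available is
spent on the Lipschitz dependence on the parameter. -/
theorem exists_norm_iteratedFDeriv_sub_le (hB : IsOpen B) (h0 : (0 : P) ∈ B) (hS : IsOpen S)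
    (hK : IsCompact K) (hKS : K ⊆ S) (j : ℕ) :
    ∀ {F : Type u} [NormedAddCommGroup F] [NormedSpace ℝ F] {H : P × E → F},
      ContDiffOn ℝ (j + 1) H (B ×ˢ S) → ∃ C, ∀ᶠ b in 𝓝 (0 : P), ∀ x ∈ K,
        ‖iteratedFDeriv ℝ j (fun x => H (b, x) - H (0, x)) x‖ ≤ C * ‖b‖ := by
  induction j with
  | zero =>
    intro F _ _ H hH
    simpa using exists_norm_sub_le hB h0 hS hK hKS (by simpa using hH)
  | succ j ih =>
    intro F _ _ H hH
    have ho : IsOpen (B ×ˢ S) := hB.prod hS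
    set H' : P × E → E →L[ℝ] F := fun z => (fderiv ℝ H z).comp (ContinuousLinearMap.inr ℝ P E) with hH'
    have h1 : ContDiffOn ℝ (j + 1) H' (B ×ˢ S) :=
      (hH.fderiv_of_isOpen ho (by push_cast; exact le_rfl)).clm_comp contDiffOn_const
    have hd : ∀ b ∈ B, ∀ x ∈ S, HasFDerivAt (fun x => H (b, x)) (H' (b, x)) x := fun b hb x hx =>
      HasFDerivAt.partial_right ((hH.contDiffAt (ho.mem_nhds
        (show (b, x) ∈ B ×ˢ S from ⟨hb, hx⟩))).differentiableAt (by simp)).hasFDerivAt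
    obtain ⟨C, hC⟩ := ih h1
    refine ⟨C, ?_⟩
    filter_upwards [hC, hB.mem_nhds h0] with b hb hbB x hx
    rw [← norm_iteratedFDeriv_fderiv]
    have h2 : fderiv ℝ (fun x => H (b, x) - H (0, x)) =ᶠ[𝓝 x] fun x => H' (b, x) - H' (0, x) := by
      filter_upwards [hS.mem_nhds (hKS hx)] with y hy
      exact ((hd b hbB y hy).fun_sub (hd 0 h0 y hy)).fderiv
    rw [(h2.iteratedFDeriv ℝ j).eq_of_nhds]
    exact hb x hx

theorem exists_ckClose (hB : IsOpen B) (h0 : (0 : P) ∈ B) (hS : IsOpen S)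
    (hK : IsCompact K) (hKS : K ⊆ S) (m : ℕ) {F : Type u} [NormedAddCommGroup F] [NormedSpace ℝ F]
    {H : P × E → F} (hH : ContDiffOn ℝ (m + 1) H (B ×ˢ S)) :
    ∃ C, 0 ≤ C ∧ ∀ᶠ b in 𝓝 (0 : P),
      CkCloseOn m K (fun x => H (b, x)) (fun x => H (0, x)) (C * ‖b‖) := by
  have h1 : ∀ j : Fin (m + 1), ∃ C, ∀ᶠ b in 𝓝 (0 : P), ∀ x ∈ K,
      ‖iteratedFDeriv ℝ j (fun x => H (b, x) - H (0, x)) x‖ ≤ C * ‖b‖ := fun j =>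
    exists_norm_iteratedFDeriv_sub_le hB h0 hS hK hKS j (hH.of_le (by
      have := j.2
      norm_cast))
  choose C hC using h1
  refine ⟨∑ j, |C j|, Finset.sum_nonneg fun j _ => abs_nonneg _, ?_⟩
  filter_upwards [Filter.eventually_all.2 hC] with b hb i hi x hx
  refine (hb ⟨i, by omega⟩ x hx).trans ?_
  gcongr
  exact (le_abs_self _).trans (Finset.single_le_sum (f := fun j => |C j|)
    (fun j _ => abs_nonneg _) (Finset.mem_univ _))

end Quantitative

/-! ### Estimates by components, and bounds for the model -/

section Components

variable {E F G : Type*} [NormedAddCommGroup E] [NormedSpace ℝ E] [NormedAddCommGroup F]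
  [NormedSpace ℝ F] [NormedAddCommGroup G] [NormedSpace ℝ G] {j : ℕ} {x : E} {C : ℝ}

theorem norm_iteratedFDeriv_prodMk_le {f : E → F} {g : E → G} (hf : ContDiffAt ℝ j f x)
    (hg : ContDiffAt ℝ j g x) (hfC : ‖iteratedFDeriv ℝ j f x‖ ≤ C)
    (hgC : ‖iteratedFDeriv ℝ j g x‖ ≤ C) : ‖iteratedFDeriv ℝ j (fun x => (f x, g x)) x‖ ≤ C := by
  rw [iteratedFDeriv_prodMk hf hg le_rfl, ContinuousMultilinearMap.opNorm_prod]
  exact max_le hfC hgC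

theorem norm_iteratedFDeriv_pi_le {ι : Type*} [Fintype ι] {f : E → ι → F} (hC0 : 0 ≤ C)
    (hf : ContDiffAt ℝ j f x) (hfC : ∀ i, ‖iteratedFDeriv ℝ j (fun x => f x i) x‖ ≤ C) :
    ‖iteratedFDeriv ℝ j f x‖ ≤ C := by
  refine ContinuousMultilinearMap.opNorm_le_bound hC0 fun v => ?_
  rw [pi_norm_le_iff_of_nonneg (by positivity)]
  intro i
  have h1 := (ContinuousLinearMap.proj (R := ℝ) (φ := fun _ : ι => F) i).iteratedFDeriv_comp_left hf
    (i := j) le_rfl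
  have h2 := DFunLike.congr_fun h1 v
  have h3 : iteratedFDeriv ℝ j (fun x => f x i) x v = iteratedFDeriv ℝ j f x v i := h2
  rw [← h3]
  exact ContinuousMultilinearMap.le_of_opNorm_le (hfC i) v

end Components

theorem norm_bilOf_le {n : ℕ} : ‖bilOf (n := n)‖ ≤ 1 :=
  ContinuousLinearMap.opNorm_le_bound _ zero_le_one fun β => by
    rw [one_mul]
    refine ContinuousLinearMap.opNorm_le_bound₂ _ (norm_nonneg _) fun u v => ?_
    have := β.le_opNorm ![u, v]
    simpa [Fin.prod_univ_two, mul_assoc] using this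

theorem natCast_le_of_smooth {s : WithTop ℕ∞} (hs : s = ∞ ∨ s = ω) (j : ℕ) :
    (j : WithTop ℕ∞) ≤ s := by
  rcases hs with rfl | rfl
  · exact_mod_cast le_top
  · exact le_top

theorem contDiff_model {n κ : ℕ} {Γ : Type*} [Fintype Γ] (p : Fin n → Fin κ → ℤ)
    (a : Γ → Fin n → Circle) {m : WithTop ℕ∞} : ContDiff ℝ m (model p a) := by
  refine contDiff_const.prodMk (ContDiff.prodMk (contDiff_pi.2 fun l => ?_)
    (contDiff_pi.2 fun ψ => (rotC (a ψ)).contDiff))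
  exact ((stdBil (n := n)).contDiff.comp (gen p l).contDiff).neg

theorem abs_quadratic_le {n κ : ℕ} (p : Fin n → Fin κ → ℤ) (l : Fin κ) (x : R2n n) :
    |∑ j, (p j l : ℝ) * ((x (j, 0) ^ 2 + x (j, 1) ^ 2) / 2)| ≤
      (∑ l, ∑ j, |(p j l : ℝ)|) * ‖x‖ ^ 2 := by
  have hc : ∀ i, x i ^ 2 ≤ ‖x‖ ^ 2 := fun i => by
    have := PiLp.norm_apply_le x i
    rw [← sq_abs, ← Real.norm_eq_abs]
    gcongr
  calc _ ≤ ∑ j, |(p j l : ℝ)| * ‖x‖ ^ 2 := by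
        refine (Finset.abs_sum_le_sum_abs _ _).trans (Finset.sum_le_sum fun j _ => ?_)
        rw [abs_mul]
        gcongr
        rw [abs_of_nonneg (by positivity)]
        linarith [hc (j, 0), hc (j, 1)]
    _ ≤ _ := by
        rw [← Finset.sum_mul]
        gcongr
        exact Finset.single_le_sum (f := fun l => ∑ j, |(p j l : ℝ)|)
          (fun l _ => Finset.sum_nonneg fun j _ => abs_nonneg _) (Finset.mem_univ l)

/-! ### From closeness of systems to closeness of data -/

section Perturb

variable {n κ : ℕ} {M : Type*} [TopologicalSpace M] [ChartedSpace (R2n n) M]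
  {r s : WithTop ℕ∞} [IsManifold 𝓘(ℝ, R2n n) s M] {φ : OpenPartialHomeomorph M (R2n n)} {Γ : Type*}
  [Group Γ] [Fintype Γ] {Ω Ω' : TwoForm n M} {J J' : Fin κ → M → ℝ} {θ θ' : Torus κ → M → M}
  {ρ ρ' : Γ → M → M} {p : Fin n → Fin κ → ℤ} {q : Γ → Fin n → ℚ} {c : Fin κ → ℝ} {N N' : Set M}
  {a : Γ → Fin n → Circle} {kₑ k : ℕ} {m₀ : M} {ε : ℝ} {K : Set M}

theorem IsClosePerturbation.form_close_of_le (h : IsClosePerturbation φ K k ε Ω Ω' J J' ρ ρ')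
    (hε : 0 ≤ ε) {j : ℕ} (hj : j + 1 ≤ k) {x : R2n n} (hx : x ∈ φ '' K) :
    ‖iteratedFDeriv ℝ j (fun x => formInChart φ Ω' x - formInChart φ Ω x) x‖ ≤ ε := by
  -- For n > 0 the order k + n - 2 is at least k - 1. For n = 0 it falls one short, but two-forms on
  -- the zero space vanish.
  rcases Nat.eq_zero_or_pos n with rfl | hn
  · have : (fun x => formInChart φ Ω' x - formInChart φ Ω x) = fun _ => 0 := by
      ext x v
      have hv : v = 0 := by
        ext i a
        exact a.1.elim0
      rw [hv, ContinuousAlternatingMap.sub_apply, ContinuousAlternatingMap.map_zero,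
        ContinuousAlternatingMap.map_zero]
      simp
    rw [this]
    have h0 : iteratedFDeriv ℝ j (fun _ : R2n 0 => (0 : R2n 0 [⋀^Fin 2]→L[ℝ] ℝ)) x = 0 := by
      rw [iteratedFDeriv_fun_zero]; rfl
    rw [h0, norm_zero]
    exact hε
  · exact h.form_close j (by omega) x hx

/-- The momenta enter the data through their differentials, so C^k closeness yields closeness of the
data up to order k - 1; for the form and the maps of Γ this order is available. -/
theorem IsClosePerturbation.norm_iteratedFDeriv_chartData_le (hs : s = ∞ ∨ s = ω)
    (h : IsNormalForm r Ω J θ ρ kₑ p q c φ m₀)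
    (haq : ∀ ψ j, (a ψ j : ℂ) = Complex.exp (2 * Real.pi * Complex.I * (q ψ j : ℂ)))
    (hp : ∀ (j : Fin n) l, kₑ ≤ j.val → p j l = 0)
    (h' : IsSystem s Ω' J' θ' N ρ' N') (hφ : φ ∈ IsManifold.maximalAtlas 𝓘(ℝ, R2n n) s M)
    (hsub : φ.source ⊆ N') (hcl : IsClosePerturbation φ K k ε Ω Ω' J J' ρ ρ') (hε : 0 ≤ ε)
    {j : ℕ} (hj : j + 1 ≤ k) {x : R2n n} (hx : x ∈ φ.target) (hxK : φ.symm x ∈ K) :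
    ‖iteratedFDeriv ℝ j (fun x => chartData φ Ω' J' ρ' x - model p a x) x‖ ≤ ε := by
  have hxK' : x ∈ φ '' K := ⟨_, hxK, φ.right_inv hx⟩
  have hD := h'.contDiffAt_chartData hs hφ hsub hx fun ψ => hcl.mapsTo ψ hxK
  have hjs := natCast_le_of_smooth hs j
  have hdiff : ContDiffAt ℝ j (fun x => chartData φ Ω' J' ρ' x - model p a x) x :=
    (hD.of_le hjs).sub (contDiff_model p a).contDiffAt
  have hmodel := fun y (hy : y ∈ φ.target) => h.chartData_eq haq hp hy
  have hnear := φ.open_target.mem_nhds hx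
  have h1 : ‖iteratedFDeriv ℝ j (fun x => (chartData φ Ω' J' ρ' x).1 - (model p a x).1) x‖ ≤ ε := by
    have hev : (fun x => (chartData φ Ω' J' ρ' x).1 - (model p a x).1) =ᶠ[𝓝 x]
        bilOf ∘ fun x => formInChart φ Ω' x - formInChart φ Ω x := by
      filter_upwards [hnear] with y hy
      rw [← hmodel y hy, Function.comp_apply, map_sub]
      rfl
    have hc : ContDiffAt ℝ j (fun x => formInChart φ Ω' x - formInChart φ Ω x) x :=
      contDiffAt_of_bilOf (ContDiffAt.congr_of_eventuallyEq hdiff.fst hev.symm)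
    rw [(hev.iteratedFDeriv ℝ j).eq_of_nhds]
    refine (bilOf.norm_iteratedFDeriv_comp_left hc le_rfl).trans ?_
    calc _ ≤ 1 * ε := mul_le_mul norm_bilOf_le (hcl.form_close_of_le hε hj hxK') (norm_nonneg _)
          zero_le_one
      _ = ε := one_mul ε
  have h2 : ∀ l, ‖iteratedFDeriv ℝ j
      (fun x => (chartData φ Ω' J' ρ' x).2.1 l - (model p a x).2.1 l) x‖ ≤ ε := by
    intro l
    have hev : (fun x => (chartData φ Ω' J' ρ' x).2.1 l - (model p a x).2.1 l) =ᶠ[𝓝 x]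
        fderiv ℝ fun x => (J' l ∘ φ.symm) x - (J l ∘ φ.symm) x := by
      filter_upwards [hnear] with y hy
      have h3 : DifferentiableAt ℝ (J' l ∘ φ.symm) y :=
        ((contDiffOn_momentum h'.torus.contMDiffOn_J hφ (hsub.trans h'.subset) l).contDiffAt
          (φ.open_target.mem_nhds hy)).differentiableAt (ne_zero_of_smooth hs)
      exact (h3.hasFDerivAt.fun_sub (h.hasFDerivAt_momentum hp hy l)).fderiv.symm
    rw [(hev.iteratedFDeriv ℝ j).eq_of_nhds, norm_iteratedFDeriv_fderiv]
    exact hcl.J_close l (j + 1) hj x hxK'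
  have h3 : ∀ ψ, ‖iteratedFDeriv ℝ j
      (fun x => (chartData φ Ω' J' ρ' x).2.2 ψ - (model p a x).2.2 ψ) x‖ ≤ ε := by
    intro ψ
    have hev : (fun x => (chartData φ Ω' J' ρ' x).2.2 ψ - (model p a x).2.2 ψ) =ᶠ[𝓝 x]
        fun x => (φ ∘ ρ' ψ ∘ φ.symm) x - (φ ∘ ρ ψ ∘ φ.symm) x := by
      filter_upwards [hnear] with y hy
      rw [← hmodel y hy]
      rfl
    rw [(hev.iteratedFDeriv ℝ j).eq_of_nhds]
    exact hcl.finite_close ψ j (by omega) x hxK'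
  refine norm_iteratedFDeriv_prodMk_le hdiff.fst hdiff.snd h1
    (norm_iteratedFDeriv_prodMk_le hdiff.snd.fst hdiff.snd.snd
      (norm_iteratedFDeriv_pi_le hε hdiff.snd.fst h2) (norm_iteratedFDeriv_pi_le hε hdiff.snd.snd h3))

/-- Dividing the deviation of the data from the model by ε lands in the unit ball of the space of
C^m maps, which realises the perturbed system as a member of the universal family. -/
theorem IsClosePerturbation.exists_unitMap (hs : s = ∞ ∨ s = ω)
    (h : IsNormalForm r Ω J θ ρ kₑ p q c φ m₀)
    (haq : ∀ ψ j, (a ψ j : ℂ) = Complex.exp (2 * Real.pi * Complex.I * (q ψ j : ℂ)))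
    (hp : ∀ (j : Fin n) l, kₑ ≤ j.val → p j l = 0)
    (h' : IsSystem s Ω' J' θ' N ρ' N') (hφ : φ ∈ IsManifold.maximalAtlas 𝓘(ℝ, R2n n) s M)
    (hsub : φ.source ⊆ N') (hcl : IsClosePerturbation φ K k ε Ω Ω' J J' ρ ρ') (hε : 0 < ε) {R : ℝ}
    (hball : Metric.ball 0 R ⊆ φ.target) (hK : ∀ x, ‖x‖ < R → φ.symm x ∈ K) {m : ℕ}
    (hm : m + 1 ≤ k) :
    ∃ g : UnitMap (R2n n) (DataSpace n κ Γ) (Metric.ball 0 R) m,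
      ∀ x, ε • g.toFun x = chartData φ Ω' J' ρ' x - model p a x := by
  have hdiff : ContDiffOn ℝ m (fun x => chartData φ Ω' J' ρ' x - model p a x)
      (Metric.ball 0 R) := fun x hx =>
    (((h'.contDiffAt_chartData hs hφ hsub (hball hx) fun ψ =>
      hcl.mapsTo ψ (hK x (by simpa using hx))).of_le (natCast_le_of_smooth hs m)).sub
        (contDiff_model p a).contDiffAt).contDiffWithinAt
  refine ⟨⟨fun x => ε⁻¹ • (chartData φ Ω' J' ρ' x - model p a x),
    ContDiffOn.fun_smul contDiffOn_const hdiff, fun j hj x hx => ?_⟩,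
    fun x => smul_inv_smul₀ hε.ne' _⟩
  have h1 := hcl.norm_iteratedFDeriv_chartData_le hs h haq hp h' hφ hsub hε.le (j := j)
    (by omega) (hball hx) (hK x (by simpa using hx))
  have h2 : ContDiffAt ℝ j (fun x => chartData φ Ω' J' ρ' x - model p a x) x :=
    (hdiff.contDiffAt (Metric.isOpen_ball.mem_nhds hx)).of_le (by exact_mod_cast hj)
  have h3 := iteratedFDeriv_const_smul_apply (a := ε⁻¹) h2
  rw [show (fun x => ε⁻¹ • (chartData φ Ω' J' ρ' x - model p a x)) =
    ε⁻¹ • (fun x => chartData φ Ω' J' ρ' x - model p a x) from rfl, h3, norm_smul, norm_inv,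
    Real.norm_of_nonneg hε.le, inv_mul_le_one₀ hε]
  exact h1

/-- At the perturbed centre x the momentum differs from its unperturbed value by at most ε, and that
value differs from `c l` by a quadratic term; of the two factors of this term one is bounded by δ
and the other by C ε. -/
theorem IsClosePerturbation.abs_momentum_sub_le (h : IsNormalForm r Ω J θ ρ kₑ p q c φ m₀)
    (hp : ∀ (j : Fin n) l, kₑ ≤ j.val → p j l = 0)
    (hcl : IsClosePerturbation φ K k ε Ω Ω' J J' ρ ρ') {x : R2n n} (hx : x ∈ φ.target)
    (hxK : φ.symm x ∈ K) {δ C : ℝ} (hxδ : ‖x‖ ≤ δ) (hxC : ‖x‖ ≤ C * ε) (l : Fin κ) :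
    |J' l (φ.symm x) - c l| ≤ ε + (∑ l, ∑ j, |(p j l : ℝ)|) * δ * C * ε := by
  have h2 := hcl.J_close l 0 (by omega) x ⟨_, hxK, φ.right_inv hx⟩
  rw [norm_iteratedFDeriv_zero, Function.comp_apply, Function.comp_apply,
    h.J_eq l _ (φ.map_target hx), sum_filter_quadratic p hp, φ.right_inv hx,
    Real.norm_eq_abs] at h2
  have h3 := abs_quadratic_le p l x
  set A : ℝ := ∑ l, ∑ j, |(p j l : ℝ)| with hA
  have hA0 : 0 ≤ A := Finset.sum_nonneg fun l _ => Finset.sum_nonneg fun j _ => abs_nonneg _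
  set Q := ∑ j, (p j l : ℝ) * ((x (j, 0) ^ 2 + x (j, 1) ^ 2) / 2) with hQ
  have h4 : A * ‖x‖ ^ 2 ≤ A * δ * C * ε := by
    have : ‖x‖ ^ 2 ≤ δ * (C * ε) := by
      rw [sq]
      exact mul_le_mul hxδ hxC (norm_nonneg _) ((norm_nonneg _).trans hxδ)
    calc _ ≤ A * (δ * (C * ε)) := by gcongr
      _ = _ := by ring
  have h5 : J' l (φ.symm x) - c l = (J' l (φ.symm x) - (c l + Q)) + Q := by ring
  rw [h5]
  exact (abs_add_le _ _).trans (add_le_add h2 (h3.trans h4))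

end Perturb

/-! ### Persistence under quantitative perturbations -/

section Persistence

variable {n κ : ℕ} {M : Type*} [TopologicalSpace M] [T2Space M] [ChartedSpace (R2n n) M]
  {r : WithTop ℕ∞} [IsManifold 𝓘(ℝ, R2n n) r M] {φ : OpenPartialHomeomorph M (R2n n)} {Γ : Type*}
  [Group Γ] [Finite Γ] {Ω : TwoForm n M} {J : Fin κ → M → ℝ} {θ : Torus κ → M → M}
  {ρ : Γ → M → M} {p : Fin n → Fin κ → ℤ} {q : Γ → Fin n → ℚ} {c : Fin κ → ℝ}
  {a : Γ → Fin n → Circle} {kₑ : ℕ} {m₀ : M} {R₀ : ℝ}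

/-- The normalizing maps of a family of perturbations of the linear model. -/
theorem exists_normalizable_family {P : Type*} [NormedAddCommGroup P] [NormedSpace ℝ P]
    [CompleteSpace P] [Fintype Γ] {D : P → R2n n → DataSpace n κ Γ} {R d : ℝ} (hd : 0 < d) {i : ℕ}
    (hD : ContDiffOn ℝ (i + 2 : ℕ) (fun z : P × R2n n => D z.1 z.2) (univ ×ˢ Metric.ball 0 R))
    (hmodel : ∀ x, ‖x‖ < R → D 0 x = model p a x) :
    ∃ C ≥ 0, ∃ δ > 0, ∀ b : P, ‖b‖ < δ → Normalizable p a (D b) R d ∧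
      CkCloseOn i (Metric.closedBall 0 (R - 11 * d))
        (fun x => normMap p a (D b) R d x) (fun x => x) (C * ‖b‖) := by
  obtain ⟨B, hB, hBo, h0⟩ := eventually_nhds_iff.1 (eventually_normalizable (p := p) (a := a)
    isOpen_univ (mem_univ _) hd (hD.of_le (by norm_cast; omega)) hmodel)
  -- Of the orders i + 2 one is lost in pulling back the form; the linear estimate in the parameter
  -- takes the other.
  have hη := Normalizable.contDiffOn_normMap_family (m' := ((i + 1 : ℕ) : WithTop ℕ∞)) hBo hd
    (by norm_cast) (by norm_cast) (hD.mono (prod_mono (subset_univ _) Subset.rfl)) hB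
  obtain ⟨C, hC0, hC⟩ := exists_ckClose hBo h0
    (S := Metric.ball (0 : R2n n) (R - 9 * d)) Metric.isOpen_ball
    (isCompact_closedBall (0 : R2n n) (R - 11 * d))
    (Metric.closedBall_subset_ball (by linarith)) i (by exact_mod_cast hη)
  obtain ⟨δ, hδ, hball⟩ := Metric.mem_nhds_iff.1 (hC.and (hBo.mem_nhds h0))
  refine ⟨C, hC0, δ, hδ, fun b hb => ?_⟩
  obtain ⟨h1, h2⟩ := hball (mem_ball_zero_iff.2 hb)
  refine ⟨hB b h2, fun j hj x hx => ?_⟩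
  -- At the parameter 0 the normalising map is the identity, so comparison with the member 0 is
  -- comparison with the identity.
  have hev : (fun x => normMap p a (D b) R d x - x) =ᶠ[𝓝 x]
      fun x => normMap p a (D b) R d x - normMap p a (D 0) R d x := by
    have hx' : x ∈ Metric.ball (0 : R2n n) (R - 9 * d) :=
      Metric.closedBall_subset_ball (by linarith) hx
    filter_upwards [Metric.isOpen_ball.mem_nhds hx'] with y hy
    have hN := hB 0 h0
    rw [normMap_model hd hN.lin hN.nearLin hN.moser hmodel (mem_ball_zero_iff.1 hy)]
  rw [(hev.iteratedFDeriv ℝ j).eq_of_nhds]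
  exact h1 j hj x hx

/-- The perturbed data are a member, with parameter of norm at most ε, of the universal family
around the model. The constants belong to that family and hence do not depend on the perturbation.
-/
theorem IsNormalForm.persistsUnderPerturbations (h : IsNormalForm r Ω J θ ρ kₑ p q c φ m₀)
    (ht : φ.target = Metric.ball 0 R₀) (ha : ∀ ψ χ, a (ψ * χ) = a ψ * a χ)
    (haq : ∀ ψ j, (a ψ j : ℂ) = Complex.exp (2 * Real.pi * Complex.I * (q ψ j : ℂ)))
    (hp : ∀ (j : Fin n) l, kₑ ≤ j.val → p j l = 0) :
    PersistsUnderPerturbations r Ω J ρ kₑ p q c φ m₀ := by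
  have := Fintype.ofFinite Γ
  intro k hk U' hU' hc hsub
  obtain ⟨R, δ, hδ, hδR, hR, hUR, hUδ⟩ := exists_radii h.mem_source h.centred ht hU' hc hsub
  -- The data are close up to order k - 1 = i + 3. Three more orders are spent: on regularity of the
  -- universal family, on pulling back the form, and on the linear estimate in the parameter. This
  -- leaves k - 4.
  obtain ⟨i, rfl⟩ : ∃ i, k = i + 4 := ⟨k - 4, by omega⟩
  have hcb : Metric.closedBall (0 : R2n n) R ⊆ φ.target := by
    rw [ht]; exact Metric.closedBall_subset_ball hR
  have hball : Metric.ball (0 : R2n n) R ⊆ φ.target := Metric.ball_subset_closedBall.trans hcb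
  obtain ⟨C, hC, ε₁, hε₁, hB⟩ := exists_normalizable_family (p := p) (a := a) hδ
    (contDiffOn_perturb (m := i + 2) Metric.isOpen_ball (convex_ball (0 : R2n n) R)
      (contDiff_model p a).contDiffOn) fun x _ => perturb_zero _ x
  set A : ℝ := ∑ l, ∑ j, |(p j l : ℝ)| with hA
  have hA0 : 0 ≤ A := Finset.sum_nonneg fun l _ => Finset.sum_nonneg fun j _ => abs_nonneg _
  -- Half of `ε₁` gives the strict inequality required of the parameter. The constant is a sum, so
  -- that it dominates both `C`, for the coordinates, and `1 + A * δ * C`, for the constants of the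
  -- momenta.
  refine ⟨φ.symm '' Metric.closedBall 0 R, (isCompact_closedBall 0 R).image_of_continuousOn
    (φ.continuousOn_symm.mono hcb), ?_, ε₁ / 2, by positivity, C + (1 + A * δ * C), ?_⟩
  · rintro _ ⟨x, hx, rfl⟩
    exact φ.map_target (hcb hx)
  intro ε hε hεε₁ s hs hsr Ω' J' θ' N ρ' N' h' hN' hcl
  have : IsManifold 𝓘(ℝ, R2n n) s M := IsManifold.of_le hsr
  have hφ := mem_maximalAtlas_of_le hsr h.smooth
  have hK : ∀ x : R2n n, ‖x‖ ≤ R → φ.symm x ∈ φ.symm '' Metric.closedBall 0 R := fun x hx =>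
    ⟨x, by simpa using hx, rfl⟩
  have hρ : ∀ ψ x, ‖x‖ < R → ρ' ψ (φ.symm x) ∈ φ.source := fun ψ x hx => hcl.mapsTo ψ (hK x hx.le)
  obtain ⟨g, hg⟩ := hcl.exists_unitMap hs h haq hp h' hφ hN' hε hball (fun x hx => hK x hx.le)
    (m := i + 2 + 1) (by omega)
  set b := ε • evalAt g with hb
  have hbn : ‖b‖ ≤ ε := by
    rw [hb, norm_smul, Real.norm_of_nonneg hε.le]
    exact mul_le_of_le_one_right hε.le (norm_evalAt_le g)
  have hDeq : ∀ x, ‖x‖ < R → perturb (model p a) b x = chartData φ Ω' J' ρ' x := fun x hx => by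
    rw [hb, perturb_evalAt _ _ _ (mem_ball_zero_iff.2 hx), hg, add_sub_cancel]
  obtain ⟨hN, hclose⟩ := hB b (by linarith)
  set η := normMap p a (perturb (model p a) b) R δ with hη
  obtain ⟨φ', hφ'a, hφ's, -, hnf⟩ := h'.exists_isNormalForm hs hφ hN' hball hρ hDeq hN hδ ha haq hp
    (r' := R - 12 * δ) (by linarith) le_rfl
  set x₀ := invBall η (R - 10 * δ) 0 with hx₀
  have hx₀s := hN.near.invBall_spec hδ.le (y := 0) (by simp; linarith)
  have hx₀δ : ‖x₀‖ ≤ δ := by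
    simpa using hN.near.norm_invBall_sub_le hδ.le (y := 0) (by simp; linarith)
  have hle : C * ‖b‖ ≤ C * ε := by gcongr
  refine ⟨φ.symm x₀, φ', _, hUδ _ hx₀δ, ?_, ?_, hnf, ?_, fun l => ?_⟩
  · intro m hm
    rw [hφ's]
    have h1 := hUR m hm
    refine ⟨hsub (subset_closure hm), ?_, ?_⟩
    · rw [mem_ball_zero_iff]; linarith
    · have := hN.near.norm_lt (r' := R - 14 * δ) (by linarith) h1
      rw [mem_preimage, mem_ball_zero_iff]; linarith
  · rw [hφ's]
    exact inter_subset_left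
  · rintro j hj _ ⟨m, hm, rfl⟩
    rw [hφ's] at hm
    have hm1 : ‖φ m‖ < R - 10 * δ := mem_ball_zero_iff.1 hm.2.1
    have hm2 : ‖η (φ m)‖ < R - 12 * δ := mem_ball_zero_iff.1 hm.2.2
    have hm3 := hN.near.norm_sub_le (φ m) hm1
    have hm4 : ‖φ m‖ ≤ R - 11 * δ := by
      have := norm_sub_le (η (φ m)) (η (φ m) - φ m)
      rw [sub_sub_cancel] at this
      linarith
    have hev : (fun w => (φ' ∘ φ.symm) w - id w) =ᶠ[𝓝 (φ m)] fun x => η x - x := by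
      filter_upwards [φ.open_target.mem_nhds (φ.map_source hm.1)] with y hy
      rw [Function.comp_apply, hφ'a, φ.right_inv hy]
      rfl
    rw [(hev.iteratedFDeriv ℝ j).eq_of_nhds]
    have h1 := hclose j (by omega) (φ m) (by simpa using hm4)
    refine h1.trans (hle.trans ?_)
    gcongr
    have : 0 ≤ A * δ * C := by positivity
    linarith
  · have hx₀R : ‖x₀‖ ≤ R := by linarith
    have hx₀t : x₀ ∈ φ.target := hcb (by simpa using hx₀R)
    have h1 : ‖x₀‖ ≤ C * ε := by
      have h2 := hclose 0 (by omega) x₀ (by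
        rw [mem_closedBall_zero_iff]; linarith)
      rw [norm_iteratedFDeriv_zero] at h2
      have h3 : η x₀ = 0 := hx₀s.2
      simp only [h3, zero_sub, norm_neg] at h2
      exact h2.trans hle
    refine (hcl.abs_momentum_sub_le h hp hx₀t (hK x₀ hx₀R) hx₀δ h1 l).trans ?_
    have : 0 ≤ C * ε := by positivity
    linarith

end Persistence

/-! ### Linear algebra: simultaneous reduction to rotations of planes -/

section Frame

open scoped RealInnerProductSpace

variable {V : Type*} [NormedAddCommGroup V] [InnerProductSpace ℝ V]
  {κ : ℕ} {Γ : Type*} [Group Γ] {K : Module.End ℝ V} {B : Fin κ → Module.End ℝ V}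
  {T : Γ → Module.End ℝ V}

/-- Commuting operators: skew-symmetric `K` (injective) and `B l`, and orthogonal `T ψ`. -/
structure CommutingOperators (K : Module.End ℝ V) (B : Fin κ → Module.End ℝ V)
    (T : Γ → Module.End ℝ V) : Prop where
  skew : ∀ u v, ⟪K u, v⟫ = -⟪u, K v⟫
  inj : ∀ v, K v = 0 → v = 0
  skew_gen : ∀ l u v, ⟪B l u, v⟫ = -⟪u, B l v⟫
  orth : ∀ ψ u v, ⟪T ψ u, v⟫ = ⟪u, T ψ⁻¹ v⟫
  comm_gen : ∀ l, Commute K (B l)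
  comm_fin : ∀ ψ, Commute K (T ψ)
  gen_gen : ∀ l l', Commute (B l) (B l')
  gen_fin : ∀ l ψ, Commute (B l) (T ψ)
  fin_fin : ∀ ψ χ, Commute (T ψ) (T χ)

/-- The symmetric operators formed from commuting skew-symmetric and orthogonal ones. -/
def symOp (K : Module.End ℝ V) (B : Fin κ → Module.End ℝ V) (T : Γ → Module.End ℝ V) :
    Unit ⊕ Fin κ ⊕ Γ ⊕ Γ → Module.End ℝ V
  | .inl _ => K * K
  | .inr (.inl l) => K * B l
  | .inr (.inr (.inl ψ)) => T ψ + T ψ⁻¹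
  | .inr (.inr (.inr ψ)) => K * (T ψ - T ψ⁻¹)

theorem commute_symOp {X : Module.End ℝ V} (hK : Commute X K) (hB : ∀ l, Commute X (B l))
    (hT : ∀ ψ, Commute X (T ψ)) : ∀ i, Commute X (symOp K B T i)
  | .inl _ => hK.mul_right hK
  | .inr (.inl l) => hK.mul_right (hB l)
  | .inr (.inr (.inl ψ)) => (hT ψ).add_right (hT ψ⁻¹)
  | .inr (.inr (.inr ψ)) => hK.mul_right ((hT ψ).sub_right (hT ψ⁻¹))

namespace CommutingOperators

theorem commute (h : CommutingOperators K B T) (i j : Unit ⊕ Fin κ ⊕ Γ ⊕ Γ) :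
    Commute (symOp K B T i) (symOp K B T j) :=
  commute_symOp (commute_symOp (Commute.refl K) h.comm_gen h.comm_fin i).symm
    (fun l => (commute_symOp (h.comm_gen l).symm (h.gen_gen l) (h.gen_fin l) i).symm)
    (fun ψ => (commute_symOp (h.comm_fin ψ).symm (fun l => (h.gen_fin l ψ).symm)
      (h.fin_fin ψ) i).symm) j

theorem isSymmetric (h : CommutingOperators K B T) :
    ∀ i, LinearMap.IsSymmetric (symOp K B T i)
  | .inl _ => fun u v => by
      change ⟪K (K u), v⟫ = ⟪u, K (K v)⟫
      rw [h.skew, h.skew, neg_neg]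
  | .inr (.inl l) => fun u v => by
      have h1 : K (B l v) = B l (K v) := DFunLike.congr_fun (h.comm_gen l) v
      change ⟪K (B l u), v⟫ = ⟪u, K (B l v)⟫
      rw [h.skew, h.skew_gen, neg_neg, h1]
  | .inr (.inr (.inl ψ)) => fun u v => by
      change ⟪T ψ u + T ψ⁻¹ u, v⟫ = ⟪u, T ψ v + T ψ⁻¹ v⟫
      rw [inner_add_left, inner_add_right, h.orth, h.orth, inv_inv, add_comm]
  | .inr (.inr (.inr ψ)) => fun u v => by
      have h1 : ∀ ψ, K (T ψ v) = T ψ (K v) := fun ψ => DFunLike.congr_fun (h.comm_fin ψ) v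
      change ⟪K (T ψ u - T ψ⁻¹ u), v⟫ = ⟪u, K (T ψ v - T ψ⁻¹ v)⟫
      rw [h.skew, inner_sub_left, map_sub, inner_sub_right, h.orth, h.orth, inv_inv, h1, h1]
      ring

variable [FiniteDimensional ℝ V]

/-- Commuting symmetric operators have joint eigenspaces that span the whole space, so some joint
eigenspace is not contained in the proper subspace U; its vectors are then projected to the
complement. -/
theorem exists_joint_eigenvector (h : CommutingOperators K B T) {U : Submodule ℝ V} (hU : U ≠ ⊤)
    (hinv : ∀ i, ∀ u ∈ U, symOp K B T i u ∈ U) :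
    ∃ w ∈ Uᗮ, w ≠ 0 ∧ ∀ i, ∃ γ : ℝ, symOp K B T i w = γ • w := by
  have htop := LinearMap.IsSymmetric.iSup_iInf_eq_top_of_commute h.isSymmetric
    fun i j _ => h.commute i j
  obtain ⟨χ, hχ⟩ : ∃ χ : Unit ⊕ Fin κ ⊕ Γ ⊕ Γ → ℝ,
      ¬ (⨅ i, Module.End.eigenspace (symOp K B T i) (χ i)) ≤ U := by
    by_contra hcon
    push Not at hcon
    exact hU (top_le_iff.1 (htop ▸ iSup_le hcon))
  obtain ⟨v, hv, hvU⟩ := SetLike.not_le_iff_exists.1 hχ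
  -- U and its orthogonal complement are both invariant, so the component in the complement is again
  -- a joint eigenvector, with the same eigenvalues.
  obtain ⟨u, hu, w, hw, rfl⟩ := U.exists_add_mem_mem_orthogonal v
  refine ⟨w, hw, fun hw0 => hvU (by rw [hw0, add_zero]; exact hu), fun i => ⟨χ i, ?_⟩⟩
  have hvi := Module.End.mem_eigenspace_iff.1 ((Submodule.mem_iInf _).1 hv i)
  rw [map_add, smul_add] at hvi
  have hwi : symOp K B T i w ∈ Uᗮ := by
    rw [Submodule.mem_orthogonal]
    intro u' hu'
    rw [← h.isSymmetric i u' w]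
    exact (Submodule.mem_orthogonal _ _).1 hw _ (hinv i u' hu')
  have h1 : symOp K B T i w - χ i • w = χ i • u - symOp K B T i u := by
    rw [sub_eq_sub_iff_add_eq_add, add_comm, hvi, add_comm]
  have h2 : symOp K B T i w - χ i • w ∈ U := by
    rw [h1]; exact U.sub_mem (U.smul_mem _ hu) (hinv i u hu)
  have h3 : symOp K B T i w - χ i • w ∈ Uᗮ := Uᗮ.sub_mem hwi (Uᗮ.smul_mem _ hw)
  have h4 := (Submodule.mem_orthogonal _ _).1 h3 _ h2
  exact sub_eq_zero.1 (inner_self_eq_zero.1 h4)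

end CommutingOperators

/-- A pair of vectors that spans a plane in which the operators act by rotations. -/
structure IsRotationPair (K : Module.End ℝ V) (B : Fin κ → Module.End ℝ V)
    (T : Γ → Module.End ℝ V) (v e : V) : Prop where
  exists_pos : ∃ lam : ℝ, K v = lam • e ∧ K e = -lam • v
  pairing : ⟪K v, e⟫ = 1
  gen : ∀ l, ∃ β : ℝ, B l v = β • e ∧ B l e = -β • v
  fin : ∀ ψ, ∃ c s : ℝ, T ψ v = c • v + s • e ∧ T ψ e = c • e - s • v

/-- The square of K is negative on w, so K acts on the span of w and K w as a multiple of a quarter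
turn. As K is injective, the eigenvalue of K B tells that B w is a multiple of K w; the sum of T and
its inverse gives the cosine part of T w, their difference multiplied by K the sine part.
Commutation with K transfers this to K w. -/
theorem CommutingOperators.isRotationPair (h : CommutingOperators K B T) {w : V} (hw : w ≠ 0)
    (hγ : ∀ i, ∃ γ : ℝ, symOp K B T i w = γ • w) :
    ∃ a b : ℝ, IsRotationPair K B T (a • w) (b • K w) := by
  have hKw : K w ≠ 0 := fun h0 => hw (h.inj w h0)
  obtain ⟨γ, hγ0⟩ := hγ (.inl ())
  have hγ0' : K (K w) = γ • w := hγ0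
  have hneg : γ < 0 := by
    have h1 : ⟪K (K w), w⟫ = -⟪K w, K w⟫ := h.skew _ _
    rw [hγ0', inner_smul_left, real_inner_self_eq_norm_sq, real_inner_self_eq_norm_sq] at h1
    simp only [conj_trivial] at h1
    have h2 : 0 < ‖K w‖ ^ 2 := by positivity
    have h3 : 0 < ‖w‖ ^ 2 := by positivity
    by_contra hcon
    push Not at hcon
    nlinarith [mul_nonneg hcon h3.le]
  have hcancel : ∀ (x : V) (μ : ℝ), K x = μ • w → x = (μ / γ) • K w := by
    intro x μ hx
    refine sub_eq_zero.1 (h.inj _ ?_)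
    rw [map_sub, map_smul, hx, hγ0', smul_smul, div_mul_cancel₀ _ hneg.ne, sub_self]
  set lam := Real.sqrt (-γ) with hlam
  have hlam0 : 0 < lam := Real.sqrt_pos.2 (by linarith)
  have hlamsq : lam * lam = -γ := Real.mul_self_sqrt (by linarith)
  -- With v = a w and e = (a/λ) K w the pairing of K v with e equals a² ‖K w‖² / λ, so this choice
  -- makes it 1.
  set a := Real.sqrt (lam / ‖K w‖ ^ 2) with ha
  have hKn : 0 < ‖K w‖ ^ 2 := by positivity
  have ha0 : 0 < a := Real.sqrt_pos.2 (by positivity)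
  have hasq : a * a = lam / ‖K w‖ ^ 2 := Real.mul_self_sqrt (by positivity)
  have hv : ∀ (x : Module.End ℝ V) (c s : ℝ), Commute K x → x w = c • w + s • K w →
      x (a • w) = c • (a • w) + (s * lam) • ((a / lam) • K w) ∧
      x ((a / lam) • K w) = c • ((a / lam) • K w) - (s * lam) • (a • w) := by
    intro x c s hx hxw
    have hxK : x (K w) = K (x w) := (DFunLike.congr_fun hx w).symm
    constructor
    · rw [map_smul, hxw, smul_add, smul_smul, smul_smul, smul_smul, smul_smul]
      congr 2
      · ring
      · field_simp
    · rw [map_smul, hxK, hxw, map_add, map_smul, map_smul, hγ0', smul_add, smul_smul, smul_smul,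
        smul_smul, smul_smul, smul_smul, sub_eq_add_neg, ← neg_smul]
      congr 2
      · ring
      · have : γ = -(lam * lam) := by linarith
        rw [this]
        field_simp
  refine ⟨a, a / lam, ?_, ?_, fun l => ?_, fun ψ => ?_⟩
  · have := hv K 0 1 (Commute.refl K) (by simp)
    refine ⟨lam, ?_, ?_⟩
    · rw [this.1]; simp
    · rw [this.2]; simp
  · rw [map_smul, inner_smul_left, inner_smul_right, real_inner_self_eq_norm_sq]
    simp only [conj_trivial]
    have : a * (a / lam * ‖K w‖ ^ 2) = (a * a) * ‖K w‖ ^ 2 / lam := by ring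
    rw [this, hasq]
    field_simp
  · obtain ⟨μ, hμ⟩ := hγ (.inr (.inl l))
    have h1 := hcancel (B l w) μ hμ
    have := hv (B l) 0 (μ / γ) (h.comm_gen l) (by rw [h1]; simp)
    refine ⟨μ / γ * lam, ?_, ?_⟩
    · rw [this.1]; simp
    · rw [this.2]; simp
  · obtain ⟨τ, hτ⟩ := hγ (.inr (.inr (.inl ψ)))
    obtain ⟨σ, hσ⟩ := hγ (.inr (.inr (.inr ψ)))
    have h1 := hcancel (T ψ w - T ψ⁻¹ w) σ hσ
    have h2 : T ψ w + T ψ⁻¹ w = τ • w := hτ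
    have h3 : T ψ w = (τ / 2) • w + (σ / γ / 2) • K w := by
      have h4 : (2 : ℝ) • T ψ w = τ • w + (σ / γ) • K w := by
        rw [← h1, ← h2, two_smul]; abel
      have h5 : T ψ w = (1 / 2 : ℝ) • ((2 : ℝ) • T ψ w) := by rw [smul_smul]; norm_num
      rw [h5, h4, smul_add, smul_smul, smul_smul]
      congr 2 <;> ring
    exact ⟨_, _, hv (T ψ) _ _ (h.comm_fin ψ) h3⟩

variable [FiniteDimensional ℝ V]

/-- The span of the planes found so far is invariant. A joint eigenvector orthogonal to it generates
the next plane, which is orthogonal to it as well because K is skew. -/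
theorem CommutingOperators.exists_frame (h : CommutingOperators K B T) {n : ℕ}
    (hn : Module.finrank ℝ V = 2 * n) : ∀ m ≤ n, ∃ v e : Fin m → V,
      (∀ j, IsRotationPair K B T (v j) (e j)) ∧
      ∀ i j, i ≠ j → ⟪v i, v j⟫ = 0 ∧ ⟪v i, e j⟫ = 0 ∧ ⟪e i, v j⟫ = 0 ∧ ⟪e i, e j⟫ = 0 := by
  intro m
  induction m with
  | zero => exact fun _ => ⟨Fin.elim0, Fin.elim0, fun j => j.elim0, fun i => i.elim0⟩
  | succ m ih =>
    intro hm
    obtain ⟨v, e, hg, ho⟩ := ih (by omega)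
    set U := Submodule.span ℝ (range (Sum.elim v e)) with hU
    have hvU : ∀ j, v j ∈ U := fun j => Submodule.subset_span ⟨.inl j, rfl⟩
    have heU : ∀ j, e j ∈ U := fun j => Submodule.subset_span ⟨.inr j, rfl⟩
    have hinv : ∀ X : Module.End ℝ V, (∀ j, X (v j) ∈ U ∧ X (e j) ∈ U) → ∀ u ∈ U, X u ∈ U := by
      intro X hX
      have : U ≤ U.comap X := by
        rw [hU, Submodule.span_le]
        rintro _ ⟨j | j, rfl⟩
        · exact (hX j).1
        · exact (hX j).2
      exact this
    have hKU : ∀ u ∈ U, K u ∈ U := hinv K fun j => by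
      obtain ⟨lam, h1, h2⟩ := (hg j).exists_pos
      rw [h1, h2]
      exact ⟨U.smul_mem _ (heU j), U.smul_mem _ (hvU j)⟩
    have hBU : ∀ l, ∀ u ∈ U, B l u ∈ U := fun l => hinv (B l) fun j => by
      obtain ⟨β, h1, h2⟩ := (hg j).gen l
      rw [h1, h2]
      exact ⟨U.smul_mem _ (heU j), U.smul_mem _ (hvU j)⟩
    have hTU : ∀ ψ, ∀ u ∈ U, T ψ u ∈ U := fun ψ => hinv (T ψ) fun j => by
      obtain ⟨c, s, h1, h2⟩ := (hg j).fin ψ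
      rw [h1, h2]
      exact ⟨U.add_mem (U.smul_mem _ (hvU j)) (U.smul_mem _ (heU j)),
        U.sub_mem (U.smul_mem _ (heU j)) (U.smul_mem _ (hvU j))⟩
    -- The span has dimension at most 2m, less than 2n.
    have hne : U ≠ ⊤ := by
      intro htop
      have h1 : Module.finrank ℝ U ≤ 2 * m := by
        have := finrank_range_le_card (R := ℝ) (Sum.elim v e)
        simpa [two_mul, Set.finrank] using this
      rw [htop, finrank_top, hn] at h1
      omega
    obtain ⟨w, hw, hw0, hγ⟩ := h.exists_joint_eigenvector hne fun i => by
      match i with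
      | .inl _ => exact fun u hu => hKU _ (hKU u hu)
      | .inr (.inl l) => exact fun u hu => hKU _ (hBU l u hu)
      | .inr (.inr (.inl ψ)) => exact fun u hu => U.add_mem (hTU _ u hu) (hTU _ u hu)
      | .inr (.inr (.inr ψ)) =>
        exact fun u hu => hKU _ (U.sub_mem (hTU _ u hu) (hTU _ u hu))
    obtain ⟨a, b, hab⟩ := h.isRotationPair hw0 hγ
    have hwo : ∀ u ∈ U, ⟪u, a • w⟫ = 0 := fun u hu => by
      rw [inner_smul_right, (Submodule.mem_orthogonal _ _).1 hw u hu, mul_zero]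
    have hKwo : ∀ u ∈ U, ⟪u, b • K w⟫ = 0 := fun u hu => by
      have h1 := h.skew u w
      rw [(Submodule.mem_orthogonal _ _).1 hw _ (hKU u hu)] at h1
      rw [inner_smul_right, neg_eq_zero.1 h1.symm, mul_zero]
    refine ⟨Fin.snoc v (a • w), Fin.snoc e (b • K w), fun j => ?_, fun i j => ?_⟩
    · refine Fin.lastCases ?_ (fun j => ?_) j
      · simpa using hab
      · simpa using hg j
    · refine Fin.lastCases ?_ (fun i => ?_) i <;> refine Fin.lastCases ?_ (fun j => ?_) j <;> intro hij
      · exact absurd rfl hij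
      · simp only [Fin.snoc_last, Fin.snoc_castSucc]
        refine ⟨?_, ?_, ?_, ?_⟩ <;> rw [real_inner_comm]
        · exact hwo _ (hvU j)
        · exact hwo _ (heU j)
        · exact hKwo _ (hvU j)
        · exact hKwo _ (heU j)
      · simp only [Fin.snoc_last, Fin.snoc_castSucc]
        exact ⟨hwo _ (hvU i), hKwo _ (hvU i), hwo _ (heU i), hKwo _ (heU i)⟩
      · simp only [Fin.snoc_castSucc]
        exact ho i j fun h => hij (by rw [h])

/-- The linear map defined by a frame. -/
def frameMap {n : ℕ} {W : Type*} [AddCommGroup W] [Module ℝ W] (v e : Fin n → W) : R2n n →ₗ[ℝ] W where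
  toFun x := ∑ j, (x (j, 0) • v j + x (j, 1) • e j)
  map_add' x y := by
    rw [← Finset.sum_add_distrib]
    refine Finset.sum_congr rfl fun j _ => ?_
    simp only [PiLp.add_apply, add_smul]
    abel
  map_smul' c x := by
    rw [Finset.smul_sum]
    refine Finset.sum_congr rfl fun j _ => ?_
    simp only [PiLp.smul_apply, smul_eq_mul, mul_smul, smul_add, RingHom.id_apply]

theorem frameMap_apply {n : ℕ} {W : Type*} [AddCommGroup W] [Module ℝ W] (v e : Fin n → W)
    (x : R2n n) : frameMap v e x = ∑ j, (x (j, 0) • v j + x (j, 1) • e j) := rfl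

theorem map_frameMap {n : ℕ} {W : Type*} [AddCommGroup W] [Module ℝ W] {v e : Fin n → W}
    {X : W →ₗ[ℝ] W} {z : Fin n → ℂ}
    (hX : ∀ j, X (v j) = (z j).re • v j + (z j).im • e j ∧ X (e j) = (z j).re • e j - (z j).im • v j)
    (x : R2n n) : X (frameMap v e x) = frameMap v e (mulC z x) := by
  rw [frameMap_apply, frameMap_apply, map_sum]
  refine Finset.sum_congr rfl fun j _ => ?_
  rw [map_add, map_smul, map_smul, (hX j).1, (hX j).2, ← zc_re (mulC z x), ← zc_im (mulC z x),
    zc_mulC, Complex.mul_re, Complex.mul_im, zc_re, zc_im]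
  module

/-- Distinct planes are orthogonal and invariant under K, so the form ⟨K ·, ·⟩ is block diagonal;
skewness and the normalised pairing make each block standard. -/
theorem CommutingOperators.exists_frameMap (h : CommutingOperators K B T) {n : ℕ}
    (hn : Module.finrank ℝ V = 2 * n) :
    ∃ (v e : Fin n → V) (β : Fin n → Fin κ → ℝ) (z : Γ → Fin n → ℂ),
      (∀ x y, ⟪K (frameMap v e x), frameMap v e y⟫ = stdBil x y) ∧
      (∀ l x, B l (frameMap v e x) = frameMap v e (mulC (fun j => β j l * Complex.I) x)) ∧
      ∀ ψ x, T ψ (frameMap v e x) = frameMap v e (mulC (z ψ) x) := by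
  obtain ⟨v, e, hg, ho⟩ := h.exists_frame hn n le_rfl
  choose β hβ using fun j => (hg j).gen
  choose c s hcs using fun j => (hg j).fin
  refine ⟨v, e, β, fun ψ j => ⟨c j ψ, s j ψ⟩, fun x y => ?_, fun l => map_frameMap fun j => ?_,
    fun ψ => map_frameMap fun j => hcs j ψ⟩
  · have hself : ∀ u, ⟪K u, u⟫ = 0 := fun u => by
      have h1 := h.skew u u
      rw [real_inner_comm] at h1
      linarith [real_inner_comm u (K u)]
    have hK : ∀ i j, i ≠ j → ⟪K (v i), v j⟫ = 0 ∧ ⟪K (v i), e j⟫ = 0 ∧ ⟪K (e i), v j⟫ = 0 ∧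
        ⟪K (e i), e j⟫ = 0 := by
      intro i j hij
      obtain ⟨lam, h1, h2⟩ := (hg i).exists_pos
      obtain ⟨o1, o2, o3, o4⟩ := ho i j hij
      simp [h1, h2, inner_smul_left, o1, o2, o3, o4]
    have hev : ∀ j, ⟪K (e j), v j⟫ = -1 := fun j => by
      rw [h.skew, real_inner_comm, (hg j).pairing]
    rw [frameMap_apply, frameMap_apply, map_sum, sum_inner, stdBil_apply]
    refine Finset.sum_congr rfl fun i _ => ?_
    rw [inner_sum, Finset.sum_eq_single i]
    · simp only [map_add, map_smul, inner_add_left, inner_add_right, inner_smul_left,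
        inner_smul_right, conj_trivial, hself, (hg i).pairing, hev]
      ring
    · intro j _ hji
      obtain ⟨o1, o2, o3, o4⟩ := hK i j hji.symm
      simp only [map_add, map_smul, inner_add_left, inner_add_right, inner_smul_left,
        inner_smul_right, conj_trivial, o1, o2, o3, o4]
      ring
    · simp
  · have := hβ j l
    simp [this.1, this.2]

end Frame

open scoped RealInnerProductSpace

/-! ### Invariant inner product for a linear action -/

section LinearAction

variable {n κ : ℕ} {Γ : Type*} [CommGroup Γ]

theorem isOpenQuotientMap_expT : IsOpenQuotientMap (expT (κ := κ)) :=
  IsOpenQuotientMap.piMap (f := fun _ : Fin κ => Circle.exp) fun _ =>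
    ⟨Circle.exp_surjective, Circle.exp.continuous, isLocalHomeomorph_circleExp.isOpenMap⟩

/-- The space here carries no norm of its own. This separates the averaged inner product from the
Euclidean one on the space to which the result is applied. -/
theorem exists_frameMap_of_core {V : Type*} [AddCommGroup V] [Module ℝ V] [FiniteDimensional ℝ V]
    (c : InnerProductSpace.Core ℝ V) {K : Module.End ℝ V} {B : Fin κ → Module.End ℝ V}
    {T : Γ → Module.End ℝ V} [Finite Γ] (h1 : ∀ u v, c.inner (K u) v = -c.inner u (K v))
    (h2 : ∀ v, K v = 0 → v = 0) (h3 : ∀ l u v, c.inner (B l u) v = -c.inner u (B l v))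
    (h4 : ∀ ψ u v, c.inner (T ψ u) v = c.inner u (T ψ⁻¹ v)) (h5 : ∀ l, Commute K (B l))
    (h6 : ∀ ψ, Commute K (T ψ)) (h7 : ∀ l l', Commute (B l) (B l'))
    (h8 : ∀ l ψ, Commute (B l) (T ψ)) (h9 : ∀ ψ χ, Commute (T ψ) (T χ))
    (hn : Module.finrank ℝ V = 2 * n) :
    ∃ (v e : Fin n → V) (β : Fin n → Fin κ → ℝ) (z : Γ → Fin n → ℂ),
      (∀ x y, c.inner (K (frameMap v e x)) (frameMap v e y) = stdBil x y) ∧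
      (∀ l x, B l (frameMap v e x) = frameMap v e (mulC (fun j => β j l * Complex.I) x)) ∧
      ∀ ψ x, T ψ (frameMap v e x) = frameMap v e (mulC (z ψ) x) := by
  let _ : NormedAddCommGroup V := c.toNormedAddCommGroup
  let _ : InnerProductSpace ℝ V := InnerProductSpace.ofCore c.toCore
  have hC : CommutingOperators K B T := ⟨h1, h2, h3, h4, h5, h6, h7, h8, h9⟩
  exact hC.exists_frameMap hn

/-- Commuting linear symplectic actions of a torus (lifted to its Lie algebra, with the infinitesimal
generators `B`) and of `Γ`. -/
structure IsLinearAction (w : R2n n →L[ℝ] R2n n →L[ℝ] ℝ) (A : (Fin κ → ℝ) → R2n n →L[ℝ] R2n n)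
    (B : Fin κ → R2n n →L[ℝ] R2n n) (T : Γ → R2n n →L[ℝ] R2n n) : Prop where
  injective : Function.Injective w
  add : ∀ τ σ x, A (τ + σ) x = A τ (A σ x)
  zero : ∀ x, A 0 x = x
  periodic : ∀ τ σ, expT τ = expT σ → A τ = A σ
  continuous : Continuous A
  hasDerivAt : ∀ τ : Fin κ → ℝ, HasDerivAt (fun t : ℝ => A (t • τ)) (∑ l, τ l • B l) 0
  skew : ∀ l u v, w (B l u) v = -w u (B l v)
  mul : ∀ ψ χ x, T (ψ * χ) x = T ψ (T χ x)
  one : ∀ x, T 1 x = x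
  symplectic : ∀ ψ u v, w (T ψ u) (T ψ v) = w u v
  commute : ∀ ψ l x, T ψ (B l x) = B l (T ψ x)

namespace IsLinearAction

variable {w : R2n n →L[ℝ] R2n n →L[ℝ] ℝ} {A : (Fin κ → ℝ) → R2n n →L[ℝ] R2n n}
  {B : Fin κ → R2n n →L[ℝ] R2n n} {T : Γ → R2n n →L[ℝ] R2n n}

theorem hasDerivAt' (h : IsLinearAction w A B T) (τ : Fin κ → ℝ) (t : ℝ) :
    HasDerivAt (fun t : ℝ => A (t • τ)) ((A (t • τ)).comp (∑ l, τ l • B l)) t := by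
  have h1 : HasDerivAt (fun r : ℝ => A ((r - t) • τ)) (∑ l, τ l • B l) t :=
    HasDerivAt.comp_sub_const (f := fun r : ℝ => A (r • τ)) t t (by rw [sub_self]; exact h.hasDerivAt τ)
  have h2 := (ContinuousLinearMap.compL ℝ (R2n n) (R2n n) (R2n n) (A (t • τ))).hasFDerivAt.comp_hasDerivAt
    t h1
  refine h2.congr_of_eventuallyEq (Filter.Eventually.of_forall fun r => ?_)
  ext1 x
  change A (r • τ) x = A (t • τ) (A ((r - t) • τ) x)
  rw [← h.add, ← add_smul, add_sub_cancel]

/-- A curve that solves the linear equation of the one-parameter group is one of its orbits. -/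
theorem apply_eq_of_hasDerivAt (h : IsLinearAction w A B T) (τ : Fin κ → ℝ) {y : ℝ → R2n n}
    (hy : ∀ t, HasDerivAt y ((∑ l, τ l • B l) (y t)) t) (t : ℝ) : y t = A (t • τ) (y 0) := by
  have h1 : ∀ t : ℝ, HasDerivAt (fun t : ℝ => A (t • -τ) (y t)) 0 t := fun t => by
    refine ((h.hasDerivAt' (-τ) t).clm_apply (hy t)).congr_deriv ?_
    simp [Finset.sum_neg_distrib]
  have h2 := is_const_of_deriv_eq_zero (f := fun t : ℝ => A (t • -τ) (y t))
    (fun t => (h1 t).differentiableAt) (fun t => (h1 t).deriv) t 0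
  simp only [zero_smul, smul_neg, neg_zero, h.zero] at h2
  rw [← h2, ← h.add, add_neg_cancel, h.zero]

/-- Both sides solve the same linear differential equation with the same initial value, since T
commutes with the generators. -/
theorem commute_torus (h : IsLinearAction w A B T) (ψ : Γ) (τ : Fin κ → ℝ) (x : R2n n) :
    T ψ (A τ x) = A τ (T ψ x) := by
  have h1 : ∀ t, HasDerivAt (fun t : ℝ => T ψ (A (t • τ) x))
      ((∑ l, τ l • B l) (T ψ (A (t • τ) x))) t := fun t => by
    have h2 : ∀ x, T ψ ((∑ l, τ l • B l) x) = (∑ l, τ l • B l) (T ψ x) := fun x => by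
      simp only [_root_.sum_apply, _root_.smul_apply, map_sum, map_smul, h.commute]
    have h3 : ∀ x, A (t • τ) ((∑ l, τ l • B l) x) = (∑ l, τ l • B l) (A (t • τ) x) := fun x => by
      have e1 := (h.hasDerivAt' τ t).clm_apply (hasDerivAt_const t x)
      have e2 := (((h.hasDerivAt τ).clm_apply (hasDerivAt_const 0 (A (t • τ) x))))
      have e3 : HasDerivAt (fun r : ℝ => A ((r - t) • τ) (A (t • τ) x))
          ((∑ l, τ l • B l) (A (t • τ) x)) t :=
        HasDerivAt.comp_sub_const (f := fun r : ℝ => A (r • τ) (A (t • τ) x)) t t (by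
          rw [sub_self]; simpa using e2)
      have e4 : (fun r : ℝ => A ((r - t) • τ) (A (t • τ) x)) = fun r => A (r • τ) x := by
        ext1 r
        rw [← h.add, ← add_smul, sub_add_cancel]
      rw [e4] at e3
      have := e1.unique e3
      simpa using this
    rw [← h2, ← h3]
    have h4 := (T ψ).hasFDerivAt.comp_hasDerivAt t
      ((h.hasDerivAt' τ t).clm_apply (hasDerivAt_const t x))
    exact h4.congr_deriv (by simp)
  have h5 := h.apply_eq_of_hasDerivAt τ h1 1
  simpa [h.zero] using h5

/-- The one-parameter groups commute by additivity; differentiating twice at 0 gives the claim for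
their generators. -/
theorem gen_comm (h : IsLinearAction w A B T) (l l' : Fin κ) (x : R2n n) :
    B l (B l' x) = B l' (B l x) := by
  have hs : ∀ l : Fin κ, ∑ i, (Pi.single l 1 : Fin κ → ℝ) i • B i = B l := fun l => by
    simp [Pi.single_apply]
  have hd : ∀ (l : Fin κ) (x : R2n n), HasDerivAt (fun t : ℝ => A (t • Pi.single l 1) x) (B l x) 0 :=
    fun l x => ((h.hasDerivAt (Pi.single l 1)).clm_apply (hasDerivAt_const 0 x)).congr_deriv (by
      simp [hs])
  have h1 : ∀ (τ : Fin κ → ℝ) (x : R2n n), A τ (B l x) = B l (A τ x) := fun τ x => by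
    have e1 := (A τ).hasFDerivAt.comp_hasDerivAt (0 : ℝ) (hd l x)
    have e2 := hd l (A τ x)
    have e3 : (A τ ∘ fun t : ℝ => A (t • Pi.single l 1) x) = fun t : ℝ =>
        A (t • Pi.single l 1) (A τ x) := by
      ext1 t
      rw [Function.comp_apply, ← h.add, ← h.add, add_comm]
    rw [e3] at e1
    exact e1.unique e2
  have e1 := hd l' (B l x)
  have e2 := (B l).hasFDerivAt.comp_hasDerivAt (0 : ℝ) (hd l' x)
  have e3 : (B l ∘ fun t : ℝ => A (t • Pi.single l' 1) x) = fun t : ℝ =>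
      A (t • Pi.single l' 1) (B l x) := by
    ext1 t
    rw [Function.comp_apply, h1]
  rw [e3] at e2
  exact e2.unique e1

/-- The choice of angles is discontinuous, but by periodicity the action factors through the
quotient map `expT`, on which continuity can be tested. -/
theorem continuous_torus (h : IsLinearAction w A B T) :
    Continuous fun g : Torus κ => A (argT g) := by
  rw [isOpenQuotientMap_expT.isQuotientMap.continuous_iff]
  refine h.continuous.congr fun τ => ?_
  exact h.periodic _ _ (expT_argT _).symm

theorem torus_mul (h : IsLinearAction w A B T) (g k : Torus κ) (x : R2n n) :
    A (argT (g * k)) x = A (argT g) (A (argT k) x) := by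
  rw [← h.add]
  congr 1
  refine h.periodic _ _ ?_
  rw [expT_add, expT_argT, expT_argT, expT_argT]

variable [Fintype Γ]

/-- An invariant inner product. -/
def invInner (A : (Fin κ → ℝ) → R2n n →L[ℝ] R2n n) (T : Γ → R2n n →L[ℝ] R2n n) :
    R2n n →L[ℝ] R2n n →L[ℝ] ℝ :=
  ∫ g : Torus κ, ∑ ψ, pullB (innerSL ℝ) ((A (argT g)).comp (T ψ)) ∂torusMeasure κ

theorem continuous_pullB (h : IsLinearAction w A B T) : Continuous fun g : Torus κ =>
    ∑ ψ, pullB (innerSL ℝ) ((A (argT g)).comp (T ψ)) := by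
  refine continuous_finsetSum _ fun ψ _ => ?_
  have h1 : Continuous fun g : Torus κ => (A (argT g)).comp (T ψ) :=
    h.continuous_torus.clm_comp continuous_const
  exact Continuous.clm_comp ((ContinuousLinearMap.continuous _).comp h1)
    (continuous_const.clm_comp h1)

theorem integrable_of_continuous {F : Type*} [NormedAddCommGroup F] {f : Torus κ → F}
    (hf : Continuous f) : MeasureTheory.Integrable f (torusMeasure κ) :=
  hf.integrable_of_hasCompactSupport (HasCompactSupport.of_compactSpace f)

theorem invInner_apply (h : IsLinearAction w A B T) (u v : R2n n) : invInner A T u v =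
    ∫ g : Torus κ, ∑ ψ, ⟪A (argT g) (T ψ u), A (argT g) (T ψ v)⟫ ∂torusMeasure κ := by
  have hc := integrable_of_continuous h.continuous_pullB
  have hc2 := integrable_of_continuous (h.continuous_pullB.clm_apply (continuous_const (y := u)))
  rw [invInner, ContinuousLinearMap.integral_apply hc, ContinuousLinearMap.integral_apply hc2]
  refine MeasureTheory.integral_congr_ae (Filter.Eventually.of_forall fun g => ?_)
  simp only [_root_.sum_apply, pullB_apply, ContinuousLinearMap.comp_apply]
  rfl

theorem invInner_comm (h : IsLinearAction w A B T) (u v : R2n n) :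
    invInner A T u v = invInner A T v u := by
  rw [h.invInner_apply, h.invInner_apply]
  simp only [real_inner_comm]

theorem invInner_torus (h : IsLinearAction w A B T) (τ : Fin κ → ℝ) (u v : R2n n) :
    invInner A T (A τ u) (A τ v) = invInner A T u v := by
  rw [h.invInner_apply, h.invInner_apply]
  have hτ : A τ = A (argT (expT τ)) := h.periodic _ _ (expT_argT _).symm
  have := MeasureTheory.integral_mul_right_eq_self (μ := torusMeasure κ)
    (fun g : Torus κ => ∑ ψ, ⟪A (argT g) (T ψ u), A (argT g) (T ψ v)⟫) (expT τ)
  rw [← this]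
  refine MeasureTheory.integral_congr_ae (Filter.Eventually.of_forall fun g => ?_)
  simp only [h.commute_torus, h.torus_mul, hτ]

theorem invInner_finite (h : IsLinearAction w A B T) (χ : Γ) (u v : R2n n) :
    invInner A T (T χ u) (T χ v) = invInner A T u v := by
  rw [h.invInner_apply, h.invInner_apply]
  refine MeasureTheory.integral_congr_ae (Filter.Eventually.of_forall fun g => ?_)
  simp only [← h.mul]
  exact Fintype.sum_equiv (Equiv.mulRight χ) _ _ fun ψ => rfl

theorem continuous_integrand (h : IsLinearAction w A B T) (u : R2n n) : Continuous fun g : Torus κ =>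
    ∑ ψ, ⟪A (argT g) (T ψ u), A (argT g) (T ψ u)⟫ :=
  continuous_finsetSum _ fun ψ _ =>
    (h.continuous_torus.clm_apply continuous_const).inner (h.continuous_torus.clm_apply continuous_const)

theorem invInner_nonneg (h : IsLinearAction w A B T) (u : R2n n) : 0 ≤ invInner A T u u := by
  rw [h.invInner_apply]
  exact MeasureTheory.integral_nonneg fun g => Finset.sum_nonneg fun ψ _ => real_inner_self_nonneg

instance : (torusMeasure κ).IsOpenPosMeasure := by unfold torusMeasure; infer_instance

/-- Haar measure is positive on open sets, so a continuous nonnegative integrand with integral zero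
vanishes everywhere, in particular at the identity elements of both groups. -/
theorem eq_zero_of_invInner (h : IsLinearAction w A B T) {u : R2n n} (hu : invInner A T u u = 0) :
    u = 0 := by
  rw [h.invInner_apply, MeasureTheory.integral_eq_zero_iff_of_nonneg
    (fun g => Finset.sum_nonneg fun ψ _ => real_inner_self_nonneg)
    (integrable_of_continuous (h.continuous_integrand u)),
    Continuous.ae_eq_iff_eq _ (h.continuous_integrand u) continuous_zero] at hu
  have h1 := congrFun hu 1
  rw [Pi.zero_apply, Finset.sum_eq_zero_iff_of_nonneg fun _ _ => real_inner_self_nonneg] at h1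
  have h2 := inner_self_eq_zero.1 (h1 1 (Finset.mem_univ _))
  have h3 : A (argT (1 : Torus κ)) = A 0 := h.periodic _ _ (by rw [expT_argT, expT_zero])
  rwa [h.one, h3, h.zero] at h2

/-- The derivative at time 0 of the invariance of the inner product under a circle. -/
theorem invInner_gen (h : IsLinearAction w A B T) (l : Fin κ) (u v : R2n n) :
    invInner A T (B l u) v = -invInner A T u (B l v) := by
  have hs : ∑ i, (Pi.single l 1 : Fin κ → ℝ) i • B i = B l := by simp [Pi.single_apply]
  have hd : ∀ x : R2n n, HasDerivAt (fun t : ℝ => A (t • Pi.single l 1) x) (B l x) 0 :=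
    fun x => ((h.hasDerivAt (Pi.single l 1)).clm_apply (hasDerivAt_const 0 x)).congr_deriv (by
      simp [hs])
  have h1 := ((invInner A T).hasFDerivAt.comp_hasDerivAt (0 : ℝ) (hd u)).clm_apply (hd v)
  have h2 : (fun t : ℝ => (invInner A T ∘ fun t : ℝ => A (t • Pi.single l 1) u) t
      (A (t • Pi.single l 1) v)) = fun _ => invInner A T u v := by
    ext1 t
    exact h.invInner_torus _ u v
  rw [h2] at h1
  have h3 := h1.unique (hasDerivAt_const 0 _)
  simp only [Function.comp_apply, zero_smul, h.zero] at h3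
  linarith

/-- The invariant inner product, as an inner product space structure. -/
@[reducible]
def core (h : IsLinearAction w A B T) : InnerProductSpace.Core ℝ (R2n n) where
  inner u v := invInner A T u v
  conj_inner_symm u v := by rw [conj_trivial, h.invInner_comm]
  re_inner_nonneg u := h.invInner_nonneg u
  add_left u v x := by simp
  smul_left u v c := by simp
  definite u hu := h.eq_zero_of_invInner hu

theorem invInner_injective (h : IsLinearAction w A B T) : Function.Injective (invInner A T) :=
  (injective_iff_map_eq_zero _).2 fun u hu => h.eq_zero_of_invInner (by rw [hu]; rfl)

theorem exists_operator (h : IsLinearAction w A B T) :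
    ∃ K : R2n n →L[ℝ] R2n n, ∀ u v, invInner A T (K u) v = w u v := by
  obtain ⟨e, he⟩ := isInvertible_of_injective h.invInner_injective
  refine ⟨(e.symm : (R2n n →L[ℝ] ℝ) →L[ℝ] R2n n).comp w, fun u v => ?_⟩
  rw [← he]
  simp

/-- The operator K that represents the form is skew because the form is alternating, and it commutes
with the actions because form and inner product are both invariant. Commutativity of Γ enters here:
its operators must be diagonalised together. -/
theorem exists_frameMap (h : IsLinearAction w A B T) (hw : ∀ u v, w u v = -w v u) :
    ∃ (v e : Fin n → R2n n) (β : Fin n → Fin κ → ℝ) (z : Γ → Fin n → ℂ),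
      (∀ x y, w (frameMap v e x) (frameMap v e y) = stdBil x y) ∧
      (∀ l x, B l (frameMap v e x) = frameMap v e (mulC (fun j => β j l * Complex.I) x)) ∧
      ∀ ψ x, T ψ (frameMap v e x) = frameMap v e (mulC (z ψ) x) := by
  obtain ⟨K, hK⟩ := h.exists_operator
  have hinj := h.invInner_injective
  have hext : ∀ x y, (∀ v, invInner A T x v = invInner A T y v) → x = y := fun x y hxy =>
    hinj (ContinuousLinearMap.ext hxy)
  have hTinv : ∀ ψ x, T ψ (T ψ⁻¹ x) = x := fun ψ x => by rw [← h.mul, mul_inv_cancel, h.one]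
  have key := exists_frameMap_of_core h.core
    (K := (K : R2n n →ₗ[ℝ] R2n n)) (B := fun l => (B l : R2n n →ₗ[ℝ] R2n n))
    (T := fun ψ => (T ψ : R2n n →ₗ[ℝ] R2n n)) (n := n)
    (fun u v => by
      change invInner A T (K u) v = -invInner A T u (K v)
      rw [hK, h.invInner_comm, hK, hw])
    (fun v hv => by
      have hv' : K v = 0 := hv
      refine h.injective (ContinuousLinearMap.ext fun u => ?_)
      rw [← hK, hv', map_zero, map_zero])
    (fun l u v => h.invInner_gen l u v)
    (fun ψ u v => by
      change invInner A T (T ψ u) v = invInner A T u (T ψ⁻¹ v)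
      rw [← h.invInner_finite ψ u, hTinv])
    (fun l => LinearMap.ext fun x => hext _ _ fun v => by
      change invInner A T (K (B l x)) v = invInner A T (B l (K x)) v
      rw [hK, h.invInner_gen, hK, h.skew])
    (fun ψ => LinearMap.ext fun x => hext _ _ fun v => by
      change invInner A T (K (T ψ x)) v = invInner A T (T ψ (K x)) v
      rw [hK, ← hTinv ψ v, h.symplectic, h.invInner_finite, hK])
    (fun l l' => LinearMap.ext fun x => h.gen_comm l l' x)
    (fun l ψ => LinearMap.ext fun x => (h.commute ψ l x).symm)
    (fun ψ χ => LinearMap.ext fun x => by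
      change T ψ (T χ x) = T χ (T ψ x)
      rw [← h.mul, ← h.mul, mul_comm])
    (by rw [finrank_euclideanSpace, Fintype.card_prod, Fintype.card_fin, Fintype.card_fin, mul_comm])
  obtain ⟨v, e, β, z, h1, h2, h3⟩ := key
  refine ⟨v, e, β, z, fun x y => ?_, h2, h3⟩
  rw [← hK]
  exact h1 x y

end IsLinearAction

end LinearAction

/-! ### Integer weights, roots of unity and the order of the coordinates -/

section LinearNormalForm

variable {n κ : ℕ} {Γ : Type*}

/-- Indices can be sorted according to a predicate. -/
theorem exists_perm_lt_iff (P : Fin n → Prop) :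
    ∃ (k : ℕ) (σ : Equiv.Perm (Fin n)), k ≤ n ∧ ∀ j, j.val < k ↔ P (σ j) := by
  classical
  have hk : Fintype.card {j // P j} ≤ n := (Fintype.card_subtype_le P).trans (Fintype.card_fin n).le
  have hcard : Fintype.card {j : Fin n // j.val < Fintype.card {j // P j}} =
      Fintype.card {j // P j} := by
    rw [Fintype.card_subtype, Fin.card_filter_val_lt, min_eq_right hk]
  refine ⟨_, (Fintype.equivOfCardEq hcard).extendSubtype, hk, fun j => ⟨fun hj => ?_, fun hj => ?_⟩⟩
  · exact Equiv.extendSubtype_mem _ _ hj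
  · by_contra hc
    exact (Fintype.equivOfCardEq hcard).extendSubtype_not_mem j hc hj

/-- Permutation of the complex coordinates. -/
def permC (σ : Equiv.Perm (Fin n)) : R2n n →ₗ[ℝ] R2n n where
  toFun x := ofZ fun j => zc x (σ.symm j)
  map_add' x y := ext_zc fun j => by simp [zc_add]
  map_smul' t x := ext_zc fun j => by simp [zc_smul]

theorem zc_permC (σ : Equiv.Perm (Fin n)) (x : R2n n) (j : Fin n) :
    zc (permC σ x) j = zc x (σ.symm j) := zc_ofZ _ _

theorem stdBil_permC (σ : Equiv.Perm (Fin n)) (x y : R2n n) :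
    stdBil (permC σ x) (permC σ y) = stdBil x y := by
  simp only [stdBil_eq_zc, zc_permC]
  exact Equiv.sum_comp σ.symm fun j => (starRingEnd ℂ (zc x j) * zc y j).im

theorem mulC_permC (σ : Equiv.Perm (Fin n)) (z : Fin n → ℂ) (x : R2n n) :
    mulC z (permC σ x) = permC σ (mulC (fun j => z (σ j)) x) :=
  ext_zc fun j => by simp [zc_permC]

theorem mulC_injective : Function.Injective (mulC (n := n)) := fun z z' h => by
  ext1 j
  have h1 := congrArg (fun y => zc y j) (DFunLike.congr_fun h (ofZ fun _ => 1))
  simpa using h1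

theorem injective_of_stdBil {w : R2n n →L[ℝ] R2n n →L[ℝ] ℝ} {L : R2n n →ₗ[ℝ] R2n n}
    (hL : ∀ x y, w (L x) (L y) = stdBil x y) : Function.Injective L := by
  rw [injective_iff_map_eq_zero]
  intro x hx
  have h1 : stdBil x = 0 := ContinuousLinearMap.ext fun y => by rw [← hL, hx]; simp
  exact stdBil_isInvertible.injective (h1.trans (map_zero _).symm)

namespace IsLinearAction

variable [CommGroup Γ]
variable {w : R2n n →L[ℝ] R2n n →L[ℝ] ℝ} {A : (Fin κ → ℝ) → R2n n →L[ℝ] R2n n}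
  {B : Fin κ → R2n n →L[ℝ] R2n n} {T : Γ → R2n n →L[ℝ] R2n n}

/-- The weights of a torus action are integers. -/
theorem exists_int_weight (h : IsLinearAction w A B T) {F : R2n n →ₗ[ℝ] R2n n}
    (hF : Function.Injective F) {β : Fin n → ℝ} {l : Fin κ}
    (hB : ∀ x, B l (F x) = F (mulC (fun j => β j * Complex.I) x)) (j : Fin n) :
    ∃ p : ℤ, β j = p := by
  have hs : ∑ i, (Pi.single l 1 : Fin κ → ℝ) i • B i = B l := by simp [Pi.single_apply]
  let x : R2n n := ofZ fun _ => 1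
  let y : ℝ → R2n n := fun t => F (mulC (fun j => Complex.exp (t * (β j * Complex.I))) x)
  have hy : ∀ t, HasDerivAt y ((∑ i, (Pi.single l 1 : Fin κ → ℝ) i • B i) (y t)) t := fun t => by
    have h1 : HasDerivAt (fun t : ℝ => fun j => Complex.exp (t * (β j * Complex.I)))
        (fun j => (β j * Complex.I) * Complex.exp (t * (β j * Complex.I))) t := by
      refine hasDerivAt_pi.2 fun j => ?_
      have h2 : HasDerivAt (fun t : ℝ => (t : ℂ) * (β j * Complex.I)) (β j * Complex.I) t := by
        simpa using (Complex.ofRealCLM.hasDerivAt (x := t)).mul_const ((β j : ℂ) * Complex.I)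
      exact h2.cexp.congr_deriv (mul_comm _ _)
    have h3 := (mulC (n := n)).hasFDerivAt.comp_hasDerivAt t h1
    have h4 := (LinearMap.toContinuousLinearMap F).hasFDerivAt.comp_hasDerivAt t
      (h3.clm_apply (hasDerivAt_const t x))
    refine h4.congr_deriv ?_
    rw [hs, hB]
    change F _ = F _
    congr 1
    exact ext_zc fun j => by simp [mul_assoc]
  -- After time 2π the circle returns to the identity, so exp(2πiβ_j) = 1 and β_j is an integer.
  have h1 := h.apply_eq_of_hasDerivAt _ hy (2 * Real.pi)
  have h2 : A ((2 * Real.pi) • Pi.single l 1) = A 0 := h.periodic _ _ (by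
    ext1 i
    by_cases hi : i = l <;> simp [expT, hi])
  rw [h2, h.zero] at h1
  have h3 := congrArg (fun y => zc y j) (hF h1)
  simp only [zc_mulC, Complex.ofReal_zero, zero_mul, Complex.exp_zero, zc_ofZ, x, mul_one] at h3
  obtain ⟨m, hm⟩ := Complex.exp_eq_one_iff.1 h3
  refine ⟨m, ?_⟩
  have h4 : ((2 * Real.pi * Complex.I : ℂ)) * β j = (2 * Real.pi * Complex.I) * m := by
    push_cast at hm
    linear_combination hm
  have h5 := mul_left_cancel₀ Complex.two_pi_I_ne_zero h4
  exact_mod_cast h5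

/-- The multipliers of a finite group are roots of unity. -/
theorem exists_rat_multiplier [Finite Γ] (h : IsLinearAction w A B T) {F : R2n n →ₗ[ℝ] R2n n}
    (hF : Function.Injective F) {z : Γ → Fin n → ℂ}
    (hT : ∀ ψ x, T ψ (F x) = F (mulC (z ψ) x)) (ψ : Γ) (j : Fin n) :
    ∃ q : ℚ, z ψ j = Complex.exp (2 * Real.pi * Complex.I * q) := by
  have hmul : ∀ ψ χ, z (ψ * χ) = z ψ * z χ := fun ψ χ => mulC_injective <|
    ContinuousLinearMap.ext fun x => hF (by rw [← hT, h.mul, hT, hT, mulC_mul]; rfl)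
  have hone : z 1 = 1 := mulC_injective <| ContinuousLinearMap.ext fun x => hF (by
    rw [← hT, h.one, mulC_one]; rfl)
  let f : Γ →* (Fin n → ℂ) := ⟨⟨z, hone⟩, hmul⟩
  -- Multipliers are characters of Γ, so their power with exponent the order of Γ is 1.
  have hpow : z ψ j ^ Nat.card Γ = 1 := by
    have h1 := map_pow f ψ (Nat.card Γ)
    rw [pow_card_eq_one', map_one] at h1
    exact (congrFun h1 j).symm
  have : NeZero (Nat.card Γ) := ⟨Nat.card_pos.ne'⟩
  have hu : IsUnit (z ψ j) := IsUnit.of_pow_eq_one hpow Nat.card_pos.ne'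
  obtain ⟨i, -, hi⟩ := (Complex.mem_rootsOfUnity (Nat.card Γ) hu.unit).1 (by
    rw [mem_rootsOfUnity]
    ext
    simpa using hpow)
  refine ⟨i / Nat.card Γ, ?_⟩
  rw [IsUnit.unit_spec] at hi
  rw [← hi]
  push_cast
  rfl

theorem exists_normal_form [Finite Γ] (h : IsLinearAction w A B T) (hw : ∀ u v, w u v = -w v u) :
    ∃ (L : R2n n ≃L[ℝ] R2n n) (kₑ : ℕ) (p : Fin n → Fin κ → ℤ) (q : Γ → Fin n → ℚ)
      (a : Γ → Fin n → Circle), kₑ ≤ n ∧ (∀ ψ (j : Fin n), kₑ ≤ j.val → ∃ b : ℤ, q ψ j = b / 2) ∧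
      (∀ j l, kₑ ≤ j.val → p j l = 0) ∧ (∀ ψ χ, a (ψ * χ) = a ψ * a χ) ∧
      (∀ ψ j, (a ψ j : ℂ) = Complex.exp (2 * Real.pi * Complex.I * (q ψ j : ℂ))) ∧
      (∀ x y, w (L x) (L y) = stdBil x y) ∧ (∀ l x, B l (L x) = L (gen p l x)) ∧
      ∀ ψ x, T ψ (L x) = L (rotC (a ψ) x) := by
  have := Fintype.ofFinite Γ
  obtain ⟨v, e, β, z, h1, h2, h3⟩ := h.exists_frameMap hw
  have hinj := injective_of_stdBil h1
  choose p hp using fun j l => h.exists_int_weight hinj (h2 l) j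
  choose q hq using h.exists_rat_multiplier hinj h3
  -- Coordinates with a nonzero weight or with a multiplier exponent that is not half-integral come
  -- first. The remaining ones have zero weights and exponents in ½ℤ, as the statement demands
  -- beyond `kₑ`.
  obtain ⟨k, σ, hk, hσ⟩ := exists_perm_lt_iff fun j => (∃ l, p j l ≠ 0) ∨
    ∃ ψ, ¬∃ b : ℤ, q ψ j = b / 2
  have hL : ∀ x y, w (((frameMap v e).comp (permC σ)) x) (((frameMap v e).comp (permC σ)) y) =
      stdBil x y := fun x y => by
    simp only [LinearMap.comp_apply, h1, stdBil_permC]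
  let L := (LinearEquiv.ofInjectiveEndo _ (injective_of_stdBil hL)).toContinuousLinearEquiv
  let a : Γ → Fin n → Circle := fun ψ j => Circle.exp (2 * Real.pi * q ψ (σ j))
  have haz : ∀ ψ j, (a ψ j : ℂ) = Complex.exp (2 * Real.pi * Complex.I * (q ψ (σ j) : ℂ)) :=
    fun ψ j => by
      rw [Circle.coe_exp]
      congr 1
      push_cast
      ring
  have hT : ∀ ψ x, T ψ (L x) = L (rotC (a ψ) x) := fun ψ x => by
    change T ψ (frameMap v e (permC σ x)) = frameMap v e (permC σ (rotC (a ψ) x))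
    rw [h3, mulC_permC, rotC]
    congr 4
    ext1 j
    rw [haz, hq]
  refine ⟨L, k, fun j l => p (σ j) l, fun ψ j => q ψ (σ j), a, hk, fun ψ j hj => ?_,
    fun j l hj => ?_, fun ψ χ => ?_, haz, hL, fun l x => ?_, hT⟩
  · by_contra hc
    exact absurd ((hσ j).2 (.inr ⟨ψ, hc⟩)) (not_lt.2 hj)
  · by_contra hc
    exact absurd ((hσ j).2 (.inl ⟨l, hc⟩)) (not_lt.2 hj)
  -- The rational exponents need not be additive in ψ; the multipliers themselves are multiplicative
  -- since they are determined by the operators of an action.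
  · have h4 : mulC (fun j => (a (ψ * χ) j : ℂ)) = mulC fun j => ((a ψ * a χ) j : ℂ) :=
      ContinuousLinearMap.ext fun x => L.injective (by
        change L (rotC (a (ψ * χ)) x) = L (rotC (a ψ * a χ) x)
        rw [← hT, h.mul, hT, hT, rotC_mul_apply])
    ext1 j
    exact Circle.ext (congrFun (mulC_injective h4) j)
  · change B l (frameMap v e (permC σ x)) = frameMap v e (permC σ (gen _ l x))
    rw [h2, mulC_permC, gen]
    congr 4
    ext1 j
    rw [hp]
    simp

end IsLinearAction

end LinearNormalForm

/-! ### The linearised action at the fixed point -/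

section Linearization

variable {n κ : ℕ} {M : Type*} [TopologicalSpace M] [ChartedSpace (R2n n) M]
  {s : WithTop ℕ∞} [IsManifold 𝓘(ℝ, R2n n) s M] {φ : OpenPartialHomeomorph M (R2n n)} {Γ : Type*}
  {Ω : TwoForm n M} {J : Fin κ → M → ℝ} {θ : Torus κ → M → M} {N : Set M} {ρ : Γ → M → M}
  {N' : Set M} {m₀ : M}

/-- `φ` is a chart centred at the fixed point `m₀` of a system. -/
structure IsFixedPointChart [Group Γ] (s : WithTop ℕ∞) [IsManifold 𝓘(ℝ, R2n n) s M] (Ω : TwoForm n M)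
    (J : Fin κ → M → ℝ) (θ : Torus κ → M → M) (N : Set M) (ρ : Γ → M → M) (N' : Set M)
    (φ : OpenPartialHomeomorph M (R2n n)) (m₀ : M) : Prop where
  smooth : s = ∞ ∨ s = ω
  system : IsSystem s Ω J θ N ρ N'
  mem_atlas : φ ∈ IsManifold.maximalAtlas 𝓘(ℝ, R2n n) s M
  subset : φ.source ⊆ N'
  mem : m₀ ∈ φ.source
  centred : φ m₀ = 0
  torus_fixed : ∀ t, θ t m₀ = m₀
  finite_fixed : ∀ ψ, ρ ψ m₀ = m₀

/-- The coordinate expression of the torus action. -/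
def torusInChart (φ : OpenPartialHomeomorph M (R2n n)) (θ : Torus κ → M → M) (τ : Fin κ → ℝ)
    (x : R2n n) : R2n n := φ (θ (expT τ) (φ.symm x))

/-- The coordinate expression of the action of the finite group. -/
def finiteInChart (φ : OpenPartialHomeomorph M (R2n n)) (ρ : Γ → M → M) (ψ : Γ)
    (x : R2n n) : R2n n := φ (ρ ψ (φ.symm x))

/-- The coordinate expression of a Hamiltonian vector field. -/
def vfInChart (φ : OpenPartialHomeomorph M (R2n n)) (Ω : TwoForm n M) (J : Fin κ → M → ℝ)
    (ρ : Γ → M → M) (l : Fin κ) (x : R2n n) : R2n n := hamVF (chartData φ Ω J ρ x) l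

namespace IsFixedPointChart

variable [Group Γ]

theorem zero_mem (h : IsFixedPointChart s Ω J θ N ρ N' φ m₀) : (0 : R2n n) ∈ φ.target :=
  h.centred ▸ φ.map_source h.mem

theorem symm_zero (h : IsFixedPointChart s Ω J θ N ρ N' φ m₀) : φ.symm 0 = m₀ := by
  rw [← h.centred, φ.left_inv h.mem]

theorem subset_N (h : IsFixedPointChart s Ω J θ N ρ N' φ m₀) {x : R2n n} (hx : x ∈ φ.target) :
    φ.symm x ∈ N := h.system.subset (h.subset (φ.map_target hx))

theorem target_mem (h : IsFixedPointChart s Ω J θ N ρ N' φ m₀) : ∀ᶠ x in 𝓝 (0 : R2n n), x ∈ φ.target :=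
  φ.open_target.mem_nhds h.zero_mem

theorem torusInChart_zero (h : IsFixedPointChart s Ω J θ N ρ N' φ m₀) (τ : Fin κ → ℝ) :
    torusInChart φ θ τ 0 = 0 := by
  rw [torusInChart, h.symm_zero, h.torus_fixed, h.centred]

theorem finiteInChart_zero (h : IsFixedPointChart s Ω J θ N ρ N' φ m₀) (ψ : Γ) :
    finiteInChart φ ρ ψ 0 = 0 := by
  rw [finiteInChart, h.symm_zero, h.finite_fixed, h.centred]

theorem contMDiffAt_torus (h : IsFixedPointChart s Ω J θ N ρ N' φ m₀) (τ : Fin κ → ℝ) {x : R2n n}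
    (hx : x ∈ φ.target) :
    ContMDiffAt 𝓘(ℝ, (Fin κ → ℝ) × R2n n) 𝓘(ℝ, R2n n) s
      (fun z : (Fin κ → ℝ) × R2n n => θ (expT z.1) (φ.symm z.2)) (τ, x) := by
  have h1 := h.system.torus.contMDiffOn.contMDiffAt (x := (τ, φ.symm x))
    ((isOpen_univ.prod h.system.isOpen).mem_nhds ⟨mem_univ _, h.subset_N hx⟩)
  exact ContMDiffAt.comp (τ, x)
    (g := fun τm : (Fin κ → ℝ) × M => θ (fun l => Circle.exp (τm.1 l)) τm.2) h1
    (contMDiffAt_pair_symm h.mem_atlas hx)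

theorem contDiffAt_torus (h : IsFixedPointChart s Ω J θ N ρ N' φ m₀) (τ : Fin κ → ℝ) {x : R2n n}
    (hx : x ∈ φ.target) (hx' : θ (expT τ) (φ.symm x) ∈ φ.source) :
    ContDiffAt ℝ s (Function.uncurry (torusInChart φ θ)) (τ, x) := by
  rw [← contMDiffAt_iff_contDiffAt]
  exact ContMDiffAt.comp (τ, x) (g := φ)
    (f := fun z : (Fin κ → ℝ) × R2n n => θ (expT z.1) (φ.symm z.2))
    ((contMDiffOn_of_mem_maximalAtlas h.mem_atlas).contMDiffAt (φ.open_source.mem_nhds hx'))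
    (h.contMDiffAt_torus τ hx)

theorem contDiffAt_torus_zero (h : IsFixedPointChart s Ω J θ N ρ N' φ m₀) (τ : Fin κ → ℝ) :
    ContDiffAt ℝ s (Function.uncurry (torusInChart φ θ)) (τ, 0) :=
  h.contDiffAt_torus τ h.zero_mem (by rw [h.symm_zero, h.torus_fixed]; exact h.mem)

theorem differentiableAt_torus (h : IsFixedPointChart s Ω J θ N ρ N' φ m₀) (τ : Fin κ → ℝ) :
    DifferentiableAt ℝ (torusInChart φ θ τ) 0 := by
  have h1 := (h.contDiffAt_torus_zero τ).comp (0 : R2n n)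
    (contDiffAt_const.prodMk contDiffAt_id : ContDiffAt ℝ s (fun x : R2n n => (τ, x)) 0)
  exact h1.differentiableAt (ne_zero_of_smooth h.smooth)

/-- Only an identity of germs at the origin: away from the fixed point orbits may leave the chart.
-/
theorem torusInChart_add (h : IsFixedPointChart s Ω J θ N ρ N' φ m₀) (τ σ : Fin κ → ℝ) :
    torusInChart φ θ (τ + σ) =ᶠ[𝓝 0] torusInChart φ θ τ ∘ torusInChart φ θ σ := by
  have h1 : ContinuousAt (fun x => θ (expT σ) (φ.symm x)) (0 : R2n n) :=
    ContinuousAt.comp (x := (0 : R2n n)) (g := fun z : (Fin κ → ℝ) × R2n n => θ (expT z.1) (φ.symm z.2))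
      (f := fun x : R2n n => (σ, x)) (h.contMDiffAt_torus σ h.zero_mem).continuousAt (by fun_prop)
  have h2 := h1.preimage_mem_nhds (φ.open_source.mem_nhds (by
    rw [h.symm_zero, h.torus_fixed]; exact h.mem))
  filter_upwards [h.target_mem, h2] with x hx hx2
  simp only [torusInChart, Function.comp_apply]
  rw [φ.left_inv hx2, expT_add, h.system.torus.mul _ _ _ (h.subset_N hx)]

theorem torusInChart_id (h : IsFixedPointChart s Ω J θ N ρ N' φ m₀) :
    torusInChart φ θ (0 : Fin κ → ℝ) =ᶠ[𝓝 0] id := by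
  filter_upwards [h.target_mem] with x hx
  rw [torusInChart, expT_zero, h.system.torus.one _ (h.subset_N hx), φ.right_inv hx, id]

variable [Fintype Γ]

theorem contDiffAt_chartData (h : IsFixedPointChart s Ω J θ N ρ N' φ m₀) :
    ContDiffAt ℝ s (chartData φ Ω J ρ) 0 :=
  h.system.contDiffAt_chartData h.smooth h.mem_atlas h.subset h.zero_mem fun ψ => by
    rw [h.symm_zero, h.finite_fixed]; exact h.mem

theorem isInvertible (h : IsFixedPointChart s Ω J θ N ρ N' φ m₀) {x : R2n n} (hx : x ∈ φ.target) :
    (chartData φ Ω J ρ x).1.IsInvertible :=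
  h.system.symplectic.isInvertible
    (mdifferentiable_of_mem_maximalAtlas (ne_zero_of_smooth h.smooth) h.mem_atlas) hx (h.subset_N hx)

theorem differentiableAt_vf (h : IsFixedPointChart s Ω J θ N ρ N' φ m₀) (l : Fin κ) :
    DifferentiableAt ℝ (vfInChart φ Ω J ρ l) 0 := by
  have hd := h.contDiffAt_chartData.differentiableAt (ne_zero_of_smooth h.smooth)
  have h1 := ((h.isInvertible h.zero_mem).contDiffAt_map_inverse (n := 1)).differentiableAt one_ne_zero
  have h2 : DifferentiableAt ℝ (fun x => (chartData φ Ω J ρ x).1.inverse) 0 :=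
    DifferentiableAt.comp (g := ContinuousLinearMap.inverse) (0 : R2n n) h1 hd.fst
  exact (h2.clm_apply (differentiableAt_pi.1 hd.snd.fst l)).neg

theorem vf_zero (h : IsFixedPointChart s Ω J θ N ρ N' φ m₀) (l : Fin κ) :
    vfInChart φ Ω J ρ l 0 = 0 := by
  have h1 := h.system.torus.hasDerivAt_zero (ρ := ρ) h.smooth h.system.isOpen h.system.symplectic
    h.mem_atlas h.mem (h.system.subset (h.subset h.mem)) (Pi.single l 1)
  simp only [h.torus_fixed, h.centred] at h1
  have h2 := h1.unique (hasDerivAt_const 0 _)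
  simpa [Pi.single_apply, vfInChart] using h2

theorem contDiffAt_finite (h : IsFixedPointChart s Ω J θ N ρ N' φ m₀) (ψ : Γ) :
    ContDiffAt ℝ s (finiteInChart φ ρ ψ) 0 :=
  h.system.contDiffAt_finite h.mem_atlas h.subset h.zero_mem (by
    rw [h.symm_zero, h.finite_fixed]; exact h.mem)

theorem differentiableAt_finite (h : IsFixedPointChart s Ω J θ N ρ N' φ m₀) (ψ : Γ) :
    DifferentiableAt ℝ (finiteInChart φ ρ ψ) 0 :=
  (h.contDiffAt_finite ψ).differentiableAt (ne_zero_of_smooth h.smooth)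

theorem finite_mem (h : IsFixedPointChart s Ω J θ N ρ N' φ m₀) (ψ : Γ) :
    ∀ᶠ x in 𝓝 (0 : R2n n), ρ ψ (φ.symm x) ∈ φ.source := by
  have h1 : ContinuousAt φ.symm (0 : R2n n) := φ.continuousAt_symm h.zero_mem
  have h2 : ContinuousAt (ρ ψ) (φ.symm 0) :=
    ((h.system.finite.contMDiffOn ψ).contMDiffAt (h.system.isOpen'.mem_nhds
      (h.subset (φ.map_target h.zero_mem)))).continuousAt
  exact (ContinuousAt.comp h2 h1).preimage_mem_nhds (φ.open_source.mem_nhds (by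
    rw [Function.comp_apply, h.symm_zero, h.finite_fixed]; exact h.mem))

theorem finiteInChart_mul (h : IsFixedPointChart s Ω J θ N ρ N' φ m₀) (ψ χ : Γ) :
    finiteInChart φ ρ (ψ * χ) =ᶠ[𝓝 0] finiteInChart φ ρ ψ ∘ finiteInChart φ ρ χ := by
  filter_upwards [h.target_mem, h.finite_mem χ] with x hx hx2
  simp only [finiteInChart, Function.comp_apply]
  rw [φ.left_inv hx2, h.system.finite.mul _ _ _ (h.subset (φ.map_target hx))]

theorem finiteInChart_id (h : IsFixedPointChart s Ω J θ N ρ N' φ m₀) :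
    finiteInChart φ ρ 1 =ᶠ[𝓝 0] id := by
  filter_upwards [h.target_mem] with x hx
  rw [finiteInChart, h.system.finite.one _ (h.subset (φ.map_target hx)), φ.right_inv hx, id]

/-- Differentiating Ω(v, X) = dJ(v) at a zero of X removes the derivative of Ω, so the linearised
field is the Hamiltonian field of the Hessian of J. -/
theorem fderiv_vf_symm (h : IsFixedPointChart s Ω J θ N ρ N' φ m₀) (l : Fin κ) (u v : R2n n) :
    (chartData φ Ω J ρ 0).1 v (fderiv ℝ (vfInChart φ Ω J ρ l) 0 u) =
      (fderiv ℝ (fun x => (chartData φ Ω J ρ x).2.1 l) 0 u) v := by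
  have hd := h.contDiffAt_chartData.differentiableAt (ne_zero_of_smooth h.smooth)
  have h1 := (hd.fst.hasFDerivAt.clm_apply (hasFDerivAt_const v (0 : R2n n))).clm_apply
    (h.differentiableAt_vf l).hasFDerivAt
  have h2 := (differentiableAt_pi.1 hd.snd.fst l).hasFDerivAt.clm_apply
    (hasFDerivAt_const v (0 : R2n n))
  have h3 : (fun x => (chartData φ Ω J ρ x).1 v (vfInChart φ Ω J ρ l x)) =ᶠ[𝓝 0]
      fun x => (chartData φ Ω J ρ x).2.1 l v := by
    filter_upwards [h.target_mem] with x hx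
    exact hamVF_spec (h.isInvertible hx) (fun u v => chartData_swap x u v) l v
  have h4 := DFunLike.congr_fun (h1.unique (h2.congr_of_eventuallyEq h3)) u
  simpa [h.vf_zero] using h4

/-- Symmetry of the mixed second derivative: the time derivative of the linearised action is the
linearisation of the time derivative of the action, that is, of the Hamiltonian field. -/
theorem hasDerivAt_torus (h : IsFixedPointChart s Ω J θ N ρ N' φ m₀) (τ : Fin κ → ℝ) :
    HasDerivAt (fun t : ℝ => fderiv ℝ (torusInChart φ θ (t • τ)) 0)
      (∑ l, τ l • fderiv ℝ (vfInChart φ Ω J ρ l) 0) 0 := by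
  set G := Function.uncurry (torusInChart φ θ) with hG
  have hs0 := ne_zero_of_smooth h.smooth
  have hG2 : ContDiffAt ℝ s G (0, 0) := h.contDiffAt_torus_zero 0
  have hsym := hG2.isSymmSndFDerivAt (by simpa using two_le_of_smooth h.smooth)
  have hG1 : DifferentiableAt ℝ (fderiv ℝ G) (0, 0) :=
    (hG2.fderiv_right (m := 1) (two_le_of_smooth h.smooth)).differentiableAt one_ne_zero
  have hinr : ∀ σ : Fin κ → ℝ, fderiv ℝ (torusInChart φ θ σ) 0 =
      (fderiv ℝ G (σ, 0)).comp (ContinuousLinearMap.inr ℝ (Fin κ → ℝ) (R2n n)) := fun σ => by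
    have h1 := ((h.contDiffAt_torus_zero σ).differentiableAt hs0).hasFDerivAt.comp (0 : R2n n)
      (hasFDerivAt_prodMk_right σ (0 : R2n n))
    exact h1.fderiv
  have hline : HasDerivAt (fun t : ℝ => fderiv ℝ G (t • τ, 0))
      (fderiv ℝ (fderiv ℝ G) (0, 0) (τ, 0)) 0 := by
    have h1 : HasDerivAt (fun t : ℝ => (t • τ, (0 : R2n n))) (τ, 0) 0 := by
      simpa using ((hasDerivAt_id (0 : ℝ)).smul_const τ).prodMk (hasDerivAt_const (0 : ℝ) (0 : R2n n))
    refine HasFDerivAt.comp_hasDerivAt (l := fderiv ℝ G) (0 : ℝ) ?_ h1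
    rw [zero_smul]
    exact hG1.hasFDerivAt
  have h2 := ((ContinuousLinearMap.compL ℝ (R2n n) ((Fin κ → ℝ) × R2n n) (R2n n)).flip
    (ContinuousLinearMap.inr ℝ (Fin κ → ℝ) (R2n n))).hasFDerivAt.comp_hasDerivAt (0 : ℝ) hline
  refine (h2.congr_of_eventuallyEq (Filter.Eventually.of_forall fun t => hinr _)).congr_deriv ?_
  refine ContinuousLinearMap.ext fun v => ?_
  change fderiv ℝ (fderiv ℝ G) (0, 0) (τ, 0) (0, v) = _
  rw [hsym.eq]
  have h3 : HasFDerivAt (fun x : R2n n => fderiv ℝ G (0, x) (τ, 0))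
      (((ContinuousLinearMap.apply ℝ (R2n n) ((τ, 0) : (Fin κ → ℝ) × R2n n)).comp
        (fderiv ℝ (fderiv ℝ G) (0, 0))).comp (ContinuousLinearMap.inr ℝ (Fin κ → ℝ) (R2n n))) 0 :=
    ((ContinuousLinearMap.apply ℝ (R2n n) ((τ, 0) : (Fin κ → ℝ) × R2n n)).hasFDerivAt.comp _
      hG1.hasFDerivAt).comp (0 : R2n n) (hasFDerivAt_prodMk_right (0 : Fin κ → ℝ) (0 : R2n n))
  have h4 : HasFDerivAt (fun x : R2n n => ∑ l, τ l • vfInChart φ Ω J ρ l x)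
      (∑ l, τ l • fderiv ℝ (vfInChart φ Ω J ρ l) 0) 0 :=
    HasFDerivAt.fun_sum fun l _ => (h.differentiableAt_vf l).hasFDerivAt.fun_const_smul _
  have h5 : (fun x : R2n n => fderiv ℝ G (0, x) (τ, 0)) =ᶠ[𝓝 0]
      fun x => ∑ l, τ l • vfInChart φ Ω J ρ l x := by
    filter_upwards [h.target_mem] with x hx
    have e1 := h.system.torus.hasDerivAt_zero (ρ := ρ) h.smooth h.system.isOpen h.system.symplectic
      h.mem_atlas (φ.map_target hx) (h.subset_N hx) τ
    rw [φ.right_inv hx] at e1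
    have e2 : DifferentiableAt ℝ G (0, x) := (h.contDiffAt_torus 0 hx (by
      rw [expT_zero, h.system.torus.one _ (h.subset_N hx)]; exact φ.map_target hx)).differentiableAt hs0
    have e3 : HasDerivAt (fun t : ℝ => (t • τ, x)) (τ, 0) 0 := by
      simpa using ((hasDerivAt_id (0 : ℝ)).smul_const τ).prodMk (hasDerivAt_const (0 : ℝ) x)
    have e4 : HasFDerivAt G (fderiv ℝ G (0, x)) ((0 : ℝ) • τ, x) := by
      rw [zero_smul]; exact e2.hasFDerivAt
    have e5 := HasFDerivAt.comp_hasDerivAt (l := G) (0 : ℝ) e4 e3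
    exact HasDerivAt.unique e5 e1
  exact DFunLike.congr_fun (h3.unique (h4.congr_of_eventuallyEq h5)) v

theorem continuous_fderiv_torus (h : IsFixedPointChart s Ω J θ N ρ N' φ m₀) :
    Continuous fun τ => fderiv ℝ (torusInChart φ θ τ) 0 := by
  rw [continuous_iff_continuousAt]
  intro τ
  have h1 := ContDiffAt.fderiv (f := torusInChart φ θ) (g := fun _ => (0 : R2n n)) (x₀ := τ) (m := 0)
    (h.contDiffAt_torus_zero τ) contDiffAt_const
    (le_trans (by norm_num) (two_le_of_smooth h.smooth))
  exact h1.continuousAt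

/-- The derivative at the fixed point of the invariance of the Hamiltonian field under ρ(ψ); the
second derivative of ρ(ψ) drops out because the field vanishes there. -/
theorem finite_commute (h : IsFixedPointChart s Ω J θ N ρ N' φ m₀) (ψ : Γ) (l : Fin κ) (u : R2n n) :
    fderiv ℝ (finiteInChart φ ρ ψ) 0 (fderiv ℝ (vfInChart φ Ω J ρ l) 0 u) =
      fderiv ℝ (vfInChart φ Ω J ρ l) 0 (fderiv ℝ (finiteInChart φ ρ ψ) 0 u) := by
  have h1 : DifferentiableAt ℝ (fderiv ℝ (finiteInChart φ ρ ψ)) 0 :=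
    ((h.contDiffAt_finite ψ).fderiv_right (m := 1) (two_le_of_smooth h.smooth)).differentiableAt
      one_ne_zero
  have h2 := h1.hasFDerivAt.clm_apply (h.differentiableAt_vf l).hasFDerivAt
  have h3 := HasFDerivAt.comp (g := vfInChart φ Ω J ρ l) (f := finiteInChart φ ρ ψ) (0 : R2n n)
    (by rw [h.finiteInChart_zero]; exact (h.differentiableAt_vf l).hasFDerivAt)
    (h.differentiableAt_finite ψ).hasFDerivAt
  have h4 : (fun x => fderiv ℝ (finiteInChart φ ρ ψ) x (vfInChart φ Ω J ρ l x)) =ᶠ[𝓝 0]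
      vfInChart φ Ω J ρ l ∘ finiteInChart φ ρ ψ := by
    filter_upwards [h.target_mem, h.finite_mem ψ] with x hx hx2
    exact h.system.finite_hamVF h.smooth h.mem_atlas h.subset hx hx2 l
  have h5 := DFunLike.congr_fun (h2.unique (h3.congr_of_eventuallyEq h4)) u
  simpa [h.vf_zero] using h5

end IsFixedPointChart

theorem IsFixedPointChart.isLinearAction [CommGroup Γ] [Fintype Γ]
    (h : IsFixedPointChart s Ω J θ N ρ N' φ m₀) :
    IsLinearAction (chartData φ Ω J ρ 0).1 (fun τ => fderiv ℝ (torusInChart φ θ τ) 0)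
      (fun l => fderiv ℝ (vfInChart φ Ω J ρ l) 0) fun ψ => fderiv ℝ (finiteInChart φ ρ ψ) 0 where
  injective := (h.isInvertible h.zero_mem).injective
  add τ σ x := by
    rw [(h.torusInChart_add τ σ).fderiv_eq, fderiv_comp _ (by
      rw [h.torusInChart_zero]; exact h.differentiableAt_torus τ) (h.differentiableAt_torus σ),
      h.torusInChart_zero]
    rfl
  zero x := by rw [h.torusInChart_id.fderiv_eq, fderiv_id]; rfl
  periodic τ σ hτ := by
    have : torusInChart φ θ τ = torusInChart φ θ σ := by
      ext1 x
      rw [torusInChart, hτ, torusInChart]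
    rw [this]
  continuous := h.continuous_fderiv_torus
  hasDerivAt := h.hasDerivAt_torus
  -- Infinitesimal symplecticity of the generator is the symmetry of the Hessian of the momentum.
  skew l u v := by
    rw [chartData_swap, h.fderiv_vf_symm, h.system.momentum_symm h.smooth h.mem_atlas h.subset h.zero_mem,
      ← h.fderiv_vf_symm]
  mul ψ χ x := by
    rw [(h.finiteInChart_mul ψ χ).fderiv_eq, fderiv_comp _ (by
      rw [h.finiteInChart_zero]; exact h.differentiableAt_finite ψ) (h.differentiableAt_finite χ),
      h.finiteInChart_zero]
    rfl
  one x := by rw [h.finiteInChart_id.fderiv_eq, fderiv_id]; rfl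
  symplectic ψ u v := by
    have h1 := h.system.finite_symplectic h.smooth h.mem_atlas h.subset h.zero_mem (ψ := ψ)
      (by rw [h.symm_zero, h.finite_fixed]; exact h.mem) u v
    rw [h.symm_zero, h.finite_fixed, h.centred] at h1
    exact h1
  commute := h.finite_commute

end Linearization

/-! ### Hadamard's quotient -/

section Hadamard

variable {E F : Type*} [NormedAddCommGroup E] [NormedSpace ℝ E] [CompleteSpace E]
  [NormedAddCommGroup F] [NormedSpace ℝ F] [CompleteSpace F]

/-- The difference quotient of `f` at the origin, extended to the parameter `0`. -/
def scaledQuotient (f : E → F) (z : ℝ × E) : F := ∫ t in (0 : ℝ)..1, fderiv ℝ f ((t * z.1) • z.2) z.2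

theorem contDiffOn_scaledQuotient {f : E → F} {r : ℝ} {s : WithTop ℕ∞} (hs : s + 1 ≤ s)
    (hf : ContDiffOn ℝ s f (Metric.ball 0 r)) {S : Set (ℝ × E)} (hS : ∀ z ∈ S, ‖z.1 • z.2‖ < r) :
    ContDiffOn ℝ s (scaledQuotient f) S := by
  let g : ℝ × ℝ × E → E := fun w => (w.1 * w.2.1) • w.2.2
  have hg : ContDiff ℝ s g := by fun_prop
  refine contDiffOn_integral_param (H := fun w : ℝ × ℝ × E => fderiv ℝ f (g w) w.2.2)
    (O := g ⁻¹' Metric.ball 0 r) (Metric.isOpen_ball.preimage hg.continuous) ?_ fun z hz t ht => ?_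
  · exact ((hf.fderiv_of_isOpen Metric.isOpen_ball hs).comp hg.contDiffOn fun _ h => h).clm_apply
      (contDiff_snd.snd.contDiffOn)
  · rw [mem_preimage, mem_ball_zero_iff]
    refine lt_of_le_of_lt ?_ (hS z hz)
    simp only [g]
    rw [mul_smul, norm_smul, Real.norm_of_nonneg ht.1]
    exact mul_le_of_le_one_left (norm_nonneg _) ht.2

theorem scaledQuotient_zero (f : E → F) (x : E) : scaledQuotient f (0, x) = fderiv ℝ f 0 x := by
  simp [scaledQuotient]

/-- The fundamental theorem of calculus along the segment from 0 to b x. The quotient is regular up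
to b = 0, where it is the differential of f at the origin. -/
theorem smul_scaledQuotient {f : E → F} {r : ℝ} (hf : ContDiffOn ℝ 1 f (Metric.ball 0 r))
    (h0 : f 0 = 0) {b : ℝ} {x : E} (hx : ‖b • x‖ < r) : b • scaledQuotient f (b, x) = f (b • x) := by
  have hmem : ∀ t ∈ uIcc (0 : ℝ) 1, (t * b) • x ∈ Metric.ball (0 : E) r := fun t ht => by
    rw [uIcc_of_le zero_le_one] at ht
    rw [mem_ball_zero_iff, mul_smul, norm_smul, Real.norm_of_nonneg ht.1]
    exact lt_of_le_of_lt (mul_le_of_le_one_left (norm_nonneg _) ht.2) hx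
  have hd : ∀ t ∈ uIcc (0 : ℝ) 1, HasDerivAt (fun t : ℝ => f ((t * b) • x))
      (b • fderiv ℝ f ((t * b) • x) x) t := fun t ht => by
    have h1 := ((hf.differentiableOn one_ne_zero).differentiableAt
      (Metric.isOpen_ball.mem_nhds (hmem t ht))).hasFDerivAt
    have h2 : HasDerivAt (fun t : ℝ => (t * b) • x) (b • x) t := by
      simpa using ((hasDerivAt_id t).mul_const b).smul_const x
    exact (HasFDerivAt.comp_hasDerivAt (l := f) t h1 h2).congr_deriv (map_smul _ _ _)
  have hc : ContinuousOn (fun t : ℝ => fderiv ℝ f ((t * b) • x)) (uIcc 0 1) :=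
    (hf.continuousOn_fderiv_of_isOpen Metric.isOpen_ball le_rfl).comp (by fun_prop) hmem
  have h3 := intervalIntegral.integral_eq_sub_of_hasDerivAt hd
    ((hc.clm_apply continuousOn_const).const_smul b).intervalIntegrable
  rw [intervalIntegral.integral_smul] at h3
  simpa [scaledQuotient, h0] using h3

end Hadamard

/-! ### Linear changes of coordinates and rescaling -/

section ChartChange

variable {n κ : ℕ} {M : Type*} [TopologicalSpace M] [ChartedSpace (R2n n) M]
  {s : WithTop ℕ∞} [IsManifold 𝓘(ℝ, R2n n) s M] {φ : OpenPartialHomeomorph M (R2n n)} {Γ : Type*}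
  {Ω : TwoForm n M} {J : Fin κ → M → ℝ} {θ : Torus κ → M → M} {N : Set M} {ρ : Γ → M → M}
  {N' : Set M} {m₀ : M}

/-- The chart `Λ⁻¹ ∘ φ`. -/
def linChart (φ : OpenPartialHomeomorph M (R2n n)) (Λ : R2n n ≃L[ℝ] R2n n) :
    OpenPartialHomeomorph M (R2n n) := φ.transHomeomorph Λ.symm.toHomeomorph

theorem linChart_mem_maximalAtlas (hφ : φ ∈ IsManifold.maximalAtlas 𝓘(ℝ, R2n n) s M)
    (Λ : R2n n ≃L[ℝ] R2n n) : linChart φ Λ ∈ IsManifold.maximalAtlas 𝓘(ℝ, R2n n) s M := by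
  rw [linChart, OpenPartialHomeomorph.transHomeomorph_eq_trans]
  exact trans_mem_maximalAtlas hφ Λ.symm.contDiff.contDiffOn Λ.contDiff.contDiffOn

theorem formInChart_linChart (hs : s ≠ 0) (hφ : φ ∈ IsManifold.maximalAtlas 𝓘(ℝ, R2n n) s M)
    (Λ : R2n n ≃L[ℝ] R2n n) {x : R2n n} (hx : Λ x ∈ φ.target) :
    bilOf (formInChart (linChart φ Λ) Ω x) = pullB (bilOf (formInChart φ Ω (Λ x))) Λ := by
  have h1 := formInChart_eq_pullback (Ω := Ω)
    (mdifferentiable_of_mem_maximalAtlas hs (linChart_mem_maximalAtlas hφ Λ))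
    (mdifferentiable_of_mem_maximalAtlas hs hφ) (x := x) hx (φ.map_target hx)
  have h2 : φ ∘ (linChart φ Λ).symm =ᶠ[𝓝 x] Λ := by
    filter_upwards [(φ.open_target.preimage Λ.continuous).mem_nhds hx] with y hy
    exact φ.right_inv hy
  rw [h1, h2.fderiv_eq, Λ.fderiv]
  congr 3
  exact φ.right_inv hx

theorem chartData_linChart (hs : s ≠ 0) (hφ : φ ∈ IsManifold.maximalAtlas 𝓘(ℝ, R2n n) s M)
    (Λ : R2n n ≃L[ℝ] R2n n) {x : R2n n} (hx : Λ x ∈ φ.target) :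
    chartData (linChart φ Λ) Ω J ρ x = (pullB (chartData φ Ω J ρ (Λ x)).1 Λ,
      fun l => ((chartData φ Ω J ρ (Λ x)).2.1 l).comp (Λ : R2n n →L[ℝ] R2n n),
      fun ψ => Λ.symm ((chartData φ Ω J ρ (Λ x)).2.2 ψ)) := by
  refine Prod.ext (formInChart_linChart hs hφ Λ hx) (Prod.ext ?_ rfl)
  ext1 l
  exact Λ.comp_right_fderiv (f := J l ∘ φ.symm)

theorem chartData_const_smul (c : ℝ) (x : R2n n)
    (hJ : ∀ l, DifferentiableAt ℝ (J l ∘ φ.symm) x) :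
    chartData φ (fun m => c • Ω m) (fun l m => c * J l m) ρ x =
      (c • (chartData φ Ω J ρ x).1, c • (chartData φ Ω J ρ x).2.1, (chartData φ Ω J ρ x).2.2) := by
  refine Prod.ext (map_smul bilOf c (formInChart φ Ω x)) (Prod.ext ?_ rfl)
  ext1 l
  exact fderiv_const_smul (hJ l) c

/-- Multiplying the form and the momenta by the same nonzero constant does not change the
Hamiltonian fields, hence the action stays the same. -/
theorem IsSystem.const_smul [Group Γ] (hs : s ≠ 0) (h : IsSystem s Ω J θ N ρ N') {c : ℝ} (hc : c ≠ 0) :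
    IsSystem s (fun m => c • Ω m) (fun l m => c * J l m) θ N ρ N' where
  isOpen := h.isOpen
  isOpen' := h.isOpen'
  subset := h.subset
  symplectic :=
    { contDiffOn := fun e he => (h.symplectic.contDiffOn e he).const_smul c
      closed := fun e he w hw => by
        have h1 := extDeriv_smul (x := w) c (formInChart e Ω)
        rw [h.symplectic.closed e he w hw, smul_zero] at h1
        exact h1
      nondegenerate := fun m hm v hv => by
        obtain ⟨w, hw⟩ := h.symplectic.nondegenerate m hm v hv
        exact ⟨w, mul_ne_zero hc hw⟩ }
  torus :=
    { contMDiffOn_J := fun l => contMDiffOn_const.mul (h.torus.contMDiffOn_J l)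
      mapsTo := h.torus.mapsTo
      one := h.torus.one
      mul := h.torus.mul
      contMDiffOn := h.torus.contMDiffOn
      generates := fun l m hm => by
        obtain ⟨X, hX, hJ⟩ := h.torus.generates l m hm
        refine ⟨X, hX, fun v => ?_⟩
        have h1 : MDifferentiableAt 𝓘(ℝ, R2n n) 𝓘(ℝ, ℝ) (J l) m :=
          ((h.torus.contMDiffOn_J l).contMDiffAt (h.isOpen.mem_nhds hm)).mdifferentiableAt hs
        have h2 := DFunLike.congr_fun (const_smul_mfderiv h1 c) v
        refine h2.trans ?_
        change c • (mfderiv 𝓘(ℝ, R2n n) 𝓘(ℝ, ℝ) (J l) m v) = c • (Ω m ![v, X])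
        exact congrArg (fun y : ℝ => c • y) (hJ v) }
  finite :=
    { mapsTo := h.finite.mapsTo
      one := h.finite.one
      mul := h.finite.mul
      contMDiffOn := h.finite.contMDiffOn
      symplectic := fun ψ m hm => congrArg (fun β => c • β) (h.finite.symplectic ψ m hm)
      preserves_J := fun ψ l m hm => by rw [h.finite.preserves_J ψ l m hm] }

/-- Multiplication by a nonzero number. -/
def homothety (n : ℕ) {b : ℝ} (hb : b ≠ 0) : R2n n ≃L[ℝ] R2n n :=
  ContinuousLinearEquiv.smulLeft (Units.mk0 b hb)

theorem homothety_apply {b : ℝ} (hb : b ≠ 0) (x : R2n n) : homothety n hb x = b • x := rfl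

/-- A homothety by b multiplies the standard form and quadratic functions by b², which cancels the
division; rotations commute with homotheties, so weights and multipliers are unchanged. -/
theorem IsNormalForm.rescale {kₑ : ℕ} {p : Fin n → Fin κ → ℤ} {q : Γ → Fin n → ℚ} {c : Fin κ → ℝ}
    (hs : s ≠ 0) {b : ℝ} (hb : b ≠ 0)
    (h : IsNormalForm s (fun m => (b ^ 2)⁻¹ • Ω m) (fun l m => (b ^ 2)⁻¹ * J l m) θ ρ kₑ p q c φ m₀) :
    IsNormalForm s Ω J θ ρ kₑ p q (fun l => b ^ 2 * c l)
      (linChart φ (homothety n (inv_ne_zero hb))) m₀ where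
  smooth := linChart_mem_maximalAtlas h.smooth _
  mem_source := h.mem_source
  centred := by
    change (homothety n (inv_ne_zero hb)).symm (φ m₀) = 0
    rw [h.centred, map_zero]
  torus_fixed := h.torus_fixed
  finite_fixed := h.finite_fixed
  torus_invariant := h.torus_invariant
  finite_invariant := h.finite_invariant
  form_eq w hw u v := by
    have hw' : homothety n (inv_ne_zero hb) w ∈ φ.target := hw
    have h1 := h.form_eq _ hw' u v
    have h2 := DFunLike.congr_fun (DFunLike.congr_fun
      (formInChart_linChart (Ω := Ω) hs h.smooth (homothety n (inv_ne_zero hb)) hw') u) v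
    rw [← h1]
    refine h2.trans ?_
    rw [pullB_apply]
    change bilOf _ (b⁻¹ • u) (b⁻¹ • v) = (b ^ 2)⁻¹ * bilOf (formInChart φ Ω _) u v
    simp only [map_smul, _root_.smul_apply, smul_eq_mul]
    ring
  J_eq l m hm := by
    have h1 := h.J_eq l m hm
    have h2 : ∀ i, linChart φ (homothety n (inv_ne_zero hb)) m i = b * φ m i := fun i => by
      change ((b⁻¹)⁻¹ • φ m) i = _
      rw [inv_inv]; rfl
    have h3 : J l m = b ^ 2 * ((b ^ 2)⁻¹ * J l m) := by field_simp
    rw [h3, h1, mul_add, Finset.mul_sum]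
    refine congrArg _ (Finset.sum_congr rfl fun j _ => ?_)
    rw [h2, h2]
    ring
  finite_eq ψ j m hm := by
    change zc ((b⁻¹)⁻¹ • φ (ρ ψ m)) j = _ * zc ((b⁻¹)⁻¹ • φ m) j
    rw [zc_smul, zc_smul, h.finite_eq ψ j m hm]
    ring

theorem linChart_homothety_target {r b : ℝ} (hb : 0 < b) (ht : φ.target = Metric.ball 0 r) :
    (linChart φ (homothety n (inv_ne_zero hb.ne'))).target = Metric.ball 0 (b * r) := by
  ext x
  change b⁻¹ • x ∈ φ.target ↔ _
  rw [ht, mem_ball_zero_iff, mem_ball_zero_iff, norm_smul, Real.norm_of_nonneg (inv_nonneg.2 hb.le),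
    inv_mul_lt_iff₀ hb]

end ChartChange

/-! ### A chart in which the linearisation is the model -/

section LocalNormalForm

variable {n κ : ℕ} {M : Type*} [TopologicalSpace M] [ChartedSpace (R2n n) M]
  {s : WithTop ℕ∞} [IsManifold 𝓘(ℝ, R2n n) s M] {φ : OpenPartialHomeomorph M (R2n n)} {Γ : Type*}
  {Ω : TwoForm n M} {J : Fin κ → M → ℝ} {θ : Torus κ → M → M} {N : Set M} {ρ : Γ → M → M}
  {N' : Set M} {m₀ : M}

theorem IsSystem.exists_isFixedPointChart [Group Γ] (hs : s = ∞ ∨ s = ω)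
    (h : IsSystem s Ω J θ N ρ N') (hm : m₀ ∈ N') (hθ : ∀ t, θ t m₀ = m₀) (hρ : ∀ ψ, ρ ψ m₀ = m₀) :
    ∃ φ, IsFixedPointChart s Ω J θ N ρ N' φ m₀ := by
  have h1 : (chartAt (R2n n) m₀).restr N' ∈ IsManifold.maximalAtlas 𝓘(ℝ, R2n n) s M :=
    restr_mem_maximalAtlas _ (IsManifold.chart_mem_maximalAtlas m₀) h.isOpen'
  let e := (Homeomorph.subRight (chartAt (R2n n) m₀ m₀)).toOpenPartialHomeomorph
  refine ⟨((chartAt (R2n n) m₀).restr N').trans e, hs, h,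
    trans_mem_maximalAtlas h1 (contDiff_id.sub contDiff_const).contDiffOn
      (contDiff_id.add contDiff_const).contDiffOn, fun m hm' => ?_, ?_, ?_, hθ, hρ⟩
  · rw [OpenPartialHomeomorph.trans_source, OpenPartialHomeomorph.restr_source, h.isOpen'.interior_eq]
      at hm'
    exact hm'.1.2
  · rw [OpenPartialHomeomorph.trans_source, OpenPartialHomeomorph.restr_source, h.isOpen'.interior_eq]
    exact ⟨⟨mem_chart_source _ _, hm⟩, mem_univ _⟩
  · exact sub_self (chartAt (R2n n) m₀ m₀)

theorem IsFixedPointChart.linChart [Group Γ] (h : IsFixedPointChart s Ω J θ N ρ N' φ m₀)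
    (Λ : R2n n ≃L[ℝ] R2n n) :
    IsFixedPointChart s Ω J θ N ρ N' (TorusNormalForm.linChart φ Λ) m₀ where
  smooth := h.smooth
  system := h.system
  mem_atlas := linChart_mem_maximalAtlas h.mem_atlas Λ
  subset := h.subset
  mem := h.mem
  centred := by
    change Λ.symm (φ m₀) = 0
    rw [h.centred, map_zero]
  torus_fixed := h.torus_fixed
  finite_fixed := h.finite_fixed

/-- The differentials at the fixed point are those of the linear model. -/
structure IsLinearModel (φ : OpenPartialHomeomorph M (R2n n)) (Ω : TwoForm n M) (J : Fin κ → M → ℝ)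
    (ρ : Γ → M → M) [Fintype Γ] (p : Fin n → Fin κ → ℤ) (a : Γ → Fin n → Circle) : Prop where
  form : (chartData φ Ω J ρ 0).1 = stdBil
  fderiv : ∀ x, fderiv ℝ (fun x => (chartData φ Ω J ρ x).2) 0 x = (model p a x).2

/-- At a fixed point the Hamiltonian fields, hence the differentials of the momenta, vanish.
Hadamard's quotient can therefore be applied to this part of the data. -/
theorem IsFixedPointChart.snd_zero [Group Γ] [Fintype Γ] (h : IsFixedPointChart s Ω J θ N ρ N' φ m₀) :
    (chartData φ Ω J ρ 0).2 = 0 := by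
  refine Prod.ext ?_ ?_
  · ext1 l
    refine ContinuousLinearMap.ext fun v => ?_
    rw [← hamVF_spec (h.isInvertible h.zero_mem) (fun u v => chartData_swap 0 u v) l v]
    have h1 := h.vf_zero l
    rw [vfInChart] at h1
    rw [h1, map_zero]
    rfl
  · ext1 ψ
    exact h.finiteInChart_zero ψ

/-- The linear normal form L of the linearised action is used as a change of coordinates; the
derivative of the transformed data at 0 is then computed by the chain rule. -/
theorem IsFixedPointChart.exists_isLinearModel [CommGroup Γ] [Fintype Γ]
    (h : IsFixedPointChart s Ω J θ N ρ N' φ m₀) :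
    ∃ (φ' : OpenPartialHomeomorph M (R2n n)) (kₑ : ℕ) (p : Fin n → Fin κ → ℤ) (q : Γ → Fin n → ℚ)
      (a : Γ → Fin n → Circle), kₑ ≤ n ∧ (∀ ψ (j : Fin n), kₑ ≤ j.val → ∃ b : ℤ, q ψ j = b / 2) ∧
      (∀ j l, kₑ ≤ j.val → p j l = 0) ∧ (∀ ψ χ, a (ψ * χ) = a ψ * a χ) ∧
      (∀ ψ j, (a ψ j : ℂ) = Complex.exp (2 * Real.pi * Complex.I * (q ψ j : ℂ))) ∧
      IsFixedPointChart s Ω J θ N ρ N' φ' m₀ ∧ IsLinearModel φ' Ω J ρ p a := by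
  obtain ⟨L, kₑ, p, q, a, hk, hq, hp, ha, haq, hw, hB, hT⟩ :=
    h.isLinearAction.exists_normal_form fun u v => chartData_swap 0 u v
  have hs0 := ne_zero_of_smooth h.smooth
  have hdata : ∀ᶠ x in 𝓝 (0 : R2n n), chartData (TorusNormalForm.linChart φ L) Ω J ρ x =
      (pullB (chartData φ Ω J ρ (L x)).1 L,
      fun l => ((chartData φ Ω J ρ (L x)).2.1 l).comp (L : R2n n →L[ℝ] R2n n),
      fun ψ => L.symm ((chartData φ Ω J ρ (L x)).2.2 ψ)) := by
    filter_upwards [(φ.open_target.preimage L.continuous).mem_nhds (by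
      rw [mem_preimage, map_zero]; exact h.zero_mem)] with x hx
    exact chartData_linChart hs0 h.mem_atlas L hx
  refine ⟨_, kₑ, p, q, a, hk, hq, hp, ha, haq, h.linChart L, ?_, fun x => ?_⟩
  · rw [hdata.self_of_nhds]
    refine ContinuousLinearMap.ext fun u => ContinuousLinearMap.ext fun v => ?_
    rw [pullB_apply, map_zero]
    exact hw u v
  · have hd := h.contDiffAt_chartData.differentiableAt hs0
    have hd' : DifferentiableAt ℝ (chartData φ Ω J ρ) (L 0) := by rw [map_zero]; exact hd
    have hdL : HasFDerivAt (fun x => chartData φ Ω J ρ (L x))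
        ((fderiv ℝ (chartData φ Ω J ρ) 0).comp (L : R2n n →L[ℝ] R2n n)) 0 := by
      have := hd'.hasFDerivAt.comp (0 : R2n n) L.hasFDerivAt
      rw [map_zero] at this
      exact this
    have hdl := (h.linChart L).contDiffAt_chartData.differentiableAt hs0
    have h1 : ∀ y : R2n n, (fderiv ℝ (fun x => (chartData (TorusNormalForm.linChart φ L) Ω J ρ x).2) 0 y) =
        (fun l => ((fderiv ℝ (fun x => (chartData φ Ω J ρ x).2.1 l) 0 (L y))).comp
          (L : R2n n →L[ℝ] R2n n),
        fun ψ => L.symm (fderiv ℝ (finiteInChart φ ρ ψ) 0 (L y))) := fun y => by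
      refine Prod.ext ?_ ?_
      · ext1 l
        have e1 := (hasFDerivAt_pi'.1 hdl.snd.hasFDerivAt.fst l)
        have e2 : HasFDerivAt (fun x => (chartData φ Ω J ρ (L x)).2.1 l)
            ((fderiv ℝ (fun x => (chartData φ Ω J ρ x).2.1 l) 0).comp (L : R2n n →L[ℝ] R2n n)) 0 := by
          have e3 : HasFDerivAt (fun x => (chartData φ Ω J ρ x).2.1 l)
              (fderiv ℝ (fun x => (chartData φ Ω J ρ x).2.1 l) 0) (L 0) := by
            rw [map_zero]; exact (differentiableAt_pi.1 hd.snd.fst l).hasFDerivAt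
          exact e3.comp (0 : R2n n) L.hasFDerivAt
        have e4 := e2.clm_comp (hasFDerivAt_const (L : R2n n →L[ℝ] R2n n) (0 : R2n n))
        have e5 := e1.unique (e4.congr_of_eventuallyEq (hdata.mono fun x hx => by simp only [hx]))
        have e6 := DFunLike.congr_fun e5 y
        refine e6.trans ?_
        simp
      · ext1 ψ
        have e1 := (hasFDerivAt_pi'.1 hdl.snd.hasFDerivAt.snd ψ)
        have e2 : HasFDerivAt (fun x => finiteInChart φ ρ ψ (L x))
            ((fderiv ℝ (finiteInChart φ ρ ψ) 0).comp (L : R2n n →L[ℝ] R2n n)) 0 := by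
          have e3 : HasFDerivAt (finiteInChart φ ρ ψ) (fderiv ℝ (finiteInChart φ ρ ψ) 0) (L 0) := by
            rw [map_zero]; exact (h.differentiableAt_finite ψ).hasFDerivAt
          exact e3.comp (0 : R2n n) L.hasFDerivAt
        have e4 := L.symm.hasFDerivAt.comp (0 : R2n n) e2
        exact DFunLike.congr_fun (e1.unique (e4.congr_of_eventuallyEq
          (hdata.mono fun x hx => by simp only [hx]; rfl))) y
    rw [h1]
    refine Prod.ext ?_ ?_
    · ext1 l
      refine ContinuousLinearMap.ext fun v => ?_
      change fderiv ℝ (fun x => (chartData φ Ω J ρ x).2.1 l) 0 (L x) (L v) = -stdBil (gen p l x) v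
      rw [← h.fderiv_vf_symm, hB, hw, stdBil_swap]
    · ext1 ψ
      change L.symm (fderiv ℝ (finiteInChart φ ρ ψ) 0 (L x)) = rotC (a ψ) x
      rw [hT, L.symm_apply_apply]

end LocalNormalForm

/-! ### Existence of the normal form by blowing up the fixed point -/

section Existence

variable {n κ : ℕ} {M : Type*} [TopologicalSpace M] [ChartedSpace (R2n n) M]
  {s : WithTop ℕ∞} [IsManifold 𝓘(ℝ, R2n n) s M] {φ : OpenPartialHomeomorph M (R2n n)} {Γ : Type*}
  [Group Γ] [Fintype Γ]
  {Ω : TwoForm n M} {J : Fin κ → M → ℝ} {θ : Torus κ → M → M} {N : Set M} {ρ : Γ → M → M}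
  {N' : Set M} {m₀ : M} {p : Fin n → Fin κ → ℤ} {a : Γ → Fin n → Circle}

/-- The family of data that arises from a system by scaling. -/
def scaledData (φ : OpenPartialHomeomorph M (R2n n)) (Ω : TwoForm n M) (J : Fin κ → M → ℝ)
    (ρ : Γ → M → M) (b : ℝ) (x : R2n n) : DataSpace n κ Γ :=
  ((chartData φ Ω J ρ (b • x)).1, scaledQuotient (fun x => (chartData φ Ω J ρ x).2) (b, x))

theorem IsLinearModel.scaledData_zero (h : IsLinearModel φ Ω J ρ p a) (x : R2n n) :
    scaledData φ Ω J ρ 0 x = model p a x := by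
  refine Prod.ext ?_ ?_
  · change (chartData φ Ω J ρ ((0 : ℝ) • x)).1 = stdBil
    rw [zero_smul, h.form]
  · change scaledQuotient (fun x => (chartData φ Ω J ρ x).2) (0, x) = _
    rw [scaledQuotient_zero, h.fderiv]

theorem IsFixedPointChart.exists_radius (h : IsFixedPointChart s Ω J θ N ρ N' φ m₀) :
    ∃ r > 0, ∀ x : R2n n, ‖x‖ < r → x ∈ φ.target ∧ ∀ ψ, ρ ψ (φ.symm x) ∈ φ.source := by
  obtain ⟨r, hr, hb⟩ := Metric.eventually_nhds_iff.1
    (h.target_mem.and (Filter.eventually_all.2 h.finite_mem))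
  exact ⟨r, hr, fun x hx => hb (by simpa using hx)⟩

theorem IsFixedPointChart.contDiffOn_chartData (h : IsFixedPointChart s Ω J θ N ρ N' φ m₀) {r : ℝ}
    (hr : ∀ x : R2n n, ‖x‖ < r → x ∈ φ.target ∧ ∀ ψ, ρ ψ (φ.symm x) ∈ φ.source) :
    ContDiffOn ℝ s (chartData φ Ω J ρ) (Metric.ball 0 r) := fun x hx =>
  (h.system.contDiffAt_chartData h.smooth h.mem_atlas h.subset (hr x (by simpa using hx)).1
    (hr x (by simpa using hx)).2).contDiffWithinAt

theorem contDiffOn_scaledData {r R : ℝ} (hs : s = ∞ ∨ s = ω) {B : Set ℝ}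
    (hD : ContDiffOn ℝ s (chartData φ Ω J ρ) (Metric.ball 0 r))
    (hB : ∀ b ∈ B, ∀ x : R2n n, ‖x‖ < R → ‖b • x‖ < r) :
    ContDiffOn ℝ s (fun z : ℝ × R2n n => scaledData φ Ω J ρ z.1 z.2) (B ×ˢ Metric.ball 0 R) := by
  have hm : ∀ z ∈ B ×ˢ Metric.ball (0 : R2n n) R, ‖z.1 • z.2‖ < r := fun z hz =>
    hB z.1 hz.1 z.2 (by simpa using hz.2)
  refine ContDiffOn.prodMk ?_ ?_
  · exact (contDiff_fst.comp_contDiffOn hD).comp (contDiff_fst.smul contDiff_snd).contDiffOn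
      fun z hz => by simpa using hm z hz
  · exact contDiffOn_scaledQuotient (add_one_le_of_smooth hs) (contDiff_snd.comp_contDiffOn hD) hm

/-- For b ≠ 0 the member b is a genuine system: the original one seen through the homothety by b,
with form and momenta divided by b². The pulled-back form regains its original values, and the
momentum differentials and maps of Γ become difference quotients. -/
theorem IsFixedPointChart.scaledData_eq (h : IsFixedPointChart s Ω J θ N ρ N' φ m₀) {r : ℝ}
    (hr : ∀ x : R2n n, ‖x‖ < r → x ∈ φ.target ∧ ∀ ψ, ρ ψ (φ.symm x) ∈ φ.source) {b : ℝ} (hb : b ≠ 0)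
    {x : R2n n} (hx : ‖b • x‖ < r) :
    scaledData φ Ω J ρ b x = chartData (TorusNormalForm.linChart φ (homothety n hb))
      (fun m => (b ^ 2)⁻¹ • Ω m) (fun l m => (b ^ 2)⁻¹ * J l m) ρ x := by
  have hs0 := ne_zero_of_smooth h.smooth
  have hxt : homothety n hb x ∈ φ.target := (hr _ hx).1
  have hq := smul_scaledQuotient (contDiff_snd.comp_contDiffOn
    ((h.contDiffOn_chartData hr).of_le (le_trans (by norm_num) (two_le_of_smooth h.smooth))))
    h.snd_zero hx
  have hq' : scaledQuotient (fun x => (chartData φ Ω J ρ x).2) (b, x) =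
      b⁻¹ • (chartData φ Ω J ρ (b • x)).2 := by
    rw [eq_inv_smul_iff₀ hb]
    exact hq
  rw [chartData_linChart hs0 h.mem_atlas _ hxt, chartData_const_smul _ _ fun l =>
    ((contDiffOn_momentum h.system.torus.contMDiffOn_J h.mem_atlas
      (h.subset.trans h.system.subset) l).contDiffAt
        (φ.open_target.mem_nhds hxt)).differentiableAt hs0, scaledData, hq', homothety_apply]
  refine Prod.ext ?_ (Prod.ext ?_ rfl)
  · refine ContinuousLinearMap.ext fun u => ContinuousLinearMap.ext fun v => ?_
    change _ = (b ^ 2)⁻¹ * (chartData φ Ω J ρ (b • x)).1 (b • u) (b • v)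
    simp only [map_smul, _root_.smul_apply, smul_eq_mul]
    field_simp
  · ext1 l
    refine ContinuousLinearMap.ext fun v => ?_
    change b⁻¹ * (chartData φ Ω J ρ (b • x)).2.1 l v =
      (b ^ 2)⁻¹ * (chartData φ Ω J ρ (b • x)).2.1 l (b • v)
    rw [map_smul, smul_eq_mul]
    field_simp

/-- The scaled data form a regular family with the linear model at b = 0, so some member with b > 0
can be normalised. That member is the given system up to homothety, and undoing the homothety gives
its normal form. -/
theorem IsFixedPointChart.exists_isNormalForm [T2Space M]
    (h : IsFixedPointChart s Ω J θ N ρ N' φ m₀) (hl : IsLinearModel φ Ω J ρ p a)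
    (ha : ∀ ψ χ, a (ψ * χ) = a ψ * a χ) {q : Γ → Fin n → ℚ}
    (haq : ∀ ψ j, (a ψ j : ℂ) = Complex.exp (2 * Real.pi * Complex.I * (q ψ j : ℂ))) {kₑ : ℕ}
    (hp : ∀ (j : Fin n) l, kₑ ≤ j.val → p j l = 0) :
    ∃ (φ' : OpenPartialHomeomorph M (R2n n)) (c : Fin κ → ℝ) (R₀ : ℝ), φ'.source ⊆ N' ∧
      φ'.target = Metric.ball 0 R₀ ∧ IsNormalForm s Ω J θ ρ kₑ p q c φ' m₀ := by
  have hs0 := ne_zero_of_smooth h.smooth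
  obtain ⟨r, hr0, hr⟩ := h.exists_radius
  -- The scale is free, so fixed numbers are chosen: R = 14 and d = 1 leave room for a final ball of
  -- radius 1, at most R - 12 d.
  have hB : ∀ b ∈ Metric.ball (0 : ℝ) (r / 14), ∀ x : R2n n, ‖x‖ < 14 → ‖b • x‖ < r :=
    fun b hb x hx => by
      rw [mem_ball_zero_iff] at hb
      rw [norm_smul]
      calc ‖b‖ * ‖x‖ ≤ ‖b‖ * 14 := by gcongr
        _ < r := by linarith
  have hev := eventually_normalizable (p := p) (a := a) (D := scaledData φ Ω J ρ) (R := 14) (d := 1)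
    Metric.isOpen_ball (Metric.mem_ball_self (by positivity)) one_pos
    ((contDiffOn_scaledData h.smooth (h.contDiffOn_chartData hr) hB).of_le
      (two_le_of_smooth h.smooth)) fun x _ => hl.scaledData_zero x
  obtain ⟨δ, hδ, hδ'⟩ := Metric.eventually_nhds_iff.1
    (hev.and (Metric.ball_mem_nhds (0 : ℝ) (by positivity : 0 < r / 14)))
  obtain ⟨hN, hbB⟩ := hδ' (y := δ / 2) (by
    rw [Real.dist_eq, sub_zero, abs_of_pos (by positivity)]; linarith)
  set b := δ / 2 with hbdef
  have hb : 0 < b := by positivity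
  have hbx := hB b hbB
  set e := TorusNormalForm.linChart φ (homothety n hb.ne') with he
  have hD : ∀ x : R2n n, ‖x‖ < 14 → scaledData φ Ω J ρ b x =
      chartData e (fun m => (b ^ 2)⁻¹ • Ω m) (fun l m => (b ^ 2)⁻¹ * J l m) ρ x := fun x hx =>
    h.scaledData_eq hr hb.ne' (hbx x hx)
  have hf := h.linChart (homothety n hb.ne')
  obtain ⟨φ', -, hsrc, htgt, hnf⟩ := (h.system.const_smul hs0 (c := (b ^ 2)⁻¹)
    (by positivity)).exists_isNormalForm h.smooth hf.mem_atlas hf.subset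
    (fun x hx => (hr _ (hbx x (by simpa using hx))).1) (fun ψ x hx => (hr _ (hbx x hx)).2 ψ) hD hN one_pos
    ha haq hp (r' := 1) one_pos (by norm_num)
  -- The data vanish at the origin apart from the form, so the normalising map fixes the origin and
  -- the coordinates are centred at the given point.
  have h0 : normMap p a (scaledData φ Ω J ρ b) 14 1 0 = 0 := by
    have hz : (scaledData φ Ω J ρ b 0).2 = 0 := by
      simp [scaledData, scaledQuotient]
    refine hN.normMap_zero one_pos (by norm_num) (fun l => ?_) fun ψ => ?_
    · rw [hamVF, hz]
      simp
    · rw [hz]; rfl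
  have h1 : invBall (normMap p a (scaledData φ Ω J ρ b) 14 1) (14 - 10 * 1) 0 = 0 := by
    have := hN.near.invBall_apply (x := (0 : R2n n)) (by norm_num)
    rwa [h0] at this
  have h2 : e.symm 0 = m₀ := hf.symm_zero
  rw [h1, h2] at hnf
  refine ⟨_, _, _, ?_, linChart_homothety_target hb htgt, hnf.rescale hs0 hb.ne'⟩
  change φ'.source ⊆ N'
  rw [hsrc]
  exact inter_subset_left.trans hf.subset

end Existence

end TorusNormalForm

end

/-! ### The theorem -/

open TorusNormalForm in
theorem mainTheorem7 {n κ : ℕ} {M : Type*} [TopologicalSpace M] [T2Space M]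
    [ChartedSpace (R2n n) M] {Γ : Type*} [CommGroup Γ] [Finite Γ]
    (r : WithTop ℕ∞) (hr : r = ∞ ∨ r = ω) [IsManifold 𝓘(ℝ, R2n n) r M]
    (Ω : TwoForm n M) (J : Fin κ → M → ℝ) (θ : Torus κ → M → M)
    (ρ : Γ → M → M) (N' : Set M)
    (hsys : IsSystem r Ω J θ univ ρ N')
    (m₀ : M) (hm₀ : m₀ ∈ N')
    (hθ : ∀ t, θ t m₀ = m₀) (hρ : ∀ ψ, ρ ψ m₀ = m₀) :
    ∃ (φ : OpenPartialHomeomorph M (R2n n)) (kₑ : ℕ) (p : Fin n → Fin κ → ℤ)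
      (q : Γ → Fin n → ℚ) (c : Fin κ → ℝ),
      kₑ ≤ n ∧ φ.source ⊆ N' ∧
      (∀ ψ (j : Fin n), kₑ ≤ j.val → ∃ a : ℤ, q ψ j = a / 2) ∧
      IsNormalForm r Ω J θ ρ kₑ p q c φ m₀ ∧
      PersistsUnderPerturbations r Ω J ρ kₑ p q c φ m₀ ∧
      PersistsInFamilies r Ω J ρ kₑ p q φ m₀ := by
  have := Fintype.ofFinite Γ
  obtain ⟨φ₁, h₁⟩ := hsys.exists_isFixedPointChart hr hm₀ hθ hρ
  obtain ⟨φ₂, kₑ, p, q, a, hk, hq, hp, ha, haq, h₂, hl⟩ := h₁.exists_isLinearModel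
  -- That the target is a ball is kept: both persistence statements choose their radii inside it.
  obtain ⟨φ, c, R₀, hsub, ht, h⟩ := h₂.exists_isNormalForm hl ha haq hp
  exact ⟨φ, kₑ, p, q, c, hk, hsub, hq, h, h.persistsUnderPerturbations ht ha haq hp,
    h.persistsInFamilies ht ha haq hp⟩
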